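/- Let $D\ge 3$. A *bubble* is a bipartite $D$-regular graph, with $p$ white and $p$ black vertices, whose edges are properly coloured by $1,\dots,D$; $\mathrm{Tr}_{\mathcal B}(T,\bar T)$ is the associated trace invariant of a complex tensor $T_{a_1\dots a_D}$ ($1\le a_c\le N$): one $T$ per white vertex, one $\bar T$ per black vertex, and a contraction of the $c$-th indices for each edge of colour $c$. $\mathcal B_2$ is the bubble with two vertices. *Inserting a dipole* on an edge $e_c$ of colour $c$ of $\mathcal B$ means replacing $e_c$ by two new vertices joined to each other by $D-1$ edges of the colours other than $c$, each having one edge of colour $c$ to a former end of $e_c$; the result is $\mathcal B+(e_c)$. *Melonic* bubbles are those obtained from $\mathcal B_2$ by iterated dipole insertions; $\mathcal B_{4,\{c\}}=\mathcal B_2+(e_c)$. Let $(\mathcal B_i)_{i\in I}$ be a finite family of melonic bubbles with $p_i\ge 2$ white vertices and let $t_i\in\mathbb C$, the family of bubbles with couplings being invariant under every permutation of the colours. Let $S=\mathrm{Tr}_{\mathcal B_2}-\sum_i\frac{z^{p_i-1}}{p_i}t_i\mathrm{Tr}_{\mathcal B_i}$ and let $\langle F\rangle$ be the expectation of $F$ for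 the weight $e^{-N^{D-1}S}$, understood as a formal power series in $z$ (expand the exponential of the interaction in $z$, integrate term by term against the Gaussian weight $e^{-N^{D-1}\mathrm{Tr}_{\mathcal B_2}}$, and divide by the series of the partition function). All expansions in $1/N$ below hold coefficient by coefficient in $z$. Put $K(\mathcal B_2;N)=\frac1N\langle\mathrm{Tr}_{\mathcal B_2}\rangle$. Let $W(\mathcal B_{4,\mathcal C};N)$ be the coefficients of the expansion of the 4-point cumulant on the symmetrized trace-invariant operators of the bubbles $\mathcal B_{4,\mathcal C}=\mathcal B_{4,\mathcal C^c}$, $\mathcal C\subset\{1,\dots,D\}$ (two pairs of one white and one black vertex, joined inside the pairs by the colours not in $\mathcal C$ and across the pairs by the colours in $\mathcal C$), and let $K(\mathcal B_{4,\{c\}};N)=N^{3(D-1)}W(\mathcal B_{4,\{c\}};N)$. Combinatorial constants. For a bubble $\mathcal B$ with $2p$ vertices let $\alpha(\mathcal B)$ be the number of Wick pairings of its white with its black vertices that contribute to $\frac1N\langle \mathrm{Tr}_{\mathcal B}\rangle$ at order exactly $N^{-(D-2)}$, i.e. with $F-1-(D-1)p=-(D-2)$ where $F$ is the number of faces (cycles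 alternating between the pairing and a colour $c$, for $c=1,\dots,D$). Let $\alpha'(\mathcal B)=\sum_c\alpha'_c(\mathcal B)$, where $\alpha'_c(\mathcal B)$ is the number of ways to attach to $\mathcal B$ one 4-point cumulant with boundary graph $\mathcal B_{4,\{c\}}$ and $p-2$ 2-point functions so that the total scaling $F-1-(D-1)(p-2)-3(D-1)$ is $-(D-2)$. For a colour $c$ write $\alpha_i=\alpha(\mathcal B_i)$, $\alpha_i'=\alpha'(\mathcal B_i)$, $\beta_i=\sum_{e_c}\alpha(\mathcal B_i+(e_c))$, $\beta_i'=\sum_{e_c}\alpha'(\mathcal B_i+(e_c))$, the sums running over the edges of colour $c$ of $\mathcal B_i$. Then the following holds. (1) For all $N\ge1$ and all colours $c$ the Schwinger–Dyson equations hold: $$N-\langle\mathrm{Tr}_{\mathcal B_2}\rangle+\sum_i z^{p_i-1}t_i\langle\mathrm{Tr}_{\mathcal B_i}\rangle=0,$$ $$\Bigl(1+\tfrac1{N^{D-2}}\Bigr)\langle\mathrm{Tr}_{\mathcal B_2}\rangle-\langle\mathrm{Tr}_{\mathcal B_{4,\{c\}}}\rangle+\sum_i\tfrac{z^{p_i-1}}{p_i}t_i\sum_{e_c\in\mathcal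 B_i}\langle\mathrm{Tr}_{\mathcal B_i+(e_c)}\rangle=0.$$ (2) The expansion of the 4-point cumulant on trace invariants exists and is unique for $N\ge2$, and there are power series $T$, $K_2^{\rm NLO}$, $K_{4,\bullet}^{\rm LO}$ in $z$ with $K(\mathcal B_2;N)=T+N^{-(D-2)}\bigl(K_2^{\rm NLO}+O(1/N)\bigr)$ and $K(\mathcal B_{4,\{c\}};N)=K_{4,\bullet}^{\rm LO}+O(1/N)$ for every colour $c$. Moreover $T|_{z=0}=1$, $1-T+\sum_i t_iz^{p_i-1}T^{p_i}=0$, and for every melonic bubble $\mathcal B$ with $2p$ vertices $$\tfrac1N\langle\mathrm{Tr}_{\mathcal B}\rangle=T^{p}+N^{-(D-2)}\bigl(p\,T^{p-1}K_2^{\rm NLO}+\alpha(\mathcal B)T^{p}+\alpha'(\mathcal B)T^{p-2}K_{4,\bullet}^{\rm LO}+O(1/N)\bigr)$$ (the term with $\alpha'(\mathcal B)$ being absent for $p=1$, where $\alpha'(\mathcal B)=0$). (3) With $C=1-\sum_i t_ip_i[zT]^{p_i-1}$, for every colour $c$, $$\begin{pmatrix}-C&\sum_i t_i\alpha_i'z^{p_i-1}T^{p_i-2}\\-C&\frac1T\bigl(-1+\sum_i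 t_i\frac{\beta_i'}{p_i}[zT]^{p_i-1}\bigr)\end{pmatrix}\begin{pmatrix}K_2^{\rm NLO}\\K_{4,\bullet}^{\rm LO}\end{pmatrix}=\begin{pmatrix}-\sum_i t_i\alpha_iz^{p_i-1}T^{p_i}\\\sum_i t_i\frac{p_i-\beta_i}{p_i}z^{p_i-1}T^{p_i}\end{pmatrix},$$ $$K_2^{\rm NLO}=\frac TC\;\frac{\bigl(1-\sum_i t_i\frac{\beta_i'}{p_i}[zT]^{p_i-1}\bigr)\sum_i t_i\alpha_iz^{p_i-1}T^{p_i}-\sum_{i,j}t_it_j\alpha_i'\frac{p_j-\beta_j}{p_j}z^{p_i+p_j-2}T^{p_i+p_j-1}}{1-\sum_i t_i\bigl(\frac{\beta_i'}{p_i}-(\alpha_i'+1)\bigr)z^{p_i-1}T^{p_i}},$$ $$K_{4,\bullet}^{\rm LO}=\frac{\sum_i t_i\bigl(\frac{\beta_i}{p_i}-(\alpha_i+1)\bigr)z^{p_i-1}T^{p_i+2}}{1-\sum_i t_i\bigl(\frac{\beta_i'}{p_i}-(\alpha_i'+1)\bigr)z^{p_i-1}T^{p_i}}.$$ (4) In the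 quartic case $I=\{1,\dots,D\}$, $\mathcal B_i=\mathcal B_{4,\{i\}}$, $t_i=1$, one has $\alpha_i=\alpha_i'=1$ and $\beta_i=\beta_i'=6$ if $i=c$, $\beta_i=\beta'_i=4$ if $i\ne c$; and for complex $|z|<\frac1{4D}$ the power series $T,K_2^{\rm NLO},K_{4,\bullet}^{\rm LO}$ converge to $$T(z)=\frac{1-\sqrt{1-4Dz}}{2Dz}\quad(T(0)=1),\qquad K_2^{\rm NLO}(z)=\frac{Dz\,T(z)^2}{\sqrt{1-4Dz}\,(1-zT(z)^2)},\qquad K_{4,\bullet}^{\rm LO}(z)=\frac{z\,T(z)^4}{1-zT(z)^2}.$$ -/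

import Mathlib

namespace TensorModel

/-! ### Coloured graphs and melonic bubbles -/

/-- A bipartite, `D`-regular, properly edge-coloured graph with `p` white and `p` black vertices,
both labelled by `Fin p`: the edge of colour `c` at the white vertex `v` ends at the black vertex
`adj c v`. -/
structure ColoredGraph (D : ℕ) where
  p : ℕ
  adj : Fin D → Equiv.Perm (Fin p)

namespace ColoredGraph

variable {D : ℕ}

/-- Isomorphism of coloured graphs: relabelling of the white and of the black vertices. -/
def Iso (G H : ColoredGraph D) : Prop :=
  ∃ e f : Fin G.p ≃ Fin H.p, ∀ c v, H.adj c (e v) = f (G.adj c v)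

/-- Renaming of the colours. -/
def relabel (π : Equiv.Perm (Fin D)) (G : ColoredGraph D) : ColoredGraph D where
  p := G.p
  adj c := G.adj (π c)

/-- The two-vertex bubble. -/
def twoVertex (D : ℕ) : ColoredGraph D where
  p := 1
  adj _ := 1

/-- Extension of a permutation of `Fin p` to `Fin (p + 1)` fixing the last point. -/
def extendPerm {p : ℕ} (σ : Equiv.Perm (Fin p)) : Equiv.Perm (Fin (p + 1)) :=
  finSuccEquivLast.symm.permCongr (Equiv.optionCongr σ)

/-- Insertion of a `(D-1)`-dipole on the edge of colour `c` at the white vertex `v`. The new white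
vertex and the new black vertex (both labelled `Fin.last p`) are joined by all colours but `c`; in
colour `c`, `v` is joined to the new black vertex and the new white vertex to the former
`c`-neighbour of `v`. The result is `G + (e_c)`, with `e_c` the edge of colour `c` at `v`. -/
def insertDipole (G : ColoredGraph D) (c : Fin D) (v : Fin G.p) : ColoredGraph D where
  p := G.p + 1
  adj c' :=
    if c' = c then extendPerm (G.adj c) * Equiv.swap v.castSucc (Fin.last G.p)
    else extendPerm (G.adj c')

/-- Melonic bubbles: those obtained from the two-vertex bubble by iterated dipole insertions. -/
inductive IsMelonic : ColoredGraph D → Prop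
  | twoVertex : IsMelonic (twoVertex D)
  | insertDipole (G : ColoredGraph D) (c : Fin D) (v : Fin G.p) :
      IsMelonic G → IsMelonic (G.insertDipole c v)
  | iso (G H : ColoredGraph D) : Iso G H → IsMelonic G → IsMelonic H

/-- The quartic melonic bubble `B_{4,{c}}`. -/
def quartic (c : Fin D) : ColoredGraph D :=
  (twoVertex D).insertDipole c (0 : Fin 1)

/-- Number of cycles of a permutation, fixed points included. -/
def cycleCount {n : ℕ} (σ : Equiv.Perm (Fin n)) : ℕ := σ.partition.parts.card

/-- The constant `α`: the number of Wick pairings `τ` (white `v` paired with black `τ v`) of `G`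
whose number `F` of faces satisfies `F - 1 - (D-1) p = -(D-2)`, that is, the number of Gaussian
contributions to `N⁻¹ ⟨Tr_G⟩` of order exactly `N^{-(D-2)}`. -/
def alpha (G : ColoredGraph D) : ℕ :=
  (Finset.univ.filter fun τ : Equiv.Perm (Fin G.p) =>
    ∑ c, cycleCount (τ⁻¹ * G.adj c) + (D - 2) = 1 + (D - 1) * G.p).card

/-- The constant `α'_c`: the number of ways to attach to `G` one 4-point cumulant with boundary
graph `B_{4,{c}}` (at the white vertices `v < w` and the black vertices `τ v`, `τ w`, with `v, τ v`
and `w, τ w` joined by all colours but `c`, and `v, τ w` and `w, τ v` joined by `c`) and `p - 2`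
2-point cumulants (joining `u` to `τ u`), with total scaling
`F - 1 - (D-1)(p-2) - 3(D-1) = -(D-2)`. -/
def alphaPrimeColor (G : ColoredGraph D) (c : Fin D) : ℕ :=
  (Finset.univ.filter fun x : Equiv.Perm (Fin G.p) × Fin G.p × Fin G.p =>
    x.2.1 < x.2.2 ∧
    ∑ c', cycleCount
        ((if c' = c then x.1 * Equiv.swap x.2.1 x.2.2 else x.1)⁻¹ * G.adj c') + (D - 2)
      = 1 + (D - 1) * (G.p + 1)).card

/-- The constant `α' = ∑ c, α'_c`. -/
def alphaPrime (G : ColoredGraph D) : ℕ := ∑ c, G.alphaPrimeColor c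

/-- The constant `β_c`: the sum of `α (G + (e_c))` over the edges `e_c` of colour `c`. -/
def beta (G : ColoredGraph D) (c : Fin D) : ℕ := ∑ v, (G.insertDipole c v).alpha

/-- The constant `β'_c`: the sum of `α' (G + (e_c))` over the edges `e_c` of colour `c`. -/
def betaPrime (G : ColoredGraph D) (c : Fin D) : ℕ := ∑ v, (G.insertDipole c v).alphaPrime

end ColoredGraph

/-! ### The tensor model, in perturbation theory -/

/-- Complex tensors of rank `D` and size `N`. -/
abbrev Tensor (D N : ℕ) : Type := (Fin D → Fin N) → ℂ

/-- The trace invariant `Tr_G(T, T̄)`. -/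
noncomputable def traceInvariant {D : ℕ} (G : ColoredGraph D) {N : ℕ} (T : Tensor D N) : ℂ :=
  ∑ a : Fin G.p → Fin D → Fin N, ∑ b : Fin G.p → Fin D → Fin N,
    (∏ v, T (a v)) * (∏ w, (starRingEnd ℂ) (T (b w))) *
      ∏ c, ∏ v, (if a v c = b (G.adj c v) c then 1 else 0)

/-- The Gaussian integral `∫ ∏ₐ (N^{D-1} dTₐ dT̄ₐ / 2πi) e^{-N^{D-1} ∑ₐ Tₐ T̄ₐ} F(T)`, where
`dT dT̄ / 2i` is the Lebesgue measure on `ℂ`. -/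
noncomputable def gaussianIntegral (D N : ℕ) (F : Tensor D N → ℂ) : ℂ :=
  ∫ T : Tensor D N,
    F T * ((∏ a, ((N : ℝ) ^ (D - 1) / Real.pi *
      Real.exp (-((N : ℝ) ^ (D - 1) * ‖T a‖ ^ 2)) : ℝ)) : ℝ)

section Model

variable {D : ℕ} {I : Type*} [Fintype I] (B : I → ColoredGraph D) (t : I → ℂ) (N : ℕ)

/-- `N^{D-1}` times the interaction part `∑ᵢ (z^{pᵢ-1} / pᵢ) tᵢ Tr_{Bᵢ}` of minus the action, as a
power series in `z`. -/
noncomputable def interaction (T : Tensor D N) : PowerSeries ℂ :=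
  ∑ i, ((N : ℂ) ^ (D - 1) * (t i / (B i).p) * traceInvariant (B i) T) •
    (PowerSeries.X : PowerSeries ℂ) ^ ((B i).p - 1)

/-- The coefficient of `z^n` in the exponential of `interaction` (a power series without constant
term as soon as all `pᵢ ≥ 2`, so that the `k`-th power starts at order `k`). -/
noncomputable def weightCoeff (n : ℕ) (T : Tensor D N) : ℂ :=
  ∑ k ∈ Finset.range (n + 1), PowerSeries.coeff n (interaction B t N T ^ k) / (k.factorial : ℂ)

/-- The perturbative expansion in `z` of `∫ [dT dT̄] e^{-N^{D-1} S} F`: the exponential of the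
interaction is expanded and the sum is exchanged with the Gaussian integral. -/
noncomputable def moment (F : Tensor D N → ℂ) : PowerSeries ℂ :=
  PowerSeries.mk fun n => gaussianIntegral D N fun T => F T * weightCoeff B t N n T

/-- The (perturbative) expectation `⟨F⟩`; the partition function `moment 1` has constant term 1. -/
noncomputable def expectation (F : Tensor D N → ℂ) : PowerSeries ℂ :=
  moment B t N F * (moment B t N fun _ => 1)⁻¹

/-- The rescaled 2-point function `K(B₂; N) = N⁻¹ ⟨Tr_{B₂}⟩`. -/
noncomputable def twoPoint : PowerSeries ℂ :=
  ((N : ℂ)⁻¹) • expectation B t N (traceInvariant (ColoredGraph.twoVertex D))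

/-- The 2-point cumulant. -/
noncomputable def cumulantTwo (a b : Fin D → Fin N) : PowerSeries ℂ :=
  expectation B t N fun T => T a * (starRingEnd ℂ) (T b)

/-- The 4-point cumulant `W⁽⁴⁾`, i.e. the part of order `J J J̄ J̄` of `ln Z(J, J̄)` (expectations
with unequally many `T` and `T̄` vanish by invariance under phases). -/
noncomputable def cumulantFour (a₁ a₂ b₁ b₂ : Fin D → Fin N) : PowerSeries ℂ :=
  expectation B t N
      (fun T => T a₁ * T a₂ * (starRingEnd ℂ) (T b₁) * (starRingEnd ℂ) (T b₂))
    - cumulantTwo B t N a₁ b₁ * cumulantTwo B t N a₂ b₂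
    - cumulantTwo B t N a₁ b₂ * cumulantTwo B t N a₂ b₁

/-- `w` is the family of coefficients `W(B_{4,𝒞}; N)` of the expansion of the 4-point cumulant on
trace-invariant operators. The bubble `B_{4,𝒞}` has two pairs (one white and one black vertex each),
joined inside a pair by the colours not in `𝒞` and across the pairs by the colours in `𝒞`. The sets
`𝒞` and `𝒞ᶜ` describe the same bubble, and the operator of `B_{4,𝒞}`, symmetrized over its indices,
is the sum of the two operators below for `𝒞` and `𝒞ᶜ`. So the sum over all `𝒞` with `w 𝒞ᶜ = w 𝒞` is
the sum over all bubbles with four vertices. -/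
def IsInvariantExpansion (w : Finset (Fin D) → PowerSeries ℂ) : Prop :=
  (∀ 𝒞, w 𝒞ᶜ = w 𝒞) ∧
  ∀ a₁ a₂ b₁ b₂ : Fin D → Fin N,
    cumulantFour B t N a₁ a₂ b₁ b₂ =
      ∑ 𝒞 : Finset (Fin D),
        ((∏ c, if c ∈ 𝒞 then (if a₁ c = b₂ c ∧ a₂ c = b₁ c then 1 else 0)
            else (if a₁ c = b₁ c ∧ a₂ c = b₂ c then 1 else 0)) : ℂ) • w 𝒞

/-- The set of interaction bubbles, with their couplings, is invariant under colour relabelling. -/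
def IsColorSymmetric : Prop :=
  ∀ π : Equiv.Perm (Fin D), ∃ ε : Equiv.Perm I,
    ∀ i, t (ε i) = t i ∧ ((B i).relabel π).Iso (B (ε i))

end Model

/-! ### Expansions in `1/N`, order by order in `z` -/

/-- `f N = A + O(1/N)`. -/
def HasLOExpansion (f : ℕ → PowerSeries ℂ) (A : PowerSeries ℂ) : Prop :=
  ∀ n, (fun N : ℕ => PowerSeries.coeff n (f N) - PowerSeries.coeff n A)
    =O[Filter.atTop] fun N : ℕ => ((N : ℝ))⁻¹

/-- `f N = A + N^{-(D-2)} (A' + O(1/N))`. -/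
def HasNLOExpansion (D : ℕ) (f : ℕ → PowerSeries ℂ) (A A' : PowerSeries ℂ) : Prop :=
  ∀ n, (fun N : ℕ =>
      (N : ℂ) ^ (D - 2) * (PowerSeries.coeff n (f N) - PowerSeries.coeff n A)
        - PowerSeries.coeff n A')
    =O[Filter.atTop] fun N : ℕ => ((N : ℝ))⁻¹

/-- `T` and `K₂` are the leading and next-to-leading orders of the 2-point function
(`K(B₂; N) = T + N^{-(D-2)} (K₂ + O(1/N))`), the 4-point cumulant has for each `N ≥ 2` a unique
expansion on trace invariants, and for every colour `c` the function `K₄` is the leading order of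
its rescaled coefficient `K(B_{4,{c}}; N) = N^{3(D-1)} W(B_{4,{c}}; N)`. -/
structure IsLargeNSolution {D : ℕ} {I : Type*} [Fintype I] (B : I → ColoredGraph D) (t : I → ℂ)
    (T K₂ K₄ : PowerSeries ℂ) : Prop where
  two_point : HasNLOExpansion D (twoPoint B t) T K₂
  expansion : ∀ N : ℕ, 2 ≤ N → ∃! w, IsInvariantExpansion B t N w
  four_point : ∀ W : ℕ → Finset (Fin D) → PowerSeries ℂ,
    (∀ N, 2 ≤ N → IsInvariantExpansion B t N (W N)) →
    ∀ c, HasLOExpansion (fun N => ((N : ℂ) ^ (3 * (D - 1))) • W N {c}) K₄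

section Functions

variable {D : ℕ} {I : Type*} [Fintype I] (B : I → ColoredGraph D) (t : I → ℂ) (T : PowerSeries ℂ)

/-- The singular factor `C = 1 - ∑ᵢ tᵢ pᵢ (zT)^{pᵢ-1}`. -/
noncomputable def singularFactor : PowerSeries ℂ :=
  1 - ∑ i, (t i * (B i).p) • ((PowerSeries.X : PowerSeries ℂ) * T) ^ ((B i).p - 1)

/-- The denominator `1 - ∑ᵢ tᵢ (β'ᵢ / pᵢ - (α'ᵢ + 1)) z^{pᵢ-1} T^{pᵢ}`. -/
noncomputable def denominator (c : Fin D) : PowerSeries ℂ :=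
  1 - ∑ i, (t i * ((B i).betaPrime c / (B i).p - ((B i).alphaPrime + 1))) •
    ((PowerSeries.X : PowerSeries ℂ) ^ ((B i).p - 1) * T ^ (B i).p)

end Functions

/-- The leading order 2-point function of the quartic model. -/
noncomputable def quarticT (D : ℕ) (z : ℂ) : ℂ :=
  if z = 0 then 1 else (1 - (1 - 4 * D * z) ^ (1 / 2 : ℂ)) / (2 * D * z)

end TensorModel

/-!
Order by order in `z`, expectations are finite combinations of Gaussian moments, so that they define
a linear functional `expect` on polynomials in the entries of `T` and `T̄`. Gaussian integration by
parts at a black vertex of a coloured graph gives the `loop_equation`: the vertex is contracted with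
a white vertex of the graph, or with a white vertex of an interaction bubble at the price of a power
of `z`. For an isolated two-vertex bubble and for a dipole these are the two Schwinger–Dyson
equations, exact in `N`.

The large `N` expansion is read off the same equations. A graph whose white and black vertices are
paired is a family of permutations, one for each colour, and its faces are their cycles. Euler's
inequality for the incidence graph between pairs and faces (`numFaces_le`) is an equality exactly
when this graph is a forest (`IsForest`); melonic bubbles with their leading pairing are trees. A
forest has a leaf, and a leaf is an isolated bubble or a dipole (`IsForest.exists_reduction`). The
loop equation removes it: the terms which are not forests are bounded by one factor `N` for each
connected component (`graphExp_mem_orderBound`), and the forests are treated by induction on the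
order in `z` and on the number of vertices. If `T`, `M` and `K` solve the fixed point equations of
`MelonicSeries`, a tree with `p` pairs has the expectation
`N (T^p + N^{-(D-2)} (p T^{p-1} K + α T^{p-2} M) + O(N^{-(D-1)}))` (`graphExp_sub_main_mem`).

The pairings of a tree at relative order `N^{-(D-2)}` are the leading one followed by the
transposition of two vertices of a common face (`IsTree.numFaces_repair_le`). Hence `α` counts the
pairs of distinct vertices lying in a common face, and `α'_c` those lying in a common face of colour
`c`. As two vertices share at most one face, `α' = α`, and `β` is `p α` plus the sum of the squares
of the lengths of the faces of colour `c` (`beta_eq`).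

The action is invariant under rotations of the indices of each colour, so that the 4-point cumulant
is an invariant tensor (`expect_rotation`, `invariant_four`); its coefficients on trace invariants
are its values at indices marking them, hence exist and are unique for `N ≥ 2`
(`isInvariantExpansion_iff`). They are recovered from the contractions of the cumulant along the
bubbles with four vertices by inverting a tensor power of a two by two matrix (`sum_fourTrace`). All
these contractions are `O(N^{3-D})` (`fourSeq_mem`), but for the coefficient of `{c}` the one along
`{c}` has the dominant weight, so that this coefficient, multiplied by `N^{3(D-1)}`, is `M - T ^ 2`
at leading order (`hasLOExpansion_fourPoint`).

The equations for `K` and `M` are then the linear system and its solution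
(`MelonicSeries.solution`). In the quartic model they are algebraic equations with explicit analytic
solutions, which are the sums of the power series by uniqueness of power series expansions; the
denominator `1 - z T ^ 2` has no zero, because the principal square root has nonnegative real part.
-/

set_option linter.unusedSectionVars false

open MeasureTheory

namespace TensorModel

/-! ### Gaussian integrals of monomials -/

theorem integral_complex_norm_pow_gaussian {s : ℝ} (hs : 0 < s) (n : ℕ) :
    ∫ z : ℂ, ‖z‖ ^ n * (s / Real.pi * Real.exp (-(s * ‖z‖ ^ 2))) =
      s / Real.pi * (Real.pi * s ^ (-((n : ℝ) + 2) / 2) * Real.Gamma (((n : ℝ) + 2) / 2)) := by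
  have h := Complex.integral_rpow_mul_exp_neg_mul_rpow (p := 2) (q := n) (b := s) (by norm_num)
    (by have : (0 : ℝ) ≤ n := n.cast_nonneg
        linarith) hs
  have h2 : (2 * Real.pi / 2 : ℝ) = Real.pi := by ring
  rw [h2] at h
  rw [← h, ← integral_const_mul]
  refine integral_congr_ae (Filter.Eventually.of_forall fun z => ?_)
  simp only [Real.rpow_natCast]
  norm_num
  ring

theorem integrable_norm_pow_gaussian {s : ℝ} (hs : 0 < s) (n : ℕ) :
    Integrable fun z : ℂ => ‖z‖ ^ n * (s / Real.pi * Real.exp (-(s * ‖z‖ ^ 2))) := by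
  by_contra h
  have h1 := integral_complex_norm_pow_gaussian hs n
  rw [integral_undef h] at h1
  have h3 : (0 : ℝ) < ((n : ℝ) + 2) / 2 := by positivity
  have : (0 : ℝ) < s / Real.pi *
      (Real.pi * s ^ (-((n : ℝ) + 2) / 2) * Real.Gamma (((n : ℝ) + 2) / 2)) := by
    have := Real.Gamma_pos_of_pos h3
    have := Real.pi_pos
    positivity
  linarith

/-- The one-dimensional Gaussian weight. -/
noncomputable def gaussWeight (s : ℝ) (z : ℂ) : ℝ := s / Real.pi * Real.exp (-(s * ‖z‖ ^ 2))

theorem integrable_pow_mul_conj_pow_gaussian {s : ℝ} (hs : 0 < s) (m n : ℕ) :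
    Integrable fun z : ℂ => z ^ m * (starRingEnd ℂ) z ^ n * (gaussWeight s z : ℂ) := by
  refine (integrable_norm_pow_gaussian hs (m + n)).mono ?_ (Filter.Eventually.of_forall fun z => ?_)
  · unfold gaussWeight
    exact (Continuous.aestronglyMeasurable (by fun_prop))
  · simp only [gaussWeight, norm_mul, norm_pow, RCLike.norm_conj, Complex.norm_real,
      Real.norm_eq_abs, abs_norm]
    rw [pow_add]

/-- Moments of the complex Gaussian measure of covariance `1 / s`. The mixed moments with `m ≠ n`
vanish by invariance under the rotation by the angle `π / (m - n)`. -/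
theorem integral_pow_mul_conj_pow_gaussian {s : ℝ} (hs : 0 < s) (m n : ℕ) :
    ∫ z : ℂ, z ^ m * (starRingEnd ℂ) z ^ n * (gaussWeight s z : ℂ) =
      if m = n then (m.factorial : ℂ) / (s : ℂ) ^ m else 0 := by
  split_ifs with h
  · subst h
    have h1 : ∀ z : ℂ, z ^ m * (starRingEnd ℂ) z ^ m * (gaussWeight s z : ℂ) =
        ((‖z‖ ^ (2 * m) * (s / Real.pi * Real.exp (-(s * ‖z‖ ^ 2))) : ℝ) : ℂ) := by
      intro z
      rw [← mul_pow, Complex.mul_conj, gaussWeight, Complex.normSq_eq_norm_sq]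
      push_cast
      ring
    simp_rw [h1]
    rw [integral_complex_ofReal, integral_complex_norm_pow_gaussian hs]
    have h2 : (((2 * m : ℕ) : ℝ) + 2) / 2 = (m : ℝ) + 1 := by push_cast; ring
    have h3 : -(((2 * m : ℕ) : ℝ) + 2) / 2 = -((m + 1 : ℕ) : ℝ) := by push_cast; ring
    rw [h2, h3, Real.Gamma_nat_eq_factorial, Real.rpow_neg hs.le, Real.rpow_natCast]
    have := Real.pi_ne_zero
    have := hs.ne'
    have : s / Real.pi * (Real.pi * (s ^ (m + 1))⁻¹ * (m.factorial : ℝ)) = m.factorial / s ^ m := by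
      field_simp
      ring
    rw [this]
    push_cast
    rfl
  -- the integrand changes sign under the rotation by this angle
  · set θ : ℝ := Real.pi / ((m : ℝ) - n) with hθ
    have hmn : ((m : ℝ) - n) ≠ 0 := sub_ne_zero.2 (by exact_mod_cast h)
    set u : Circle := Circle.exp θ with hu
    have hu1 : ((u : ℂ)) ^ m * (starRingEnd ℂ) (u : ℂ) ^ n = -1 := by
      have h1 : (starRingEnd ℂ) (u : ℂ) = (u : ℂ)⁻¹ := by
        rw [← Circle.coe_inv_eq_conj, Circle.coe_inv]
      rw [h1, hu, Circle.coe_exp, ← Complex.exp_neg, ← Complex.exp_nat_mul, ← Complex.exp_nat_mul,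
        ← Complex.exp_add, ← Complex.exp_pi_mul_I]
      congr 1
      have : (θ : ℂ) * ((m : ℂ) - n) = Real.pi := by
        rw [hθ]
        push_cast
        have : ((m : ℂ) - n) ≠ 0 := by exact_mod_cast hmn
        field_simp
      linear_combination Complex.I * this
    have h2 := (rotation u).measurePreserving.integral_comp
      (rotation u).toHomeomorph.measurableEmbedding
      (fun z : ℂ => z ^ m * (starRingEnd ℂ) z ^ n * (gaussWeight s z : ℂ))
    have h3 : ∀ z : ℂ, (rotation u z) ^ m * (starRingEnd ℂ) (rotation u z) ^ n *
        (gaussWeight s (rotation u z) : ℂ) =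
        -1 * (z ^ m * (starRingEnd ℂ) z ^ n * (gaussWeight s z : ℂ)) := by
      intro z
      rw [← hu1]
      simp only [gaussWeight, rotation_apply, map_mul, norm_mul, Circle.norm_coe, one_mul, mul_pow]
      ring
    simp_rw [h3] at h2
    rw [integral_const_mul] at h2
    have h4 : ∀ w : ℂ, -1 * w = w → w = 0 := fun w hw => by linear_combination (-1 / 2) * hw
    exact h4 _ h2

/-! ### The Gaussian functional on polynomials -/

section GaussianFunctional

variable {ι : Type*}

/-- Polynomials in the components `T a` (variables `inl a`) and `conj (T a)` (variables `inr a`)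
of a tensor. -/
abbrev TensorPoly (ι : Type*) := MvPolynomial (ι ⊕ ι) ℂ

/-- Evaluation of a polynomial at a tensor. -/
noncomputable def evalTensor (T : ι → ℂ) : TensorPoly ι →ₐ[ℂ] ℂ :=
  MvPolynomial.aeval (Sum.elim T fun a => (starRingEnd ℂ) (T a))

@[simp] theorem evalTensor_inl (T : ι → ℂ) (a : ι) :
    evalTensor T (MvPolynomial.X (Sum.inl a)) = T a := by simp [evalTensor]

@[simp] theorem evalTensor_inr (T : ι → ℂ) (a : ι) :
    evalTensor T (MvPolynomial.X (Sum.inr a)) = (starRingEnd ℂ) (T a) := by simp [evalTensor]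

/-- The moment `E[z ^ m * conj z ^ n]` of a complex Gaussian of covariance `1 / s`. -/
noncomputable def gaussMoment (s : ℝ) (m n : ℕ) : ℂ :=
  if m = n then (m.factorial : ℂ) / (s : ℂ) ^ m else 0

theorem gaussMoment_succ_right {s : ℝ} (hs : s ≠ 0) (m n : ℕ) :
    gaussMoment s m (n + 1) = (s : ℂ)⁻¹ * m * gaussMoment s (m - 1) n := by
  have hs' : (s : ℂ) ≠ 0 := by exact_mod_cast hs
  unfold gaussMoment
  rcases m with _ | m
  · simp
  · simp only [Nat.add_right_cancel_iff, Nat.add_sub_cancel]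
    split_ifs
    · rw [Nat.factorial_succ]
      push_cast
      field_simp
      ring
    · simp

theorem gaussMoment_comm (s : ℝ) (m n : ℕ) : gaussMoment s m n = gaussMoment s n m := by
  unfold gaussMoment
  by_cases h : m = n
  · simp [h]
  · simp [h, Ne.symm h]

variable [Fintype ι]

theorem evalTensor_monomial (T : ι → ℂ) (m : (ι ⊕ ι) →₀ ℕ) (c : ℂ) :
    evalTensor T (MvPolynomial.monomial m c) =
      c * ∏ a, T a ^ m (Sum.inl a) * (starRingEnd ℂ) (T a) ^ m (Sum.inr a) := by
  rw [evalTensor, MvPolynomial.aeval_monomial, Finsupp.prod_fintype _ _ (by simp),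
    Fintype.prod_sum_type, Finset.prod_mul_distrib]
  simp

theorem integrable_evalTensor {s : ℝ} (hs : 0 < s) (p : TensorPoly ι) :
    Integrable fun T : ι → ℂ => evalTensor T p * ((∏ a, gaussWeight s (T a) : ℝ) : ℂ) := by
  induction p using MvPolynomial.induction_on' with
  | monomial m c =>
    have h := (Integrable.fintype_prod (f := fun a => fun z : ℂ =>
      z ^ m (Sum.inl a) * (starRingEnd ℂ) z ^ m (Sum.inr a) * (gaussWeight s z : ℂ))
      (fun a => integrable_pow_mul_conj_pow_gaussian hs _ _)).const_mul c
    refine h.congr (Filter.Eventually.of_forall fun T => ?_)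
    simp only [evalTensor_monomial]
    push_cast
    rw [Finset.prod_mul_distrib, mul_assoc]
  | add p q hp hq =>
    refine (hp.add hq).congr (Filter.Eventually.of_forall fun T => ?_)
    simp only [map_add, Pi.add_apply]
    ring

/-- The Gaussian expectation of covariance `1 / s`, as a linear functional on polynomials. -/
noncomputable def gaussE {s : ℝ} (hs : 0 < s) : TensorPoly ι →ₗ[ℂ] ℂ where
  toFun p := ∫ T : ι → ℂ, evalTensor T p * ((∏ a, gaussWeight s (T a) : ℝ) : ℂ)
  map_add' p q := by
    rw [← integral_add (integrable_evalTensor hs p) (integrable_evalTensor hs q)]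
    simp only [map_add, add_mul]
  map_smul' c p := by
    simp only [map_smul, smul_eq_mul, mul_assoc, RingHom.id_apply]
    exact integral_const_mul _ _

theorem gaussE_monomial {s : ℝ} (hs : 0 < s) (m : (ι ⊕ ι) →₀ ℕ) (c : ℂ) :
    gaussE hs (MvPolynomial.monomial m c) =
      c * ∏ a, gaussMoment s (m (Sum.inl a)) (m (Sum.inr a)) := by
  have h : ∀ T : ι → ℂ, evalTensor T (MvPolynomial.monomial m c) *
      ((∏ a, gaussWeight s (T a) : ℝ) : ℂ) =
      c * ∏ a, (T a ^ m (Sum.inl a) * (starRingEnd ℂ) (T a) ^ m (Sum.inr a) *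
        (gaussWeight s (T a) : ℂ)) := by
    intro T
    rw [evalTensor_monomial]
    push_cast
    rw [mul_assoc, ← Finset.prod_mul_distrib]
  change ∫ T : ι → ℂ, evalTensor T (MvPolynomial.monomial m c) *
      ((∏ a, gaussWeight s (T a) : ℝ) : ℂ) = _
  simp_rw [h]
  rw [integral_const_mul, integral_fintype_prod_volume_eq_prod (fun a => fun z : ℂ =>
      z ^ m (Sum.inl a) * (starRingEnd ℂ) z ^ m (Sum.inr a) * (gaussWeight s z : ℂ))]
  simp_rw [integral_pow_mul_conj_pow_gaussian hs]
  rfl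

theorem gaussE_one {s : ℝ} (hs : 0 < s) : gaussE hs (1 : TensorPoly ι) = 1 := by
  have h := gaussE_monomial (ι := ι) hs 0 1
  simpa [gaussMoment] using h

variable [DecidableEq ι]

/-- Gaussian integration by parts. -/
theorem gaussE_X_inr_mul {s : ℝ} (hs : 0 < s) (β : ι) (p : TensorPoly ι) :
    gaussE hs (MvPolynomial.X (Sum.inr β) * p) =
      (s : ℂ)⁻¹ * gaussE hs (MvPolynomial.pderiv (Sum.inl β) p) := by
  induction p using MvPolynomial.induction_on' with
  | monomial m c =>
    rw [MvPolynomial.pderiv_monomial, MvPolynomial.X, MvPolynomial.monomial_mul, gaussE_monomial,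
      gaussE_monomial, ← Finset.mul_prod_erase _ _ (Finset.mem_univ β),
      ← Finset.mul_prod_erase _ _ (Finset.mem_univ β)]
    have h : ∀ a ∈ Finset.univ.erase β,
        gaussMoment s ((Finsupp.single (Sum.inr β) 1 + m : (ι ⊕ ι) →₀ ℕ) (Sum.inl a))
          ((Finsupp.single (Sum.inr β) 1 + m : (ι ⊕ ι) →₀ ℕ) (Sum.inr a)) =
        gaussMoment s ((m - Finsupp.single (Sum.inl β) 1 : (ι ⊕ ι) →₀ ℕ) (Sum.inl a))
          ((m - Finsupp.single (Sum.inl β) 1 : (ι ⊕ ι) →₀ ℕ) (Sum.inr a)) := by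
      intro a ha
      have := (Finset.ne_of_mem_erase ha).symm
      simp [this]
    rw [Finset.prod_congr rfl h]
    simp only [Finsupp.add_apply, Finsupp.single_apply, Finsupp.tsub_apply, reduceCtorEq, if_false,
      if_true, zero_add, tsub_zero]
    rw [add_comm 1, gaussMoment_succ_right hs.ne']
    ring
  | add p q hp hq =>
    simp only [mul_add, map_add, hp, hq]

/-- Gaussian integration by parts for the entries of `T`. -/
theorem gaussE_X_inl_mul {s : ℝ} (hs : 0 < s) (β : ι) (p : TensorPoly ι) :
    gaussE hs (MvPolynomial.X (Sum.inl β) * p) =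
      (s : ℂ)⁻¹ * gaussE hs (MvPolynomial.pderiv (Sum.inr β) p) := by
  induction p using MvPolynomial.induction_on' with
  | monomial m c =>
    rw [MvPolynomial.pderiv_monomial, MvPolynomial.X, MvPolynomial.monomial_mul, gaussE_monomial,
      gaussE_monomial, ← Finset.mul_prod_erase _ _ (Finset.mem_univ β),
      ← Finset.mul_prod_erase _ _ (Finset.mem_univ β)]
    have h : ∀ a ∈ Finset.univ.erase β,
        gaussMoment s ((Finsupp.single (Sum.inl β) 1 + m : (ι ⊕ ι) →₀ ℕ) (Sum.inl a))
          ((Finsupp.single (Sum.inl β) 1 + m : (ι ⊕ ι) →₀ ℕ) (Sum.inr a)) =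
        gaussMoment s ((m - Finsupp.single (Sum.inr β) 1 : (ι ⊕ ι) →₀ ℕ) (Sum.inl a))
          ((m - Finsupp.single (Sum.inr β) 1 : (ι ⊕ ι) →₀ ℕ) (Sum.inr a)) := by
      intro a ha
      have := (Finset.ne_of_mem_erase ha).symm
      simp [this]
    rw [Finset.prod_congr rfl h]
    simp only [Finsupp.add_apply, Finsupp.single_apply, Finsupp.tsub_apply, reduceCtorEq, if_false,
      if_true, zero_add, tsub_zero]
    rw [add_comm 1, gaussMoment_comm, gaussMoment_succ_right hs.ne', gaussMoment_comm]
    ring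
  | add p q hp hq =>
    simp only [mul_add, map_add, hp, hq]

end GaussianFunctional

end TensorModel
open MeasureTheory

namespace TensorModel

/-! ### Perturbative moments and their Schwinger–Dyson equations -/

section TracePoly

variable {D N : ℕ} {V : Type*} [Fintype V] [DecidableEq V]

/-- The indices carried by the black vertex `w` when the white vertices carry the indices `a`. -/
def blackIndex (σ : Fin D → Equiv.Perm V) (a : V → Fin D → Fin N) (w : V) : Fin D → Fin N :=
  fun c => a ((σ c)⁻¹ w) c

/-- The trace invariant, as a polynomial, of the coloured graph with white and black vertices both
labelled by `V`, in which the edge of colour `c` at the white vertex `v` ends at the black vertex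
`σ c v`. -/
noncomputable def tracePoly (N : ℕ) (σ : Fin D → Equiv.Perm V) : TensorPoly (Fin D → Fin N) :=
  ∑ a : V → Fin D → Fin N, (∏ v, MvPolynomial.X (Sum.inl (a v))) *
    ∏ w, MvPolynomial.X (Sum.inr (blackIndex σ a w))

theorem traceInvariant_eq_evalTensor (G : ColoredGraph D) (T : Tensor D N) :
    traceInvariant G T = evalTensor T (tracePoly N G.adj) := by
  unfold traceInvariant tracePoly
  rw [map_sum]
  refine Finset.sum_congr rfl fun a _ => ?_
  have key : ∀ b : Fin G.p → Fin D → Fin N,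
      (∏ c, ∏ v, (if a v c = b (G.adj c v) c then (1 : ℂ) else 0)) =
        if b = blackIndex G.adj a then 1 else 0 := by
    intro b
    split_ifs with h
    · subst h
      simp [blackIndex]
    · have : ∃ w c, b w c ≠ blackIndex G.adj a w c := by
        by_contra! hcon
        exact h (funext fun w => funext fun c => hcon w c)
      obtain ⟨w, c, hwc⟩ := this
      refine Finset.prod_eq_zero (Finset.mem_univ c)
        (Finset.prod_eq_zero (Finset.mem_univ ((G.adj c)⁻¹ w)) (if_neg ?_))
      simpa [blackIndex, eq_comm] using hwc
  simp_rw [key]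
  rw [Finset.sum_eq_single (blackIndex G.adj a)]
  · simp
  · intro b _ hb
    simp [hb]
  · simp

end TracePoly

section Weight

theorem coeff_pow_eq_zero_of_lt {R : Type*} [CommRing R] {f : PowerSeries R} (hf : PowerSeries.constantCoeff f = 0)
    {n k : ℕ} (h : n < k) : PowerSeries.coeff n (f ^ k) = 0 :=
  PowerSeries.X_pow_dvd_iff.1 (pow_dvd_pow_of_dvd (PowerSeries.X_dvd_iff.2 hf) k) n h

variable {R : Type*} [CommRing R] [Algebra ℂ R]

/-- A derivation applied to the coefficients of a power series. -/
noncomputable def coeffDerivation (δ : Derivation ℂ R R) (f : PowerSeries R) : PowerSeries R :=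
  PowerSeries.mk fun n => δ (PowerSeries.coeff n f)

theorem coeffDerivation_mul (δ : Derivation ℂ R R) (f g : PowerSeries R) :
    coeffDerivation δ (f * g) = f * coeffDerivation δ g + g * coeffDerivation δ f := by
  ext n
  rw [mul_comm g]
  simp only [coeffDerivation, PowerSeries.coeff_mk, PowerSeries.coeff_mul, map_add, map_sum,
    Derivation.leibniz, smul_eq_mul, Finset.sum_add_distrib]
  congr 1
  exact Finset.sum_congr rfl fun _ _ => mul_comm _ _

theorem coeffDerivation_pow_succ (δ : Derivation ℂ R R) (f : PowerSeries R) (k : ℕ) :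
    coeffDerivation δ (f ^ (k + 1)) = (k + 1 : ℂ) • (f ^ k * coeffDerivation δ f) := by
  induction k with
  | zero => simp
  | succ k ih =>
    rw [pow_succ, coeffDerivation_mul, ih]
    simp only [Algebra.smul_def, map_add, map_natCast, map_one]
    push_cast
    ring

/-- The coefficient of order `n` of the exponential of a power series without constant term. -/
noncomputable def expCoeff (f : PowerSeries R) (n : ℕ) : R :=
  ∑ k ∈ Finset.range (n + 1), ((k.factorial : ℂ)⁻¹) • PowerSeries.coeff n (f ^ k)

theorem expCoeff_eq_sum_range {f : PowerSeries R} (hf : PowerSeries.constantCoeff f = 0)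
    {n m : ℕ} (h : n < m) :
    expCoeff f n = ∑ k ∈ Finset.range m, ((k.factorial : ℂ)⁻¹) • PowerSeries.coeff n (f ^ k) := by
  refine Finset.sum_subset (Finset.range_mono h) fun k _ hk => ?_
  rw [coeff_pow_eq_zero_of_lt hf (by simpa using hk), smul_zero]

/-- The derivative `δ (exp f) = exp f * δ f`, coefficient by coefficient. Although the exponential
series is truncated at a length depending on `n`, nothing is lost, as `f ^ k` starts at order
`k`. -/
theorem derivation_expCoeff (δ : Derivation ℂ R R) {f : PowerSeries R}
    (hf : PowerSeries.constantCoeff f = 0) (n : ℕ) :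
    δ (expCoeff f n) = ∑ x ∈ Finset.HasAntidiagonal.antidiagonal n,
      expCoeff f x.1 * δ (PowerSeries.coeff x.2 f) := by
  have h1 : ∀ k : ℕ, δ (PowerSeries.coeff n (f ^ (k + 1))) =
      (k + 1 : ℂ) • ∑ x ∈ Finset.HasAntidiagonal.antidiagonal n,
        PowerSeries.coeff x.1 (f ^ k) * δ (PowerSeries.coeff x.2 f) := by
    intro k
    have h := congrArg (PowerSeries.coeff n) (coeffDerivation_pow_succ δ f k)
    simpa [coeffDerivation, PowerSeries.coeff_mul] using h
  rw [expCoeff_eq_sum_range hf (show n < n + 2 by omega), map_sum, Finset.sum_range_succ']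
  simp only [Derivation.map_smul, h1, pow_zero]
  have h0 : δ (PowerSeries.coeff n (1 : PowerSeries R)) = 0 := by
    rw [PowerSeries.coeff_one]
    split_ifs <;> simp
  rw [h0, smul_zero, add_zero]
  have h2 : ∀ x ∈ Finset.HasAntidiagonal.antidiagonal n, expCoeff f x.1 * δ (PowerSeries.coeff x.2 f) =
      ∑ k ∈ Finset.range (n + 1), ((k.factorial : ℂ)⁻¹) •
        (PowerSeries.coeff x.1 (f ^ k) * δ (PowerSeries.coeff x.2 f)) := by
    intro x hx
    have : x.1 < n + 1 := by
      have := Finset.HasAntidiagonal.mem_antidiagonal.1 hx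
      omega
    rw [expCoeff_eq_sum_range hf this, Finset.sum_mul]
    simp only [smul_mul_assoc]
  rw [Finset.sum_congr rfl h2, Finset.sum_comm]
  refine Finset.sum_congr rfl fun k _ => ?_
  rw [smul_smul, Finset.smul_sum]
  refine Finset.sum_congr rfl fun x _ => ?_
  congr 1
  rw [Nat.factorial_succ]
  push_cast
  have h3 : (k : ℂ) + 1 ≠ 0 := by exact_mod_cast Nat.succ_ne_zero k
  have h4 : (k.factorial : ℂ) ≠ 0 := by exact_mod_cast k.factorial_ne_zero
  field_simp

end Weight

section SchwingerDyson

variable {D : ℕ} {I : Type*} [Fintype I] (B : I → ColoredGraph D) (t : I → ℂ) (N : ℕ)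

/-- `N ^ (D - 1)` times minus the interaction part of the action, as a power series with polynomial
coefficients. -/
noncomputable def interactionPoly : PowerSeries (TensorPoly (Fin D → Fin N)) :=
  ∑ i, PowerSeries.X ^ ((B i).p - 1) *
    PowerSeries.C (((N : ℂ) ^ (D - 1) * (t i / (B i).p)) • tracePoly N (B i).adj)

theorem map_interactionPoly (T : Tensor D N) :
    PowerSeries.map (evalTensor T : TensorPoly (Fin D → Fin N) →+* ℂ) (interactionPoly B t N) =
      interaction B t N T := by
  unfold interactionPoly interaction
  rw [map_sum]
  refine Finset.sum_congr rfl fun i _ => ?_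
  simp only [map_mul, map_pow, PowerSeries.map_X, PowerSeries.map_C, RingHom.coe_coe, map_smul,
    ← traceInvariant_eq_evalTensor, PowerSeries.smul_eq_C_mul, smul_eq_mul]
  ring

theorem evalTensor_expCoeff (T : Tensor D N) (n : ℕ) :
    evalTensor T (expCoeff (interactionPoly B t N) n) = weightCoeff B t N n T := by
  unfold expCoeff weightCoeff
  rw [map_sum]
  refine Finset.sum_congr rfl fun k _ => ?_
  rw [← map_interactionPoly, ← map_pow, PowerSeries.coeff_map, map_smul, smul_eq_mul,
    div_eq_inv_mul]
  rfl

theorem constantCoeff_interactionPoly (hB : ∀ i, 2 ≤ (B i).p) :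
    PowerSeries.constantCoeff (interactionPoly B t N) = 0 := by
  unfold interactionPoly
  rw [map_sum]
  refine Finset.sum_eq_zero fun i _ => ?_
  have := hB i
  rw [map_mul, map_pow, PowerSeries.constantCoeff_X, zero_pow (by omega), zero_mul]

theorem coeff_interactionPoly (n : ℕ) :
    PowerSeries.coeff n (interactionPoly B t N) =
      ∑ i, if n = (B i).p - 1 then
        ((N : ℂ) ^ (D - 1) * (t i / (B i).p)) • tracePoly N (B i).adj else 0 := by
  unfold interactionPoly
  rw [map_sum]
  refine Finset.sum_congr rfl fun i _ => ?_
  rw [mul_comm, PowerSeries.coeff_C_mul, PowerSeries.coeff_X_pow]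
  split_ifs <;> simp

variable {N}

theorem scale_pos (hN : 1 ≤ N) : (0 : ℝ) < (N : ℝ) ^ (D - 1) := by
  have : (0 : ℝ) < N := by exact_mod_cast hN
  positivity

/-- The perturbative moments, as a linear map on polynomials. -/
noncomputable def momentPoly (hN : 1 ≤ N) :
    TensorPoly (Fin D → Fin N) →ₗ[ℂ] PowerSeries ℂ where
  toFun p := PowerSeries.mk fun n =>
    gaussE (scale_pos (D := D) hN) (p * expCoeff (interactionPoly B t N) n)
  map_add' p q := by
    ext n
    simp [add_mul]
  map_smul' c p := by
    ext n
    simp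

theorem momentPoly_eq (hN : 1 ≤ N) (p : TensorPoly (Fin D → Fin N)) :
    momentPoly B t hN p = moment B t N fun T => evalTensor T p := by
  ext n
  simp only [momentPoly, moment, LinearMap.coe_mk, AddHom.coe_mk, PowerSeries.coeff_mk,
    gaussianIntegral, ← evalTensor_expCoeff, ← map_mul]
  rfl

theorem coeff_momentPoly (hN : 1 ≤ N) (p : TensorPoly (Fin D → Fin N)) (n : ℕ) :
    PowerSeries.coeff n (momentPoly B t hN p) =
      gaussE (scale_pos (D := D) hN) (p * expCoeff (interactionPoly B t N) n) := by
  simp [momentPoly]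

variable {B}

/-- The derivative of the exponential of the interaction produces one interaction vertex. -/
theorem gaussE_mul_derivation_expCoeff (hB : ∀ i, 2 ≤ (B i).p) (hN : 1 ≤ N)
    (δ : Derivation ℂ (TensorPoly (Fin D → Fin N)) (TensorPoly (Fin D → Fin N)))
    (p : TensorPoly (Fin D → Fin N)) (n : ℕ) :
    gaussE (scale_pos (D := D) hN) (p * δ (expCoeff (interactionPoly B t N) n)) =
      PowerSeries.coeff n (∑ i, ((N : ℂ) ^ (D - 1) * (t i / (B i).p)) •
        (PowerSeries.X ^ ((B i).p - 1) * momentPoly B t hN (p * δ (tracePoly N (B i).adj)))) := by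
  rw [derivation_expCoeff δ (constantCoeff_interactionPoly B t N hB), Finset.mul_sum, map_sum,
    map_sum]
  simp only [coeff_interactionPoly, map_sum, Finset.mul_sum]
  rw [Finset.sum_comm]
  refine Finset.sum_congr rfl fun i _ => ?_
  rw [PowerSeries.coeff_smul, mul_comm (PowerSeries.X ^ _), PowerSeries.coeff_mul, smul_eq_mul,
    Finset.mul_sum]
  refine Finset.sum_congr rfl fun x _ => ?_
  rw [coeff_momentPoly, PowerSeries.coeff_X_pow]
  split_ifs with h
  · rw [Derivation.map_smul, mul_smul_comm, mul_smul_comm, map_smul, smul_eq_mul, mul_one]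
    congr 2
    ring
  · simp

/-- The Schwinger–Dyson equation for perturbative moments. -/
theorem momentPoly_X_inr_mul (hB : ∀ i, 2 ≤ (B i).p) (hN : 1 ≤ N) (β : Fin D → Fin N)
    (p : TensorPoly (Fin D → Fin N)) :
    momentPoly B t hN (MvPolynomial.X (Sum.inr β) * p) =
      ((N : ℂ) ^ (D - 1))⁻¹ • momentPoly B t hN (MvPolynomial.pderiv (Sum.inl β) p) +
      ∑ i, (t i / (B i).p) • (PowerSeries.X ^ ((B i).p - 1) *
        momentPoly B t hN (p * MvPolynomial.pderiv (Sum.inl β) (tracePoly N (B i).adj))) := by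
  have hs : (N : ℂ) ^ (D - 1) ≠ 0 := pow_ne_zero _ (by exact_mod_cast (by omega : N ≠ 0))
  ext n
  rw [coeff_momentPoly, mul_assoc, gaussE_X_inr_mul, Derivation.leibniz, map_add, smul_eq_mul,
    smul_eq_mul, gaussE_mul_derivation_expCoeff t hB hN, map_add, PowerSeries.coeff_smul,
    coeff_momentPoly, mul_comm (expCoeff _ _), mul_add, add_comm]
  push_cast
  congr 1
  rw [map_sum, map_sum, Finset.mul_sum]
  refine Finset.sum_congr rfl fun i _ => ?_
  simp only [PowerSeries.coeff_smul, smul_eq_mul]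
  field_simp

variable (B)

/-- The perturbative expectation, as a linear map on polynomials. -/
noncomputable def expect (hN : 1 ≤ N) : TensorPoly (Fin D → Fin N) →ₗ[ℂ] PowerSeries ℂ :=
  (LinearMap.mulRight ℂ (momentPoly B t hN 1)⁻¹).comp (momentPoly B t hN)

theorem expect_apply (hN : 1 ≤ N) (p : TensorPoly (Fin D → Fin N)) :
    expect B t hN p = momentPoly B t hN p * (momentPoly B t hN 1)⁻¹ := rfl

theorem expectation_evalTensor (hN : 1 ≤ N) (p : TensorPoly (Fin D → Fin N)) :
    expectation B t N (fun T => evalTensor T p) = expect B t hN p := by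
  rw [expectation, expect_apply, momentPoly_eq, momentPoly_eq]
  simp only [map_one]

theorem expectation_traceInvariant (hN : 1 ≤ N) (G : ColoredGraph D) :
    expectation B t N (traceInvariant G) = expect B t hN (tracePoly N G.adj) := by
  rw [← expectation_evalTensor]
  congr 1
  funext T
  exact traceInvariant_eq_evalTensor G T

theorem expect_one (hN : 1 ≤ N) : expect B t hN 1 = 1 := by
  rw [expect_apply]
  apply PowerSeries.mul_inv_cancel
  rw [← PowerSeries.coeff_zero_eq_constantCoeff_apply, coeff_momentPoly]
  simp [expCoeff, gaussE_one]

variable {B}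

/-- The Schwinger–Dyson equation for normalized expectations. -/
theorem expect_X_inr_mul (hB : ∀ i, 2 ≤ (B i).p) (hN : 1 ≤ N) (β : Fin D → Fin N)
    (p : TensorPoly (Fin D → Fin N)) :
    expect B t hN (MvPolynomial.X (Sum.inr β) * p) =
      ((N : ℂ) ^ (D - 1))⁻¹ • expect B t hN (MvPolynomial.pderiv (Sum.inl β) p) +
      ∑ i, (t i / (B i).p) • (PowerSeries.X ^ ((B i).p - 1) *
        expect B t hN (p * MvPolynomial.pderiv (Sum.inl β) (tracePoly N (B i).adj))) := by
  simp only [expect_apply]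
  rw [momentPoly_X_inr_mul t hB hN, add_mul, smul_mul_assoc, Finset.sum_mul]
  congr 1
  refine Finset.sum_congr rfl fun i _ => ?_
  rw [smul_mul_assoc, mul_assoc]

end SchwingerDyson

end TensorModel
open MeasureTheory

namespace TensorModel

/-! ### Operations on coloured graphs and the loop equation -/

section Operations

variable {D : ℕ} {U V W : Type*} [DecidableEq U] [DecidableEq V] [DecidableEq W]

/-- Exchange of the ends of the edges of colour `c` at the white vertices `v` and `x`. -/
def swapAt (σ : Fin D → Equiv.Perm V) (c : Fin D) (v x : V) : Fin D → Equiv.Perm V :=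
  fun c' => if c' = c then σ c' * Equiv.swap v x else σ c'

/-- Disjoint union with an isolated two-vertex bubble, whose vertices are labelled `none`. -/
def addBubble (σ : Fin D → Equiv.Perm V) : Fin D → Equiv.Perm (Option V) :=
  fun c => Equiv.optionCongr (σ c)

/-- Insertion of a dipole, with vertices labelled `none`, on the edge of colour `c` at `v`. -/
def insDipole (σ : Fin D → Equiv.Perm V) (c : Fin D) (v : V) : Fin D → Equiv.Perm (Option V) :=
  swapAt (addBubble σ) c (some v) none

/-- Disjoint union. -/
def graphSum (σ : Fin D → Equiv.Perm V) (τ : Fin D → Equiv.Perm W) :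
    Fin D → Equiv.Perm (V ⊕ W) :=
  fun c => Equiv.sumCongr (σ c) (τ c)

/-- Removal of the black vertex `none` and the white vertex `x`, whose neighbours are joined colour
by colour. -/
def contract (ρ : Fin D → Equiv.Perm (Option U)) (x : Option U) : Fin D → Equiv.Perm U :=
  fun c => Equiv.removeNone (ρ c * Equiv.swap none x)

/-- The number of edges between the white vertex `x` and the black vertex `none`. -/
def directEdges (ρ : Fin D → Equiv.Perm (Option U)) (x : Option U) : ℕ :=
  (Finset.univ.filter fun c => ρ c x = none).card

/-- The vertex `none` of the left part is moved to the right part. -/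
def moveNone (U V : Type*) : Option U ⊕ V ≃ U ⊕ Option V where
  toFun := Sum.elim (fun u => u.elim (Sum.inr none) Sum.inl) fun v => Sum.inr (some v)
  invFun := Sum.elim (fun u => Sum.inl (some u)) fun v => v.elim (Sum.inl none) Sum.inr
  left_inv := by rintro ((_ | u) | v) <;> rfl
  right_inv := by rintro (u | (_ | v)) <;> rfl

/-- The graph obtained from `ρ` and `τ` by removing the black vertex `none` of `ρ` and the white
vertex `none` of `τ`, whose neighbours are joined colour by colour. The remaining white vertex
`none` of `ρ` and black vertex `none` of `τ` are both labelled `inl none`. -/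
def glue (ρ : Fin D → Equiv.Perm (Option U)) (τ : Fin D → Equiv.Perm (Option V)) :
    Fin D → Equiv.Perm (Option U ⊕ V) :=
  fun c => (moveNone U V).symm.permCongr (Equiv.sumCongr 1 (τ c)) * Equiv.sumCongr (ρ c) 1

/-- Relabelling of a graph such that the vertex `x` becomes `none`. -/
def rootAt (τ : Fin D → Equiv.Perm V) (x : V) : Fin D → Equiv.Perm (Option {v // v ≠ x}) :=
  fun c => (Equiv.optionSubtypeNe x).symm.permCongr (τ c)

end Operations

section TraceIdentities

variable {D N : ℕ} {U V W : Type*} [Fintype U] [Fintype V] [Fintype W]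
  [DecidableEq U] [DecidableEq V] [DecidableEq W]

theorem tracePoly_relabel {σ : Fin D → Equiv.Perm V} {σ' : Fin D → Equiv.Perm W} (e f : V ≃ W)
    (h : ∀ c v, σ' c (e v) = f (σ c v)) : tracePoly N σ = tracePoly N σ' := by
  unfold tracePoly
  refine Fintype.sum_equiv (e.arrowCongr (Equiv.refl _)) _ _ fun a => ?_
  have h1 : ∀ c w, (σ' c)⁻¹ (f w) = e ((σ c)⁻¹ w) := fun c w => by
    rw [Equiv.Perm.inv_eq_iff_eq, h]
    simp
  have h2 : ∀ w, blackIndex σ' (e.arrowCongr (Equiv.refl _) a) (f w) = blackIndex σ a w := by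
    intro w
    funext c
    simp [blackIndex, h1]
  rw [← Equiv.prod_comp e, ← Equiv.prod_comp f]
  simp only [h2]
  simp

theorem tracePoly_graphSum (σ : Fin D → Equiv.Perm V) (τ : Fin D → Equiv.Perm W) :
    tracePoly N (graphSum σ τ) = tracePoly N σ * tracePoly N τ := by
  unfold tracePoly
  rw [Finset.sum_mul_sum, ← Fintype.sum_prod_type']
  refine Fintype.sum_equiv (Equiv.sumArrowEquivProdArrow V W _) _ _ fun a => ?_
  have h1 : ∀ w, blackIndex (graphSum σ τ) a (Sum.inl w) = blackIndex σ (a ∘ Sum.inl) w :=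
    fun w => by funext c; simp [blackIndex, graphSum]
  have h2 : ∀ w, blackIndex (graphSum σ τ) a (Sum.inr w) = blackIndex τ (a ∘ Sum.inr) w :=
    fun w => by funext c; simp [blackIndex, graphSum]
  simp only [Fintype.prod_sum_type, h1, h2]
  simp only [Equiv.sumArrowEquivProdArrow, Equiv.coe_fn_mk, Function.comp_apply]
  change _ * _ * (_ * _) = (_ * _) * (_ * _)
  rw [mul_mul_mul_comm]

theorem tracePoly_of_isEmpty [IsEmpty V] (σ : Fin D → Equiv.Perm V) : tracePoly N σ = 1 := by
  simp [tracePoly]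

/-- The part of the contraction of the black vertex `none` in which it meets the white vertex
`x`. -/
noncomputable def contractSum (N : ℕ) (ρ : Fin D → Equiv.Perm (Option U)) (x : Option U) :
    TensorPoly (Fin D → Fin N) :=
  ∑ a : Option U → Fin D → Fin N, if a x = blackIndex ρ a none then
    (∏ v ∈ Finset.univ.erase x, MvPolynomial.X (Sum.inl (a v))) *
      ∏ w : U, MvPolynomial.X (Sum.inr (blackIndex ρ a (some w))) else 0

/-- Exchanging the white vertices `x` and `none` reduces a contraction to that of two vertices with
the same label. -/
theorem contractSum_eq_none (ρ : Fin D → Equiv.Perm (Option U)) (x : Option U) :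
    contractSum N ρ x = contractSum N (fun c => ρ c * Equiv.swap none x) none := by
  unfold contractSum
  refine Fintype.sum_equiv ((Equiv.swap none x).arrowCongr (Equiv.refl _)) _ _ fun a => ?_
  have h1 : ∀ w, blackIndex (fun c => ρ c * Equiv.swap none x)
      ((Equiv.swap none x).arrowCongr (Equiv.refl _) a) w = blackIndex ρ a w := by
    intro w
    funext c
    simp [blackIndex, mul_inv_rev]
  simp only [h1]
  have h2 : (Equiv.swap none x).arrowCongr (Equiv.refl _) a none = a x := by simp
  rw [h2]
  split_ifs
  · congr 1
    refine Finset.prod_equiv (Equiv.swap none x) (fun v => ?_) fun v _ => by simp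
    simp only [Finset.mem_erase, Finset.mem_univ, and_true]
    rw [not_iff_not, Equiv.swap_apply_eq_iff, Equiv.swap_apply_left]
  · rfl

/-- Each edge joining the two contracted vertices becomes a free sum over an index, hence a factor
`N`; the other edges are joined colour by colour. -/
theorem contractSum_none (ρ : Fin D → Equiv.Perm (Option U)) :
    contractSum N ρ none =
      ((N : ℂ) ^ directEdges ρ none) • tracePoly N (fun c => Equiv.removeNone (ρ c)) := by
  unfold contractSum
  rw [← Equiv.sum_comp (Equiv.piOptionEquivProd (α := U) (β := fun _ => Fin D → Fin N)).symm,
    Fintype.sum_prod_type_right, tracePoly, Finset.smul_sum]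
  refine Finset.sum_congr rfl fun a' _ => ?_
  -- the white neighbour of the black vertex `none` along each colour
  set g : Fin D → Option U := fun c => (ρ c)⁻¹ none with hg
  -- the values of the index at `none` compatible with the contraction
  set S : Finset (Fin D → Fin N) := Fintype.piFinset fun c =>
    (g c).elim Finset.univ fun u => {a' u c} with hS
  have hcond : ∀ a₀ : Fin D → Fin N,
      ((Equiv.piOptionEquivProd (α := U) (β := fun _ => Fin D → Fin N)).symm (a₀, a') none =
        blackIndex ρ ((Equiv.piOptionEquivProd (α := U) (β := fun _ => Fin D → Fin N)).symm
          (a₀, a')) none) ↔ a₀ ∈ S := by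
    intro a₀
    rw [hS, Fintype.mem_piFinset, funext_iff]
    refine forall_congr' fun c => ?_
    change a₀ c = (Equiv.piOptionEquivProd (α := U) (β := fun _ => Fin D → Fin N)).symm
      (a₀, a') (g c) c ↔ _
    cases g c <;> simp [Equiv.piOptionEquivProd]
  have hval : ∀ a₀ ∈ S, ∀ w : U,
      blackIndex ρ ((Equiv.piOptionEquivProd (α := U) (β := fun _ => Fin D → Fin N)).symm
          (a₀, a')) (some w) = blackIndex (fun c => Equiv.removeNone (ρ c)) a' w := by
    intro a₀ ha₀ w
    funext c
    rw [hS, Fintype.mem_piFinset] at ha₀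
    have hc := ha₀ c
    have h1 : (Equiv.removeNone (ρ c))⁻¹ = Equiv.removeNone (ρ c)⁻¹ := Equiv.removeNone_symm _
    simp only [blackIndex, h1]
    cases h2 : (ρ c)⁻¹ (some w) with
    | none =>
      have h3 := Equiv.removeNone_none (ρ c)⁻¹ h2
      have h4 : g c = some (Equiv.removeNone (ρ c)⁻¹ w) := h3.symm
      rw [h4] at hc
      simpa [Equiv.piOptionEquivProd] using hc
    | some u =>
      have h3 := Equiv.removeNone_some (ρ c)⁻¹ ⟨u, h2⟩
      rw [h2] at h3
      rw [Option.some_injective _ h3]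
      simp [Equiv.piOptionEquivProd]
  have hcard : (S.card : ℂ) = (N : ℂ) ^ directEdges ρ none := by
    rw [hS, Fintype.card_piFinset, directEdges]
    have h1 : ∀ c, ((g c).elim Finset.univ fun u => {a' u c} : Finset (Fin N)).card =
        if ρ c none = none then N else 1 := by
      intro c
      have h2 : g c = none ↔ ρ c none = none := by
        rw [hg]
        simp only [Equiv.Perm.inv_eq_iff_eq]
        exact eq_comm
      by_cases h3 : ρ c none = none
      · rw [if_pos h3, h2.2 h3]
        simp
      · rw [if_neg h3]
        obtain ⟨u, hu⟩ := Option.ne_none_iff_exists'.1 (fun h => h3 (h2.1 h))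
        rw [hu]
        simp
    simp only [h1]
    rw [Finset.prod_ite]
    simp
  simp only [hcond]
  rw [← Finset.sum_filter, Finset.filter_mem_eq_inter, Finset.univ_inter]
  rw [Finset.sum_congr rfl (g := fun _ => (∏ v, MvPolynomial.X (Sum.inl (a' v))) *
    ∏ w, MvPolynomial.X (Sum.inr (blackIndex (fun c => Equiv.removeNone (ρ c)) a' w)))]
  · rw [Finset.sum_const, ← hcard]
    simp [Algebra.smul_def]
  · intro a₀ ha₀
    simp only [hval a₀ ha₀]
    congr 1
    have : (Finset.univ.erase none : Finset (Option U)) = Finset.univ.map Function.Embedding.some := by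
      ext x
      cases x <;> simp
    rw [this, Finset.prod_map]
    simp [Equiv.piOptionEquivProd]

theorem contractSum_eq (ρ : Fin D → Equiv.Perm (Option U)) (x : Option U) :
    contractSum N ρ x = ((N : ℂ) ^ directEdges ρ x) • tracePoly N (contract ρ x) := by
  rw [contractSum_eq_none, contractSum_none]
  simp [directEdges]
  rfl

/-- The part of the derivative of a trace invariant in which the white vertex `none` is removed, its
indices being given by the black vertex `none` of another graph. -/
theorem sum_glue (ρ : Fin D → Equiv.Perm (Option U)) (τ : Fin D → Equiv.Perm (Option V)) :
    (∑ a : Option U → Fin D → Fin N, ((∏ v, MvPolynomial.X (Sum.inl (a v))) *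
      ∏ w : U, MvPolynomial.X (Sum.inr (blackIndex ρ a (some w)))) *
      ∑ a' : Option V → Fin D → Fin N, if a' none = blackIndex ρ a none then
        (∏ v ∈ Finset.univ.erase none, MvPolynomial.X (Sum.inl (a' v))) *
          ∏ w, MvPolynomial.X (Sum.inr (blackIndex τ a' w)) else 0) =
      tracePoly N (glue ρ τ) := by
  rw [tracePoly, ← Equiv.sum_comp (Equiv.sumArrowEquivProdArrow (Option U) V (Fin D → Fin N)).symm,
    Fintype.sum_prod_type]
  refine Finset.sum_congr rfl fun a _ => ?_
  rw [← Equiv.sum_comp (Equiv.piOptionEquivProd (α := V) (β := fun _ => Fin D → Fin N)).symm,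
    Fintype.sum_prod_type_right, Finset.mul_sum]
  refine Finset.sum_congr rfl fun a'' _ => ?_
  rw [Finset.sum_eq_single (blackIndex ρ a none)]
  · set a' := (Equiv.piOptionEquivProd (α := V) (β := fun _ => Fin D → Fin N)).symm
      (blackIndex ρ a none, a'') with ha'
    set A := (Equiv.sumArrowEquivProdArrow (Option U) V (Fin D → Fin N)).symm (a, a'') with hA
    have hA1 : ∀ u, A (Sum.inl u) = a u := fun u => rfl
    have hA2 : ∀ v, A (Sum.inr v) = a'' v := fun u => rfl
    have ha1 : a' none = blackIndex ρ a none := rfl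
    have ha2 : ∀ v, a' (some v) = a'' v := fun v => rfl
    have hinv : ∀ c w, (glue ρ τ c)⁻¹ w = (Equiv.sumCongr (ρ c)⁻¹ 1)
        ((moveNone U V).symm (Equiv.sumCongr 1 (τ c)⁻¹ (moveNone U V w))) := by
      intro c w
      rw [Equiv.Perm.inv_eq_iff_eq]
      simp only [glue, Equiv.Perm.mul_apply, Equiv.permCongr_apply, Equiv.symm_symm]
      rw [← Equiv.Perm.mul_apply (Equiv.sumCongr (ρ c) 1)]
      simp [Equiv.Perm.sumCongr_mul]
    have hb1 : ∀ u, blackIndex (glue ρ τ) A (Sum.inl (some u)) = blackIndex ρ a (some u) := by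
      intro u
      funext c
      simp only [blackIndex, hinv]
      rfl
    have hb2 : ∀ w : Option V, blackIndex (glue ρ τ) A ((moveNone U V).symm (Sum.inr w)) =
        blackIndex τ a' w := by
      intro w
      funext c
      simp only [blackIndex, hinv, Equiv.apply_symm_apply, Equiv.sumCongr_apply, Sum.map_inr]
      cases (τ c)⁻¹ w <;> rfl
    rw [if_pos ha1]
    have : (Finset.univ.erase none : Finset (Option V)) = Finset.univ.map Function.Embedding.some := by
      ext x
      cases x <;> simp
    rw [this, Finset.prod_map, Fintype.prod_sum_type, Fintype.prod_sum_type (fun w =>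
      MvPolynomial.X (Sum.inr (blackIndex (glue ρ τ) A w))), Fintype.prod_option (fun u =>
      MvPolynomial.X (Sum.inr (blackIndex (glue ρ τ) A (Sum.inl u)))), Fintype.prod_option (fun w =>
      MvPolynomial.X (Sum.inr (blackIndex τ a' w)))]
    simp only [← hb2, hb1, hA1, hA2, Function.Embedding.some_apply, ha2]
    have e1 : (moveNone U V).symm (Sum.inr none) = Sum.inl none := rfl
    have e2 : ∀ v, (moveNone U V).symm (Sum.inr (some v)) = Sum.inr v := fun v => rfl
    simp only [e1, e2]
    ring
  · intro a₀ _ ha₀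
    exact if_neg ha₀
  · simp

end TraceIdentities

section LoopEquation

theorem derivation_prod {R : Type*} [CommRing R] [Algebra ℂ R] (δ : Derivation ℂ R R)
    {V : Type*} [DecidableEq V] (s : Finset V) (f : V → R) :
    δ (∏ v ∈ s, f v) = ∑ x ∈ s, δ (f x) * ∏ v ∈ s.erase x, f v := by
  induction s using Finset.induction_on with
  | empty => simp
  | insert a s ha ih =>
    rw [Finset.prod_insert ha, Derivation.leibniz, ih, Finset.sum_insert ha,
      Finset.erase_insert ha, smul_eq_mul, smul_eq_mul, Finset.mul_sum, add_comm, mul_comm]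
    congr 1
    refine Finset.sum_congr rfl fun x hx => ?_
    have hax : a ≠ x := fun h => ha (h ▸ hx)
    rw [Finset.erase_insert_of_ne hax, Finset.prod_insert (fun h => ha (Finset.mem_of_mem_erase h))]
    ring

variable {D N : ℕ} {U V : Type*} [Fintype U] [Fintype V] [DecidableEq U] [DecidableEq V]

theorem pderiv_prod_inl (β : Fin D → Fin N) (a : V → Fin D → Fin N) :
    MvPolynomial.pderiv (Sum.inl β) (∏ v, MvPolynomial.X (Sum.inl (a v)) :
      TensorPoly (Fin D → Fin N)) =
      ∑ x, if a x = β then ∏ v ∈ Finset.univ.erase x, MvPolynomial.X (Sum.inl (a v)) else 0 := by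
  rw [derivation_prod]
  refine Finset.sum_congr rfl fun x _ => ?_
  rw [MvPolynomial.pderiv_X]
  by_cases h : a x = β
  · simp [h]
  · simp [h]

theorem pderiv_prod_inr {W : Type*} [Fintype W] (β : Fin D → Fin N) (b : W → Fin D → Fin N) :
    MvPolynomial.pderiv (Sum.inl β) (∏ v, MvPolynomial.X (Sum.inr (b v)) :
      TensorPoly (Fin D → Fin N)) = 0 := by
  classical
  rw [derivation_prod]
  refine Finset.sum_eq_zero fun x _ => ?_
  rw [MvPolynomial.pderiv_X]
  simp

/-- The derivative of a trace invariant with respect to an entry of `T` removes a white vertex,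
whose indices are then fixed. -/
theorem pderiv_tracePoly (β : Fin D → Fin N) (τ : Fin D → Equiv.Perm V) :
    MvPolynomial.pderiv (Sum.inl β) (tracePoly N τ) =
      ∑ x, ∑ a : V → Fin D → Fin N, if a x = β then
        (∏ v ∈ Finset.univ.erase x, MvPolynomial.X (Sum.inl (a v))) *
          ∏ w, MvPolynomial.X (Sum.inr (blackIndex τ a w)) else 0 := by
  unfold tracePoly
  rw [map_sum, Finset.sum_comm]
  refine Finset.sum_congr rfl fun a _ => ?_
  rw [Derivation.leibniz, pderiv_prod_inl, pderiv_prod_inr, smul_zero, zero_add, smul_eq_mul,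
    Finset.mul_sum]
  refine Finset.sum_congr rfl fun x _ => ?_
  split_ifs
  · ring
  · simp

/-- The terms of the derivative of a trace invariant, with the derived vertex labelled `none`. -/
theorem sum_erase_eq_rootAt (β : Fin D → Fin N) (τ : Fin D → Equiv.Perm V) (x : V) :
    (∑ a : V → Fin D → Fin N, if a x = β then
        (∏ v ∈ Finset.univ.erase x, MvPolynomial.X (Sum.inl (a v))) *
          ∏ w, MvPolynomial.X (Sum.inr (blackIndex τ a w)) else 0 : TensorPoly (Fin D → Fin N)) =
      ∑ a : Option {v // v ≠ x} → Fin D → Fin N, if a none = β then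
        (∏ v ∈ Finset.univ.erase none, MvPolynomial.X (Sum.inl (a v))) *
          ∏ w, MvPolynomial.X (Sum.inr (blackIndex (rootAt τ x) a w)) else 0 := by
  refine Fintype.sum_equiv ((Equiv.optionSubtypeNe x).symm.arrowCongr (Equiv.refl _)) _ _
    fun a => ?_
  set a' := (Equiv.optionSubtypeNe x).symm.arrowCongr (Equiv.refl _) a with ha'
  have h0 : ∀ y, a' y = a (Equiv.optionSubtypeNe x y) := fun y => by
    simp [ha', Equiv.arrowCongr]
  have h1 : ∀ w, blackIndex (rootAt τ x) a' w = blackIndex τ a (Equiv.optionSubtypeNe x w) := by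
    intro w
    funext c
    simp only [blackIndex, h0]
    have : (rootAt τ x c)⁻¹ w = (Equiv.optionSubtypeNe x).symm
        ((τ c)⁻¹ (Equiv.optionSubtypeNe x w)) := by
      rw [Equiv.Perm.inv_eq_iff_eq]
      simp only [rootAt, Equiv.permCongr_apply, Equiv.symm_symm, Equiv.apply_symm_apply]
      exact (by rw [show τ c ((τ c)⁻¹ (Equiv.optionSubtypeNe x w)) = Equiv.optionSubtypeNe x w from
        (τ c).apply_symm_apply _, Equiv.symm_apply_apply])
    rw [this, Equiv.apply_symm_apply]
  have h2 : a' none = a x := by rw [h0, Equiv.optionSubtypeNe_none]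
  simp only [h1]
  rw [h2]
  split_ifs
  · congr 1
    · refine Finset.prod_equiv (Equiv.optionSubtypeNe x).symm (fun v => ?_) fun v _ => by
        rw [h0, Equiv.apply_symm_apply]
      simp only [Finset.mem_erase, Finset.mem_univ, and_true]
      rw [not_iff_not, Equiv.symm_apply_eq, Equiv.optionSubtypeNe_none]
    · exact (Equiv.prod_comp (Equiv.optionSubtypeNe x) fun w =>
        (MvPolynomial.X (Sum.inr (blackIndex τ a w)) : TensorPoly (Fin D → Fin N))).symm
  · rfl

variable {I : Type*} [Fintype I] {B : I → ColoredGraph D} (t : I → ℂ)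

/-- The loop equation: contraction of the black vertex `none` of a coloured graph with the other
white vertices of the graph and with those of the interaction. -/
theorem loop_equation (hB : ∀ i, 2 ≤ (B i).p) (hN : 1 ≤ N)
    {τ : ∀ i, Fin D → Equiv.Perm (Fin (B i).p)}
    (hτ : ∀ i, tracePoly N (B i).adj = tracePoly N (τ i)) (ρ : Fin D → Equiv.Perm (Option U)) :
    expect B t hN (tracePoly N ρ) =
      ∑ x, (((N : ℂ) ^ (D - 1))⁻¹ * (N : ℂ) ^ directEdges ρ x) •
        expect B t hN (tracePoly N (contract ρ x)) +
      ∑ i, (t i / (B i).p) • (PowerSeries.X ^ ((B i).p - 1) *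
        ∑ x, expect B t hN (tracePoly N (glue ρ (rootAt (τ i) x)))) := by
  have h1 : tracePoly N ρ = ∑ a : Option U → Fin D → Fin N,
      MvPolynomial.X (Sum.inr (blackIndex ρ a none)) *
        ((∏ v, MvPolynomial.X (Sum.inl (a v))) *
          ∏ w : U, MvPolynomial.X (Sum.inr (blackIndex ρ a (some w)))) := by
    unfold tracePoly
    refine Finset.sum_congr rfl fun a _ => ?_
    rw [Fintype.prod_option (fun w => MvPolynomial.X (Sum.inr (blackIndex ρ a w)))]
    ring
  rw [h1, map_sum]
  simp only [expect_X_inr_mul t hB hN]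
  rw [Finset.sum_add_distrib]
  congr 1
  · rw [← Finset.smul_sum, ← map_sum]
    have h2 : ∑ a : Option U → Fin D → Fin N, MvPolynomial.pderiv (Sum.inl (blackIndex ρ a none))
        ((∏ v, MvPolynomial.X (Sum.inl (a v))) *
          ∏ w : U, MvPolynomial.X (Sum.inr (blackIndex ρ a (some w)))) =
        ∑ x, contractSum N ρ x := by
      unfold contractSum
      rw [Finset.sum_comm]
      refine Finset.sum_congr rfl fun a _ => ?_
      rw [Derivation.leibniz, pderiv_prod_inl, pderiv_prod_inr, smul_zero, zero_add, smul_eq_mul,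
        Finset.mul_sum]
      refine Finset.sum_congr rfl fun x _ => ?_
      split_ifs
      · ring
      · simp
    rw [h2, map_sum, Finset.smul_sum]
    refine Finset.sum_congr rfl fun x _ => ?_
    rw [contractSum_eq, map_smul, smul_smul]
  · rw [Finset.sum_comm]
    refine Finset.sum_congr rfl fun i _ => ?_
    rw [← Finset.smul_sum, ← Finset.mul_sum, ← map_sum, ← map_sum]
    congr 3
    simp only [hτ, pderiv_tracePoly, Finset.mul_sum]
    rw [Finset.sum_comm]
    refine Finset.sum_congr rfl fun x _ => ?_
    rw [← sum_glue]
    refine Finset.sum_congr rfl fun a _ => ?_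
    rw [← Finset.mul_sum, sum_erase_eq_rootAt]

end LoopEquation

end TensorModel

namespace TensorModel

/-! ### Loop equations for dipoles and isolated bubbles -/

section Removal

variable {D : ℕ} {U V W : Type*} [DecidableEq U] [DecidableEq V] [DecidableEq W]

theorem some_removeNone_apply (e : Equiv.Perm (Option U)) (u : U) :
    some (Equiv.removeNone e u) = if e (some u) = none then e none else e (some u) := by
  split_ifs with h
  · exact Equiv.removeNone_none e h
  · exact Equiv.removeNone_some e (Option.ne_none_iff_exists'.1 h)

theorem contract_addBubble (σ : Fin D → Equiv.Perm V) (x : Option V) :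
    contract (addBubble σ) x = σ := by
  funext c
  ext u
  apply Option.some_injective
  rw [contract, some_removeNone_apply]
  rcases x with _ | y
  · simp [addBubble]
  · by_cases h : u = y
    · subst h
      simp [addBubble]
    · simp [addBubble, Equiv.swap_apply_of_ne_of_ne, h]

theorem contract_insDipole_none (σ : Fin D → Equiv.Perm V) (c : Fin D) (v : V) :
    contract (insDipole σ c v) none = σ := by
  funext c'
  ext u
  apply Option.some_injective
  rw [contract, some_removeNone_apply]
  simp only [Equiv.swap_self, insDipole, swapAt, addBubble]
  by_cases h : c' = c
  · by_cases hu : u = v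
    · subst hu
      simp [h]
    · simp [h, Equiv.swap_apply_of_ne_of_ne, hu]
  · simp [h]

theorem contract_insDipole_some (σ : Fin D → Equiv.Perm V) (c : Fin D) (v x : V) :
    contract (insDipole σ c v) (some x) = swapAt σ c v x := by
  funext c'
  ext u
  apply Option.some_injective
  rw [contract, some_removeNone_apply]
  simp only [insDipole, swapAt, addBubble]
  by_cases h : c' = c
  · by_cases hu : u = x
    · subst hu
      simp [h]
    · by_cases hv : u = v
      · subst hv
        simp [h, Equiv.swap_apply_of_ne_of_ne, hu, Ne.symm hu]
      · simp [h, Equiv.swap_apply_of_ne_of_ne, hu, hv]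
  · by_cases hu : u = x
    · subst hu
      simp [h]
    · simp [h, Equiv.swap_apply_of_ne_of_ne, hu]

theorem directEdges_addBubble_none (σ : Fin D → Equiv.Perm V) :
    directEdges (addBubble σ) none = D := by
  simp [directEdges, addBubble]

theorem directEdges_addBubble_some (σ : Fin D → Equiv.Perm V) (x : V) :
    directEdges (addBubble σ) (some x) = 0 := by
  simp [directEdges, addBubble]

theorem directEdges_insDipole_none (σ : Fin D → Equiv.Perm V) (c : Fin D) (v : V) :
    directEdges (insDipole σ c v) none = D - 1 := by
  have h : (Finset.univ.filter fun c' => insDipole σ c v c' none = none) = {c}ᶜ := by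
    ext c'
    rw [Finset.mem_filter]
    by_cases h : c' = c <;> simp [insDipole, swapAt, addBubble, h]
  rw [directEdges, h, Finset.card_compl]
  simp

theorem directEdges_insDipole_self (σ : Fin D → Equiv.Perm V) (c : Fin D) (v : V) :
    directEdges (insDipole σ c v) (some v) = 1 := by
  have h : (Finset.univ.filter fun c' => insDipole σ c v c' (some v) = none) = {c} := by
    ext c'
    rw [Finset.mem_filter]
    by_cases h : c' = c <;> simp [insDipole, swapAt, addBubble, h]
  rw [directEdges, h]
  simp

theorem directEdges_insDipole_of_ne (σ : Fin D → Equiv.Perm V) (c : Fin D) {v x : V}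
    (hx : x ≠ v) : directEdges (insDipole σ c v) (some x) = 0 := by
  have h : (Finset.univ.filter fun c' => insDipole σ c v c' (some x) = none) = ∅ := by
    ext c'
    rw [Finset.mem_filter]
    by_cases h : c' = c <;>
      simp [insDipole, swapAt, addBubble, h, Equiv.swap_apply_of_ne_of_ne, hx]
  rw [directEdges, h]
  simp

/-- Identification of the vertices of `glue ρ (rootAt τ x)` with those of the two graphs, when one
vertex of the first graph is removed. -/
def glueLabel (U : Type*) (x : W) : Option U ⊕ {w // w ≠ x} ≃ U ⊕ W :=
  (moveNone U _).trans (Equiv.sumCongr (Equiv.refl U) (Equiv.optionSubtypeNe x))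

theorem glueLabel_glue (ρ : Fin D → Equiv.Perm (Option U)) (τ : Fin D → Equiv.Perm W) (x : W)
    (c : Fin D) (y : Option U ⊕ {w // w ≠ x}) :
    glueLabel U x (glue ρ (rootAt τ x) c y) =
      Equiv.sumCongr 1 (τ c) (glueLabel U x (Equiv.sumCongr (ρ c) 1 y)) := by
  simp only [glue, Equiv.Perm.mul_apply, Equiv.permCongr_apply, Equiv.symm_symm, glueLabel,
    Equiv.trans_apply, Equiv.apply_symm_apply]
  generalize moveNone U { w // w ≠ x } (Equiv.sumCongr (ρ c) 1 y) = z
  rcases z with u | w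
  · rfl
  · simp only [Equiv.sumCongr_apply, Sum.map_inr]
    congr 1
    simp only [rootAt, Equiv.permCongr_apply, Equiv.symm_symm, Equiv.apply_symm_apply]

variable {N : ℕ} [Fintype V] [Fintype W]

theorem tracePoly_glue_addBubble (σ : Fin D → Equiv.Perm V) (τ : Fin D → Equiv.Perm W) (x : W) :
    tracePoly N (glue (addBubble σ) (rootAt τ x)) = tracePoly N (graphSum σ τ) := by
  refine tracePoly_relabel (glueLabel V x) (glueLabel V x) fun c y => ?_
  rw [glueLabel_glue]
  rcases y with (_ | u) | w <;> rfl

theorem tracePoly_glue_insDipole (σ : Fin D → Equiv.Perm V) (c : Fin D) (v : V)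
    (τ : Fin D → Equiv.Perm W) (x : W) :
    tracePoly N (glue (insDipole σ c v) (rootAt τ x)) =
      tracePoly N (swapAt (graphSum σ τ) c (Sum.inl v) (Sum.inr x)) := by
  refine tracePoly_relabel (glueLabel V x) (glueLabel V x) fun c' y => ?_
  rw [glueLabel_glue]
  have h0 : glueLabel V x (Sum.inl none) = Sum.inr x := rfl
  have h1 : ∀ u, glueLabel V x (Sum.inl (some u)) = Sum.inl u := fun _ => rfl
  have h2 : ∀ w, glueLabel V x (Sum.inr w) = Sum.inr w.1 := fun _ => rfl
  by_cases hc : c' = c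
  · rcases y with (_ | u) | w
    · rw [h0]
      simp [insDipole, swapAt, hc, addBubble, graphSum, h1]
    · rw [h1]
      by_cases hu : u = v
      · subst hu
        simp [insDipole, swapAt, hc, addBubble, graphSum, h0]
      · simp [insDipole, swapAt, hc, addBubble, graphSum, h1, Equiv.swap_apply_of_ne_of_ne, hu]
    · rw [h2]
      have := w.2
      simp [insDipole, swapAt, hc, addBubble, graphSum, h2, Equiv.swap_apply_of_ne_of_ne, this]
  · rcases y with (_ | u) | w
    · rw [h0]
      simp [insDipole, swapAt, hc, addBubble, graphSum, h0]
    · rw [h1]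
      simp [insDipole, swapAt, hc, addBubble, graphSum, h1]
    · rw [h2]
      simp [insDipole, swapAt, hc, addBubble, graphSum, h2]

variable {I : Type*} [Fintype I] {B : I → ColoredGraph D} (t : I → ℂ)

/-- The loop equation for the black vertex of an isolated two-vertex bubble: its contraction with
its own white vertex produces `D` direct edges, and each of the other contractions restores the
graph `σ`. -/
theorem loop_equation_addBubble (hB : ∀ i, 2 ≤ (B i).p) (hN : 1 ≤ N) (hD : 1 ≤ D)
    {τ : ∀ i, Fin D → Equiv.Perm (Fin (B i).p)}
    (hτ : ∀ i, tracePoly N (B i).adj = tracePoly N (τ i)) (σ : Fin D → Equiv.Perm V) :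
    expect B t hN (tracePoly N (addBubble σ)) =
      ((N : ℂ) + Fintype.card V * ((N : ℂ) ^ (D - 1))⁻¹) • expect B t hN (tracePoly N σ) +
      ∑ i, t i • (PowerSeries.X ^ ((B i).p - 1) *
        expect B t hN (tracePoly N (graphSum σ (τ i)))) := by
  have hN' : (N : ℂ) ≠ 0 := by exact_mod_cast (by omega : N ≠ 0)
  rw [loop_equation t hB hN hτ, Fintype.sum_option]
  simp only [contract_addBubble, directEdges_addBubble_none, directEdges_addBubble_some,
    tracePoly_glue_addBubble]
  congr 1
  · rw [Finset.sum_const, ← Nat.cast_smul_eq_nsmul ℂ, smul_smul, ← add_smul]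
    congr 1
    obtain ⟨d, rfl⟩ : ∃ d, D = d + 1 := ⟨D - 1, by omega⟩
    simp only [Nat.add_sub_cancel, pow_zero, mul_one, Finset.card_univ]
    rw [pow_succ]
    field_simp
  · refine Finset.sum_congr rfl fun i _ => ?_
    rw [Finset.sum_const, Finset.card_univ, Fintype.card_fin, ← Nat.cast_smul_eq_nsmul ℂ,
      mul_smul_comm, smul_smul]
    congr 1
    have : ((B i).p : ℂ) ≠ 0 := by
      have := hB i
      exact_mod_cast (by omega : (B i).p ≠ 0)
    field_simp

/-- The loop equation for the black vertex of a dipole on the edge of colour `c` at `v`. Its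
contraction with its own white vertex produces `D - 1` direct edges and that with `v` one, both
restoring the graph `σ`; the other ones move the end of an edge of colour `c`. -/
theorem loop_equation_insDipole (hB : ∀ i, 2 ≤ (B i).p) (hN : 1 ≤ N) (hD : 2 ≤ D)
    {τ : ∀ i, Fin D → Equiv.Perm (Fin (B i).p)}
    (hτ : ∀ i, tracePoly N (B i).adj = tracePoly N (τ i)) (σ : Fin D → Equiv.Perm V)
    (c : Fin D) (v : V) :
    expect B t hN (tracePoly N (insDipole σ c v)) =
      (1 + ((N : ℂ) ^ (D - 2))⁻¹) • expect B t hN (tracePoly N σ) +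
      ∑ x ∈ Finset.univ.erase v,
        ((N : ℂ) ^ (D - 1))⁻¹ • expect B t hN (tracePoly N (swapAt σ c v x)) +
      ∑ i, (t i / (B i).p) • (PowerSeries.X ^ ((B i).p - 1) *
        ∑ x, expect B t hN
          (tracePoly N (swapAt (graphSum σ (τ i)) c (Sum.inl v) (Sum.inr x)))) := by
  have hN' : (N : ℂ) ≠ 0 := by exact_mod_cast (by omega : N ≠ 0)
  rw [loop_equation t hB hN hτ, Fintype.sum_option]
  simp only [contract_insDipole_none, contract_insDipole_some, directEdges_insDipole_none,
    tracePoly_glue_insDipole]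
  congr 1
  rw [← Finset.add_sum_erase _ _ (Finset.mem_univ v), directEdges_insDipole_self, ← add_assoc]
  congr 1
  · have : swapAt σ c v v = σ := by
      funext c'
      simp only [swapAt, Equiv.swap_self]
      split_ifs <;> rfl
    rw [this, ← add_smul]
    congr 1
    obtain ⟨d, rfl⟩ : ∃ d, D = d + 2 := ⟨D - 2, by omega⟩
    simp only [Nat.add_sub_cancel]
    rw [show d + 2 - 1 = d + 1 by omega, pow_succ]
    field_simp
  · refine Finset.sum_congr rfl fun x hx => ?_
    rw [directEdges_insDipole_of_ne σ c (Finset.ne_of_mem_erase hx), pow_zero, mul_one]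

end Removal

end TensorModel

namespace TensorModel

/-! ### Cycles and orbits through invariant functions -/

/-- The comparison of dimensions by which numbers of orbits and components are estimated below. -/
theorem finrank_le_of_maps {M M' : Type*} [AddCommGroup M] [Module ℚ M] [AddCommGroup M']
    [Module ℚ M'] [FiniteDimensional ℚ M'] (p : Submodule ℚ M) (q : Submodule ℚ M')
    (L : M →ₗ[ℚ] M') (hL : ∀ x ∈ p, L x ∈ q) (hinj : ∀ x ∈ p, L x = 0 → x = 0) :
    Module.finrank ℚ p ≤ Module.finrank ℚ q := by
  refine LinearMap.finrank_le_finrank_of_injective (f := L.restrict hL) ?_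
  rw [← LinearMap.ker_eq_bot, LinearMap.ker_eq_bot']
  rintro ⟨x, hx⟩ h
  have h' : L x = 0 := congrArg Subtype.val h
  exact Subtype.ext (hinj x hx h')

section Orbits

variable {K V W : Type*}

/-- The functions invariant under a family of permutations. -/
def invariants (σ : K → Equiv.Perm V) : Submodule ℚ (V → ℚ) where
  carrier := {f | ∀ k v, f (σ k v) = f v}
  add_mem' hf hg k v := by simp [hf k v, hg k v]
  zero_mem' _ _ := rfl
  smul_mem' r f hf k v := by simp [hf k v]

theorem mem_invariants {σ : K → Equiv.Perm V} {f : V → ℚ} :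
    f ∈ invariants σ ↔ ∀ k v, f (σ k v) = f v := Iff.rfl

/-- The number of orbits of the group generated by a family of permutations. -/
noncomputable def numOrbits (σ : K → Equiv.Perm V) : ℕ := Module.finrank ℚ (invariants σ)

/-- The number of cycles of a permutation, fixed points included. -/
noncomputable def numCycles (π : Equiv.Perm V) : ℕ := numOrbits fun _ : Unit => π

variable [Fintype V] [Fintype W]

theorem numOrbits_le_of_equiv {σ : K → Equiv.Perm V} {τ : K → Equiv.Perm W} (e : V ≃ W)
    (h : ∀ k v, τ k (e v) = e (σ k v)) : numOrbits σ ≤ numOrbits τ := by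
  refine finrank_le_of_maps _ _ (LinearMap.funLeft ℚ ℚ e.symm) (fun f hf k w => ?_) fun f _ h0 => ?_
  · simp only [LinearMap.funLeft_apply]
    obtain ⟨v, rfl⟩ := e.surjective w
    rw [h, Equiv.symm_apply_apply, Equiv.symm_apply_apply]
    exact hf k v
  · funext v
    simpa using congrFun h0 (e v)

theorem numOrbits_eq_of_equiv {σ : K → Equiv.Perm V} {τ : K → Equiv.Perm W} (e : V ≃ W)
    (h : ∀ k v, τ k (e v) = e (σ k v)) : numOrbits σ = numOrbits τ := by
  refine le_antisymm (numOrbits_le_of_equiv e h) (numOrbits_le_of_equiv e.symm fun k w => ?_)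
  rw [Equiv.eq_symm_apply, ← h, Equiv.apply_symm_apply]

theorem numCycles_eq_of_equiv {π : Equiv.Perm V} {ρ : Equiv.Perm W} (e : V ≃ W)
    (h : ∀ v, ρ (e v) = e (π v)) : numCycles π = numCycles ρ :=
  numOrbits_eq_of_equiv e fun _ => h

theorem numOrbits_sumCongr (σ : K → Equiv.Perm V) (τ : K → Equiv.Perm W) :
    numOrbits (fun k => Equiv.sumCongr (σ k) (τ k)) = numOrbits σ + numOrbits τ := by
  unfold numOrbits
  rw [← Module.finrank_prod]
  refine LinearEquiv.finrank_eq
    { toFun := fun f => (⟨f.1 ∘ Sum.inl, fun k v => f.2 k (Sum.inl v)⟩,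
        ⟨f.1 ∘ Sum.inr, fun k v => f.2 k (Sum.inr v)⟩)
      invFun := fun f => ⟨Sum.elim f.1.1 f.2.1, ?_⟩
      map_add' := fun _ _ => rfl
      map_smul' := fun _ _ => rfl
      left_inv := fun f => ?_
      right_inv := fun f => rfl }
  · rintro k (v | v)
    · exact f.1.2 k v
    · exact f.2.2 k v
  · apply Subtype.ext
    funext x
    rcases x with x | x <;> rfl

theorem numOrbits_optionCongr (σ : K → Equiv.Perm V) :
    numOrbits (fun k => Equiv.optionCongr (σ k)) = numOrbits σ + 1 := by
  unfold numOrbits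
  rw [← Module.finrank_self ℚ, ← Module.finrank_prod]
  refine LinearEquiv.finrank_eq
    { toFun := fun f => (⟨f.1 ∘ some, fun k v => f.2 k (some v)⟩, f.1 none)
      invFun := fun f => ⟨fun x => x.elim f.2 f.1.1, ?_⟩
      map_add' := fun _ _ => rfl
      map_smul' := fun _ _ => rfl
      left_inv := fun f => ?_
      right_inv := fun f => rfl }
  · rintro k (_ | v)
    · rfl
    · exact f.1.2 k v
  · apply Subtype.ext
    funext x
    rcases x with _ | x <;> rfl

theorem numCycles_sumCongr (π : Equiv.Perm V) (ρ : Equiv.Perm W) :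
    numCycles (Equiv.sumCongr π ρ) = numCycles π + numCycles ρ :=
  numOrbits_sumCongr (fun _ : Unit => π) fun _ => ρ

theorem numCycles_optionCongr (π : Equiv.Perm V) :
    numCycles (Equiv.optionCongr π) = numCycles π + 1 :=
  numOrbits_optionCongr fun _ : Unit => π

theorem numCycles_conj (π ρ : Equiv.Perm V) : numCycles (ρ * π * ρ⁻¹) = numCycles π :=
  (numCycles_eq_of_equiv ρ fun v => by simp).symm

theorem numCycles_mul_comm (π ρ : Equiv.Perm V) : numCycles (π * ρ) = numCycles (ρ * π) := by
  rw [← numCycles_conj (π * ρ) ρ]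
  simp [mul_assoc]

theorem numOrbits_one : numOrbits (fun _ : K => (1 : Equiv.Perm V)) = Fintype.card V := by
  unfold numOrbits
  have : invariants (fun _ : K => (1 : Equiv.Perm V)) = ⊤ := by
    ext f
    simp [mem_invariants]
  rw [this, finrank_top, Module.finrank_fintype_fun_eq_card]

theorem numCycles_one : numCycles (1 : Equiv.Perm V) = Fintype.card V := numOrbits_one

theorem invariant_sameCycle {π : Equiv.Perm V} {f : V → ℚ} (hf : ∀ v, f (π v) = f v) {v w : V}
    (h : π.SameCycle v w) : f v = f w := by
  obtain ⟨n, rfl⟩ := h.exists_nat_pow_eq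
  induction n with
  | zero => simp
  | succ n ih => rw [pow_succ', Equiv.Perm.mul_apply, hf, ← ih ⟨n, by simp⟩]

variable [DecidableEq V]

theorem sameCycle_iff_invariants {π : Equiv.Perm V} {v w : V} :
    π.SameCycle v w ↔ ∀ f : V → ℚ, (∀ v, f (π v) = f v) → f v = f w := by
  refine ⟨fun h f hf => invariant_sameCycle hf h, fun h => ?_⟩
  have := h (fun y => if π.SameCycle v y then 1 else 0) fun y => by
    simp [Equiv.Perm.sameCycle_apply_right]
  by_contra hc
  rw [if_pos (Equiv.Perm.SameCycle.refl _ _), if_neg hc] at this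
  exact one_ne_zero this

/-- The number of cycles in terms of the cycle type. -/
theorem numCycles_add_support (π : Equiv.Perm V) :
    numCycles π + π.support.card = Multiset.card π.cycleType + Fintype.card V := by
  classical
  -- a vertex is sent to its cycle, or to itself if it is fixed; invariant functions are those
  -- factoring through this map
  set h : V → Equiv.Perm V ⊕ V := fun v =>
    if π v = v then Sum.inr v else Sum.inl (π.cycleOf v) with hh
  set S : Finset (Equiv.Perm V ⊕ V) := π.cycleFactorsFinset.disjSum (π.support)ᶜ with hS
  have hmem : ∀ v, h v ∈ S := by
    intro v
    simp only [hh, hS]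
    split_ifs with hv
    · simp [hv]
    · simp [Equiv.Perm.cycleOf_mem_cycleFactorsFinset_iff, hv]
  let H : V → S := fun v => ⟨h v, hmem v⟩
  have hsame : ∀ v w, h v = h w → π.SameCycle v w := by
    intro v w hvw
    simp only [hh] at hvw
    split_ifs at hvw with h1 h2 h2
    · rw [Sum.inr.inj hvw]
    · have h3 := Sum.inl.inj hvw
      have : w ∈ (π.cycleOf w).support := by
        rw [Equiv.Perm.mem_support_cycleOf_iff]
        exact ⟨Equiv.Perm.SameCycle.refl _ _, by simpa using h2⟩
      rw [← h3, Equiv.Perm.mem_support_cycleOf_iff] at this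
      exact this.1
  have hsurj : Function.Surjective H := by
    rintro ⟨x | x, hx⟩
    · simp only [hS, Finset.inl_mem_disjSum] at hx
      obtain ⟨a, ha⟩ : x.support.Nonempty :=
        ((Equiv.Perm.mem_cycleFactorsFinset_iff.1 hx).1).nonempty_support
      refine ⟨a, Subtype.ext ?_⟩
      have h1 : x = π.cycleOf a := Equiv.Perm.cycle_is_cycleOf ha hx
      have h2 : π a ≠ a := by
        have := Equiv.Perm.mem_cycleFactorsFinset_support_le hx ha
        simpa using this
      simp [H, hh, h2, ← h1]
    · simp only [hS, Finset.inr_mem_disjSum, Finset.mem_compl, Equiv.Perm.mem_support,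
        not_not] at hx
      exact ⟨x, Subtype.ext (by simp [H, hh, hx])⟩
  have hrange : LinearMap.range (LinearMap.funLeft ℚ ℚ H) = invariants fun _ : Unit => π := by
    ext f
    rw [LinearMap.mem_range, mem_invariants]
    constructor
    · rintro ⟨g, rfl⟩ _ v
      simp only [LinearMap.funLeft_apply]
      congr 1
      apply Subtype.ext
      simp only [H, hh, EmbeddingLike.apply_eq_iff_eq]
      split_ifs with hv
      · rw [hv]
      · rw [((Equiv.Perm.sameCycle_apply_left (f := π)).2
          (Equiv.Perm.SameCycle.refl π v)).cycleOf_eq]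
    · intro hf
      refine ⟨fun s => f (Function.surjInv hsurj s), funext fun v => ?_⟩
      simp only [LinearMap.funLeft_apply]
      refine invariant_sameCycle (hf ()) (hsame _ _ ?_)
      exact congrArg Subtype.val (Function.surjInv_eq hsurj (H v))
  have hcard : numCycles π = S.card := by
    rw [numCycles, numOrbits, ← hrange, LinearMap.finrank_range_of_inj
      (LinearMap.funLeft_injective_of_surjective ℚ ℚ H hsurj), Module.finrank_fintype_fun_eq_card,
      Fintype.card_coe]
  have h1 := Finset.card_add_card_compl π.support
  rw [hcard, hS, Finset.card_disjSum, Equiv.Perm.cycleType_def, Multiset.card_map]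
  simp only [Finset.card_val]
  omega

theorem cycleCount_eq_numCycles {n : ℕ} (π : Equiv.Perm (Fin n)) :
    ColoredGraph.cycleCount π = numCycles π := by
  have h := numCycles_add_support π
  have h2 := π.support.card_le_univ
  rw [ColoredGraph.cycleCount, Equiv.Perm.parts_partition, Multiset.card_add,
    Multiset.card_replicate]
  omega

/-- A permutation with many moved points has few cycles. -/
theorem two_mul_numCycles_add_support_le (π : Equiv.Perm V) :
    2 * numCycles π + π.support.card ≤ 2 * Fintype.card V := by
  have h := numCycles_add_support π
  have h1 : 2 * Multiset.card π.cycleType ≤ π.support.card := by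
    rw [← Equiv.Perm.sum_cycleType, mul_comm, ← smul_eq_mul]
    exact Multiset.card_nsmul_le_sum fun x hx => Equiv.Perm.two_le_of_mem_cycleType hx
  omega

/-- The signature, in terms of the number of cycles: multiplication by a transposition changes the
parity of this number. -/
theorem numCycles_parity (π : Equiv.Perm V) :
    (Equiv.Perm.sign π : ℤ) = (-1) ^ (numCycles π + Fintype.card V) := by
  have h := numCycles_add_support π
  rw [Equiv.Perm.sign_of_cycleType, Equiv.Perm.sum_cycleType]
  push_cast
  refine neg_one_pow_congr ?_
  rw [Nat.even_add, Nat.even_add]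
  have h2 : Even (numCycles π + π.support.card) ↔
      Even (Multiset.card π.cycleType + Fintype.card V) := by rw [h]
  rw [Nat.even_add, Nat.even_add] at h2
  tauto

theorem apply_swap_of_eq {v x : V} {f : V → ℚ} (hvx : f v = f x) (y : V) :
    f (Equiv.swap v x y) = f y := by
  rw [Equiv.swap_apply_def]
  split_ifs with h1 h2
  · rw [h1, hvx]
  · rw [h2, hvx]
  · rfl

theorem invariant_mul_swap_iff {π : Equiv.Perm V} {v x : V} {f : V → ℚ} (hvx : f v = f x) :
    (∀ y, f ((π * Equiv.swap v x) y) = f y) ↔ ∀ y, f (π y) = f y := by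
  constructor
  · intro h1 y
    have := h1 (Equiv.swap v x y)
    rwa [Equiv.Perm.mul_apply, ← Equiv.Perm.mul_apply (Equiv.swap v x), Equiv.swap_mul_self,
      Equiv.Perm.one_apply, apply_swap_of_eq hvx] at this
  · intro h1 y
    rw [Equiv.Perm.mul_apply, h1, apply_swap_of_eq hvx]

theorem finrank_le_inf_ker_add_one {M : Type*} [AddCommGroup M] [Module ℚ M]
    [FiniteDimensional ℚ M] (p : Submodule ℚ M) (φ : M →ₗ[ℚ] ℚ) :
    Module.finrank ℚ p ≤ Module.finrank ℚ (p ⊓ LinearMap.ker φ : Submodule ℚ M) + 1 := by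
  rw [← LinearMap.finrank_range_add_finrank_ker (φ.domRestrict p)]
  have h1 : Module.finrank ℚ (LinearMap.range (φ.domRestrict p)) ≤ 1 := by
    simpa using Submodule.finrank_le (LinearMap.range (φ.domRestrict p))
  have h2 : Module.finrank ℚ (LinearMap.ker (φ.domRestrict p)) ≤
      Module.finrank ℚ (p ⊓ LinearMap.ker φ : Submodule ℚ M) :=
    finrank_le_of_maps _ _ p.subtype (fun x hx => ⟨x.2, hx⟩) fun x _ h => Subtype.ext h
  omega

/-- The functions taking the same value at two points are the kernel of a linear form. -/
def diffForm (v x : V) : (V → ℚ) →ₗ[ℚ] ℚ :=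
  LinearMap.proj (R := ℚ) (φ := fun _ : V => ℚ) v - LinearMap.proj (R := ℚ) (φ := fun _ : V => ℚ) x

theorem mem_ker_diffForm {v x : V} {f : V → ℚ} : f ∈ LinearMap.ker (diffForm v x) ↔ f v = f x := by
  rw [LinearMap.mem_ker, diffForm, LinearMap.sub_apply, LinearMap.proj_apply, LinearMap.proj_apply,
    sub_eq_zero]

/-- A transposition of two points of a cycle cuts it in two. Invariant functions show that the
number of cycles increases by at most one, and the signature that it changes. -/
theorem numCycles_mul_swap_of_sameCycle {π : Equiv.Perm V} {v x : V} (hvx : v ≠ x)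
    (h : π.SameCycle v x) : numCycles (π * Equiv.swap v x) = numCycles π + 1 := by
  have h1 : numCycles π ≤ numCycles (π * Equiv.swap v x) :=
    Submodule.finrank_mono fun f hf u => (invariant_mul_swap_iff
      (invariant_sameCycle (fun v => hf () v) h)).2 (fun v => hf () v)
  have h2 : numCycles (π * Equiv.swap v x) ≤ numCycles π + 1 := by
    refine (finrank_le_inf_ker_add_one _ (diffForm v x)).trans (Nat.add_le_add_right ?_ 1)
    exact Submodule.finrank_mono fun f hf u =>
      (invariant_mul_swap_iff (mem_ker_diffForm.1 hf.2)).1 (fun v => hf.1 () v)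
  -- by parity, the number of cycles cannot remain the same
  have h3 := numCycles_parity π
  have h4 := numCycles_parity (π * Equiv.swap v x)
  rw [Equiv.Perm.sign_mul, Equiv.Perm.sign_swap hvx] at h4
  push_cast at h4
  rw [h3] at h4
  rcases Nat.le_iff_lt_or_eq.1 h1 with h5 | h5
  · omega
  · rw [← h5, pow_add] at h4
    have : ((-1 : ℤ) ^ numCycles π * (-1) ^ Fintype.card V) ≠ 0 := by positivity
    exfalso
    apply this
    linarith

/-- A transposition of two points of different cycles joins these cycles. -/
theorem sameCycle_mul_swap {π : Equiv.Perm V} {v x : V} (h : ¬π.SameCycle v x) :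
    (π * Equiv.swap v x).SameCycle v x := by
  classical
  rw [sameCycle_iff_invariants]
  intro f hf
  have hvx : v ≠ x := fun hc => h (hc ▸ Equiv.Perm.SameCycle.refl _ _)
  -- the indicator of the cycle of `x`: summation over this cycle of the increments of an invariant
  -- function along `π` leaves only the increment at `x`
  set χ : V → ℚ := fun y => if π.SameCycle x y then 1 else 0 with hχ
  have hχπ : ∀ y, χ (π y) = χ y := fun y => by simp [hχ, Equiv.Perm.sameCycle_apply_right]
  have h0 : ∑ y, χ y * (f (π y) - f y) = 0 := by
    simp only [mul_sub, Finset.sum_sub_distrib]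
    rw [sub_eq_zero]
    calc ∑ y, χ y * f (π y) = ∑ y, χ (π y) * f (π y) := by simp only [hχπ]
      _ = ∑ y, χ y * f y := Equiv.sum_comp π fun y => χ y * f y
  have h1 : ∑ y, χ y * (f (π y) - f y) = f v - f x := by
    rw [Finset.sum_eq_single x]
    · have h2 := hf v
      rw [Equiv.Perm.mul_apply, Equiv.swap_apply_left] at h2
      have h3 : χ x = 1 := if_pos (Equiv.Perm.SameCycle.refl _ _)
      rw [h2, h3, one_mul]
    · intro y _ hyx
      by_cases hyv : y = v
      · have : χ y = 0 := by
          rw [hχ, hyv]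
          exact if_neg fun hc => h hc.symm
        rw [this, zero_mul]
      · have h2 := hf y
        rw [Equiv.Perm.mul_apply, Equiv.swap_apply_of_ne_of_ne hyv hyx] at h2
        rw [h2, sub_self, mul_zero]
    · simp
  rw [h1] at h0
  exact sub_eq_zero.1 h0

theorem numCycles_mul_swap_of_not_sameCycle {π : Equiv.Perm V} {v x : V}
    (h : ¬π.SameCycle v x) : numCycles (π * Equiv.swap v x) + 1 = numCycles π := by
  have hvx : v ≠ x := fun hc => h (hc ▸ Equiv.Perm.SameCycle.refl _ _)
  rw [← numCycles_mul_swap_of_sameCycle hvx (sameCycle_mul_swap h), mul_assoc,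
    Equiv.swap_mul_self, mul_one]

theorem numCycles_mul_swap_le (π : Equiv.Perm V) (v x : V) :
    numCycles (π * Equiv.swap v x) ≤ numCycles π + 1 := by
  by_cases hvx : v = x
  · subst hvx
    rw [Equiv.swap_self]
    exact Nat.le_succ _
  · by_cases h : π.SameCycle v x
    · exact (numCycles_mul_swap_of_sameCycle hvx h).le
    · have := numCycles_mul_swap_of_not_sameCycle h
      omega

end Orbits

/-! ### Forests -/

section Forest

variable {D : ℕ} {V W : Type*} [Fintype V] [Fintype W] [DecidableEq V] [DecidableEq W]

/-- The total number of faces of a graph whose vertices are paired by their labels. -/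
noncomputable def numFaces (σ : Fin D → Equiv.Perm V) : ℕ := ∑ c, numCycles (σ c)

/-- The map whose kernel consists of the common invariants, and which is onto for forests. -/
noncomputable def faceMap (σ : Fin D → Equiv.Perm V) (c₀ : Fin D) :
    ((c : Fin D) → invariants fun _ : Unit => σ c) →ₗ[ℚ] ({c // c ≠ c₀} → V → ℚ) where
  toFun f c := (f c).1 - (f c₀).1
  map_add' f g := by
    funext c
    simp
    abel
  map_smul' r f := by
    funext c
    simp [smul_sub]

theorem numFaces_le_finrank_range (σ : Fin D → Equiv.Perm V) (c₀ : Fin D) :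
    numFaces σ ≤ Module.finrank ℚ (LinearMap.range (faceMap σ c₀)) + numOrbits σ := by
  have h := LinearMap.finrank_range_add_finrank_ker (faceMap σ c₀)
  rw [Module.finrank_pi_fintype] at h
  have h1 : Module.finrank ℚ (LinearMap.ker (faceMap σ c₀)) ≤ numOrbits σ := by
    refine finrank_le_of_maps _ _
      ((invariants fun _ : Unit => σ c₀).subtype.comp (LinearMap.proj c₀)) ?_ ?_
    · intro f hf c v
      have hc : ∀ c, (f c).1 = (f c₀).1 := by
        intro c
        by_cases h : c = c₀
        · rw [h]
        · exact sub_eq_zero.1 (congrFun (LinearMap.mem_ker.1 hf) ⟨c, h⟩)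
      have := (f c).2 () v
      rw [hc] at this
      exact this
    · intro f hf h0
      funext c
      apply Subtype.ext
      have h0' : (f c₀).1 = 0 := h0
      by_cases h : c = c₀
      · rw [h]
        exact h0'
      · have := sub_eq_zero.1 (congrFun (LinearMap.mem_ker.1 hf) ⟨c, h⟩)
        exact this.trans h0'
  have h2 : numFaces σ = ∑ c, Module.finrank ℚ (invariants fun _ : Unit => σ c) := rfl
  omega

theorem finrank_faceMap_target (c₀ : Fin D) :
    Module.finrank ℚ ({c // c ≠ c₀} → V → ℚ) = (D - 1) * Fintype.card V := by
  rw [Module.finrank_pi_fintype]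
  simp [Fintype.card_subtype_compl]

/-- Euler's inequality for the incidence graph between vertices and faces. -/
theorem numFaces_le (hD : 1 ≤ D) (σ : Fin D → Equiv.Perm V) :
    numFaces σ ≤ (D - 1) * Fintype.card V + numOrbits σ := by
  have h1 := numFaces_le_finrank_range σ ⟨0, hD⟩
  have h2 := Submodule.finrank_le (LinearMap.range (faceMap σ ⟨0, hD⟩))
  rw [finrank_faceMap_target] at h2
  omega

/-- The incidence graph between the vertices and the faces is a forest. These graphs are the
disjoint unions of melonic graphs, the labels of the vertices giving the leading order pairing. -/
def IsForest (σ : Fin D → Equiv.Perm V) : Prop :=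
  numFaces σ = (D - 1) * Fintype.card V + numOrbits σ

/-- In a forest, Euler's inequality is an equality, so that `faceMap` is onto: every function is a
difference of functions constant on the faces of two given colours. -/
theorem IsForest.exists_sub_eq {σ : Fin D → Equiv.Perm V} (hσ : IsForest σ) {c₁ c₂ : Fin D}
    (h : c₁ ≠ c₂) (ψ : V → ℚ) : ∃ f₁ f₂ : V → ℚ, (∀ v, f₁ (σ c₁ v) = f₁ v) ∧
      (∀ v, f₂ (σ c₂ v) = f₂ v) ∧ f₁ - f₂ = ψ := by
  have h1 := numFaces_le_finrank_range σ c₂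
  rw [hσ] at h1
  have h2 : LinearMap.range (faceMap σ c₂) = ⊤ := by
    refine Submodule.eq_top_of_finrank_eq (le_antisymm (Submodule.finrank_le _) ?_)
    rw [finrank_faceMap_target]
    omega
  obtain ⟨f, hf⟩ := (LinearMap.range_eq_top.1 h2) fun _ => ψ
  exact ⟨(f c₁).1, (f c₂).1, fun v => (f c₁).2 () v, fun v => (f c₂).2 () v,
    congrFun hf ⟨c₁, h⟩⟩

/-- In a forest, the two vertices of a pair remain connected when all colours but two are
deleted. -/
theorem IsForest.eq_of_two_colours {σ : Fin D → Equiv.Perm V} (hσ : IsForest σ) {c₁ c₂ : Fin D}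
    (h : c₁ ≠ c₂) {f g : V → ℚ} (h1 : ∀ v, g (σ c₁ v) = f v) (h2 : ∀ v, g (σ c₂ v) = f v) :
    f = g := by
  obtain ⟨f₁, f₂, hf₁, hf₂, hψ⟩ := hσ.exists_sub_eq h (g - f)
  -- invariance under the two colours makes `g - f` orthogonal to all functions constant on the
  -- faces, and `g - f` itself is a difference of two of these
  have key : ∀ (π : Equiv.Perm V) (φ : V → ℚ), (∀ v, φ (π v) = φ v) → (∀ v, g (π v) = f v) →
      ∑ v, (g v - f v) * φ v = 0 := by
    intro π φ hφ hg
    simp only [sub_mul, Finset.sum_sub_distrib]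
    rw [sub_eq_zero, ← Equiv.sum_comp π]
    exact Finset.sum_congr rfl fun v _ => by rw [hφ, hg]
  have h3 : ∑ v, (g v - f v) * (g v - f v) = 0 := by
    have : ∀ v, g v - f v = f₁ v - f₂ v := fun v => (congrFun hψ v).symm
    calc ∑ v, (g v - f v) * (g v - f v)
        = ∑ v, ((g v - f v) * f₁ v - (g v - f v) * f₂ v) :=
          Finset.sum_congr rfl fun v _ => by rw [← mul_sub, ← this]
      _ = 0 := by rw [Finset.sum_sub_distrib, key _ _ hf₁ h1, key _ _ hf₂ h2, sub_zero]
  funext v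
  have h4 := (Finset.sum_eq_zero_iff_of_nonneg fun v _ => mul_self_nonneg _).1 h3 v
    (Finset.mem_univ v)
  have := mul_self_eq_zero.1 h4
  linarith

end Forest

end TensorModel

namespace TensorModel

/-! ### Operations on forests -/

section ForestOperations

variable {D : ℕ} {U V W : Type*} [Fintype U] [Fintype V] [Fintype W]
  [DecidableEq U] [DecidableEq V] [DecidableEq W]

theorem numFaces_eq_of_equiv {σ : Fin D → Equiv.Perm V} {τ : Fin D → Equiv.Perm W} (e : V ≃ W)
    (h : ∀ c v, τ c (e v) = e (σ c v)) : numFaces σ = numFaces τ :=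
  Finset.sum_congr rfl fun c _ => numCycles_eq_of_equiv e (h c)

theorem isForest_iff_of_equiv {σ : Fin D → Equiv.Perm V} {τ : Fin D → Equiv.Perm W} (e : V ≃ W)
    (h : ∀ c v, τ c (e v) = e (σ c v)) : IsForest σ ↔ IsForest τ := by
  unfold IsForest
  rw [numFaces_eq_of_equiv e h, numOrbits_eq_of_equiv e h, Fintype.card_congr e]

theorem numFaces_addBubble (σ : Fin D → Equiv.Perm V) :
    numFaces (addBubble σ) = numFaces σ + D := by
  unfold numFaces addBubble
  simp [numCycles_optionCongr, Finset.sum_add_distrib]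

theorem numFaces_graphSum (σ : Fin D → Equiv.Perm V) (τ : Fin D → Equiv.Perm W) :
    numFaces (graphSum σ τ) = numFaces σ + numFaces τ := by
  unfold numFaces graphSum
  simp [numCycles_sumCongr, Finset.sum_add_distrib]

theorem numFaces_swapAt (σ : Fin D → Equiv.Perm V) (c : Fin D) (v x : V) :
    numFaces (swapAt σ c v x) + numCycles (σ c) =
      numFaces σ + numCycles (σ c * Equiv.swap v x) := by
  unfold numFaces
  rw [← Finset.add_sum_erase _ _ (Finset.mem_univ c),
    ← Finset.add_sum_erase _ (fun c => numCycles (σ c)) (Finset.mem_univ c)]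
  have : ∑ c' ∈ Finset.univ.erase c, numCycles (swapAt σ c v x c') =
      ∑ c' ∈ Finset.univ.erase c, numCycles (σ c') :=
    Finset.sum_congr rfl fun c' hc' => by simp [swapAt, Finset.ne_of_mem_erase hc']
  rw [this]
  simp only [swapAt, if_true]
  omega

theorem numFaces_swapAt_of_sameCycle {σ : Fin D → Equiv.Perm V} {c : Fin D} {v x : V}
    (hvx : v ≠ x) (h : (σ c).SameCycle v x) : numFaces (swapAt σ c v x) = numFaces σ + 1 := by
  have h1 := numFaces_swapAt σ c v x
  rw [numCycles_mul_swap_of_sameCycle hvx h] at h1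
  omega

theorem numFaces_swapAt_of_not_sameCycle {σ : Fin D → Equiv.Perm V} {c : Fin D} {v x : V}
    (h : ¬(σ c).SameCycle v x) : numFaces (swapAt σ c v x) + 1 = numFaces σ := by
  have h1 := numFaces_swapAt σ c v x
  have h2 := numCycles_mul_swap_of_not_sameCycle h
  omega

theorem mem_invariants_swapAt {σ : Fin D → Equiv.Perm V} {c : Fin D} {v x : V} {f : V → ℚ}
    (hvx : f v = f x) : f ∈ invariants (swapAt σ c v x) ↔ f ∈ invariants σ := by
  rw [mem_invariants, mem_invariants]
  refine forall_congr' fun c' => ?_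
  by_cases h : c' = c
  · simp only [swapAt, h, if_true]
    exact invariant_mul_swap_iff hvx
  · simp only [swapAt, h, if_false]

theorem eq_of_mem_invariants_swapAt {σ : Fin D → Equiv.Perm V} {c : Fin D} {v x : V} {f : V → ℚ}
    (h : ¬(σ c).SameCycle v x) (hf : f ∈ invariants (swapAt σ c v x)) : f v = f x := by
  refine invariant_sameCycle (π := σ c * Equiv.swap v x) (fun y => ?_) (sameCycle_mul_swap h)
  have := hf c y
  simpa only [swapAt, if_true] using this

theorem numOrbits_swapAt_le (σ : Fin D → Equiv.Perm V) (c : Fin D) (v x : V) :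
    numOrbits (swapAt σ c v x) ≤ numOrbits σ + 1 := by
  refine (finrank_le_inf_ker_add_one _ (diffForm v x)).trans (Nat.add_le_add_right ?_ 1)
  exact Submodule.finrank_mono fun f hf =>
    (mem_invariants_swapAt (mem_ker_diffForm.1 hf.2)).1 hf.1

/-- Cutting a face of a forest splits a component. -/
theorem IsForest.swapAt_of_sameCycle (hD : 1 ≤ D) {σ : Fin D → Equiv.Perm V} (hσ : IsForest σ)
    {c : Fin D} {v x : V} (hvx : v ≠ x) (h : (σ c).SameCycle v x) :
    IsForest (swapAt σ c v x) ∧ numOrbits (swapAt σ c v x) = numOrbits σ + 1 := by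
  have h1 := numFaces_swapAt_of_sameCycle hvx h
  have h2 := numFaces_le hD (swapAt σ c v x)
  have h3 := numOrbits_swapAt_le σ c v x
  have h4 : numFaces σ = _ := hσ
  constructor
  · unfold IsForest
    omega
  · omega

theorem isForest_addBubble (hD : 1 ≤ D) {σ : Fin D → Equiv.Perm V} :
    IsForest (addBubble σ) ↔ IsForest σ := by
  unfold IsForest
  have h : numOrbits (addBubble σ) = numOrbits σ + 1 := numOrbits_optionCongr σ
  rw [numFaces_addBubble, h, Fintype.card_option, mul_add, mul_one]
  omega

theorem not_sameCycle_addBubble (σ : Fin D → Equiv.Perm V) (c : Fin D) (v : V) :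
    ¬(addBubble σ c).SameCycle (some v) none := by
  rw [sameCycle_iff_invariants]
  intro h
  have := h (fun y => y.elim 1 0) (by rintro (_ | y) <;> rfl)
  norm_num at this

theorem numFaces_insDipole (hD : 1 ≤ D) (σ : Fin D → Equiv.Perm V) (c : Fin D) (v : V) :
    numFaces (insDipole σ c v) = numFaces σ + (D - 1) := by
  have h1 := numFaces_swapAt_of_not_sameCycle (not_sameCycle_addBubble σ c v)
  rw [numFaces_addBubble] at h1
  unfold insDipole
  omega

theorem insDipole_same_some (σ : Fin D → Equiv.Perm V) {c : Fin D} {u v : V} (h : u ≠ v) :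
    insDipole σ c v c (some u) = some (σ c u) := by
  simp [insDipole, swapAt, addBubble, Equiv.swap_apply_of_ne_of_ne, h]

@[simp] theorem insDipole_same_self (σ : Fin D → Equiv.Perm V) (c : Fin D) (v : V) :
    insDipole σ c v c (some v) = none := by
  simp [insDipole, swapAt, addBubble]

@[simp] theorem insDipole_same_none (σ : Fin D → Equiv.Perm V) (c : Fin D) (v : V) :
    insDipole σ c v c none = some (σ c v) := by
  simp [insDipole, swapAt, addBubble]

theorem insDipole_ne_some (σ : Fin D → Equiv.Perm V) {c c' : Fin D} (v u : V) (h : c' ≠ c) :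
    insDipole σ c v c' (some u) = some (σ c' u) := by
  simp [insDipole, swapAt, addBubble, h]

theorem insDipole_ne_none (σ : Fin D → Equiv.Perm V) {c c' : Fin D} (v : V) (h : c' ≠ c) :
    insDipole σ c v c' none = none := by
  simp [insDipole, swapAt, addBubble, h]

theorem invariant_insDipole {σ : Fin D → Equiv.Perm V} {c : Fin D} {v : V} {f : Option V → ℚ}
    (hf : f ∈ invariants (insDipole σ c v)) :
    f none = f (some v) ∧ (f ∘ some) ∈ invariants σ := by
  have h1 : f none = f (some v) := by
    have := hf c (some v)
    rwa [insDipole_same_self] at this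
  refine ⟨h1, fun c' u => ?_⟩
  by_cases hc : c' = c
  · subst hc
    by_cases hu : u = v
    · subst hu
      have := hf c' none
      rw [insDipole_same_none, h1] at this
      exact this
    · have := hf c' (some u)
      rw [insDipole_same_some _ hu] at this
      exact this
  · have := hf c' (some u)
    rw [insDipole_ne_some _ _ _ hc] at this
    exact this

theorem mem_invariants_insDipole {σ : Fin D → Equiv.Perm V} {f : V → ℚ} (hf : f ∈ invariants σ)
    (c : Fin D) (v : V) : (fun x : Option V => x.elim (f v) f) ∈ invariants (insDipole σ c v) := by
  rw [insDipole, mem_invariants_swapAt (by rfl)]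
  rintro c' (_ | u)
  · rfl
  · exact hf c' u

theorem numOrbits_insDipole (σ : Fin D → Equiv.Perm V) (c : Fin D) (v : V) :
    numOrbits (insDipole σ c v) = numOrbits σ := by
  refine le_antisymm ?_ ?_
  · refine finrank_le_of_maps _ _ (LinearMap.funLeft ℚ ℚ some)
      (fun f hf => (invariant_insDipole hf).2) fun f hf h0 => ?_
    funext x
    rcases x with _ | u
    · rw [(invariant_insDipole hf).1]
      exact congrFun h0 v
    · exact congrFun h0 u
  · refine finrank_le_of_maps _ _ (LinearMap.funLeft ℚ ℚ fun x : Option V => x.elim v id)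
      (fun f hf => ?_) fun f hf h0 => ?_
    · have h := mem_invariants_insDipole hf c v
      convert h using 1
      funext x
      rcases x with _ | u <;> rfl
    · funext u
      exact congrFun h0 (some u)

theorem isForest_insDipole (hD : 1 ≤ D) {σ : Fin D → Equiv.Perm V} {c : Fin D} {v : V} :
    IsForest (insDipole σ c v) ↔ IsForest σ := by
  unfold IsForest
  rw [numFaces_insDipole hD, numOrbits_insDipole, Fintype.card_option, mul_add, mul_one]
  omega

theorem not_sameCycle_graphSum (σ : Fin D → Equiv.Perm V) (τ : Fin D → Equiv.Perm W) (c : Fin D)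
    (v : V) (w : W) : ¬(graphSum σ τ c).SameCycle (Sum.inl v) (Sum.inr w) := by
  rw [sameCycle_iff_invariants]
  intro h
  have := h (Sum.elim (fun _ => 1) fun _ => 0) (by rintro (y | y) <;> rfl)
  norm_num at this

theorem isForest_graphSum (hD : 1 ≤ D) {σ : Fin D → Equiv.Perm V} {τ : Fin D → Equiv.Perm W}
    (hσ : IsForest σ) (hτ : IsForest τ) : IsForest (graphSum σ τ) := by
  have h : numOrbits (graphSum σ τ) = numOrbits σ + numOrbits τ := numOrbits_sumCongr σ τ
  unfold IsForest at *
  rw [numFaces_graphSum, h, hσ, hτ, Fintype.card_sum]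
  ring

theorem numOrbits_pos [Nonempty V] (σ : Fin D → Equiv.Perm V) : 1 ≤ numOrbits σ := by
  unfold numOrbits
  rw [Nat.one_le_iff_ne_zero, Ne, Submodule.finrank_eq_zero]
  intro h
  have h1 : (fun _ => 1 : V → ℚ) ∈ invariants σ := fun _ _ => rfl
  rw [h, Submodule.mem_bot] at h1
  obtain ⟨v⟩ := ‹Nonempty V›
  exact one_ne_zero (congrFun h1 v)

theorem eq_of_numOrbits_eq_one {σ : Fin D → Equiv.Perm V} (h : numOrbits σ = 1) {f : V → ℚ}
    (hf : f ∈ invariants σ) (v w : V) : f v = f w := by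
  obtain ⟨g, -, hg⟩ := finrank_eq_one_iff'.1 h
  obtain ⟨r, hr⟩ := hg ⟨fun _ => 1, fun _ _ => rfl⟩
  obtain ⟨s, hs⟩ := hg ⟨f, hf⟩
  have hr' : ∀ y, r * g.1 y = 1 := fun y => congrFun (congrArg Subtype.val hr) y
  have hs' : ∀ y, s * g.1 y = f y := fun y => congrFun (congrArg Subtype.val hs) y
  have hr0 : r ≠ 0 := by
    rintro rfl
    have := hr' v
    simp at this
  have : g.1 v = g.1 w := mul_left_cancel₀ hr0 ((hr' v).trans (hr' w).symm)
  rw [← hs', ← hs', this]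

/-- Grafting a melonic graph on a forest. -/
theorem IsForest.swapAt_graphSum (hD : 1 ≤ D) {σ : Fin D → Equiv.Perm V}
    {τ : Fin D → Equiv.Perm W} (hσ : IsForest σ) (hτ : IsForest τ) (hτ1 : numOrbits τ = 1)
    (c : Fin D) (v : V) (w : W) :
    IsForest (swapAt (graphSum σ τ) c (Sum.inl v) (Sum.inr w)) ∧
      numOrbits (swapAt (graphSum σ τ) c (Sum.inl v) (Sum.inr w)) = numOrbits σ := by
  have h0 := not_sameCycle_graphSum σ τ c v w
  have h1 := numFaces_swapAt_of_not_sameCycle h0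
  have h2 : numFaces (graphSum σ τ) = _ := isForest_graphSum hD hσ hτ
  have h : numOrbits (graphSum σ τ) = numOrbits σ + numOrbits τ := numOrbits_sumCongr σ τ
  have h3 := numFaces_le hD (swapAt (graphSum σ τ) c (Sum.inl v) (Sum.inr w))
  have h4 : numOrbits (swapAt (graphSum σ τ) c (Sum.inl v) (Sum.inr w)) ≤ numOrbits σ := by
    refine finrank_le_of_maps _ _ (LinearMap.funLeft ℚ ℚ Sum.inl) (fun f hf => ?_)
      fun f hf hf0 => ?_
    · have hvw := eq_of_mem_invariants_swapAt h0 hf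
      rw [mem_invariants_swapAt hvw] at hf
      exact fun c' u => hf c' (Sum.inl u)
    · have hvw := eq_of_mem_invariants_swapAt h0 hf
      rw [mem_invariants_swapAt hvw] at hf
      have h5 : ∀ u, f (Sum.inl u) = 0 := fun u => congrFun hf0 u
      funext x
      rcases x with u | y
      · exact h5 u
      · have := eq_of_numOrbits_eq_one hτ1 (f := f ∘ Sum.inr) (fun c' u => hf c' (Sum.inr u)) y w
        change f (Sum.inr y) = f (Sum.inr w) at this
        rw [this, ← hvw, h5]
        rfl
  constructor
  · unfold IsForest
    omega
  · omega

/-! ### Leaves -/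

/-- The number of colours moving a vertex. -/
def moveCount (σ : Fin D → Equiv.Perm V) (v : V) : ℕ :=
  (Finset.univ.filter fun c => σ c v ≠ v).card

/-- A vertex moved by many colours lies on many faces with at least two vertices, which makes the
number of faces small. -/
theorem two_mul_numFaces_add_le (σ : Fin D → Equiv.Perm V) :
    2 * numFaces σ + ∑ v, moveCount σ v ≤ 2 * (D * Fintype.card V) := by
  have h1 : ∑ v, moveCount σ v = ∑ c, (σ c).support.card := by
    simp only [moveCount, Equiv.Perm.support, Finset.card_filter]
    exact Finset.sum_comm
  rw [h1, numFaces, Finset.mul_sum, ← Finset.sum_add_distrib]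
  refine (Finset.sum_le_sum fun c _ => two_mul_numCycles_add_support_le (σ c)).trans ?_
  rw [Finset.sum_const, Finset.card_univ, Fintype.card_fin, smul_eq_mul]
  apply le_of_eq
  ring

/-- If all vertices were moved by at least two colours, there would be at most `(D - 1) p` faces,
too few for a forest. -/
theorem IsForest.exists_leaf (hD : 1 ≤ D) [Nonempty V] {σ : Fin D → Equiv.Perm V}
    (hσ : IsForest σ) : ∃ v, moveCount σ v ≤ 1 := by
  by_contra! hcon
  have h1 := two_mul_numFaces_add_le σ
  have h2 : Fintype.card V * 2 ≤ ∑ v, moveCount σ v := by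
    rw [← smul_eq_mul, ← Finset.card_univ]
    exact Finset.card_nsmul_le_sum _ _ _ fun v _ => hcon v
  have h3 := numOrbits_pos σ
  have h4 : numFaces σ = _ := hσ
  obtain ⟨d, rfl⟩ : ∃ d, D = d + 1 := ⟨D - 1, by omega⟩
  rw [Nat.add_sub_cancel] at h4
  rw [add_mul, one_mul] at h1
  omega

theorem optionCongr_removeNone_of_fixed {π : Equiv.Perm (Option U)} (h : π none = none) :
    Equiv.optionCongr (Equiv.removeNone π) = π := by
  ext1 x
  rcases x with _ | u
  · simp [h]
  · rw [Equiv.optionCongr_apply, Option.map_some, some_removeNone_apply, if_neg]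
    intro hu
    have := π.injective (hu.trans h.symm)
    simp at this

/-- A vertex moved by no colour is an isolated bubble, and a vertex moved by one colour is a
dipole. -/
theorem eq_addBubble_or_insDipole {ρ : Fin D → Equiv.Perm (Option U)}
    (h : moveCount ρ none ≤ 1) :
    (∃ σ : Fin D → Equiv.Perm U, ρ = addBubble σ) ∨
      ∃ (σ : Fin D → Equiv.Perm U) (c : Fin D) (v : U), ρ = insDipole σ c v := by
  by_cases h0 : ∀ c, ρ c none = none
  · exact Or.inl ⟨fun c => Equiv.removeNone (ρ c),
      funext fun c => (optionCongr_removeNone_of_fixed (h0 c)).symm⟩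
  · push Not at h0
    obtain ⟨c, hc⟩ := h0
    have h1 : ∀ c', c' ≠ c → ρ c' none = none := by
      intro c' hc'
      by_contra hcon
      exact hc' (Finset.card_le_one.1 h c' (by simp [hcon]) c (by simp [hc]))
    obtain ⟨v, hv⟩ : ∃ v, ρ c (some v) = none := by
      obtain ⟨x, hx⟩ := (ρ c).surjective none
      rcases x with _ | v
      · exact absurd hx hc
      · exact ⟨v, hx⟩
    refine Or.inr ⟨fun c' => Equiv.removeNone (swapAt ρ c (some v) none c'), c, v, ?_⟩
    have h2 : ∀ c', swapAt ρ c (some v) none c' none = none := by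
      intro c'
      by_cases hc' : c' = c
      · subst hc'
        simp [swapAt, hv]
      · simp [swapAt, hc', h1]
    funext c'
    have h3 := optionCongr_removeNone_of_fixed (h2 c')
    by_cases hc' : c' = c
    · subst hc'
      simp only [insDipole, swapAt, if_true, addBubble] at h3 ⊢
      rw [h3, mul_assoc, Equiv.swap_mul_self, mul_one]
    · simp only [insDipole, swapAt, if_neg hc', addBubble] at h3 ⊢
      rw [h3]

theorem rootAt_apply (σ : Fin D → Equiv.Perm V) (x : V) (c : Fin D) (y : V) :
    rootAt σ x c ((Equiv.optionSubtypeNe x).symm y) = (Equiv.optionSubtypeNe x).symm (σ c y) := by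
  simp only [rootAt, Equiv.permCongr_apply, Equiv.symm_symm, Equiv.apply_symm_apply]

theorem moveCount_eq_of_equiv {σ : Fin D → Equiv.Perm V} {τ : Fin D → Equiv.Perm W} (e : V ≃ W)
    (h : ∀ c v, τ c (e v) = e (σ c v)) (v : V) : moveCount τ (e v) = moveCount σ v := by
  unfold moveCount
  congr 1
  ext c
  simp [h]

/-- Forests are built from isolated bubbles by dipole insertions. -/
theorem IsForest.exists_reduction (hD : 1 ≤ D) [Nonempty V] {σ : Fin D → Equiv.Perm V}
    (hσ : IsForest σ) : ∃ (v : V) (σ' : Fin D → Equiv.Perm {y // y ≠ v}),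
      IsForest σ' ∧ (rootAt σ v = addBubble σ' ∨ ∃ c y, rootAt σ v = insDipole σ' c y) := by
  obtain ⟨v, hv⟩ := hσ.exists_leaf hD
  have h1 : moveCount (rootAt σ v) none ≤ 1 := by
    rw [← Equiv.optionSubtypeNe_symm_self v,
      moveCount_eq_of_equiv (Equiv.optionSubtypeNe v).symm (rootAt_apply σ v)]
    exact hv
  have h2 : IsForest (rootAt σ v) :=
    (isForest_iff_of_equiv (Equiv.optionSubtypeNe v).symm (rootAt_apply σ v)).1 hσ
  rcases eq_addBubble_or_insDipole h1 with ⟨σ', h⟩ | ⟨σ', c, y, h⟩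
  · exact ⟨v, σ', (isForest_addBubble hD).1 (h ▸ h2), Or.inl h⟩
  · exact ⟨v, σ', (isForest_insDipole hD).1 (h ▸ h2), Or.inr ⟨c, y, h⟩⟩

end ForestOperations

end TensorModel

namespace TensorModel

/-! ### Connected components of coloured graphs -/

section Components

variable {D : ℕ} {U V W : Type*} [Fintype U] [Fintype V] [Fintype W]
  [DecidableEq U] [DecidableEq V] [DecidableEq W]

/-- The functions on the vertices (white ones first) of a coloured graph that are constant along
the edges. -/
def graphSpace (ρ : Fin D → Equiv.Perm V) : Submodule ℚ ((V → ℚ) × (V → ℚ)) where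
  carrier := {f | ∀ c v, f.2 (ρ c v) = f.1 v}
  add_mem' hf hg c v := by simp [hf c v, hg c v]
  zero_mem' _ _ := rfl
  smul_mem' r f hf c v := by simp [hf c v]

theorem mem_graphSpace {ρ : Fin D → Equiv.Perm V} {f : (V → ℚ) × (V → ℚ)} :
    f ∈ graphSpace ρ ↔ ∀ c v, f.2 (ρ c v) = f.1 v := Iff.rfl

/-- The number of connected components of a coloured graph. -/
noncomputable def graphComps (ρ : Fin D → Equiv.Perm V) : ℕ := Module.finrank ℚ (graphSpace ρ)

theorem graphComps_le_of_equiv {ρ : Fin D → Equiv.Perm V} {τ : Fin D → Equiv.Perm W} (e f : V ≃ W)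
    (h : ∀ c v, τ c (e v) = f (ρ c v)) : graphComps τ ≤ graphComps ρ := by
  refine finrank_le_of_maps _ _ ((LinearMap.funLeft ℚ ℚ e).prodMap (LinearMap.funLeft ℚ ℚ f))
    (fun x hx c v => ?_) fun x _ h0 => ?_
  · simp only [LinearMap.prodMap_apply, LinearMap.funLeft_apply]
    rw [← h]
    exact hx c (e v)
  · have h1 := congrArg Prod.fst h0
    have h2 := congrArg Prod.snd h0
    refine Prod.ext (funext fun w => ?_) (funext fun w => ?_)
    · simpa using congrFun h1 (e.symm w)
    · simpa using congrFun h2 (f.symm w)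

theorem graphComps_eq_of_equiv {ρ : Fin D → Equiv.Perm V} {τ : Fin D → Equiv.Perm W} (e f : V ≃ W)
    (h : ∀ c v, τ c (e v) = f (ρ c v)) : graphComps τ = graphComps ρ := by
  refine le_antisymm (graphComps_le_of_equiv e f h) (graphComps_le_of_equiv e.symm f.symm ?_)
  intro c w
  rw [Equiv.eq_symm_apply, ← h, Equiv.apply_symm_apply]

theorem graphComps_insDipole_le (hD : 2 ≤ D) (ρ : Fin D → Equiv.Perm V) (c : Fin D) (v : V) :
    graphComps (insDipole ρ c v) ≤ graphComps ρ := by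
  have : Nontrivial (Fin D) := Fin.nontrivial_iff_two_le.2 hD
  obtain ⟨c', hc'⟩ := exists_ne c
  have key : ∀ x ∈ graphSpace (insDipole ρ c v), x.2 none = x.1 none ∧ x.2 none = x.1 (some v) ∧
      x.2 (some (ρ c v)) = x.1 none := by
    intro x hx
    have h1 := hx c' none
    have h2 := hx c (some v)
    have h3 := hx c none
    rw [insDipole_ne_none ρ v hc'] at h1
    rw [insDipole_same_self] at h2
    rw [insDipole_same_none] at h3
    exact ⟨h1, h2, h3⟩
  refine finrank_le_of_maps _ _
    ((LinearMap.funLeft ℚ ℚ some).prodMap (LinearMap.funLeft ℚ ℚ some)) (fun x hx c'' u => ?_)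
    fun x hx h0 => ?_
  · obtain ⟨h1, h2, h3⟩ := key x hx
    simp only [LinearMap.prodMap_apply, LinearMap.funLeft_apply]
    by_cases hc : c'' = c
    · subst hc
      by_cases hu : u = v
      · subst hu
        rw [h3, ← h1, h2]
      · have := hx c'' (some u)
        rwa [insDipole_same_some _ hu] at this
    · have := hx c'' (some u)
      rwa [insDipole_ne_some _ _ _ hc] at this
  · obtain ⟨h1, h2, h3⟩ := key x hx
    have e1 : ∀ u, x.1 (some u) = 0 := fun u => congrFun (congrArg Prod.fst h0) u
    have e2 : ∀ u, x.2 (some u) = 0 := fun u => congrFun (congrArg Prod.snd h0) u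
    refine Prod.ext (funext fun w => ?_) (funext fun w => ?_)
    · rcases w with _ | w
      · rw [← h1, h2, e1]; rfl
      · exact e1 w
    · rcases w with _ | w
      · rw [h2, e1]; rfl
      · exact e2 w

theorem graphComps_swapAt_le (ρ : Fin D → Equiv.Perm V) (c : Fin D) (v x : V) :
    graphComps (swapAt ρ c v x) ≤ graphComps ρ + 1 := by
  refine (finrank_le_inf_ker_add_one _ ((diffForm v x).comp (LinearMap.fst ℚ _ _))).trans
    (Nat.add_le_add_right ?_ 1)
  refine Submodule.finrank_mono fun f hf c' u => ?_
  have hvx : f.1 v = f.1 x := mem_ker_diffForm.1 hf.2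
  by_cases h : c' = c
  · have h1 := hf.1 c' (Equiv.swap v x u)
    simp only [swapAt, h, if_true] at h1
    rw [Equiv.Perm.mul_apply, ← Equiv.Perm.mul_apply (Equiv.swap v x), Equiv.swap_mul_self,
      Equiv.Perm.one_apply, apply_swap_of_eq hvx] at h1
    rw [h, h1]
  · have h1 := hf.1 c' u
    simpa only [swapAt, h, if_false] using h1

/-- Moving an edge between two faces of a forest does not create components: two other colours keep
the pairs connected, and the move joins two faces. -/
theorem IsForest.graphComps_swapAt_le (hD : 3 ≤ D) {σ : Fin D → Equiv.Perm V} (hσ : IsForest σ)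
    {c : Fin D} {v x : V} (h : ¬(σ c).SameCycle v x) :
    graphComps (swapAt σ c v x) ≤ numOrbits σ := by
  obtain ⟨c₁, h1, c₂, h2, h12⟩ : ∃ c₁, c₁ ≠ c ∧ ∃ c₂, c₂ ≠ c ∧ c₁ ≠ c₂ := by
    have h3 : 1 < ((Finset.univ : Finset (Fin D)).erase c).card := by
      rw [Finset.card_erase_of_mem (Finset.mem_univ _), Finset.card_univ, Fintype.card_fin]
      omega
    obtain ⟨a, ha, b, hb, hab⟩ := Finset.one_lt_card.1 h3
    exact ⟨a, Finset.ne_of_mem_erase ha, b, Finset.ne_of_mem_erase hb, hab⟩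
  have key : ∀ f ∈ graphSpace (swapAt σ c v x), f.1 = f.2 ∧ f.1 ∈ invariants (swapAt σ c v x) := by
    intro f hf
    have h3 : f.1 = f.2 := by
      refine hσ.eq_of_two_colours h12 (fun u => ?_) fun u => ?_
      · have := hf c₁ u
        simpa only [swapAt, h1, if_false] using this
      · have := hf c₂ u
        simpa only [swapAt, h2, if_false] using this
    refine ⟨h3, fun c' u => ?_⟩
    rw [← hf c' u, h3]
  refine finrank_le_of_maps _ _ (LinearMap.fst ℚ _ _) (fun f hf => ?_) fun f hf h0 => ?_
  · obtain ⟨-, h4⟩ := key f hf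
    exact (mem_invariants_swapAt (eq_of_mem_invariants_swapAt h h4)).1 h4
  · obtain ⟨h3, -⟩ := key f hf
    refine Prod.ext h0 ?_
    rw [← h3]
    exact h0

theorem finrank_le_inf_ker_add {M M' : Type*} [AddCommGroup M] [Module ℚ M]
    [FiniteDimensional ℚ M] [AddCommGroup M'] [Module ℚ M'] [FiniteDimensional ℚ M']
    (p : Submodule ℚ M) (φ : M →ₗ[ℚ] M') :
    Module.finrank ℚ p ≤
      Module.finrank ℚ (p ⊓ LinearMap.ker φ : Submodule ℚ M) + Module.finrank ℚ M' := by
  rw [← LinearMap.finrank_range_add_finrank_ker (φ.domRestrict p)]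
  have h1 : Module.finrank ℚ (LinearMap.range (φ.domRestrict p)) ≤ Module.finrank ℚ M' :=
    Submodule.finrank_le (LinearMap.range (φ.domRestrict p))
  have h2 : Module.finrank ℚ (LinearMap.ker (φ.domRestrict p)) ≤
      Module.finrank ℚ (p ⊓ LinearMap.ker φ : Submodule ℚ M) :=
    finrank_le_of_maps _ _ p.subtype (fun x hx => ⟨x.2, hx⟩) fun x _ h => Subtype.ext h
  omega

/-- The functions constant along the edges of a graph from which the vertices `none` have been
removed, together with one value for each edge or pair of half-edges left by the removal. -/
def cutSpace (ρ : Fin D → Equiv.Perm (Option U)) :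
    Submodule ℚ (((U → ℚ) × (U → ℚ)) × (Fin D → ℚ)) where
  carrier := {f | ∀ c x, (ρ c x).elim (f.2 c) f.1.2 = x.elim (f.2 c) f.1.1}
  add_mem' {f g} hf hg c x := by
    have h1 := hf c x
    have h2 := hg c x
    revert h1 h2
    generalize ρ c x = y
    rcases x with _ | x <;> rcases y with _ | y <;> intro h1 h2 <;>
      simp only [Option.elim_none, Option.elim_some, Prod.fst_add, Prod.snd_add, Pi.add_apply]
        at h1 h2 ⊢ <;> rw [h1, h2]
  zero_mem' c x := by
    generalize ρ c x = y
    rcases x with _ | x <;> rcases y with _ | y <;> rfl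
  smul_mem' r f hf c x := by
    have h1 := hf c x
    revert h1
    generalize ρ c x = y
    rcases x with _ | x <;> rcases y with _ | y <;> intro h1 <;>
      simp only [Option.elim_none, Option.elim_some, Prod.smul_fst, Prod.smul_snd, Pi.smul_apply]
        at h1 ⊢ <;> rw [h1]

/-- The values at the `D` edges at the removed vertices are equal for a function on the whole graph,
which amounts to `D - 1` linear conditions. -/
theorem finrank_cutSpace_le (hD : 1 ≤ D) (ρ : Fin D → Equiv.Perm (Option U)) :
    Module.finrank ℚ (cutSpace ρ) ≤ graphComps ρ + (D - 1) := by
  set c₀ : Fin D := ⟨0, hD⟩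
  set φ : (((U → ℚ) × (U → ℚ)) × (Fin D → ℚ)) →ₗ[ℚ] ({c // c ≠ c₀} → ℚ) :=
    LinearMap.pi fun c => (diffForm c.1 c₀).comp (LinearMap.snd ℚ _ _) with hφ
  have hker : ∀ f ∈ LinearMap.ker φ, ∀ c, f.2 c = f.2 c₀ := by
    intro f hf c
    by_cases hc : c = c₀
    · rw [hc]
    · have := congrFun (LinearMap.mem_ker.1 hf) ⟨c, hc⟩
      simp only [hφ, LinearMap.pi_apply, LinearMap.comp_apply, LinearMap.snd_apply] at this
      exact mem_ker_diffForm.1 (LinearMap.mem_ker.2 this)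
  refine (finrank_le_inf_ker_add _ φ).trans ?_
  have h1 : Module.finrank ℚ ({c // c ≠ c₀} → ℚ) = D - 1 := by
    rw [Module.finrank_fintype_fun_eq_card, Fintype.card_subtype_compl, Fintype.card_fin,
      Fintype.card_subtype_eq]
  rw [h1]
  refine Nat.add_le_add_right ?_ _
  set L : (((U → ℚ) × (U → ℚ)) × (Fin D → ℚ)) →ₗ[ℚ] ((Option U → ℚ) × (Option U → ℚ)) :=
    { toFun := fun f => (fun x => x.elim (f.2 c₀) f.1.1, fun x => x.elim (f.2 c₀) f.1.2)
      map_add' := fun f g => Prod.ext (funext fun x => by rcases x with _ | x <;> rfl)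
        (funext fun x => by rcases x with _ | x <;> rfl)
      map_smul' := fun r f => Prod.ext (funext fun x => by rcases x with _ | x <;> rfl)
        (funext fun x => by rcases x with _ | x <;> rfl) } with hL
  refine finrank_le_of_maps _ _ L (fun f hf c x => ?_) fun f hf h0 => ?_
  · have := hf.1 c x
    rw [hker f hf.2 c] at this
    exact this
  · have e1 := congrArg Prod.fst h0
    have e2 := congrArg Prod.snd h0
    refine Prod.ext (Prod.ext (funext fun u => ?_) (funext fun u => ?_)) (funext fun c => ?_)
    · exact congrFun e1 (some u)
    · exact congrFun e2 (some u)
    · rw [hker f hf.2 c]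
      exact congrFun e1 none

/-- A contraction of two vertices creates at most `D - 1` new components, if each direct edge, which
contributes a factor `N`, is counted as a component without vertices. -/
theorem graphComps_contract_none_le (hD : 1 ≤ D) (ρ : Fin D → Equiv.Perm (Option U)) :
    graphComps (contract ρ none) + directEdges ρ none ≤ graphComps ρ + (D - 1) := by
  refine le_trans ?_ (finrank_cutSpace_le hD ρ)
  have h1 : directEdges ρ none = Module.finrank ℚ ({c // ρ c none = none} → ℚ) := by
    rw [Module.finrank_fintype_fun_eq_card, Fintype.card_subtype, directEdges]
  rw [h1, graphComps, ← Module.finrank_prod]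
  -- an invariant function on the contracted graph, and a value for each direct edge, give a
  -- function on the cut graph: the value at an edge is that of its remaining white end
  set L : (graphSpace (contract ρ none) × ({c // ρ c none = none} → ℚ)) →ₗ[ℚ]
      (((U → ℚ) × (U → ℚ)) × (Fin D → ℚ)) :=
    { toFun := fun f => (f.1.1, fun c => if h : ρ c none = none then f.2 ⟨c, h⟩ else
        ((ρ c).symm none).elim 0 f.1.1.1)
      map_add' := fun f g => by
        refine Prod.ext rfl (funext fun c => ?_)
        by_cases h : ρ c none = none
        · simp [h]
        · simp only [h, dif_neg, not_false_eq_true, Prod.snd_add, Pi.add_apply]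
          generalize (ρ c).symm none = y
          rcases y with _ | y
          · simp
          · simp
      map_smul' := fun r f => by
        refine Prod.ext rfl (funext fun c => ?_)
        by_cases h : ρ c none = none
        · simp [h]
        · simp only [h, dif_neg, not_false_eq_true, Prod.smul_snd, Pi.smul_apply]
          generalize (ρ c).symm none = y
          rcases y with _ | y
          · simp
          · simp } with hL
  have hmem : ∀ f, L f ∈ cutSpace ρ := by
    rintro ⟨⟨⟨f, g⟩, hfg⟩, η⟩ c x
    have hcon : ∀ u, g (contract ρ none c u) = f u := hfg c
    have hrem : ∀ u, some (contract ρ none c u) =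
        if ρ c (some u) = none then ρ c none else ρ c (some u) := by
      intro u
      rw [contract, some_removeNone_apply]
      simp [Equiv.swap_self]
    change (ρ c x).elim (if h : ρ c none = none then η ⟨c, h⟩ else ((ρ c).symm none).elim 0 f) g =
      x.elim (if h : ρ c none = none then η ⟨c, h⟩ else ((ρ c).symm none).elim 0 f) f
    by_cases h : ρ c none = none
    · rcases x with _ | u
      · simp [h]
      · have h2 : ρ c (some u) ≠ none := fun hc => by
          have := (ρ c).injective (hc.trans h.symm)
          simp at this
        have h3 := hrem u
        rw [if_neg h2] at h3
        rw [← h3]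
        exact hcon u
    · obtain ⟨w, hw⟩ : ∃ w, (ρ c).symm none = some w := by
        refine Option.ne_none_iff_exists'.1 fun hc => h ?_
        rw [Equiv.symm_apply_eq] at hc
        exact hc.symm
      have hw' : ρ c (some w) = none := by rw [← hw, Equiv.apply_symm_apply]
      simp only [dif_neg h, hw, Option.elim_some]
      rcases x with _ | u
      · have h3 := hrem w
        rw [if_pos hw'] at h3
        rw [← h3]
        exact hcon w
      · by_cases hu : u = w
        · subst hu
          rw [hw']
          rfl
        · have h2 : ρ c (some u) ≠ none := fun hc => by
            have := (ρ c).injective (hc.trans hw'.symm)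
            exact hu (Option.some_injective _ this)
          have h3 := hrem u
          rw [if_neg h2] at h3
          rw [← h3]
          exact hcon u
  refine LinearMap.finrank_le_finrank_of_injective (f := L.codRestrict (cutSpace ρ) hmem) ?_
  rw [← LinearMap.ker_eq_bot, LinearMap.ker_eq_bot']
  rintro ⟨⟨f, hf⟩, η⟩ h0
  have h2 : L (⟨f, hf⟩, η) = 0 := congrArg Subtype.val h0
  refine Prod.ext (Subtype.ext (congrArg Prod.fst h2)) (funext fun c => ?_)
  have := congrFun (congrArg Prod.snd h2) c.1
  simpa [hL, c.2] using this

theorem graphComps_contract_le (hD : 1 ≤ D) (ρ : Fin D → Equiv.Perm (Option U)) (x : Option U) :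
    graphComps (contract ρ x) + directEdges ρ x ≤ graphComps ρ + (D - 1) := by
  have h1 : contract ρ x = contract (fun c => ρ c * Equiv.swap none x) none := by
    funext c
    simp only [contract, Equiv.swap_self]
    rfl
  have h2 : directEdges ρ x = directEdges (fun c => ρ c * Equiv.swap none x) none := by
    simp [directEdges]
  have h3 : graphComps ρ = graphComps (fun c => ρ c * Equiv.swap none x) :=
    graphComps_eq_of_equiv (Equiv.swap none x) (Equiv.refl _) fun c v => rfl
  rw [h1, h2, h3]
  exact graphComps_contract_none_le hD _

theorem graphComps_of_isEmpty [IsEmpty V] (ρ : Fin D → Equiv.Perm V) : graphComps ρ = 0 := by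
  rw [graphComps, Module.finrank_zero_of_subsingleton]

end Components

/-! ### Rooted forests -/

section Rooted

variable {D : ℕ} {A V W : Type*} [Fintype A] [Fintype V] [Fintype W]
  [DecidableEq A] [DecidableEq V] [DecidableEq W]

/-- A forest each of whose components contains exactly one of the vertices of the left part, its
roots. -/
def IsRootedForest (μ : Fin D → Equiv.Perm (A ⊕ V)) : Prop :=
  numFaces μ = (D - 1) * Fintype.card (A ⊕ V) + Fintype.card A ∧
    ∀ f ∈ invariants μ, (∀ a, f (Sum.inl a) = 0) → f = 0

/-- The roots of `μ` are inserted in the graph `ρ`. -/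
def graft (ρ : Fin D → Equiv.Perm A) (μ : Fin D → Equiv.Perm (A ⊕ V)) :
    Fin D → Equiv.Perm (A ⊕ V) :=
  fun c => Equiv.sumCongr (ρ c) 1 * μ c

/-- A rooted forest without other vertices than its roots is trivial. -/
theorem IsRootedForest.eq_self [IsEmpty V] {μ : Fin D → Equiv.Perm (A ⊕ V)} (hμ : IsRootedForest μ)
    (hD : 1 ≤ D) (c : Fin D) (x : A ⊕ V) : μ c x = x := by
  have h1 := two_mul_numFaces_add_le μ
  rw [hμ.1, Fintype.card_sum, Fintype.card_eq_zero (α := V), add_zero] at h1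
  have h2 : ∑ v, moveCount μ v = 0 := by
    obtain ⟨d, rfl⟩ : ∃ d, D = d + 1 := ⟨D - 1, by omega⟩
    rw [Nat.add_sub_cancel] at h1
    rw [add_mul, one_mul] at h1
    omega
  have h3 := Finset.sum_eq_zero_iff.1 h2 x (Finset.mem_univ x)
  rw [moveCount, Finset.card_eq_zero, Finset.filter_eq_empty_iff] at h3
  simpa using h3 (Finset.mem_univ c)

/-- A rooted forest has a leaf outside its roots: otherwise the count of faces would force all roots
to be isolated, and the other vertices to be disconnected from them. -/
theorem IsRootedForest.exists_leaf [Nonempty V] {μ : Fin D → Equiv.Perm (A ⊕ V)}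
    (hμ : IsRootedForest μ) (hD : 1 ≤ D) : ∃ v, moveCount μ (Sum.inr v) ≤ 1 := by
  by_contra! hcon
  have h1 := two_mul_numFaces_add_le μ
  rw [hμ.1, Fintype.card_sum, Fintype.sum_sum_type] at h1
  have h2 : Fintype.card V * 2 ≤ ∑ v, moveCount μ (Sum.inr v) := by
    rw [← smul_eq_mul, ← Finset.card_univ]
    exact Finset.card_nsmul_le_sum _ _ _ fun v _ => hcon v
  have h3 : ∑ a, moveCount μ (Sum.inl a) = 0 := by
    obtain ⟨d, rfl⟩ : ∃ d, D = d + 1 := ⟨D - 1, by omega⟩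
    rw [Nat.add_sub_cancel, add_mul d 1, one_mul] at h1
    omega
  have h4 : ∀ c a, μ c (Sum.inl a) = Sum.inl a := fun c a => by
    have h5 := Finset.sum_eq_zero_iff.1 h3 a (Finset.mem_univ a)
    rw [moveCount, Finset.card_eq_zero, Finset.filter_eq_empty_iff] at h5
    simpa using h5 (Finset.mem_univ c)
  -- the indicator of the vertices other than the roots contradicts the definition
  have h5 : (Sum.elim (fun _ => 0) (fun _ => 1) : A ⊕ V → ℚ) ∈ invariants μ := by
    rintro c (a | v)
    · rw [h4]
    · rcases h6 : μ c (Sum.inr v) with a | w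
      · have := (μ c).injective (h6.trans (h4 c a).symm)
        simp at this
      · rfl
  obtain ⟨v⟩ := ‹Nonempty V›
  have := congrFun (hμ.2 _ h5 fun _ => rfl) (Sum.inr v)
  simp at this

/-- Labels of a rooted forest from which one vertex is singled out. -/
def rootLabel (A : Type*) (v : V) : A ⊕ V ≃ Option (A ⊕ {w // w ≠ v}) where
  toFun := Sum.elim (fun a => some (Sum.inl a))
    fun w => if h : w = v then none else some (Sum.inr ⟨w, h⟩)
  invFun x := x.elim (Sum.inr v) (Sum.elim Sum.inl fun w => Sum.inr w.1)
  left_inv := by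
    rintro (a | w)
    · rfl
    · by_cases h : w = v
      · simp [h]
      · simp [h]
  right_inv := by
    rintro (_ | a | w)
    · simp
    · simp
    · simp [w.2]

@[simp] theorem rootLabel_self (v : V) : rootLabel A v (Sum.inr v) = none := by simp [rootLabel]

/-- A rooted forest is built from its roots by dipole insertions. -/
theorem IsRootedForest.exists_reduction [Nonempty V] {μ : Fin D → Equiv.Perm (A ⊕ V)}
    (hμ : IsRootedForest μ) (hD : 1 ≤ D) :
    ∃ (v : V) (μ' : Fin D → Equiv.Perm (A ⊕ {w // w ≠ v})) (c : Fin D) (y : A ⊕ {w // w ≠ v}),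
      IsRootedForest μ' ∧
        ∀ c' x, insDipole μ' c y c' (rootLabel A v x) = rootLabel A v (μ c' x) := by
  obtain ⟨v, hv⟩ := hμ.exists_leaf hD
  set ν : Fin D → Equiv.Perm (Option (A ⊕ {w // w ≠ v})) :=
    fun c => (rootLabel A v).permCongr (μ c) with hν
  have h1 : ∀ c x, ν c (rootLabel A v x) = rootLabel A v (μ c x) := fun c x => by simp [hν]
  have h2 : moveCount ν none ≤ 1 := by
    rw [← rootLabel_self (A := A) v, moveCount_eq_of_equiv (rootLabel A v) h1]
    exact hv
  have hinv : ∀ f ∈ invariants ν, (∀ a, f (some (Sum.inl a)) = 0) → f = 0 := by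
    intro f hf h0
    have h3 := hμ.2 (f ∘ rootLabel A v) (fun c x => by
      simp only [Function.comp_apply]
      rw [← h1, hf]) h0
    funext x
    obtain ⟨y, rfl⟩ := (rootLabel A v).surjective x
    exact congrFun h3 y
  have hfaces := numFaces_eq_of_equiv (rootLabel A v) h1
  have hcard : Fintype.card (A ⊕ V) = Fintype.card (A ⊕ {w // w ≠ v}) + 1 := by
    rw [Fintype.card_congr (rootLabel A v), Fintype.card_option]
  rcases eq_addBubble_or_insDipole h2 with ⟨μ', h⟩ | ⟨μ', c, y, h⟩
  · have := hinv (fun x => x.elim 1 fun _ => 0) (by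
      rw [h]
      rintro c (_ | x) <;> rfl) fun a => rfl
    have := congrFun this none
    simp at this
  · refine ⟨v, μ', c, y, ⟨?_, fun f hf h0 => ?_⟩, ?_⟩
    · rw [h, numFaces_insDipole hD, hμ.1, hcard] at hfaces
      rw [mul_add, mul_one] at hfaces
      omega
    · have h3 := hinv _ (h ▸ mem_invariants_insDipole hf c y) h0
      funext x
      exact congrFun h3 (some x)
    · rw [← h]
      exact h1

theorem insDipole_graft (ρ : Fin D → Equiv.Perm A) (μ : Fin D → Equiv.Perm (A ⊕ V)) (c : Fin D)
    (y : A ⊕ V) (c' : Fin D) : insDipole (graft ρ μ) c y c' =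
      Equiv.optionCongr (Equiv.sumCongr (ρ c') 1) * insDipole μ c y c' := by
  have h : ∀ c', addBubble (graft ρ μ) c' =
      Equiv.optionCongr (Equiv.sumCongr (ρ c') 1) * addBubble μ c' := fun c' => by
    ext1 x
    rcases x with _ | x <;> rfl
  unfold insDipole swapAt
  split_ifs
  · rw [h, mul_assoc]
  · rw [h]

/-- Grafting commutes with the insertion of dipoles in the rooted forest. -/
theorem insDipole_graft_rootLabel {ρ : Fin D → Equiv.Perm A} {μ : Fin D → Equiv.Perm (A ⊕ V)}
    {v : V} {μ' : Fin D → Equiv.Perm (A ⊕ {w // w ≠ v})} {c : Fin D} {y : A ⊕ {w // w ≠ v}}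
    (h : ∀ c' x, insDipole μ' c y c' (rootLabel A v x) = rootLabel A v (μ c' x))
    (c' : Fin D) (x : A ⊕ V) :
    insDipole (graft ρ μ') c y c' (rootLabel A v x) = rootLabel A v (graft ρ μ c' x) := by
  rw [insDipole_graft, Equiv.Perm.mul_apply, h]
  simp only [graft, Equiv.Perm.mul_apply]
  rcases μ c' x with a | w
  · rfl
  · by_cases hw : w = v
    · simp [hw]
    · simp [rootLabel, hw]

/-- Grafting a rooted forest does not create components, as it is a sequence of dipole
insertions. -/
theorem graphComps_graft_le (hD : 2 ≤ D) (ρ : Fin D → Equiv.Perm A) :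
    ∀ (n : ℕ) {V : Type*} [Fintype V] [DecidableEq V] {μ : Fin D → Equiv.Perm (A ⊕ V)},
      Fintype.card V = n → IsRootedForest μ → graphComps (graft ρ μ) ≤ graphComps ρ := by
  intro n
  induction n with
  | zero =>
    intro V _ _ μ hn hμ
    have : IsEmpty V := Fintype.card_eq_zero_iff.1 hn
    refine graphComps_le_of_equiv (Equiv.sumEmpty A V).symm (Equiv.sumEmpty A V).symm fun c a => ?_
    simp only [graft, Equiv.Perm.mul_apply, hμ.eq_self (by omega)]
    rfl
  | succ n ih =>
    intro V _ _ μ hn hμ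
    have : Nonempty V := Fintype.card_pos_iff.1 (by omega)
    obtain ⟨v, μ', c, y, hμ', h⟩ := hμ.exists_reduction (by omega)
    rw [← graphComps_eq_of_equiv _ _ (insDipole_graft_rootLabel (ρ := ρ) h)]
    refine (graphComps_insDipole_le hD _ _ _).trans (ih ?_ hμ')
    rw [Fintype.card_subtype_compl, Fintype.card_subtype_eq, hn, Nat.add_sub_cancel]

/-- Grafting a melonic graph on a rooted forest. -/
theorem IsRootedForest.swapAt_graphSum {μ : Fin D → Equiv.Perm (A ⊕ V)}
    {τ : Fin D → Equiv.Perm W} (hμ : IsRootedForest μ) (hτ : IsForest τ) (hτ1 : numOrbits τ = 1)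
    (c : Fin D) (y : A ⊕ V) (w : W) : IsRootedForest fun c' => (Equiv.sumAssoc A V W).permCongr
      (swapAt (graphSum μ τ) c (Sum.inl y) (Sum.inr w) c') := by
  set ν := swapAt (graphSum μ τ) c (Sum.inl y) (Sum.inr w) with hν
  have h0 := not_sameCycle_graphSum μ τ c y w
  have he : ∀ c' x, (Equiv.sumAssoc A V W).permCongr (ν c') (Equiv.sumAssoc A V W x) =
      Equiv.sumAssoc A V W (ν c' x) := fun c' x => by simp
  refine ⟨?_, fun f hf hf0 => ?_⟩
  · rw [← numFaces_eq_of_equiv _ he, ← Fintype.card_congr (Equiv.sumAssoc A V W)]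
    have h1 := numFaces_swapAt_of_not_sameCycle h0
    change numFaces ν + 1 = _ at h1
    have h2 : numFaces τ = _ := hτ
    rw [numFaces_graphSum, hμ.1, h2, hτ1] at h1
    rw [Fintype.card_sum (α := A ⊕ V), mul_add]
    omega
  · set g := f ∘ Equiv.sumAssoc A V W with hg
    have hgν : g ∈ invariants ν := fun c' x => by
      simp only [hg, Function.comp_apply]
      rw [← he]
      exact hf c' _
    have hyw := eq_of_mem_invariants_swapAt h0 hgν
    rw [mem_invariants_swapAt hyw] at hgν
    have h1 := hμ.2 (g ∘ Sum.inl) (fun c' u => hgν c' (Sum.inl u)) hf0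
    have h2 : ∀ u, g (Sum.inl u) = 0 := fun u => congrFun h1 u
    have h3 : ∀ u, g (Sum.inr u) = 0 := fun u => by
      have := eq_of_numOrbits_eq_one hτ1 (f := g ∘ Sum.inr) (fun c' u => hgν c' (Sum.inr u)) u w
      change g (Sum.inr u) = g (Sum.inr w) at this
      rw [this, ← hyw, h2]
    funext x
    obtain ⟨z, rfl⟩ := (Equiv.sumAssoc A V W).surjective x
    rcases z with z | z
    · exact h2 z
    · exact h3 z

/-- Grafting a melonic graph on a graph with grafted roots amounts to enlarging the rooted
forest. -/
theorem graft_swapAt_graphSum (ρ : Fin D → Equiv.Perm A) (μ : Fin D → Equiv.Perm (A ⊕ V))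
    (τ : Fin D → Equiv.Perm W) (c : Fin D) (y : A ⊕ V) (w : W) (c' : Fin D) (x : (A ⊕ V) ⊕ W) :
    graft ρ (fun c' => (Equiv.sumAssoc A V W).permCongr
      (swapAt (graphSum μ τ) c (Sum.inl y) (Sum.inr w) c')) c' (Equiv.sumAssoc A V W x) =
      Equiv.sumAssoc A V W (swapAt (graphSum (graft ρ μ) τ) c (Sum.inl y) (Sum.inr w) c' x) := by
  have h1 : ∀ z : (A ⊕ V) ⊕ W, Equiv.sumCongr (ρ c') 1 (Equiv.sumAssoc A V W z) =
      Equiv.sumAssoc A V W (Equiv.sumCongr (Equiv.sumCongr (ρ c') 1) 1 z) := by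
    rintro ((a | v) | w) <;> rfl
  have h2 : ∀ z, graphSum (graft ρ μ) τ c' z =
      Equiv.sumCongr (Equiv.sumCongr (ρ c') 1) 1 (graphSum μ τ c' z) := by
    rintro (z | z) <;> rfl
  simp only [graft, Equiv.Perm.mul_apply, Equiv.permCongr_apply, Equiv.symm_apply_apply]
  rw [h1]
  congr 1
  unfold swapAt
  split_ifs
  · rw [Equiv.Perm.mul_apply, Equiv.Perm.mul_apply, h2]
  · rw [h2]

/-- The rooted forest by which a melonic graph is glued to a graph. -/
def glueForest (ρ : Fin D → Equiv.Perm (Option A)) (τ : Fin D → Equiv.Perm (Option V)) :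
    Fin D → Equiv.Perm (Option A ⊕ V) :=
  fun c => (Equiv.sumCongr (ρ c) 1)⁻¹ * glue ρ τ c

theorem graft_glueForest (ρ : Fin D → Equiv.Perm (Option A)) (τ : Fin D → Equiv.Perm (Option V)) :
    graft ρ (glueForest ρ τ) = glue ρ τ := by
  funext c
  exact mul_inv_cancel_left _ _

/-- Gluing a melonic graph to a vertex `none` is grafting a rooted forest, whose only nontrivial
component contains the root `none`. -/
theorem isRootedForest_glueForest (hD : 1 ≤ D) (ρ : Fin D → Equiv.Perm (Option A))
    {τ : Fin D → Equiv.Perm (Option V)} (hτ : IsForest τ) (hτ1 : numOrbits τ = 1) :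
    IsRootedForest (glueForest ρ τ) := by
  refine ⟨?_, fun f hf hf0 => ?_⟩
  · have h1 : ∀ c, numCycles (glueForest ρ τ c) = Fintype.card A + numCycles (τ c) := by
      intro c
      rw [glueForest, glue, numCycles_mul_comm, mul_assoc, mul_inv_cancel, mul_one,
        ← numCycles_one (V := A), ← numCycles_sumCongr]
      refine (numCycles_eq_of_equiv (moveNone A V).symm fun v => ?_).symm
      simp
    have h2 : numFaces τ = _ := hτ
    unfold numFaces at h2 ⊢
    rw [Finset.sum_congr rfl fun c _ => h1 c, Finset.sum_add_distrib, h2, hτ1, Finset.sum_const,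
      Finset.card_univ, Fintype.card_fin, Fintype.card_sum, Fintype.card_option,
      Fintype.card_option, smul_eq_mul]
    obtain ⟨d, rfl⟩ : ∃ d, D = d + 1 := ⟨D - 1, by omega⟩
    rw [Nat.add_sub_cancel]
    ring
  · have h1 : ∀ c z, f ((Equiv.sumCongr (ρ c) (1 : Equiv.Perm V)) z) = f z := by
      rintro c (a | v)
      · simp [hf0]
      · rfl
    have h2 : ∀ c z, f ((moveNone A V).symm (Equiv.sumCongr 1 (τ c) z)) =
        f ((moveNone A V).symm z) := by
      intro c z
      obtain ⟨z', hz'⟩ := (Equiv.sumCongr (ρ c) (1 : Equiv.Perm V)).surjective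
        ((moveNone A V).symm z)
      have h3 := hf c z'
      rw [← h1 c, glueForest, Equiv.Perm.mul_apply, ← Equiv.Perm.mul_apply (Equiv.sumCongr _ _),
        mul_inv_cancel, Equiv.Perm.one_apply, glue, Equiv.Perm.mul_apply, hz',
        Equiv.permCongr_apply] at h3
      simp only [Equiv.symm_symm, Equiv.apply_symm_apply] at h3
      rw [h3, ← hz', h1]
    have h3 : ∀ z, f ((moveNone A V).symm (Sum.inr z)) = 0 := fun z => by
      have := eq_of_numOrbits_eq_one hτ1 (f := fun z => f ((moveNone A V).symm (Sum.inr z)))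
        (fun c z => h2 c (Sum.inr z)) z none
      exact this.trans (hf0 none)
    funext x
    rcases x with a | v
    · exact hf0 a
    · exact h3 (some v)

theorem graphComps_glue_le (hD : 2 ≤ D) (ρ : Fin D → Equiv.Perm (Option A))
    {τ : Fin D → Equiv.Perm (Option V)} (hτ : IsForest τ) (hτ1 : numOrbits τ = 1) :
    graphComps (glue ρ τ) ≤ graphComps ρ := by
  rw [← graft_glueForest]
  exact graphComps_graft_le hD ρ _ rfl (isRootedForest_glueForest (by omega) ρ hτ hτ1)

end Rooted

end TensorModel

namespace TensorModel

/-! ### Cycle lengths -/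

section CycleLengths

variable {D : ℕ} {U V W : Type*} [Fintype U] [Fintype V] [Fintype W]
  [DecidableEq U] [DecidableEq V] [DecidableEq W]

/-- The length of the cycle of `π` through `v`. -/
def cycleLen (π : Equiv.Perm V) (v : V) : ℕ := (Finset.univ.filter fun w => π.SameCycle v w).card

/-- The sum of the squares of the lengths of the cycles of `π`. -/
def cycleSq (π : Equiv.Perm V) : ℕ := ∑ v, cycleLen π v

/-- The sum of the squares of the lengths of the faces of a graph whose vertices are paired by their
labels. -/
def faceSq (σ : Fin D → Equiv.Perm V) : ℕ := ∑ c, cycleSq (σ c)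

theorem sameCycle_iff_of_equiv {π : Equiv.Perm V} {ρ : Equiv.Perm W} (e : V ≃ W)
    (h : ∀ v, ρ (e v) = e (π v)) (v w : V) : ρ.SameCycle (e v) (e w) ↔ π.SameCycle v w := by
  rw [sameCycle_iff_invariants, sameCycle_iff_invariants]
  constructor
  · intro h1 f hf
    have := h1 (f ∘ e.symm) fun y => by
      obtain ⟨z, rfl⟩ := e.surjective y
      simp [h, hf]
    simpa using this
  · intro h1 f hf
    exact h1 (f ∘ e) fun y => by simp [← h, hf]

theorem cycleLen_eq_of_equiv {π : Equiv.Perm V} {ρ : Equiv.Perm W} (e : V ≃ W)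
    (h : ∀ v, ρ (e v) = e (π v)) (v : V) : cycleLen ρ (e v) = cycleLen π v := by
  refine (Finset.card_equiv e fun w => ?_).symm
  simp [sameCycle_iff_of_equiv e h]

theorem cycleSq_eq_of_equiv {π : Equiv.Perm V} {ρ : Equiv.Perm W} (e : V ≃ W)
    (h : ∀ v, ρ (e v) = e (π v)) : cycleSq π = cycleSq ρ :=
  Fintype.sum_equiv e _ _ fun v => (cycleLen_eq_of_equiv e h v).symm

theorem faceSq_eq_of_equiv {σ : Fin D → Equiv.Perm V} {τ : Fin D → Equiv.Perm W} (e : V ≃ W)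
    (h : ∀ c v, τ c (e v) = e (σ c v)) : faceSq σ = faceSq τ :=
  Finset.sum_congr rfl fun c _ => cycleSq_eq_of_equiv e (h c)

theorem sameCycle_sumCongr_inl (π : Equiv.Perm V) (ρ : Equiv.Perm W) (v : V) (x : V ⊕ W) :
    Equiv.Perm.SameCycle (Equiv.sumCongr π ρ) (Sum.inl v) x ↔ ∃ w, π.SameCycle v w ∧ x = Sum.inl w := by
  rw [sameCycle_iff_invariants]
  constructor
  · intro h
    rcases x with w | w
    · refine ⟨w, sameCycle_iff_invariants.2 fun f hf => ?_, rfl⟩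
      exact h (Sum.elim f 0) (by rintro (y | y); exacts [hf y, rfl])
    · have := h (Sum.elim 1 0) (by rintro (y | y) <;> rfl)
      simp at this
  · rintro ⟨w, hw, rfl⟩ f hf
    exact sameCycle_iff_invariants.1 hw (f ∘ Sum.inl) fun y => hf (Sum.inl y)

theorem sameCycle_sumCongr_inr (π : Equiv.Perm V) (ρ : Equiv.Perm W) (v : W) (x : V ⊕ W) :
    Equiv.Perm.SameCycle (Equiv.sumCongr π ρ) (Sum.inr v) x ↔ ∃ w, ρ.SameCycle v w ∧ x = Sum.inr w := by
  rw [sameCycle_iff_invariants]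
  constructor
  · intro h
    rcases x with w | w
    · have := h (Sum.elim 1 0) (by rintro (y | y) <;> rfl)
      simp at this
    · refine ⟨w, sameCycle_iff_invariants.2 fun f hf => ?_, rfl⟩
      exact h (Sum.elim 0 f) (by rintro (y | y); exacts [rfl, hf y])
  · rintro ⟨w, hw, rfl⟩ f hf
    exact sameCycle_iff_invariants.1 hw (f ∘ Sum.inr) fun y => hf (Sum.inr y)

theorem cycleLen_sumCongr_inl (π : Equiv.Perm V) (ρ : Equiv.Perm W) (v : V) :
    cycleLen (Equiv.sumCongr π ρ) (Sum.inl v) = cycleLen π v := by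
  have h : (Finset.univ.filter fun x => Equiv.Perm.SameCycle (Equiv.sumCongr π ρ) (Sum.inl v) x) =
      (Finset.univ.filter fun w => π.SameCycle v w).map Function.Embedding.inl := by
    ext x
    simp [sameCycle_sumCongr_inl, eq_comm]
  rw [cycleLen, h, Finset.card_map, cycleLen]

theorem cycleLen_sumCongr_inr (π : Equiv.Perm V) (ρ : Equiv.Perm W) (v : W) :
    cycleLen (Equiv.sumCongr π ρ) (Sum.inr v) = cycleLen ρ v := by
  have h : (Finset.univ.filter fun x => Equiv.Perm.SameCycle (Equiv.sumCongr π ρ) (Sum.inr v) x) =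
      (Finset.univ.filter fun w => ρ.SameCycle v w).map Function.Embedding.inr := by
    ext x
    simp [sameCycle_sumCongr_inr, eq_comm]
  rw [cycleLen, h, Finset.card_map, cycleLen]

theorem cycleSq_sumCongr (π : Equiv.Perm V) (ρ : Equiv.Perm W) :
    cycleSq (Equiv.sumCongr π ρ) = cycleSq π + cycleSq ρ := by
  simp [cycleSq, cycleLen_sumCongr_inl, cycleLen_sumCongr_inr]

theorem cycleLen_one (v : V) : cycleLen (1 : Equiv.Perm V) v = 1 := by
  unfold cycleLen
  rw [Finset.card_eq_one]
  refine ⟨v, ?_⟩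
  ext w
  simp [Equiv.Perm.sameCycle_one, eq_comm]

theorem cycleSq_one : cycleSq (1 : Equiv.Perm V) = Fintype.card V := by
  simp [cycleSq, cycleLen_one]

theorem optionCongr_eq_sumCongr (π : Equiv.Perm V) (x : V ⊕ PUnit.{1}) :
    Equiv.optionCongr π ((Equiv.optionEquivSumPUnit V).symm x) =
      (Equiv.optionEquivSumPUnit V).symm (Equiv.sumCongr π 1 x) := by
  rcases x with x | x <;> rfl

theorem cycleSq_optionCongr (π : Equiv.Perm V) :
    cycleSq (Equiv.optionCongr π) = cycleSq π + 1 := by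
  rw [← cycleSq_eq_of_equiv _ (optionCongr_eq_sumCongr π), cycleSq_sumCongr, cycleSq_one]
  simp

theorem cycleLen_optionCongr_some (π : Equiv.Perm V) (v : V) :
    cycleLen (Equiv.optionCongr π) (some v) = cycleLen π v := by
  have := cycleLen_eq_of_equiv _ (optionCongr_eq_sumCongr π) (Sum.inl v)
  rw [cycleLen_sumCongr_inl] at this
  exact this

theorem cycleLen_optionCongr_none (π : Equiv.Perm V) :
    cycleLen (Equiv.optionCongr π) none = 1 := by
  have := cycleLen_eq_of_equiv _ (optionCongr_eq_sumCongr π) (Sum.inr PUnit.unit)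
  rw [cycleLen_sumCongr_inr, cycleLen_one] at this
  exact this

/-- Two cycles joined by a transposition become one cycle. -/
theorem sameCycle_mul_swap_iff {π : Equiv.Perm V} {v x : V} (h : ¬π.SameCycle v x) (y z : V) :
    (π * Equiv.swap v x).SameCycle y z ↔ π.SameCycle y z ∨ (π.SameCycle v y ∧ π.SameCycle x z) ∨
      (π.SameCycle x y ∧ π.SameCycle v z) := by
  have hinv : ∀ f : V → ℚ, (∀ y, f ((π * Equiv.swap v x) y) = f y) →
      f v = f x ∧ ∀ y, f (π y) = f y := fun f hf => by
    have h1 := invariant_sameCycle hf (sameCycle_mul_swap h)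
    exact ⟨h1, (invariant_mul_swap_iff h1).1 hf⟩
  have hinv' : ∀ f : V → ℚ, f v = f x → (∀ y, f (π y) = f y) →
      ∀ y, f ((π * Equiv.swap v x) y) = f y := fun f h1 h2 => (invariant_mul_swap_iff h1).2 h2
  rw [sameCycle_iff_invariants]
  constructor
  · intro h1
    have h3 : ∀ f : V → ℚ, f v = f x → (∀ y, f (π y) = f y) → f y = f z :=
      fun f h2 h3 => h1 f (hinv' f h2 h3)
    by_cases hy : π.SameCycle v y ∨ π.SameCycle x y
    · have h2 := h3 (fun y => if π.SameCycle v y ∨ π.SameCycle x y then 1 else 0)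
        (by simp [Equiv.Perm.SameCycle.refl])
        fun y => by simp [Equiv.Perm.sameCycle_apply_right]
      rw [if_pos hy] at h2
      have hz : π.SameCycle v z ∨ π.SameCycle x z := by
        by_contra hc
        rw [if_neg hc] at h2
        exact one_ne_zero h2
      rcases hy with hy | hy <;> rcases hz with hz | hz
      · exact Or.inl (hy.symm.trans hz)
      · exact Or.inr (Or.inl ⟨hy, hz⟩)
      · exact Or.inr (Or.inr ⟨hy, hz⟩)
      · exact Or.inl (hy.symm.trans hz)
    · left
      push Not at hy
      have h2 := h3 (fun w => if π.SameCycle y w then 1 else 0)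
        (by rw [if_neg fun hc => hy.1 hc.symm, if_neg fun hc => hy.2 hc.symm])
        fun y => by simp [Equiv.Perm.sameCycle_apply_right]
      by_contra hc
      rw [if_pos (Equiv.Perm.SameCycle.refl _ _), if_neg hc] at h2
      exact one_ne_zero h2
  · intro h1 f hf
    obtain ⟨h2, h3⟩ := hinv f hf
    rcases h1 with h1 | ⟨h1, h4⟩ | ⟨h1, h4⟩
    · exact invariant_sameCycle h3 h1
    · rw [← invariant_sameCycle h3 h1, ← invariant_sameCycle h3 h4, h2]
    · rw [← invariant_sameCycle h3 h1, ← invariant_sameCycle h3 h4, h2]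

/-- Joining cycles of lengths `a` and `b` increases the sum of squares by `2 a b`. -/
theorem cycleSq_mul_swap {π : Equiv.Perm V} {v x : V} (h : ¬π.SameCycle v x) :
    cycleSq (π * Equiv.swap v x) = cycleSq π + 2 * (cycleLen π v * cycleLen π x) := by
  have h1 : ∀ y z, (if (π * Equiv.swap v x).SameCycle y z then 1 else 0) =
      (if π.SameCycle y z then 1 else 0) +
        ((if π.SameCycle v y then 1 else 0) * (if π.SameCycle x z then 1 else 0) +
          (if π.SameCycle x y then 1 else 0) * (if π.SameCycle v z then 1 else 0)) := by
    intro y z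
    simp only [sameCycle_mul_swap_iff h]
    by_cases a : π.SameCycle v y <;> by_cases b : π.SameCycle x y
    · exact absurd (a.trans b.symm) h
    · by_cases c : π.SameCycle x z
      · have : ¬π.SameCycle y z := fun hc => b (c.trans hc.symm)
        have h2 : ¬π.SameCycle v z := fun hc => h (hc.trans c.symm)
        simp [a, b, c, this]
      · simp [a, b, c]
    · by_cases c : π.SameCycle v z
      · have : ¬π.SameCycle y z := fun hc => a (c.trans hc.symm)
        simp [a, b, c, this]
      · simp [a, b, c]
    · simp [a, b]
  unfold cycleSq cycleLen
  simp only [Finset.card_filter, h1, Finset.sum_add_distrib]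
  rw [← Finset.sum_mul_sum, ← Finset.sum_mul_sum]
  ring

theorem faceSq_swapAt {σ : Fin D → Equiv.Perm V} {c : Fin D} {v x : V}
    (h : ¬(σ c).SameCycle v x) :
    faceSq (swapAt σ c v x) = faceSq σ + 2 * (cycleLen (σ c) v * cycleLen (σ c) x) := by
  unfold faceSq
  rw [← Finset.add_sum_erase _ _ (Finset.mem_univ c),
    ← Finset.add_sum_erase _ (fun c => cycleSq (σ c)) (Finset.mem_univ c)]
  have : ∑ c' ∈ Finset.univ.erase c, cycleSq (swapAt σ c v x c') =
      ∑ c' ∈ Finset.univ.erase c, cycleSq (σ c') :=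
    Finset.sum_congr rfl fun c' hc' => by simp [swapAt, Finset.ne_of_mem_erase hc']
  rw [this]
  simp only [swapAt, if_true]
  rw [cycleSq_mul_swap h]
  ring

theorem faceSq_addBubble (σ : Fin D → Equiv.Perm V) : faceSq (addBubble σ) = faceSq σ + D := by
  unfold faceSq addBubble
  simp [cycleSq_optionCongr, Finset.sum_add_distrib]

theorem faceSq_graphSum (σ : Fin D → Equiv.Perm V) (τ : Fin D → Equiv.Perm W) :
    faceSq (graphSum σ τ) = faceSq σ + faceSq τ := by
  unfold faceSq graphSum
  simp [cycleSq_sumCongr, Finset.sum_add_distrib]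

theorem faceSq_insDipole (σ : Fin D → Equiv.Perm V) (c : Fin D) (v : V) :
    faceSq (insDipole σ c v) = faceSq σ + D + 2 * cycleLen (σ c) v := by
  rw [insDipole, faceSq_swapAt (not_sameCycle_addBubble σ c v), faceSq_addBubble, addBubble,
    cycleLen_optionCongr_some, cycleLen_optionCongr_none, mul_one]

theorem faceSq_swapAt_graphSum (σ : Fin D → Equiv.Perm V) (τ : Fin D → Equiv.Perm W) (c : Fin D)
    (v : V) (w : W) : faceSq (swapAt (graphSum σ τ) c (Sum.inl v) (Sum.inr w)) =
      faceSq σ + faceSq τ + 2 * (cycleLen (σ c) v * cycleLen (τ c) w) := by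
  rw [faceSq_swapAt (not_sameCycle_graphSum σ τ c v w), faceSq_graphSum, graphSum,
    cycleLen_sumCongr_inl, cycleLen_sumCongr_inr]

/-- Pairs of distinct points of the same cycle are counted by the lengths of the cycles. -/
theorem two_mul_card_pairs_add [LinearOrder V] (π : Equiv.Perm V) :
    2 * (Finset.univ.filter fun x : V × V => x.1 < x.2 ∧ π.SameCycle x.1 x.2).card +
      Fintype.card V = cycleSq π := by
  have h1 : cycleSq π = ∑ x : V × V, if π.SameCycle x.1 x.2 then 1 else 0 := by
    simp only [cycleSq, cycleLen, Finset.card_filter, Fintype.sum_prod_type]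
  have h2 : ∀ x : V × V, (if π.SameCycle x.1 x.2 then 1 else 0) =
      (if x.1 < x.2 ∧ π.SameCycle x.1 x.2 then 1 else 0) +
      (if x.2 < x.1 ∧ π.SameCycle x.2 x.1 then 1 else 0) + (if x.1 = x.2 then 1 else 0) := by
    intro x
    simp only [Equiv.Perm.sameCycle_comm (f := π) (x := x.2)]
    rcases lt_trichotomy x.1 x.2 with h | h | h
    · simp [h, h.not_gt, h.ne]
    · simp [h, Equiv.Perm.SameCycle.refl]
    · simp [h, h.not_gt, h.ne']
  have h3 : ∑ x : V × V, (if x.2 < x.1 ∧ π.SameCycle x.2 x.1 then 1 else 0) =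
      ∑ x : V × V, if x.1 < x.2 ∧ π.SameCycle x.1 x.2 then 1 else 0 :=
    Equiv.sum_comp (Equiv.prodComm V V) fun x : V × V =>
      if x.1 < x.2 ∧ π.SameCycle x.1 x.2 then 1 else 0
  have h4 : ∑ x : V × V, (if x.1 = x.2 then 1 else 0) = Fintype.card V := by
    rw [Fintype.sum_prod_type]
    simp
  rw [h1, Finset.sum_congr rfl fun x _ => h2 x, Finset.sum_add_distrib, Finset.sum_add_distrib, h3,
    h4, Finset.card_filter]
  ring

end CycleLengths

/-! ### Wick pairings of melonic graphs -/

section Pairings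

variable {D : ℕ} {U V W : Type*} [Fintype U] [Fintype V] [Fintype W]
  [DecidableEq U] [DecidableEq V] [DecidableEq W]

/-- A connected forest: the graph, with its pairing by labels, of a melonic bubble. -/
structure IsTree (σ : Fin D → Equiv.Perm V) : Prop where
  isForest : IsForest σ
  connected : numOrbits σ = 1

theorem isTree_iff_of_equiv {σ : Fin D → Equiv.Perm V} {τ : Fin D → Equiv.Perm W} (e : V ≃ W)
    (h : ∀ c v, τ c (e v) = e (σ c v)) : IsTree σ ↔ IsTree τ := by
  constructor
  · rintro ⟨h1, h2⟩
    exact ⟨(isForest_iff_of_equiv e h).1 h1, by rw [← numOrbits_eq_of_equiv e h, h2]⟩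
  · rintro ⟨h1, h2⟩
    exact ⟨(isForest_iff_of_equiv e h).2 h1, by rw [numOrbits_eq_of_equiv e h, h2]⟩

theorem isTree_insDipole (hD : 1 ≤ D) {σ : Fin D → Equiv.Perm V} {c : Fin D} {v : V} :
    IsTree (insDipole σ c v) ↔ IsTree σ := by
  constructor
  · rintro ⟨h1, h2⟩
    exact ⟨(isForest_insDipole hD).1 h1, by rw [← numOrbits_insDipole σ c v, h2]⟩
  · rintro ⟨h1, h2⟩
    exact ⟨(isForest_insDipole hD).2 h1, by rw [numOrbits_insDipole, h2]⟩

theorem IsTree.numFaces_eq {σ : Fin D → Equiv.Perm V} (h : IsTree σ) :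
    numFaces σ = (D - 1) * Fintype.card V + 1 := by
  have h1 : numFaces σ = _ := h.isForest
  rw [h1, h.connected]

/-- The graph `σ` with its white and black vertices paired by `τ`. -/
def repair (τ : Equiv.Perm V) (σ : Fin D → Equiv.Perm V) : Fin D → Equiv.Perm V :=
  fun c => τ⁻¹ * σ c

theorem numCycles_optionCongr_mul_swap (π : Equiv.Perm V) (v : V) :
    numCycles (Equiv.optionCongr π * Equiv.swap (some v) none) = numCycles π := by
  have h := numCycles_mul_swap_of_not_sameCycle
    (not_sameCycle_addBubble (fun _ : Fin 1 => π) 0 v)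
  have h2 := numCycles_optionCongr π
  change numCycles (Equiv.optionCongr π * _) + 1 = numCycles (Equiv.optionCongr π) at h
  omega

theorem optionCongr_mul (π ρ : Equiv.Perm V) :
    Equiv.optionCongr (π * ρ) = Equiv.optionCongr π * Equiv.optionCongr ρ := by
  ext1 x
  rcases x with _ | x <;> rfl

theorem numCycles_mul_swap_mul (α β : Equiv.Perm V) (v : V) :
    numCycles (Equiv.optionCongr α * Equiv.swap (some v) none * Equiv.optionCongr β) =
      numCycles (α * β) := by
  rw [numCycles_mul_comm, ← mul_assoc, ← optionCongr_mul, numCycles_optionCongr_mul_swap,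
    numCycles_mul_comm]

/-- A pairing matching the two vertices of a dipole has the `D - 1` faces of this dipole. -/
theorem numFaces_repair_optionCongr (hD : 1 ≤ D) (σ : Fin D → Equiv.Perm V) (c : Fin D) (v : V)
    (τ : Equiv.Perm V) : numFaces (repair (Equiv.optionCongr τ) (insDipole σ c v)) =
      numFaces (repair τ σ) + (D - 1) := by
  have h : repair (Equiv.optionCongr τ) (insDipole σ c v) = insDipole (repair τ σ) c v := by
    funext c'
    unfold repair insDipole swapAt addBubble
    rw [optionCongr_mul]
    split_ifs <;> rfl
  rw [h, numFaces_insDipole hD]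

/-- A pairing not matching the two vertices of a dipole does not have its `D - 1` small faces; with
respect to the graph without the dipole, at most one face is gained, in the colour of the dipole. -/
theorem numFaces_repair_swap_le (σ : Fin D → Equiv.Perm V) (c : Fin D) (v : V)
    (τ : Equiv.Perm V) (y : V) :
    numFaces (repair (Equiv.swap none (some y) * Equiv.optionCongr τ) (insDipole σ c v)) ≤
      numFaces (repair τ σ) + 1 := by
  have h1 : ∀ c', (Equiv.swap none (some y) * Equiv.optionCongr τ)⁻¹ * addBubble σ c' =
      Equiv.optionCongr τ⁻¹ * Equiv.swap (some y) none * Equiv.optionCongr (σ c') := fun c' => by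
    rw [mul_inv_rev, Equiv.swap_inv, Equiv.swap_comm]
    rfl
  have h2 : ∀ c', c' ≠ c → numCycles
      (repair (Equiv.swap none (some y) * Equiv.optionCongr τ) (insDipole σ c v) c') =
        numCycles (repair τ σ c') := fun c' hc' => by
    simp only [repair, insDipole, swapAt, hc', if_false]
    rw [h1, numCycles_mul_swap_mul]
  have h3 : numCycles
      (repair (Equiv.swap none (some y) * Equiv.optionCongr τ) (insDipole σ c v) c) ≤
        numCycles (repair τ σ c) + 1 := by
    simp only [repair, insDipole, swapAt, if_true]
    rw [← mul_assoc, h1]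
    refine (numCycles_mul_swap_le _ _ _).trans ?_
    rw [numCycles_mul_swap_mul]
  unfold numFaces
  rw [← Finset.add_sum_erase _ _ (Finset.mem_univ c),
    ← Finset.add_sum_erase _ (fun c => numCycles (repair τ σ c)) (Finset.mem_univ c),
    Finset.sum_congr rfl fun c' hc' => h2 c' (Finset.ne_of_mem_erase hc')]
  omega

/-- Among the Wick pairings of a melonic bubble, the one leading in `1/N` is unique, and those of
relative order `N^{-(D-2)}` differ from it by a transposition. -/
theorem IsTree.numFaces_repair_le (hD : 3 ≤ D) : ∀ (n : ℕ) {V : Type*} [Fintype V] [DecidableEq V]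
    {σ : Fin D → Equiv.Perm V}, Fintype.card V = n → IsTree σ → ∀ τ : Equiv.Perm V, τ ≠ 1 →
      numFaces (repair τ σ) + (D - 2) ≤ (D - 1) * n + 1 ∧
        (numFaces (repair τ σ) + (D - 2) = (D - 1) * n + 1 →
          ∃ v w, v ≠ w ∧ τ = Equiv.swap v w) := by
  intro n
  induction n with
  | zero =>
    intro V _ _ σ hn hσ τ hτ
    have : IsEmpty V := Fintype.card_eq_zero_iff.1 hn
    exact absurd (Subsingleton.elim _ _) hτ
  | succ n ih =>
    intro V _ _ σ hn hσ τ hτ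
    have : Nonempty V := Fintype.card_pos_iff.1 (by omega)
    obtain ⟨v, σ', hσ', h⟩ := hσ.isForest.exists_reduction (by omega)
    have hcard : Fintype.card {y // y ≠ v} = n := by
      rw [Fintype.card_subtype_compl, Fintype.card_subtype_eq, hn, Nat.add_sub_cancel]
    have hroot := (isTree_iff_of_equiv (Equiv.optionSubtypeNe v).symm (rootAt_apply σ v)).1 hσ
    rcases h with h | ⟨c, y, h⟩
    · have h1 := hroot.connected
      rw [h] at h1
      have h2 : numOrbits (addBubble σ') = numOrbits σ' + 1 := numOrbits_optionCongr σ'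
      have h3 : IsEmpty {y // y ≠ v} := by
        by_contra hc
        rw [not_isEmpty_iff] at hc
        have := numOrbits_pos σ'
        omega
      refine absurd (Equiv.ext fun x => ?_) hτ
      have h4 : ∀ x, x = v := fun x => by
        by_contra hx
        exact h3.false ⟨x, hx⟩
      rw [h4 (τ x), h4 x]
      rfl
    · rw [h, isTree_insDipole (by omega)] at hroot
      have hD1 : (D - 1) * (n + 1) = (D - 1) * n + (D - 1) := by ring
      set e := (Equiv.optionSubtypeNe v).symm with he
      set τ' : Equiv.Perm (Option {y // y ≠ v}) := e.permCongr τ with hτ'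
      have hτe : ∀ x, τ' (e x) = e (τ x) := fun x => by simp [hτ']
      have hfaces : numFaces (repair τ σ) = numFaces (repair τ' (insDipole σ' c y)) := by
        refine numFaces_eq_of_equiv e fun c' x => ?_
        rw [← h, repair, repair, Equiv.Perm.mul_apply, Equiv.Perm.inv_eq_iff_eq, hτe, rootAt_apply]
        congr 1
        simp
      have hswap : (∃ a b, a ≠ b ∧ τ' = Equiv.swap a b) → ∃ a b, a ≠ b ∧ τ = Equiv.swap a b := by
        rintro ⟨a, b, hab, hs⟩
        refine ⟨e.symm a, e.symm b, fun hc => hab (e.symm.injective hc), Equiv.ext fun x => ?_⟩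
        apply e.injective
        rw [← hτe, hs, Equiv.swap_apply_def, Equiv.swap_apply_def]
        simp only [Equiv.eq_symm_apply]
        split_ifs <;> simp
      have hτ1 : τ' ≠ 1 := fun hc => hτ (Equiv.ext fun x => e.injective (by
        rw [← hτe, hc]
        rfl))
      rw [hfaces, hD1]
      -- the permutation is decomposed according to the image of the leaf `none`
      obtain ⟨⟨x, τ''⟩, hx⟩ := Equiv.Perm.decomposeOption.symm.surjective τ'
      rw [Equiv.Perm.decomposeOption_symm_apply] at hx
      simp only at hx
      rcases x with _ | x
      · rw [Equiv.swap_self] at hx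
        have hx' : τ' = Equiv.optionCongr τ'' := by rw [← hx]; rfl
        have hτ2 : τ'' ≠ 1 := fun hc => hτ1 (by rw [hx', hc]; exact Equiv.optionCongr_refl)
        obtain ⟨h1, h2⟩ := ih hcard hroot τ'' hτ2
        rw [hx', numFaces_repair_optionCongr (by omega)]
        refine ⟨by omega, fun h3 => hswap ?_⟩
        obtain ⟨a, b, hab, hs⟩ := h2 (by omega)
        refine ⟨some a, some b, fun hc => hab (Option.some_injective _ hc), ?_⟩
        rw [hx', hs, Equiv.optionCongr_swap]
      · have h1 := numFaces_repair_swap_le σ' c y τ'' x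
        rw [hx] at h1
        by_cases hτ2 : τ'' = 1
        · have h2 : repair 1 σ' = σ' := by
            funext c'
            simp [repair]
          rw [hτ2, h2, hroot.numFaces_eq, hcard] at h1
          refine ⟨by omega, fun _ => hswap ⟨none, some x, by simp, ?_⟩⟩
          rw [← hx, hτ2]
          have : Equiv.optionCongr (1 : Equiv.Perm {y // y ≠ v}) = 1 := Equiv.optionCongr_refl
          rw [this, mul_one]
        -- two defects: at least `2 (D - 2)` faces are missing, so that equality is impossible as `3
        -- ≤ D`
        · obtain ⟨h2, -⟩ := ih hcard hroot τ'' hτ2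
          exact ⟨by omega, fun _ => by omega⟩

theorem numCycles_swap_mul_of_sameCycle {π : Equiv.Perm V} {v x : V} (hvx : v ≠ x)
    (h : π.SameCycle v x) : numCycles (Equiv.swap v x * π) = numCycles π + 1 := by
  rw [numCycles_mul_comm, numCycles_mul_swap_of_sameCycle hvx h]

theorem numCycles_swap_mul_of_not_sameCycle {π : Equiv.Perm V} {v x : V}
    (h : ¬π.SameCycle v x) : numCycles (Equiv.swap v x * π) + 1 = numCycles π := by
  rw [numCycles_mul_comm, numCycles_mul_swap_of_not_sameCycle h]

/-- Two vertices of a forest lie in a common face of at most one colour. -/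
theorem IsForest.sameCycle_unique (hD : 1 ≤ D) {σ : Fin D → Equiv.Perm V} (hσ : IsForest σ)
    {c c' : Fin D} {v x : V} (hvx : v ≠ x) (h : (σ c).SameCycle v x)
    (h' : (σ c').SameCycle v x) : c = c' := by
  by_contra hc
  obtain ⟨-, h2⟩ := hσ.swapAt_of_sameCycle hD hvx h
  have h3 : numOrbits (swapAt σ c v x) ≤ numOrbits σ := by
    refine Submodule.finrank_mono fun f hf => (mem_invariants_swapAt ?_).1 hf
    refine invariant_sameCycle (fun y => ?_) h'
    have := hf c' y
    simpa only [swapAt, Ne.symm hc, if_false] using this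
  omega

/-- A transposition of the pairing creates a face for each colour in which the two vertices lie in a
common face, and destroys one for every other colour. -/
theorem numFaces_repair_swap {σ : Fin D → Equiv.Perm V} {v x : V} (hvx : v ≠ x) :
    numFaces (repair (Equiv.swap v x) σ) + D =
      numFaces σ + 2 * (Finset.univ.filter fun c => (σ c).SameCycle v x).card := by
  have h1 : ∀ c, numCycles (repair (Equiv.swap v x) σ c) + 1 =
      numCycles (σ c) + 2 * (if (σ c).SameCycle v x then 1 else 0) := fun c => by
    unfold repair
    rw [Equiv.swap_inv]
    split_ifs with h
    · rw [numCycles_swap_mul_of_sameCycle hvx h]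
    · rw [numCycles_swap_mul_of_not_sameCycle h]
      rfl
  have h2 := Finset.sum_congr (rfl : (Finset.univ : Finset (Fin D)) = Finset.univ) fun c _ => h1 c
  rw [Finset.sum_add_distrib, Finset.sum_add_distrib, ← Finset.mul_sum] at h2
  rw [Finset.card_filter]
  simpa [numFaces] using h2

/-- The number of Wick pairings of relative order `N^{-(D-2)}`. -/
theorem IsTree.two_mul_card_nlo [LinearOrder V] (hD : 3 ≤ D) {σ : Fin D → Equiv.Perm V}
    (hσ : IsTree σ) :
    2 * (Finset.univ.filter fun τ : Equiv.Perm V =>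
      numFaces (repair τ σ) + (D - 2) = 1 + (D - 1) * Fintype.card V).card +
        D * Fintype.card V = faceSq σ := by
  have h1 : (Finset.univ.filter fun τ : Equiv.Perm V =>
      numFaces (repair τ σ) + (D - 2) = 1 + (D - 1) * Fintype.card V).card =
      (Finset.univ.filter fun x : V × V =>
        x.1 < x.2 ∧ ∃ c, (σ c).SameCycle x.1 x.2).card := by
    symm
    -- a transposition is of this order if and only if the two vertices share a face, as they share
    -- at most one
    have hkey : ∀ v x : V, v ≠ x →
        (numFaces (repair (Equiv.swap v x) σ) + (D - 2) = 1 + (D - 1) * Fintype.card V ↔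
          ∃ c, (σ c).SameCycle v x) := by
      intro v x hvx
      have h2 := numFaces_repair_swap (σ := σ) hvx
      have h3 : (Finset.univ.filter fun c => (σ c).SameCycle v x).card ≤ 1 := by
        refine Finset.card_le_one.2 fun a ha b hb => ?_
        rw [Finset.mem_filter] at ha hb
        exact hσ.isForest.sameCycle_unique (by omega) hvx ha.2 hb.2
      rw [hσ.numFaces_eq] at h2
      constructor
      · intro h4
        have h5 : (Finset.univ.filter fun c => (σ c).SameCycle v x).card ≠ 0 := by omega
        obtain ⟨c, hc⟩ := Finset.card_ne_zero.1 h5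
        rw [Finset.mem_filter] at hc
        exact ⟨c, hc.2⟩
      · rintro ⟨c, hc⟩
        have h5 : (Finset.univ.filter fun c => (σ c).SameCycle v x).card ≠ 0 :=
          Finset.card_ne_zero.2 ⟨c, by simp [hc]⟩
        omega
    refine Finset.card_bij (fun x _ => Equiv.swap x.1 x.2) (fun x hx => ?_) (fun x hx y hy h => ?_)
      fun τ hτ => ?_
    · rw [Finset.mem_filter] at hx ⊢
      exact ⟨Finset.mem_univ _, (hkey _ _ hx.2.1.ne).2 hx.2.2⟩
    · rw [Finset.mem_filter] at hx hy
      have hx1 := hx.2.1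
      have hy1 := hy.2.1
      have e1 := Equiv.congr_fun h x.1
      have e2 := Equiv.congr_fun h x.2
      rw [Equiv.swap_apply_left, Equiv.swap_apply_def] at e1
      rw [Equiv.swap_apply_right, Equiv.swap_apply_def] at e2
      obtain ⟨x1, x2⟩ := x
      obtain ⟨y1, y2⟩ := y
      simp only at *
      split_ifs at e1 e2 with a b <;> grind
    · rw [Finset.mem_filter] at hτ
      have hτ1 : τ ≠ 1 := by
        rintro rfl
        have h2 : repair 1 σ = σ := by
          funext c'
          simp [repair]
        have h3 := hτ.2
        rw [h2, hσ.numFaces_eq] at h3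
        omega
      have h2 := (hσ.numFaces_repair_le hD _ rfl τ hτ1).2 (by rw [hτ.2]; ring)
      obtain ⟨v, w, hvw, rfl⟩ := h2
      have h3 := (hkey v w hvw).1 hτ.2
      rcases lt_or_gt_of_ne hvw with h | h
      · exact ⟨(v, w), by rw [Finset.mem_filter]; exact ⟨Finset.mem_univ _, h, h3⟩, rfl⟩
      · refine ⟨(w, v), ?_, Equiv.swap_comm _ _⟩
        rw [Finset.mem_filter]
        obtain ⟨c, hc⟩ := h3
        exact ⟨Finset.mem_univ _, h, c, hc.symm⟩
  have h2 : (Finset.univ.filter fun x : V × V =>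
      x.1 < x.2 ∧ ∃ c, (σ c).SameCycle x.1 x.2).card = ∑ c, (Finset.univ.filter
        fun x : V × V => x.1 < x.2 ∧ (σ c).SameCycle x.1 x.2).card := by
    rw [← Finset.card_biUnion]
    · congr 1
      ext x
      simp
    · intro c _ c' _ hcc'
      rw [Function.onFun, Finset.disjoint_left]
      intro x hx hx'
      rw [Finset.mem_filter] at hx hx'
      exact hcc' (hσ.isForest.sameCycle_unique (by omega) hx.2.1.ne hx.2.2 hx'.2.2)
  have h3 := Finset.sum_congr (rfl : (Finset.univ : Finset (Fin D)) = Finset.univ)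
    fun c _ => two_mul_card_pairs_add (σ c)
  rw [Finset.sum_add_distrib, ← Finset.mul_sum] at h3
  rw [h1, h2]
  simpa [faceSq] using h3

/-- The number of ways to attach a 4-point function at relative order `N^{-(D-2)}`. -/
theorem IsTree.two_mul_card_fourPoint [LinearOrder V] (hD : 3 ≤ D) {σ : Fin D → Equiv.Perm V}
    (hσ : IsTree σ) (c : Fin D) :
    2 * (Finset.univ.filter fun x : Equiv.Perm V × V × V => x.2.1 < x.2.2 ∧
      ∑ c', numCycles ((if c' = c then x.1 * Equiv.swap x.2.1 x.2.2 else x.1)⁻¹ * σ c') + (D - 2) =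
        1 + (D - 1) * (Fintype.card V + 1)).card + Fintype.card V = cycleSq (σ c) := by
  rw [← two_mul_card_pairs_add]
  congr 2
  have hsum : ∀ (τ : Equiv.Perm V) (v w : V),
      ∑ c', numCycles ((if c' = c then τ * Equiv.swap v w else τ)⁻¹ * σ c') +
        numCycles (τ⁻¹ * σ c) =
      numFaces (repair τ σ) + numCycles (Equiv.swap v w * (τ⁻¹ * σ c)) := by
    intro τ v w
    unfold numFaces
    rw [← Finset.add_sum_erase _ _ (Finset.mem_univ c),
      ← Finset.add_sum_erase _ (fun c => numCycles (repair τ σ c)) (Finset.mem_univ c),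
      Finset.sum_congr rfl (g := fun c => numCycles (repair τ σ c))
        fun c' hc' => by rw [if_neg (Finset.ne_of_mem_erase hc')]; rfl]
    simp only [if_true, mul_inv_rev, Equiv.swap_inv, mul_assoc]
    unfold repair
    omega
  symm
  refine Finset.card_bij (fun x _ => ((1 : Equiv.Perm V), x)) (fun x hx => ?_)
    (fun x _ y _ h => congrArg Prod.snd h) fun x hx => ?_
  · rw [Finset.mem_filter] at hx ⊢
    refine ⟨Finset.mem_univ _, hx.2.1, ?_⟩
    have h1 := hsum 1 x.1 x.2
    have h2 : repair 1 σ = σ := by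
      funext c'
      simp [repair]
    have h3 : (1 : Equiv.Perm V)⁻¹ * σ c = σ c := by simp
    rw [h2, h3, numCycles_swap_mul_of_sameCycle hx.2.1.ne hx.2.2, hσ.numFaces_eq] at h1
    rw [mul_add, mul_one]
    simp only
    omega
  · obtain ⟨τ, v, w⟩ := x
    rw [Finset.mem_filter] at hx
    obtain ⟨-, hvw, hx⟩ := hx
    simp only at hvw hx
    have h1 := hsum τ v w
    rw [mul_add, mul_one] at hx
    have h3 : numCycles (Equiv.swap v w * (τ⁻¹ * σ c)) ≤ numCycles (τ⁻¹ * σ c) + 1 := by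
      rw [numCycles_mul_comm]
      exact numCycles_mul_swap_le _ _ _
    by_cases hτ : τ = 1
    · subst hτ
      refine ⟨(v, w), ?_, rfl⟩
      rw [Finset.mem_filter]
      refine ⟨Finset.mem_univ _, hvw, ?_⟩
      by_contra hcon
      have h2 : repair 1 σ = σ := by
        funext c'
        simp [repair]
      have h4 := numCycles_swap_mul_of_not_sameCycle (v := v) (x := w) hcon
      have h5 : (1 : Equiv.Perm V)⁻¹ * σ c = σ c := by simp
      rw [h2, h5, hσ.numFaces_eq] at h1
      omega
    · have h2 := (hσ.numFaces_repair_le hD _ rfl τ hτ).1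
      omega

end Pairings

end TensorModel

namespace TensorModel

/-! ### Melonic bubbles and their constants -/

section Melonic

variable {D : ℕ}

open ColoredGraph

/-- The permutation `τ` pairs the vertices of the bubble `G` in such a way that `G` becomes a tree;
this is the leading Wick pairing of a melonic bubble. -/
def IsMelonicPairing (G : ColoredGraph D) (τ : Equiv.Perm (Fin G.p)) : Prop :=
  IsTree (repair τ G.adj)

/-- The leading pairing is unique, as the other ones have fewer faces. -/
theorem IsTree.pairing_unique {V : Type*} [Fintype V] [DecidableEq V] (hD : 3 ≤ D)
    {σ : Fin D → Equiv.Perm V} {τ τ' : Equiv.Perm V} (h : IsTree (repair τ σ))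
    (h' : IsTree (repair τ' σ)) : τ = τ' := by
  by_contra hne
  have h1 : repair (τ⁻¹ * τ') (repair τ σ) = repair τ' σ := by
    funext c
    simp [repair, mul_assoc]
  have h2 := (h.numFaces_repair_le hD _ rfl (τ⁻¹ * τ') fun hc => hne (inv_mul_eq_one.1 hc)).1
  rw [h1, h'.numFaces_eq] at h2
  omega

theorem extendPerm_apply {p : ℕ} (σ : Equiv.Perm (Fin p)) (x : Option (Fin p)) :
    extendPerm σ (finSuccEquivLast.symm x) = finSuccEquivLast.symm (Equiv.optionCongr σ x) := by
  simp [extendPerm]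

theorem insertDipole_adj_apply (G : ColoredGraph D) (c : Fin D) (v : Fin G.p) (c' : Fin D)
    (x : Option (Fin G.p)) : (show Equiv.Perm (Fin (G.p + 1)) from (G.insertDipole c v).adj c')
      (finSuccEquivLast.symm x) = finSuccEquivLast.symm (insDipole G.adj c v c' x) := by
  have h1 : Equiv.swap v.castSucc (Fin.last G.p) (finSuccEquivLast.symm x) =
      finSuccEquivLast.symm (Equiv.swap (some v) none x) := by
    rw [Equiv.swap_apply_def, Equiv.swap_apply_def, ← finSuccEquivLast_symm_some,
      ← finSuccEquivLast_symm_none]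
    simp only [EmbeddingLike.apply_eq_iff_eq]
    split_ifs <;> rfl
  change (if c' = c then extendPerm (G.adj c) * Equiv.swap v.castSucc (Fin.last G.p)
    else extendPerm (G.adj c')) (finSuccEquivLast.symm x) = _
  by_cases hc : c' = c
  · simp only [insDipole, swapAt, addBubble, hc, if_true, Equiv.Perm.mul_apply]
    rw [h1, extendPerm_apply]
  · simp only [insDipole, swapAt, addBubble, hc, if_false]
    rw [extendPerm_apply]

theorem repair_insertDipole (G : ColoredGraph D) (c : Fin D) (v : Fin G.p)
    (τ : Equiv.Perm (Fin G.p)) (c' : Fin D) (x : Option (Fin G.p)) :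
    repair (V := Fin (G.p + 1)) (extendPerm τ) (G.insertDipole c v).adj c'
      (finSuccEquivLast.symm x) =
      finSuccEquivLast.symm (insDipole (repair τ G.adj) c v c' x) := by
  change (extendPerm τ)⁻¹ ((show Equiv.Perm (Fin (G.p + 1)) from (G.insertDipole c v).adj c')
      (finSuccEquivLast.symm x)) = _
  rw [Equiv.Perm.inv_eq_iff_eq, insertDipole_adj_apply, extendPerm_apply]
  congr 1
  have h : ∀ y, (Equiv.optionCongr τ) (addBubble (repair τ G.adj) c' y) = addBubble G.adj c' y := by
    rintro (_ | y)
    · rfl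
    · simp [addBubble, repair]
  unfold insDipole swapAt
  split_ifs
  · rw [Equiv.Perm.mul_apply, Equiv.Perm.mul_apply, h]
  · rw [h]

theorem IsMelonicPairing.insertDipole (hD : 1 ≤ D) {G : ColoredGraph D}
    {τ : Equiv.Perm (Fin G.p)} (h : IsMelonicPairing G τ) (c : Fin D) (v : Fin G.p) :
    IsMelonicPairing (G.insertDipole c v) (extendPerm τ) :=
  (isTree_iff_of_equiv (V := Option (Fin G.p)) (W := Fin (G.p + 1)) finSuccEquivLast.symm
    (repair_insertDipole G c v τ)).1 ((isTree_insDipole hD).2 h)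

theorem isMelonicPairing_twoVertex (hD : 1 ≤ D) : IsMelonicPairing (twoVertex D) 1 := by
  have h : repair 1 (twoVertex D).adj = fun _ => 1 := by
    funext c
    exact inv_mul_cancel 1
  have h1 : numOrbits (fun _ : Fin D => (1 : Equiv.Perm (Fin 1))) = 1 := numOrbits_one
  refine ⟨?_, by rw [h]; exact h1⟩
  rw [h]
  unfold IsForest numFaces
  change ∑ c : Fin D, numCycles (1 : Equiv.Perm (Fin 1)) = (D - 1) * Fintype.card (Fin 1) + numOrbits _
  have h2 : numOrbits (fun _ : Fin D => (1 : Equiv.Perm (Fin (twoVertex D).p))) = 1 := h1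
  rw [numCycles_one, h2]
  simp
  omega

theorem IsMelonicPairing.iso {G H : ColoredGraph D} {e f : Fin G.p ≃ Fin H.p}
    (h : ∀ c v, H.adj c (e v) = f (G.adj c v)) {τ : Equiv.Perm (Fin G.p)}
    (hτ : IsMelonicPairing G τ) : IsMelonicPairing H ((e.symm.trans τ).trans f) ∧
      ∀ c v, repair ((e.symm.trans τ).trans f) H.adj c (e v) = e (repair τ G.adj c v) := by
  have h1 : ∀ c v, repair ((e.symm.trans τ).trans f) H.adj c (e v) = e (repair τ G.adj c v) := by
    intro c v
    rw [repair, Equiv.Perm.mul_apply, Equiv.Perm.inv_eq_iff_eq, h]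
    simp [repair]
  exact ⟨(isTree_iff_of_equiv e h1).1 hτ, h1⟩

/-- The leading pairing of a melonic bubble matches the two vertices of each inserted dipole. -/
theorem ColoredGraph.IsMelonic.exists_pairing (hD : 1 ≤ D) {G : ColoredGraph D}
    (hG : G.IsMelonic) : ∃ τ, IsMelonicPairing G τ := by
  induction hG with
  | twoVertex => exact ⟨1, isMelonicPairing_twoVertex hD⟩
  | insertDipole G c v _ ih =>
    obtain ⟨τ, hτ⟩ := ih
    exact ⟨_, hτ.insertDipole hD c v⟩
  | iso G H h _ ih =>
    obtain ⟨e, f, h⟩ := h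
    obtain ⟨τ, hτ⟩ := ih
    exact ⟨_, (hτ.iso h).1⟩

theorem ColoredGraph.IsMelonic.p_pos {G : ColoredGraph D} (hG : G.IsMelonic) : 1 ≤ G.p := by
  induction hG with
  | twoVertex => exact le_rfl
  | insertDipole G c v _ ih => exact Nat.le_add_left 1 _
  | iso G H h _ ih =>
    obtain ⟨e, -⟩ := h
    have := Fintype.card_congr e
    simp only [Fintype.card_fin] at this
    omega

/-- The constant `α` is the number of unordered pairs of distinct vertices in a common face. -/
theorem two_mul_alpha_add (hD : 3 ≤ D) {G : ColoredGraph D} {τ : Equiv.Perm (Fin G.p)}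
    (h : IsMelonicPairing G τ) : 2 * G.alpha + D * G.p = faceSq (repair τ G.adj) := by
  rw [← IsTree.two_mul_card_nlo hD h, Fintype.card_fin]
  congr 2
  refine (Finset.card_equiv (Equiv.mulLeft τ) fun ρ => ?_).symm
  rw [Finset.mem_filter, Finset.mem_filter]
  simp [cycleCount_eq_numCycles, numFaces, repair, mul_assoc]

/-- The constant `α'_c` is the number of unordered pairs of distinct vertices in a common face of
colour `c`. -/
theorem two_mul_alphaPrimeColor_add (hD : 3 ≤ D) {G : ColoredGraph D} {τ : Equiv.Perm (Fin G.p)}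
    (h : IsMelonicPairing G τ) (c : Fin D) :
    2 * G.alphaPrimeColor c + G.p = cycleSq (repair τ G.adj c) := by
  have h1 := IsTree.two_mul_card_fourPoint hD h c
  rw [Fintype.card_fin] at h1
  rw [← h1]
  congr 2
  refine (Finset.card_equiv ((Equiv.mulLeft τ).prodCongr (Equiv.refl _)) fun x => ?_).symm
  have h2 : ∀ c', (if c' = c then τ * x.1 * Equiv.swap x.2.1 x.2.2 else τ * x.1)⁻¹ * G.adj c' =
      (if c' = c then x.1 * Equiv.swap x.2.1 x.2.2 else x.1)⁻¹ * repair τ G.adj c' := by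
    intro c'
    unfold repair
    split_ifs <;> simp [mul_assoc]
  rw [Finset.mem_filter, Finset.mem_filter]
  simp only [Finset.mem_univ, true_and, Equiv.prodCongr_apply, Prod.map, Equiv.coe_mulLeft,
    Equiv.coe_refl, id_eq, h2, cycleCount_eq_numCycles]

/-- Both constants count pairs of vertices with a common face, sorted by the colour of the face for
`α'`. -/
theorem alphaPrime_eq_alpha (hD : 3 ≤ D) {G : ColoredGraph D} {τ : Equiv.Perm (Fin G.p)}
    (h : IsMelonicPairing G τ) : G.alphaPrime = G.alpha := by
  have h1 := two_mul_alpha_add hD h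
  have h2 := Finset.sum_congr (rfl : (Finset.univ : Finset (Fin D)) = Finset.univ)
    fun c _ => two_mul_alphaPrimeColor_add hD h c
  rw [Finset.sum_add_distrib, ← Finset.mul_sum] at h2
  have h3 : 2 * G.alphaPrime + D * G.p = faceSq (repair τ G.adj) := by
    simpa [alphaPrime, faceSq] using h2
  omega

/-- The new vertex shares a face with the vertices of the face in which the dipole is inserted. -/
theorem alpha_insertDipole (hD : 3 ≤ D) {G : ColoredGraph D} {τ : Equiv.Perm (Fin G.p)}
    (h : IsMelonicPairing G τ) (c : Fin D) (v : Fin G.p) :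
    (G.insertDipole c v).alpha = G.alpha + cycleLen (repair τ G.adj c) v := by
  have h1 := two_mul_alpha_add hD h
  have h2 := two_mul_alpha_add hD (h.insertDipole (by omega) c v)
  have h3 := faceSq_eq_of_equiv (W := Fin (G.p + 1)) finSuccEquivLast.symm
    (repair_insertDipole G c v τ)
  rw [faceSq_insDipole] at h3
  have h2 := h2.trans h3.symm
  have h4 : D * (G.insertDipole c v).p = D * G.p + D := by
    change D * (G.p + 1) = _
    ring
  omega

/-- Insertion in a face of length `l` adds `l` to `α`, and there are `l` edges for such an
insertion. -/
theorem beta_eq (hD : 3 ≤ D) {G : ColoredGraph D} {τ : Equiv.Perm (Fin G.p)}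
    (h : IsMelonicPairing G τ) (c : Fin D) :
    G.beta c = G.p * G.alpha + cycleSq (repair τ G.adj c) := by
  unfold beta
  rw [Finset.sum_congr rfl fun v _ => alpha_insertDipole hD h c v, Finset.sum_add_distrib]
  simp [cycleSq]

theorem betaPrime_eq_beta (hD : 3 ≤ D) {G : ColoredGraph D} {τ : Equiv.Perm (Fin G.p)}
    (h : IsMelonicPairing G τ) (c : Fin D) : G.betaPrime c = G.beta c :=
  Finset.sum_congr rfl fun v _ => alphaPrime_eq_alpha hD (h.insertDipole (by omega) c v)

theorem IsMelonicPairing.relabel {G : ColoredGraph D} {τ : Equiv.Perm (Fin G.p)}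
    (h : IsMelonicPairing G τ) (π : Equiv.Perm (Fin D)) :
    IsMelonicPairing (G.relabel π) τ := by
  have h1 : numFaces (repair τ (G.relabel π).adj) = numFaces (repair τ G.adj) :=
    Equiv.sum_comp π fun c => numCycles (repair τ G.adj c)
  have h2 : numOrbits (repair τ (G.relabel π).adj) = numOrbits (repair τ G.adj) := by
    have h3 : invariants (repair (V := Fin G.p) τ (G.relabel π).adj) =
        invariants (repair τ G.adj) := by
      ext f
      refine ⟨fun hf c v => ?_, fun hf c v => hf (π c) v⟩
      have := hf (π.symm c) v
      change f (repair τ G.adj (π (π.symm c)) v) = f v at this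
      rwa [Equiv.apply_symm_apply] at this
    exact congrArg (fun p : Submodule ℚ (Fin G.p → ℚ) => Module.finrank ℚ p) h3
  refine ⟨?_, h2.trans h.connected⟩
  have h3 : numFaces (repair τ G.adj) = _ := h.isForest
  exact h1.trans (h3.trans (congrArg _ h2.symm))

/-- The sizes of the faces of a melonic bubble are compatible with renamings of the colours. -/
theorem cycleSq_of_iso_relabel (hD : 3 ≤ D) {G H : ColoredGraph D} {τ : Equiv.Perm (Fin G.p)}
    {τ' : Equiv.Perm (Fin H.p)} (h : IsMelonicPairing G τ) (h' : IsMelonicPairing H τ')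
    {π : Equiv.Perm (Fin D)} (hiso : (G.relabel π).Iso H) (c : Fin D) :
    H.p = G.p ∧ cycleSq (repair τ' H.adj c) = cycleSq (repair τ G.adj (π c)) := by
  obtain ⟨e, f, he⟩ := hiso
  refine ⟨(Fintype.card_fin H.p).symm.trans ((Fintype.card_congr e).symm.trans
    (Fintype.card_fin G.p)), ?_⟩
  obtain ⟨h1, h2⟩ := (h.relabel π).iso he
  rw [IsTree.pairing_unique hD h' h1]
  exact (cycleSq_eq_of_equiv e (h2 c)).symm

theorem isMelonic_quartic (c : Fin D) : (quartic c).IsMelonic :=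
  IsMelonic.insertDipole _ _ _ IsMelonic.twoVertex

/-- The quartic bubble has one face with two vertices, of colour `c`, all other faces having one. -/
theorem cycleSq_quartic (hD : 1 ≤ D) (c : Fin D) :
    ∃ τ, IsMelonicPairing (quartic c) τ ∧ ∀ c', cycleSq (repair τ (quartic c).adj c') =
      if c' = c then 4 else 2 := by
  refine ⟨_, (isMelonicPairing_twoVertex hD).insertDipole hD c (0 : Fin 1), fun c' => ?_⟩
  refine (cycleSq_eq_of_equiv (W := Fin 2) finSuccEquivLast.symm
    (repair_insertDipole (twoVertex D) c (0 : Fin 1) 1 c')).symm.trans ?_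
  have h1 : repair 1 (twoVertex D).adj = fun _ => (1 : Equiv.Perm (Fin 1)) := by
    funext c
    exact inv_mul_cancel 1
  have h2 : cycleSq (Equiv.optionCongr (1 : Equiv.Perm (Fin 1))) = 2 := by
    rw [cycleSq_optionCongr, cycleSq_one]
    rfl
  have h4 : cycleSq (insDipole (fun _ : Fin D => (1 : Equiv.Perm (Fin 1))) c 0 c') =
      if c' = c then 4 else 2 := by
    split_ifs with hc
    · subst hc
      have := not_sameCycle_addBubble (fun _ : Fin D => (1 : Equiv.Perm (Fin 1))) c' 0
      simp only [insDipole, swapAt, if_true]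
      rw [cycleSq_mul_swap this, addBubble, cycleLen_optionCongr_some, cycleLen_optionCongr_none,
        cycleLen_one, h2]
    · simp only [insDipole, swapAt, hc, if_false, addBubble]
      exact h2
  rw [← h4]
  exact congrArg (fun σ : Fin D → Equiv.Perm (Fin 1) => cycleSq (insDipole σ c 0 c')) h1

theorem quartic_constants (hD : 3 ≤ D) (c c' : Fin D) :
    (quartic c).alpha = 1 ∧ (quartic c).alphaPrime = 1 ∧
      (quartic c').beta c = (if c' = c then 6 else 4) ∧
      (quartic c').betaPrime c = (if c' = c then 6 else 4) := by
  -- here `p = 2` and the sum of the squares of the lengths is `4 + 2 (D - 1)`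
  have key : ∀ c : Fin D, (quartic c).alpha = 1 := by
    intro c
    obtain ⟨τ, hτ, h⟩ := cycleSq_quartic (by omega) c
    have h1 := two_mul_alpha_add hD hτ
    have h2 : ∑ c', (if c' = c then 4 else 2) = 2 + D * 2 := by
      have : ∀ c', (if c' = c then 4 else 2) = (if c' = c then 2 else 0) + 2 := fun c' => by
        split_ifs <;> rfl
      simp [this, Finset.sum_add_distrib]
    rw [faceSq, Finset.sum_congr rfl fun c' _ => h c', h2] at h1
    change 2 * _ + D * 2 = _ at h1
    omega
  obtain ⟨τ, hτ, -⟩ := cycleSq_quartic (by omega) c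
  obtain ⟨τ', hτ', h'⟩ := cycleSq_quartic (by omega) c'
  have h3 : (quartic c').beta c = if c' = c then 6 else 4 := by
    rw [beta_eq hD hτ', key, h']
    change 2 * 1 + _ = _
    by_cases hc : c' = c
    · simp [hc]
    · simp [hc, Ne.symm hc]
  exact ⟨key c, (alphaPrime_eq_alpha hD hτ).trans (key c), h3,
    (betaPrime_eq_beta hD hτ' c).trans h3⟩

/-- A bubble and its melonic pairing define the same trace invariant. -/
theorem tracePoly_repair {V : Type*} [Fintype V] [DecidableEq V] (N : ℕ) (τ : Equiv.Perm V)
    (σ : Fin D → Equiv.Perm V) : tracePoly N σ = tracePoly N (repair τ σ) :=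
  tracePoly_relabel (Equiv.refl V) (τ⁻¹ : Equiv.Perm V) fun _ _ => rfl

end Melonic

end TensorModel

namespace TensorModel

/-! ### Expansions in `1/N` and in `z` -/

section Order

open PowerSeries Filter Asymptotics

/-- The sequences of power series, indexed by `N - 1`, whose coefficients of order less than `n` are
`O(N^e)`. -/
noncomputable def orderBound (n : ℕ) (e : ℤ) : Submodule (PowerSeries ℂ) (ℕ → PowerSeries ℂ) where
  carrier := {f | ∀ m < n, (fun k : ℕ => coeff m (f k)) =O[atTop] fun k : ℕ => ((k : ℝ) + 1) ^ e}
  add_mem' hf hg m hm := by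
    simp only [Pi.add_apply, map_add]
    exact (hf m hm).add (hg m hm)
  zero_mem' m _ := by
    simp only [Pi.zero_apply, map_zero]
    exact isBigO_zero _ _
  smul_mem' A f hf m hm := by
    simp only [Pi.smul_apply, smul_eq_mul, coeff_mul]
    have h : ∀ x ∈ Finset.HasAntidiagonal.antidiagonal m,
        (fun k : ℕ => coeff x.1 A * coeff x.2 (f k)) =O[atTop] fun k : ℕ => ((k : ℝ) + 1) ^ e := by
      intro x hx
      refine IsBigO.const_mul_left (hf x.2 ?_) _
      have := Finset.HasAntidiagonal.mem_antidiagonal.1 hx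
      omega
    refine (IsBigO.sum h).congr_left fun k => ?_
    rw [Finset.sum_apply]

theorem orderBound_zero (e : ℤ) (f : ℕ → PowerSeries ℂ) : f ∈ orderBound 0 e :=
  fun m hm => absurd hm (Nat.not_lt_zero m)

theorem zpow_isBigO {e e' : ℤ} (h : e ≤ e') :
    (fun k : ℕ => ((k : ℝ) + 1) ^ e) =O[atTop] fun k : ℕ => ((k : ℝ) + 1) ^ e' := by
  refine IsBigO.of_bound 1 (Eventually.of_forall fun k => ?_)
  have h1 : (1 : ℝ) ≤ (k : ℝ) + 1 := by
    have : (0 : ℝ) ≤ k := Nat.cast_nonneg k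
    linarith
  rw [one_mul, Real.norm_of_nonneg (by positivity), Real.norm_of_nonneg (by positivity)]
  exact zpow_le_zpow_right₀ h1 h

theorem orderBound_mono {n n' : ℕ} {e e' : ℤ} (hn : n' ≤ n) (he : e ≤ e') :
    orderBound n e ≤ orderBound n' e' :=
  fun _ hf m hm => (hf m (hm.trans_le hn)).trans (zpow_isBigO he)

theorem mul_mem_orderBound {n : ℕ} {e e' : ℤ} {f g : ℕ → PowerSeries ℂ}
    (hf : f ∈ orderBound n e) (hg : g ∈ orderBound n e') : f * g ∈ orderBound n (e + e') := by
  intro m hm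
  simp only [Pi.mul_apply, coeff_mul]
  have h : ∀ x ∈ Finset.HasAntidiagonal.antidiagonal m, (fun k : ℕ => coeff x.1 (f k) *
      coeff x.2 (g k)) =O[atTop] fun k : ℕ => ((k : ℝ) + 1) ^ (e + e') := by
    intro x hx
    have h := Finset.HasAntidiagonal.mem_antidiagonal.1 hx
    refine ((hf x.1 (by omega)).mul (hg x.2 (by omega))).congr_right fun k => ?_
    rw [zpow_add₀]
    positivity
  refine (IsBigO.sum h).congr_left fun k => ?_
  rw [Finset.sum_apply]

/-- The powers of `N`. -/
noncomputable def powN (e : ℤ) : ℕ → PowerSeries ℂ := fun k => C (((k : ℂ) + 1) ^ e)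

theorem natCast_add_one_ne_zero (k : ℕ) : (k : ℂ) + 1 ≠ 0 := by exact_mod_cast Nat.succ_ne_zero k

theorem powN_add (e e' : ℤ) : powN (e + e') = powN e * powN e' := by
  funext k
  simp only [powN, Pi.mul_apply]
  rw [zpow_add₀ (natCast_add_one_ne_zero k), map_mul]

theorem powN_zero : powN 0 = 1 := by
  funext k
  simp [powN]

theorem powN_mem (n : ℕ) (e : ℤ) : powN e ∈ orderBound n e := by
  intro m _
  by_cases hm : m = 0
  · subst hm
    refine IsBigO.of_bound 1 (Eventually.of_forall fun k => ?_)
    simp only [powN, coeff_zero_eq_constantCoeff, constantCoeff_C, norm_zpow, one_mul]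
    have h1 : ‖(k : ℂ) + 1‖ = (k : ℝ) + 1 := by
      rw [← Nat.cast_add_one, Complex.norm_natCast, Nat.cast_add_one]
    rw [h1, Real.norm_of_nonneg (by positivity)]
  · simp only [powN, coeff_C, hm, if_false]
    exact isBigO_zero _ _

theorem one_mem_orderBound (n : ℕ) : (1 : ℕ → PowerSeries ℂ) ∈ orderBound n 0 := by
  rw [← powN_zero]
  exact powN_mem n 0

theorem powN_mul_mem {n : ℕ} {e e' : ℤ} (k : ℤ) {f : ℕ → PowerSeries ℂ}
    (hf : f ∈ orderBound n e) (h : k + e ≤ e') : powN k * f ∈ orderBound n e' :=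
  orderBound_mono le_rfl h (mul_mem_orderBound (powN_mem n k) hf)

theorem X_smul_mem {n : ℕ} {e : ℤ} {f : ℕ → PowerSeries ℂ} (hf : f ∈ orderBound n e) :
    (X : PowerSeries ℂ) • f ∈ orderBound (n + 1) e := by
  intro m hm
  rcases m with _ | m
  · simp only [Pi.smul_apply, smul_eq_mul, coeff_zero_X_mul]
    exact isBigO_zero _ _
  · simp only [Pi.smul_apply, smul_eq_mul, coeff_succ_X_mul]
    exact hf m (by omega)

/-- An interaction vertex gains one order in `z`: this drives the inductions on the order. -/
theorem smul_mem_succ {n : ℕ} {e : ℤ} {f : ℕ → PowerSeries ℂ} (hf : f ∈ orderBound n e)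
    {g : PowerSeries ℂ} (hg : X ∣ g) : g • f ∈ orderBound (n + 1) e := by
  obtain ⟨g, rfl⟩ := hg
  rw [mul_comm, mul_smul]
  exact Submodule.smul_mem _ _ (X_smul_mem hf)

end Order

/-! ### Formal power series defined by fixed points -/

section FixedPoint

open PowerSeries

/-- A contraction for the `X`-adic distance has a unique fixed point. -/
theorem existsUnique_fixedPoint (Φ : PowerSeries ℂ → PowerSeries ℂ)
    (hΦ : ∀ n A B, X ^ n ∣ A - B → X ^ (n + 1) ∣ Φ A - Φ B) : ∃! A, A = Φ A := by
  have hsep : ∀ A B : PowerSeries ℂ, (∀ n, X ^ n ∣ A - B) → A = B := by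
    intro A B h
    ext n
    have := X_pow_dvd_iff.1 (h (n + 1)) n (Nat.lt_succ_self n)
    rw [map_sub] at this
    exact sub_eq_zero.1 this
  have hiter : ∀ m, X ^ m ∣ Φ^[m + 1] 0 - Φ^[m] 0 := by
    intro m
    induction m with
    | zero => simp
    | succ m ih =>
      have := hΦ _ _ _ ih
      rwa [← Function.iterate_succ_apply' Φ, ← Function.iterate_succ_apply' Φ] at this
  have hiter2 : ∀ m k, X ^ m ∣ Φ^[m + k] 0 - Φ^[m] 0 := by
    intro m k
    induction k with
    | zero => simp
    | succ k ih =>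
      have h1 : X ^ m ∣ Φ^[m + k + 1] 0 - Φ^[m + k] 0 :=
        (pow_dvd_pow X (Nat.le_add_right m k)).trans (hiter (m + k))
      have := dvd_add h1 ih
      rwa [sub_add_sub_cancel] at this
  -- the iterates agree with the fixed point to increasing order, so that the coefficient of order
  -- `n` is final at the iterate `n + 1`
  set A : PowerSeries ℂ := mk fun n => coeff n (Φ^[n + 1] 0) with hA
  have hAm : ∀ m, X ^ m ∣ A - Φ^[m] 0 := by
    intro m
    rw [X_pow_dvd_iff]
    intro n hn
    obtain ⟨k, rfl⟩ := Nat.exists_eq_add_of_lt hn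
    have h1 := X_pow_dvd_iff.1 (hiter2 (n + 1) k) n (Nat.lt_succ_self n)
    rw [map_sub, sub_eq_zero] at h1
    rw [show n + 1 + k = n + k + 1 by omega] at h1
    rw [map_sub, hA, coeff_mk, sub_eq_zero, ← h1]
  refine ⟨A, hsep _ _ fun m => ?_, fun B hB => hsep _ _ fun m => ?_⟩
  · have h1 := hΦ _ _ _ (hAm m)
    rw [← Function.iterate_succ_apply' Φ] at h1
    have h2 := dvd_sub (hAm (m + 1)) h1
    rw [sub_sub_sub_cancel_right] at h2
    exact (pow_dvd_pow X (Nat.le_succ m)).trans h2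
  · induction m with
    | zero => simp
    | succ m ih =>
      have h1 := hΦ _ _ _ ih
      have h2 := hΦ _ _ _ (hAm m)
      rw [← hB] at h1
      rw [← Function.iterate_succ_apply' Φ] at h2
      have h3 := dvd_sub h2 (hAm (m + 1))
      rw [sub_sub_sub_cancel_right] at h3
      have h4 := dvd_add h1 h3
      rwa [sub_add_sub_cancel] at h4

/-- The equation `T = 1 + ∑ tᵢ z^{pᵢ-1} T^{pᵢ}` has a unique solution. -/
theorem existsUnique_leadingOrder {I : Type*} [Fintype I] (p : I → ℕ) (t : I → ℂ)
    (hp : ∀ i, 2 ≤ p i) :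
    ∃! T : PowerSeries ℂ, T = 1 + ∑ i, t i • (X ^ (p i - 1) * T ^ p i) := by
  refine existsUnique_fixedPoint (fun T => 1 + ∑ i, t i • (X ^ (p i - 1) * T ^ p i))
    fun n A B h => ?_
  rw [add_sub_add_left_eq_sub, ← Finset.sum_sub_distrib]
  refine Finset.dvd_sum fun i _ => ?_
  rw [← smul_sub, ← mul_sub, PowerSeries.smul_eq_C_mul]
  refine Dvd.dvd.mul_left ?_ _
  have h1 : (X : PowerSeries ℂ) ∣ X ^ (p i - 1) := dvd_pow_self X (by have := hp i; omega)
  rw [pow_succ']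
  exact mul_dvd_mul h1 (h.trans (sub_dvd_pow_sub_pow A B _))

end FixedPoint

end TensorModel

namespace TensorModel

/-! ### Large `N` expansion of the expectations of graphs -/

section Expansion

open PowerSeries

variable {D : ℕ} {I : Type*} [Fintype I] (B : I → ColoredGraph D) (t : I → ℂ)

/-- The expectation of the trace invariant of a graph, as a sequence indexed by `N - 1`. -/
noncomputable def graphExp {V : Type*} [Fintype V] [DecidableEq V] (σ : Fin D → Equiv.Perm V) :
    ℕ → PowerSeries ℂ :=
  fun k => expect B t (Nat.le_add_left 1 k) (tracePoly (k + 1) σ)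

/-- The weight `z^{pᵢ-1} tᵢ / pᵢ` of an interaction vertex. -/
noncomputable def vertexWeight (i : I) : PowerSeries ℂ := (t i / (B i).p) • X ^ ((B i).p - 1)

/-- The graph of an interaction bubble, with its leading pairing. -/
def core {B : I → ColoredGraph D} (τ : ∀ i, Equiv.Perm (Fin (B i).p)) (i : I) :
    Fin D → Equiv.Perm (Fin (B i).p) :=
  repair (τ i) (B i).adj

variable {B}

theorem X_dvd_vertexWeight (hB : ∀ i, 2 ≤ (B i).p) (i : I) : X ∣ vertexWeight B t i := by
  rw [vertexWeight, smul_eq_C_mul]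
  refine Dvd.dvd.mul_left (dvd_pow_self X ?_) _
  have := hB i
  omega

theorem natCast_mul_vertexWeight (hB : ∀ i, 2 ≤ (B i).p) (i : I) :
    ((B i).p : PowerSeries ℂ) * vertexWeight B t i = t i • X ^ ((B i).p - 1) := by
  have h : ((B i).p : ℂ) ≠ 0 := by
    have := hB i
    exact_mod_cast (by omega : (B i).p ≠ 0)
  rw [vertexWeight, ← nsmul_eq_mul, ← Nat.cast_smul_eq_nsmul ℂ, smul_smul, mul_div_cancel₀ _ h]

theorem graphExp_eq_of_equiv {V W : Type*} [Fintype V] [DecidableEq V] [Fintype W] [DecidableEq W]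
    {σ : Fin D → Equiv.Perm V} {ρ : Fin D → Equiv.Perm W} (e f : V ≃ W)
    (h : ∀ c v, ρ c (e v) = f (σ c v)) : graphExp B t σ = graphExp B t ρ := by
  funext k
  rw [graphExp, graphExp, tracePoly_relabel e f h]

theorem graphExp_of_isEmpty {V : Type*} [Fintype V] [DecidableEq V] [IsEmpty V]
    (σ : Fin D → Equiv.Perm V) : graphExp B t σ = 1 := by
  funext k
  rw [graphExp, tracePoly_of_isEmpty, expect_one]
  rfl

theorem zpow_natCast_sub {k a b : ℕ} (h : b ≤ a) :
    ((k : ℂ) + 1) ^ ((b : ℤ) - a) = (((k + 1 : ℕ) : ℂ) ^ (a - b))⁻¹ := by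
  rw [show (b : ℤ) - a = -((a - b : ℕ) : ℤ) by push_cast [h]; ring, zpow_neg, zpow_natCast]
  push_cast
  rfl

variable (τ : ∀ i, Equiv.Perm (Fin (B i).p))

theorem tracePoly_core (N : ℕ) (i : I) : tracePoly N (B i).adj = tracePoly N (core τ i) :=
  tracePoly_repair N (τ i) (B i).adj

/-- The loop equation for sequences in `N`. -/
theorem graphExp_loop (hD : 1 ≤ D) (hB : ∀ i, 2 ≤ (B i).p) {U : Type*} [Fintype U] [DecidableEq U]
    (ρ : Fin D → Equiv.Perm (Option U)) : graphExp B t ρ =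
      ∑ x, powN (1 - D + directEdges ρ x) * graphExp B t (contract ρ x) +
      ∑ i, vertexWeight B t i • ∑ x, graphExp B t (glue ρ (rootAt (core τ i) x)) := by
  funext k
  rw [graphExp, loop_equation t hB _ fun i => tracePoly_core τ (k + 1) i]
  simp only [Pi.add_apply, Finset.sum_apply, Pi.mul_apply, Pi.smul_apply, smul_eq_mul]
  congr 1
  · refine Finset.sum_congr rfl fun x _ => ?_
    rw [powN, zpow_add₀ (natCast_add_one_ne_zero k), zpow_natCast, ← smul_eq_C_mul, graphExp]
    have := zpow_natCast_sub (k := k) hD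
    rw [Nat.cast_one] at this
    rw [this]
    push_cast
    rfl
  · refine Finset.sum_congr rfl fun i _ => ?_
    rw [vertexWeight, smul_mul_assoc]
    rfl

theorem graphExp_addBubble (hD : 1 ≤ D) (hB : ∀ i, 2 ≤ (B i).p) {V : Type*} [Fintype V]
    [DecidableEq V] (σ : Fin D → Equiv.Perm V) : graphExp B t (addBubble σ) =
      powN 1 * graphExp B t σ +
        (Fintype.card V : PowerSeries ℂ) • (powN (1 - D) * graphExp B t σ) +
      ∑ i, ((B i).p * vertexWeight B t i) • graphExp B t (graphSum σ (core τ i)) := by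
  funext k
  rw [graphExp, loop_equation_addBubble t hB _ hD fun i => tracePoly_core τ (k + 1) i]
  simp only [Pi.add_apply, Finset.sum_apply, Pi.mul_apply, Pi.smul_apply, smul_eq_mul,
    natCast_mul_vertexWeight t hB]
  congr 1
  · have h1 := zpow_natCast_sub (k := k) hD
    rw [Nat.cast_one] at h1
    rw [add_smul, powN, powN, ← smul_eq_C_mul, ← smul_eq_C_mul, h1, mul_smul, zpow_one,
      Nat.cast_smul_eq_nsmul ℂ (Fintype.card V), nsmul_eq_mul]
    push_cast
    rfl
  · refine Finset.sum_congr rfl fun i _ => ?_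
    rw [smul_mul_assoc]
    rfl

theorem graphExp_insDipole (hD : 2 ≤ D) (hB : ∀ i, 2 ≤ (B i).p) {V : Type*} [Fintype V]
    [DecidableEq V] (σ : Fin D → Equiv.Perm V) (c : Fin D) (v : V) :
    graphExp B t (insDipole σ c v) =
      graphExp B t σ + powN (2 - D) * graphExp B t σ +
      powN (1 - D) * ∑ x ∈ Finset.univ.erase v, graphExp B t (swapAt σ c v x) +
      ∑ i, vertexWeight B t i •
        ∑ x, graphExp B t (swapAt (graphSum σ (core τ i)) c (Sum.inl v) (Sum.inr x)) := by
  funext k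
  rw [graphExp, loop_equation_insDipole t hB _ hD fun i => tracePoly_core τ (k + 1) i]
  simp only [Pi.add_apply, Finset.sum_apply, Pi.mul_apply, Pi.smul_apply, smul_eq_mul]
  congr 1
  · congr 1
    · have h1 := zpow_natCast_sub (k := k) hD
      rw [add_smul, one_smul, powN, ← smul_eq_C_mul]
      push_cast at h1
      rw [h1]
      push_cast
      rfl
    · have h1 := zpow_natCast_sub (k := k) (show 1 ≤ D by omega)
      rw [Nat.cast_one] at h1
      rw [powN, ← smul_eq_C_mul, Finset.smul_sum, h1]
      push_cast
      rfl
  · refine Finset.sum_congr rfl fun i _ => ?_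
    rw [vertexWeight, smul_mul_assoc]
    rfl

variable {τ}

theorem isTree_rootAt {V : Type*} [Fintype V] [DecidableEq V] {σ : Fin D → Equiv.Perm V}
    (hσ : IsTree σ) (x : V) : IsTree (rootAt σ x) :=
  (isTree_iff_of_equiv (Equiv.optionSubtypeNe x).symm (rootAt_apply σ x)).1 hσ

/-- The expectation of a graph is bounded by one power of `N` for each of its components. -/
theorem graphExp_mem_orderBound (hD : 2 ≤ D) (hB : ∀ i, 2 ≤ (B i).p)
    (hτ : ∀ i, IsMelonicPairing (B i) (τ i)) : ∀ (n m : ℕ) {V : Type} [Fintype V] [DecidableEq V]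
      (ρ : Fin D → Equiv.Perm V), Fintype.card V = m →
        graphExp B t ρ ∈ orderBound n (graphComps ρ) := by
  intro n
  induction n with
  | zero => exact fun m V _ _ ρ _ => orderBound_zero _ _
  | succ n ihn =>
    intro m
    induction m with
    | zero =>
      intro V _ _ ρ hm
      have : IsEmpty V := Fintype.card_eq_zero_iff.1 hm
      rw [graphExp_of_isEmpty, graphComps_of_isEmpty]
      exact one_mem_orderBound _
    | succ m ihm =>
      intro V _ _ ρ hm
      obtain ⟨v⟩ : Nonempty V := Fintype.card_pos_iff.1 (by omega)
      have hcard : Fintype.card {y // y ≠ v} = m := by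
        rw [Fintype.card_subtype_compl, Fintype.card_subtype_eq, hm, Nat.add_sub_cancel]
      rw [graphExp_eq_of_equiv t _ _ (rootAt_apply ρ v),
        ← graphComps_eq_of_equiv _ _ (rootAt_apply ρ v), graphExp_loop t τ (by omega) hB]
      refine Submodule.add_mem _ (Submodule.sum_mem _ fun x _ => ?_) (Submodule.sum_mem _
        fun i _ => smul_mem_succ (Submodule.sum_mem _ fun x _ => ?_) (X_dvd_vertexWeight t hB i))
      -- contraction removes a vertex, and its factors `N` compensate for the components it creates
      · refine powN_mul_mem _ (ihm (contract (rootAt ρ v) x) hcard) ?_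
        have := graphComps_contract_le (by omega) (rootAt ρ v) x
        omega
      -- gluing an interaction bubble gains an order in `z` and creates no component
      · refine orderBound_mono le_rfl ?_ (ihn _ _ rfl)
        have h : IsTree (rootAt (core τ i) x) := isTree_rootAt (hτ i) x
        exact_mod_cast graphComps_glue_le hD (rootAt ρ v) h.isForest h.connected

/-- The power series of the leading and next-to-leading orders: the leading 2-point function `T`
with its inverse `U`, the sum `M` of the chains of 4-point vertices, and the next-to-leading
2-point function `K`. -/
structure MelonicSeries (B : I → ColoredGraph D) (t : I → ℂ)
    (τ : ∀ i, Equiv.Perm (Fin (B i).p)) where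
  T : PowerSeries ℂ
  U : PowerSeries ℂ
  M : PowerSeries ℂ
  K : PowerSeries ℂ
  mul_U : T * U = 1
  T_eq : T = 1 + ∑ i, (B i).p * vertexWeight B t i * T ^ (B i).p
  M_eq : ∀ c, M = T + M * U * ∑ i, vertexWeight B t i * cycleSq (core τ i c) * T ^ (B i).p
  K_eq : K = ∑ i, (B i).p * vertexWeight B t i *
    ((B i).p * T ^ (B i).p * U * K + (B i).alpha * T ^ (B i).p * U ^ 2 * M)

variable (S : MelonicSeries B t τ)

/-- The next-to-leading order of the expectation of a forest with `p` vertices. -/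
noncomputable def MelonicSeries.nlo {t : I → ℂ} (S : MelonicSeries B t τ) (p : ℕ)
    (A : PowerSeries ℂ) : PowerSeries ℂ :=
  p * S.T ^ p * S.U * S.K + A * S.T ^ p * S.U ^ 2 * S.M

/-- The powers of `T` satisfy the leading order of the loop equations. -/
theorem MelonicSeries.sum_lo {t : I → ℂ} (S : MelonicSeries B t τ) (p : ℕ) :
    S.T ^ p + ∑ i, (B i).p * vertexWeight B t i * S.T ^ (p + (B i).p) = S.T ^ (p + 1) := by
  have h := S.T_eq
  have h1 : ∑ i, (B i).p * vertexWeight B t i * S.T ^ (p + (B i).p) =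
      S.T ^ p * ∑ i, (B i).p * vertexWeight B t i * S.T ^ (B i).p := by
    rw [Finset.mul_sum]
    exact Finset.sum_congr rfl fun i _ => by ring
  rw [h1, pow_succ]
  linear_combination - S.T ^ p * h

/-- The next-to-leading orders satisfy the loop equation of an isolated bubble: each interaction
bubble adds its number of vertices and its constant `α`. -/
theorem MelonicSeries.sum_nlo {t : I → ℂ} (S : MelonicSeries B t τ) (p : ℕ) (A : PowerSeries ℂ) :
    S.nlo p A + ∑ i, (B i).p * vertexWeight B t i * S.nlo (p + (B i).p) (A + (B i).alpha) =
      S.nlo (p + 1) A := by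
  have h := S.T_eq
  have hK := S.K_eq
  have hU := S.mul_U
  have h1 : ∑ i, (B i).p * vertexWeight B t i * S.nlo (p + (B i).p) (A + (B i).alpha) =
      (p * S.T ^ p * S.U * S.K + A * S.T ^ p * S.U ^ 2 * S.M) *
        ∑ i, (B i).p * vertexWeight B t i * S.T ^ (B i).p +
      S.T ^ p * ∑ i, (B i).p * vertexWeight B t i *
        ((B i).p * S.T ^ (B i).p * S.U * S.K +
          (B i).alpha * S.T ^ (B i).p * S.U ^ 2 * S.M) := by
    rw [Finset.mul_sum, Finset.mul_sum, ← Finset.sum_add_distrib]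
    refine Finset.sum_congr rfl fun i _ => ?_
    unfold nlo
    push_cast
    ring
  rw [h1, ← hK]
  unfold nlo
  rw [pow_succ]
  push_cast
  linear_combination (-(p * S.T ^ p * S.U * S.K + A * S.T ^ p * S.U ^ 2 * S.M)) * h -
    S.T ^ p * S.K * hU

/-- The next-to-leading orders satisfy the loop equation of a dipole inserted in a face of length
`l`. The term `l T ^ p` comes from the contractions with the vertices of this face. -/
theorem MelonicSeries.sum_nlo_dipole {t : I → ℂ} (S : MelonicSeries B t τ) (p : ℕ)
    (A : PowerSeries ℂ) (c : Fin D) (l : PowerSeries ℂ) :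
    S.nlo p A + l * S.T ^ p + ∑ i, vertexWeight B t i * ∑ x : Fin (B i).p,
      S.nlo (p + (B i).p) (A + (B i).alpha + l * cycleLen (core τ i c) x) =
      S.nlo (p + 1) (A + l) := by
  have h1 : ∀ i, vertexWeight B t i * ∑ x : Fin (B i).p,
      S.nlo (p + (B i).p) (A + (B i).alpha + l * cycleLen (core τ i c) x) =
      (B i).p * vertexWeight B t i * S.nlo (p + (B i).p) (A + (B i).alpha) +
        l * S.T ^ p * S.U ^ 2 * S.M *
          (vertexWeight B t i * cycleSq (core τ i c) * S.T ^ (B i).p) := by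
    intro i
    have h2 : ∀ x : Fin (B i).p,
        S.nlo (p + (B i).p) (A + (B i).alpha + l * cycleLen (core τ i c) x) =
        S.nlo (p + (B i).p) (A + (B i).alpha) +
          l * S.T ^ p * S.T ^ (B i).p * S.U ^ 2 * S.M * cycleLen (core τ i c) x := fun x => by
      unfold nlo
      ring
    rw [Finset.sum_congr rfl fun x _ => h2 x, Finset.sum_add_distrib, Finset.sum_const,
      Finset.card_univ, Fintype.card_fin, ← Finset.mul_sum, cycleSq, nsmul_eq_mul]
    push_cast
    ring
  rw [Finset.sum_congr rfl fun i _ => h1 i, Finset.sum_add_distrib, ← Finset.mul_sum]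
  have h3 := S.sum_nlo p A
  have hM := S.M_eq c
  have hU := S.mul_U
  have h4 : S.nlo (p + 1) (A + l) = S.nlo (p + 1) A + l * S.T ^ p * S.T * S.U ^ 2 * S.M := by
    unfold nlo
    ring
  rw [h4]
  linear_combination h3 - l * S.T ^ p * S.U * hM -
    l * S.T ^ p * (1 + S.U * S.M) * hU

/-- The constant `α` of a forest, in terms of the lengths of its faces. -/
noncomputable def nloConst {V : Type*} [Fintype V] [DecidableEq V] (σ : Fin D → Equiv.Perm V) :
    PowerSeries ℂ :=
  C (((faceSq σ : ℂ) - D * Fintype.card V) / 2)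

theorem nloConst_core (hD : 3 ≤ D) (hτ : ∀ i, IsMelonicPairing (B i) (τ i)) (i : I) :
    nloConst (core τ i) = ((B i).alpha : PowerSeries ℂ) := by
  have h := two_mul_alpha_add hD (hτ i)
  rw [nloConst, core, ← h, Fintype.card_fin]
  push_cast
  rw [add_sub_cancel_right, mul_div_cancel_left₀ _ (two_ne_zero' ℂ), map_natCast]

section Constants

variable {V W : Type*} [Fintype V] [DecidableEq V] [Fintype W] [DecidableEq W]

theorem nloConst_addBubble (σ : Fin D → Equiv.Perm V) : nloConst (addBubble σ) = nloConst σ := by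
  unfold nloConst
  rw [faceSq_addBubble, Fintype.card_option]
  congr 2
  push_cast
  ring

theorem nloConst_graphSum (σ : Fin D → Equiv.Perm V) (ρ : Fin D → Equiv.Perm W) :
    nloConst (graphSum σ ρ) = nloConst σ + nloConst ρ := by
  unfold nloConst
  rw [faceSq_graphSum, Fintype.card_sum, ← map_add]
  congr 1
  push_cast
  ring

theorem nloConst_insDipole (σ : Fin D → Equiv.Perm V) (c : Fin D) (v : V) :
    nloConst (insDipole σ c v) = nloConst σ + cycleLen (σ c) v := by
  unfold nloConst
  rw [faceSq_insDipole, Fintype.card_option, ← map_natCast (C (R := ℂ)), ← map_add]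
  congr 1
  push_cast
  ring

theorem nloConst_swapAt_graphSum (σ : Fin D → Equiv.Perm V) (ρ : Fin D → Equiv.Perm W) (c : Fin D)
    (v : V) (w : W) : nloConst (swapAt (graphSum σ ρ) c (Sum.inl v) (Sum.inr w)) =
      nloConst σ + nloConst ρ + cycleLen (σ c) v * cycleLen (ρ c) w := by
  unfold nloConst
  rw [faceSq_swapAt_graphSum, Fintype.card_sum, ← map_natCast (C (R := ℂ)),
    ← map_natCast (C (R := ℂ)), ← map_mul, ← map_add, ← map_add]
  congr 1
  push_cast
  ring

/-- The sum of the leading and next-to-leading orders of the expectation of a forest. -/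
noncomputable def MelonicSeries.main {t : I → ℂ} (S : MelonicSeries B t τ)
    (σ : Fin D → Equiv.Perm V) : ℕ → PowerSeries ℂ :=
  S.T ^ Fintype.card V • powN (numOrbits σ) +
    S.nlo (Fintype.card V) (nloConst σ) • powN (numOrbits σ + 2 - D)

theorem MelonicSeries.main_eq_of_equiv {t : I → ℂ} (S : MelonicSeries B t τ)
    {σ : Fin D → Equiv.Perm V} {ρ : Fin D → Equiv.Perm W} (e : V ≃ W)
    (h : ∀ c v, ρ c (e v) = e (σ c v)) : S.main σ = S.main ρ := by
  unfold MelonicSeries.main nloConst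
  rw [Fintype.card_congr e, numOrbits_eq_of_equiv e h, faceSq_eq_of_equiv e h]

theorem MelonicSeries.main_sub_mem {t : I → ℂ} (S : MelonicSeries B t τ) (n : ℕ)
    (σ : Fin D → Equiv.Perm V) :
    S.main σ - S.T ^ Fintype.card V • powN (numOrbits σ) ∈
      orderBound n (numOrbits σ + 2 - D) := by
  rw [MelonicSeries.main, add_sub_cancel_left]
  exact Submodule.smul_mem _ _ (powN_mem _ _)

/-- The leading and next-to-leading orders satisfy the loop equation of an isolated bubble, up to
the contractions with the other vertices, which are of lower order. -/
theorem MelonicSeries.main_addBubble {t : I → ℂ} (S : MelonicSeries B t τ) (hD : 3 ≤ D)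
    (hτ : ∀ i, IsMelonicPairing (B i) (τ i)) (σ : Fin D → Equiv.Perm V) :
    S.main (addBubble σ) = powN 1 * S.main σ +
      ∑ i, ((B i).p * vertexWeight B t i) • S.main (graphSum σ (core τ i)) := by
  have h1 : numOrbits (addBubble σ) = numOrbits σ + 1 := numOrbits_optionCongr σ
  have h2 : ∀ i, numOrbits (graphSum σ (core τ i)) = numOrbits σ + 1 := fun i => by
    rw [← (hτ i).connected]
    exact numOrbits_sumCongr σ (core τ i)
  unfold MelonicSeries.main
  simp only [h1, h2, nloConst_addBubble, nloConst_graphSum, nloConst_core hD hτ,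
    Fintype.card_option, Fintype.card_sum, Fintype.card_fin, smul_add, smul_smul,
    Finset.sum_add_distrib, ← Finset.sum_smul, mul_add, mul_smul_comm, ← powN_add]
  rw [← S.sum_lo, ← S.sum_nlo, add_smul, add_smul]
  have e1 : (1 : ℤ) + numOrbits σ = ((numOrbits σ + 1 : ℕ) : ℤ) := by push_cast; ring
  have e2 : (1 : ℤ) + (numOrbits σ + 2 - D) = ((numOrbits σ + 1 : ℕ) : ℤ) + 2 - D := by
    push_cast
    ring
  rw [e1, e2]
  abel

theorem sum_sameCycle_erase (π : Equiv.Perm V) (v : V) :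
    ∑ x ∈ Finset.univ.erase v, (if π.SameCycle v x then (1 : PowerSeries ℂ) else 0) =
      cycleLen π v - 1 := by
  have h := Finset.add_sum_erase Finset.univ
    (fun x => if π.SameCycle v x then (1 : PowerSeries ℂ) else 0) (Finset.mem_univ v)
  rw [if_pos (Equiv.Perm.SameCycle.refl _ _)] at h
  rw [cycleLen, Finset.card_filter]
  push_cast
  linear_combination h

/-- The leading and next-to-leading orders satisfy the loop equation of a dipole, where among the
contractions with other vertices only those within the face of the dipole are kept, at leading
order. -/
theorem MelonicSeries.main_insDipole {t : I → ℂ} (S : MelonicSeries B t τ) (hD : 3 ≤ D)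
    (hτ : ∀ i, IsMelonicPairing (B i) (τ i)) {σ : Fin D → Equiv.Perm V} (hσ : IsForest σ)
    (c : Fin D) (v : V) :
    S.main (insDipole σ c v) = S.main σ +
      powN (2 - D) * (S.T ^ Fintype.card V • powN (numOrbits σ)) +
      powN (1 - D) * ∑ x ∈ Finset.univ.erase v,
        ((if (σ c).SameCycle v x then 1 else 0) * S.T ^ Fintype.card V) •
          powN (numOrbits σ + 1) +
      ∑ i, vertexWeight B t i •
        ∑ x, S.main (swapAt (graphSum σ (core τ i)) c (Sum.inl v) (Sum.inr x)) := by
  have h2 : ∀ i x, numOrbits (swapAt (graphSum σ (core τ i)) c (Sum.inl v) (Sum.inr x)) =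
      numOrbits σ := fun i x =>
    (hσ.swapAt_graphSum (by omega) (hτ i).isForest (hτ i).connected c v x).2
  rw [← Finset.sum_smul, ← Finset.sum_mul, sum_sameCycle_erase]
  unfold MelonicSeries.main
  simp only [h2, numOrbits_insDipole, nloConst_insDipole, nloConst_swapAt_graphSum,
    nloConst_core hD hτ,
    Fintype.card_option, Fintype.card_sum, Fintype.card_fin, smul_add, smul_smul,
    Finset.sum_add_distrib, ← Finset.sum_smul, mul_smul_comm, ← powN_add]
  rw [← S.sum_lo, ← S.sum_nlo_dipole _ _ c]
  have e1 : (2 : ℤ) - D + numOrbits σ = numOrbits σ + 2 - D := by ring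
  have e2 : (1 : ℤ) - D + (numOrbits σ + 1) = numOrbits σ + 2 - D := by ring
  rw [e1, e2, Finset.sum_congr rfl (g := fun i => vertexWeight B t i *
    ∑ x : Fin (B i).p, S.T ^ (Fintype.card V + (B i).p)) fun i _ => by
      rw [Finset.sum_const, Finset.card_univ, Fintype.card_fin, nsmul_eq_mul]; ring]
  simp only [sub_mul, one_mul, add_smul, sub_smul]
  abel

end Constants

/-- The expectation of a forest, at leading and next-to-leading order. -/
theorem graphExp_sub_main_mem (hD : 3 ≤ D) (hB : ∀ i, 2 ≤ (B i).p)
    (hτ : ∀ i, IsMelonicPairing (B i) (τ i)) :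
    ∀ (n m : ℕ) {V : Type} [Fintype V] [DecidableEq V] (σ : Fin D → Equiv.Perm V),
      Fintype.card V = m → IsForest σ →
        graphExp B t σ - S.main σ ∈ orderBound n (numOrbits σ + 1 - D) := by
  intro n
  induction n with
  | zero => exact fun m V _ _ σ _ _ => orderBound_zero _ _
  | succ n ihn =>
    intro m
    induction m with
    | zero =>
      intro V _ _ σ hm hσ
      have : IsEmpty V := Fintype.card_eq_zero_iff.1 hm
      have h1 : numOrbits σ = 0 := by
        rw [numOrbits, Module.finrank_zero_of_subsingleton]
      have h2 : nloConst σ = 0 := by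
        simp [nloConst, faceSq, cycleSq]
      have h3 : graphExp B t σ - S.main σ = 0 := by
        rw [graphExp_of_isEmpty, MelonicSeries.main, h1, h2, hm, MelonicSeries.nlo]
        simp [powN_zero]
      rw [h3]
      exact Submodule.zero_mem _
    | succ m ihm =>
      intro V _ _ σ hm hσ
      have : Nonempty V := Fintype.card_pos_iff.1 (by omega)
      obtain ⟨v, σ', hσ', h⟩ := hσ.exists_reduction (by omega)
      have hcard : Fintype.card {y // y ≠ v} = m := by
        rw [Fintype.card_subtype_compl, Fintype.card_subtype_eq, hm, Nat.add_sub_cancel]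
      rw [graphExp_eq_of_equiv t _ _ (rootAt_apply σ v),
        numOrbits_eq_of_equiv _ (rootAt_apply σ v), S.main_eq_of_equiv _ (rootAt_apply σ v)]
      -- for terms with an explicit factor `N^{2-D}`, the leading order suffices
      have hlead : ∀ {ρ : Fin D → Equiv.Perm {y // y ≠ v}}, IsForest ρ →
          graphExp B t ρ - S.T ^ Fintype.card {y // y ≠ v} • powN (numOrbits ρ) ∈
            orderBound (n + 1) (numOrbits ρ + 2 - D) := by
        intro ρ hρ
        have := Submodule.add_mem _ (orderBound_mono le_rfl (by linarith) (ihm ρ hcard hρ))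
          (S.main_sub_mem (n + 1) ρ)
        rwa [sub_add_sub_cancel] at this
      rcases h with h | ⟨c, y, h⟩
      -- an isolated bubble
      · have h1 : numOrbits (addBubble σ') = numOrbits σ' + 1 := numOrbits_optionCongr σ'
        have hE : graphExp B t σ' ∈ orderBound (n + 1) (numOrbits σ') := by
          have := Submodule.add_mem _ (orderBound_mono le_rfl (by omega) (hlead hσ'))
            (Submodule.smul_mem _ (S.T ^ Fintype.card {y // y ≠ v})
              (powN_mem (n + 1) (numOrbits σ')))
          rwa [sub_add_cancel] at this
        rw [h, graphExp_addBubble t τ (by omega) hB, S.main_addBubble hD hτ, h1]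
        have key : powN 1 * graphExp B t σ' +
            (Fintype.card {y // y ≠ v} : PowerSeries ℂ) • (powN (1 - D) * graphExp B t σ') +
            ∑ i, ((B i).p * vertexWeight B t i) • graphExp B t (graphSum σ' (core τ i)) -
            (powN 1 * S.main σ' +
              ∑ i, ((B i).p * vertexWeight B t i) • S.main (graphSum σ' (core τ i))) =
            powN 1 * (graphExp B t σ' - S.main σ') +
            (Fintype.card {y // y ≠ v} : PowerSeries ℂ) • (powN (1 - D) * graphExp B t σ') +
            ∑ i, ((B i).p * vertexWeight B t i) •
              (graphExp B t (graphSum σ' (core τ i)) - S.main (graphSum σ' (core τ i))) := by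
          simp only [smul_sub, Finset.sum_sub_distrib, mul_sub]
          abel
        rw [key]
        refine Submodule.add_mem _ (Submodule.add_mem _
          (powN_mul_mem _ (ihm σ' hcard hσ') (by push_cast; linarith))
          (Submodule.smul_mem _ _ (powN_mul_mem _ hE (by push_cast; linarith))))
          (Submodule.sum_mem _ fun i _ => smul_mem_succ ?_
            (Dvd.dvd.mul_left (X_dvd_vertexWeight t hB i) _))
        have h2 := ihn _ (graphSum σ' (core τ i)) rfl
          (isForest_graphSum (by omega) hσ' (hτ i).isForest)
        have h3 : numOrbits (graphSum σ' (core τ i)) = numOrbits σ' + 1 := by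
          rw [← (hτ i).connected]
          exact numOrbits_sumCongr σ' (core τ i)
        rwa [h3] at h2
      -- a dipole
      · rw [h, graphExp_insDipole t τ (by omega) hB, S.main_insDipole hD hτ hσ',
          numOrbits_insDipole]
        have key : ∀ (a a' b b' : ℕ → PowerSeries ℂ) (s : Finset {y // y ≠ v})
            (f f' : {y // y ≠ v} → ℕ → PowerSeries ℂ)
            (g g' : ∀ i, Fin (B i).p → ℕ → PowerSeries ℂ),
            a + powN (2 - D) * b + powN (1 - D) * ∑ x ∈ s, f x +
              ∑ i, vertexWeight B t i • ∑ x, g i x -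
            (a' + powN (2 - D) * b' + powN (1 - D) * ∑ x ∈ s, f' x +
              ∑ i, vertexWeight B t i • ∑ x, g' i x) =
            (a - a') + powN (2 - D) * (b - b') + powN (1 - D) * ∑ x ∈ s, (f x - f' x) +
              ∑ i, vertexWeight B t i • ∑ x, (g i x - g' i x) := by
          intro a a' b b' s f f' g g'
          simp only [Finset.sum_sub_distrib, smul_sub, mul_sub]
          abel
        rw [key]
        have hD' : (3 : ℤ) ≤ D := by exact_mod_cast hD
        refine Submodule.add_mem _ (Submodule.add_mem _ (Submodule.add_mem _
          (ihm σ' hcard hσ') (powN_mul_mem _ (hlead hσ') (by linarith)))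
          (powN_mul_mem (e := numOrbits σ') _ (Submodule.sum_mem _ fun x hx => ?_) (by linarith)))
          (Submodule.sum_mem _ fun i _ => smul_mem_succ (Submodule.sum_mem _ fun x _ => ?_)
            (X_dvd_vertexWeight t hB i))
        · split_ifs with hs
          -- a contraction within a face cuts a component in two: this factor `N` makes it
          -- contribute
          · obtain ⟨h1, h2⟩ := hσ'.swapAt_of_sameCycle (by omega)
              (Finset.ne_of_mem_erase hx).symm hs
            have h3 := hlead h1
            rw [h2] at h3
            rw [one_mul]
            push_cast at h3
            exact orderBound_mono le_rfl (by linarith) h3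
          -- a contraction between two faces gives a graph with no more components, which is
          -- negligible
          · rw [zero_mul, zero_smul, sub_zero]
            refine orderBound_mono le_rfl ?_ (graphExp_mem_orderBound t (by omega) hB hτ _ _ _ rfl)
            exact_mod_cast hσ'.graphComps_swapAt_le hD hs
        · obtain ⟨h1, h2⟩ := hσ'.swapAt_graphSum (by omega) (hτ i).isForest (hτ i).connected c y x
          have h3 := ihn _ _ rfl h1
          rwa [h2] at h3

/-- Insertion of a rooted forest in a connected graph multiplies, at leading order, its expectation
by a factor `T` for each pair of vertices. -/
theorem graphExp_graft_sub_mem (hD : 3 ≤ D) (hB : ∀ i, 2 ≤ (B i).p)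
    (hτ : ∀ i, IsMelonicPairing (B i) (τ i)) {A : Type} [Fintype A] [DecidableEq A]
    {ρ : Fin D → Equiv.Perm A} (hρ : graphComps ρ ≤ 1) :
    ∀ (n m : ℕ) {V : Type} [Fintype V] [DecidableEq V] (μ : Fin D → Equiv.Perm (A ⊕ V)),
      Fintype.card V = m → IsRootedForest μ →
        graphExp B t (graft ρ μ) - S.T ^ m • graphExp B t ρ ∈ orderBound n (3 - D) := by
  intro n
  induction n with
  | zero => exact fun m V _ _ μ _ _ => orderBound_zero _ _
  | succ n ihn =>
    intro m
    induction m with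
    | zero =>
      intro V _ _ μ hm hμ
      have : IsEmpty V := Fintype.card_eq_zero_iff.1 hm
      have h1 : graphExp B t (graft ρ μ) = graphExp B t ρ := by
        refine graphExp_eq_of_equiv t (Equiv.sumEmpty A V) (Equiv.sumEmpty A V) ?_
        rintro c (a | v)
        · simp only [graft, Equiv.Perm.mul_apply, hμ.eq_self (by omega)]
          rfl
        · exact (IsEmpty.false v).elim
      rw [h1, pow_zero, one_smul, sub_self]
      exact Submodule.zero_mem _
    | succ m ihm =>
      intro V _ _ μ hm hμ
      have : Nonempty V := Fintype.card_pos_iff.1 (by omega)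
      obtain ⟨v, μ', c, y, hμ', h⟩ := hμ.exists_reduction (by omega)
      have hcard : Fintype.card {y // y ≠ v} = m := by
        rw [Fintype.card_subtype_compl, Fintype.card_subtype_eq, hm, Nat.add_sub_cancel]
      have hcomp : graphComps (graft ρ μ') ≤ 1 :=
        (graphComps_graft_le (by omega) ρ _ rfl hμ').trans hρ
      have hD' : (3 : ℤ) ≤ D := by exact_mod_cast hD
      rw [graphExp_eq_of_equiv t _ _ (insDipole_graft_rootLabel (ρ := ρ) h),
        graphExp_insDipole t τ (by omega) hB]
      set E := graphExp B t ρ with hE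
      -- the leading order of the loop equation of a dipole, with `E` as a factor
      have hsplit : S.T ^ (m + 1) • E = S.T ^ m • E +
          ∑ i, vertexWeight B t i • ∑ x : Fin (B i).p, S.T ^ (m + (B i).p) • E := by
        rw [← S.sum_lo, add_smul, Finset.sum_smul]
        congr 1
        refine Finset.sum_congr rfl fun i _ => ?_
        rw [Finset.sum_const, Finset.card_univ, Fintype.card_fin, ← Nat.cast_smul_eq_nsmul
          (PowerSeries ℂ), smul_smul, smul_smul]
        congr 1
        ring
      have key : ∀ (a b s : ℕ → PowerSeries ℂ) (g : ∀ i, Fin (B i).p → ℕ → PowerSeries ℂ),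
          a + b + s + ∑ i, vertexWeight B t i • ∑ x, g i x -
            (S.T ^ m • E + ∑ i, vertexWeight B t i • ∑ x : Fin (B i).p, S.T ^ (m + (B i).p) • E) =
          (a - S.T ^ m • E) + b + s +
            ∑ i, vertexWeight B t i • ∑ x, (g i x - S.T ^ (m + (B i).p) • E) := by
        intro a b s g
        simp only [Finset.sum_sub_distrib, smul_sub]
        abel
      rw [hsplit, key]
      have hb := graphExp_mem_orderBound t (by omega) hB hτ
      refine Submodule.add_mem _ (Submodule.add_mem _ (Submodule.add_mem _ (ihm μ' hcard hμ')
        (powN_mul_mem (e := 1) _ (orderBound_mono le_rfl ?_ (hb (n + 1) _ (graft ρ μ') rfl)) ?_))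
        (powN_mul_mem (e := 2) _ (Submodule.sum_mem _ fun x _ =>
          orderBound_mono le_rfl ?_ (hb (n + 1) _ _ rfl)) ?_))
        (Submodule.sum_mem _ fun i _ => smul_mem_succ (Submodule.sum_mem _ fun x _ => ?_)
          (X_dvd_vertexWeight t hB i))
      · exact_mod_cast hcomp
      · linarith
      · have := graphComps_swapAt_le (graft ρ μ') c y x
        exact_mod_cast this.trans (Nat.add_le_add_right hcomp 1)
      · linarith
      · have h1 := graphExp_eq_of_equiv (B := B) t _ _ (graft_swapAt_graphSum ρ μ' (core τ i) c y x)
        rw [h1]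
        refine ihn (m + (B i).p) _ ?_ (hμ'.swapAt_graphSum (hτ i).isForest (hτ i).connected c y x)
        rw [Fintype.card_sum, hcard, Fintype.card_fin]

end Expansion

end TensorModel

namespace TensorModel

/-! ### Unitary invariance -/

section Ward

theorem derivation_eq_sum_pderiv {ι : Type*} [Fintype ι] [DecidableEq ι]
    (δ : Derivation ℂ (MvPolynomial ι ℂ) (MvPolynomial ι ℂ)) (p : MvPolynomial ι ℂ) :
    δ p = ∑ x, δ (MvPolynomial.X x) * MvPolynomial.pderiv x p := by
  induction p using MvPolynomial.induction_on with
  | C r =>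
    rw [← MvPolynomial.algebraMap_eq, Derivation.map_algebraMap]
    simp
  | add p q hp hq => simp only [map_add, mul_add, Finset.sum_add_distrib, hp, hq]
  | mul_X p n hp =>
    have h : ∀ x, δ (MvPolynomial.X x) * MvPolynomial.pderiv x (p * MvPolynomial.X n) =
        (if x = n then p * δ (MvPolynomial.X x) else 0) +
          MvPolynomial.X n * (δ (MvPolynomial.X x) * MvPolynomial.pderiv x p) := by
      intro x
      rw [Derivation.leibniz, MvPolynomial.pderiv_X, smul_eq_mul, smul_eq_mul]
      by_cases hx : x = n
      · subst hx
        simp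
        ring
      · simp [hx, Ne.symm hx]
        ring
    rw [Finset.sum_congr rfl fun x _ => h x, Finset.sum_add_distrib, ← Finset.mul_sum, ← hp,
      Derivation.leibniz]
    simp

variable {D N : ℕ}

/-- The infinitesimal rotation of the indices of colour `c` by the elementary matrix with indices
`i` and `j`: it acts on `T`, and by minus the transpose on `T̄`. -/
noncomputable def rotation (c : Fin D) (i j : Fin N) :
    Derivation ℂ (TensorPoly (Fin D → Fin N)) (TensorPoly (Fin D → Fin N)) :=
  MvPolynomial.mkDerivation ℂ (Sum.elim
    (fun a => if a c = i then MvPolynomial.X (Sum.inl (Function.update a c j)) else 0)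
    fun b => -(if b c = j then MvPolynomial.X (Sum.inr (Function.update b c i)) else 0))

theorem rotation_inl (c : Fin D) (i j : Fin N) (a : Fin D → Fin N) :
    rotation c i j (MvPolynomial.X (Sum.inl a)) =
      if a c = i then MvPolynomial.X (Sum.inl (Function.update a c j)) else 0 := by
  rw [rotation, MvPolynomial.mkDerivation_X]
  rfl

theorem rotation_inr (c : Fin D) (i j : Fin N) (b : Fin D → Fin N) :
    rotation c i j (MvPolynomial.X (Sum.inr b)) =
      -(if b c = j then MvPolynomial.X (Sum.inr (Function.update b c i)) else 0) := by
  rw [rotation, MvPolynomial.mkDerivation_X]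
  rfl

/-- Two integrations by parts: an entry of `T` times a derivative in `T` may be traded for an entry
of `T̄` times a derivative in `T̄`. -/
theorem gaussE_X_mul_pderiv {s : ℝ} (hs : 0 < s) (a a' : Fin D → Fin N)
    (p : TensorPoly (Fin D → Fin N)) :
    gaussE hs (MvPolynomial.X (Sum.inl a') * MvPolynomial.pderiv (Sum.inl a) p) =
      gaussE hs (MvPolynomial.X (Sum.inr a) * MvPolynomial.pderiv (Sum.inr a') p) := by
  have hs' : (s : ℂ)⁻¹ ≠ 0 := inv_ne_zero (by exact_mod_cast hs.ne')
  have h1 := gaussE_X_inr_mul hs a (MvPolynomial.X (Sum.inl a') * p)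
  have h2 := gaussE_X_inl_mul hs a' (MvPolynomial.X (Sum.inr a) * p)
  rw [mul_left_comm, h1] at h2
  have h3 := mul_left_cancel₀ hs' h2
  rw [Derivation.leibniz, Derivation.leibniz, MvPolynomial.pderiv_X, MvPolynomial.pderiv_X,
    map_add, map_add] at h3
  by_cases h : a = a'
  · subst h
    simp only [Pi.single_eq_same, smul_eq_mul] at h3
    exact add_right_cancel h3
  · have e1 : (Pi.single (Sum.inl a) 1 :
        (Fin D → Fin N) ⊕ (Fin D → Fin N) → TensorPoly (Fin D → Fin N)) (Sum.inl a') = 0 :=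
      Pi.single_eq_of_ne (fun hc => h (Sum.inl_injective hc).symm) _
    have e2 : (Pi.single (Sum.inr a') 1 :
        (Fin D → Fin N) ⊕ (Fin D → Fin N) → TensorPoly (Fin D → Fin N)) (Sum.inr a) = 0 :=
      Pi.single_eq_of_ne (fun hc => h (Sum.inr_injective hc)) _
    rw [e1, e2] at h3
    simpa only [smul_zero, mul_zero, map_zero, add_zero, smul_eq_mul] using h3

theorem update_update_eq {a : Fin D → Fin N} {c : Fin D} {i : Fin N} (j : Fin N) (h : a c = i) :
    Function.update (Function.update a c j) c i = a := by
  rw [Function.update_idem, ← h, Function.update_eq_self]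

/-- The Gaussian functional is invariant under rotations. -/
theorem gaussE_rotation {s : ℝ} (hs : 0 < s) (c : Fin D) (i j : Fin N)
    (p : TensorPoly (Fin D → Fin N)) : gaussE hs (rotation c i j p) = 0 := by
  rw [derivation_eq_sum_pderiv, Fintype.sum_sum_type, map_add, map_sum, map_sum]
  simp only [rotation_inl, rotation_inr, ite_mul, zero_mul, neg_mul, map_neg, apply_ite (gaussE hs),
    map_zero]
  rw [Finset.sum_neg_distrib, ← sub_eq_add_neg, sub_eq_zero, ← Finset.sum_filter,
    ← Finset.sum_filter]
  refine Finset.sum_bij' (fun a _ => Function.update a c j) (fun b _ => Function.update b c i)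
    (fun a _ => ?_) (fun b _ => ?_) (fun a ha => ?_) (fun b hb => ?_) (fun a ha => ?_)
  · simp
  · simp
  · rw [Finset.mem_filter] at ha
    exact update_update_eq j ha.2
  · rw [Finset.mem_filter] at hb
    exact update_update_eq i hb.2
  · rw [Finset.mem_filter] at ha
    rw [update_update_eq j ha.2]
    exact gaussE_X_mul_pderiv hs a _ p

variable {V : Type*} [Fintype V] [DecidableEq V]

theorem derivation_prod_X {ι : Type*} (δ : Derivation ℂ (MvPolynomial ι ℂ) (MvPolynomial ι ℂ))
    (a : V → ι) : δ (∏ v, MvPolynomial.X (a v)) =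
      ∑ x, δ (MvPolynomial.X (a x)) * ∏ v ∈ Finset.univ.erase x, MvPolynomial.X (a v) :=
  derivation_prod δ _ _

theorem prod_update_erase {ι : Type*} (g : ι → MvPolynomial ((Fin D → Fin N) ⊕ (Fin D → Fin N)) ℂ)
    (a : V → ι) (x : V) (y : ι) :
    g y * ∏ v ∈ Finset.univ.erase x, g (a v) = ∏ v, g (Function.update a x y v) := by
  rw [← Finset.mul_prod_erase _ _ (Finset.mem_univ x), Function.update_self]
  congr 1
  refine Finset.prod_congr rfl fun v hv => ?_
  rw [Function.update_of_ne (Finset.ne_of_mem_erase hv)]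

/-- Trace invariants are invariant under rotations. -/
theorem rotation_tracePoly (c : Fin D) (i j : Fin N) (σ : Fin D → Equiv.Perm V) :
    rotation c i j (tracePoly N σ) = 0 := by
  set F : (V → Fin D → Fin N) → (V → Fin D → Fin N) → TensorPoly (Fin D → Fin N) := fun a b =>
    (∏ v, MvPolynomial.X (Sum.inl (a v))) * ∏ w, MvPolynomial.X (Sum.inr (b w)) with hF
  have h1 : ∀ a b : V → Fin D → Fin N, rotation c i j (F a b) =
      ∑ x, ((if a x c = i then F (Function.update a x (Function.update (a x) c j)) b else 0) -
        if b (σ c x) c = j then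
          F a (Function.update b (σ c x) (Function.update (b (σ c x)) c i)) else 0) := by
    intro a b
    rw [hF]
    simp only
    rw [Derivation.leibniz, derivation_prod_X (a := fun v => Sum.inl (a v)),
      derivation_prod_X (a := fun v => Sum.inr (b v)), Finset.sum_sub_distrib, smul_eq_mul,
      smul_eq_mul, add_comm, sub_eq_add_neg, Finset.mul_sum, Finset.mul_sum]
    simp only [rotation_inl, rotation_inr]
    congr 1
    · refine Finset.sum_congr rfl fun x _ => ?_
      split_ifs
      · rw [prod_update_erase (fun y => MvPolynomial.X (Sum.inl y)) a x, mul_comm]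
      · simp
    · rw [← Finset.sum_neg_distrib, Equiv.sum_comp (σ c) fun w => -(if b w c = j then
        (∏ v, MvPolynomial.X (Sum.inl (a v))) * ∏ w', MvPolynomial.X (Sum.inr
          (Function.update b w (Function.update (b w) c i) w')) else 0)]
      refine Finset.sum_congr rfl fun x _ => ?_
      split_ifs
      · rw [← prod_update_erase (fun y => MvPolynomial.X (Sum.inr y)) b x]
        ring
      · simp
  have h2 : tracePoly N σ = ∑ a, F a (blackIndex σ a) := rfl
  rw [h2, map_sum, Finset.sum_congr rfl fun a _ => h1 a (blackIndex σ a), Finset.sum_comm]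
  refine Finset.sum_eq_zero fun x _ => ?_
  -- moving an index of colour `c` along the edge at `x` exchanges the two kinds of terms
  have hb : ∀ a : V → Fin D → Fin N, blackIndex σ a (σ c x) c = a x c := fun a => by
    simp [blackIndex]
  rw [Finset.sum_sub_distrib, sub_eq_zero, ← Finset.sum_filter, ← Finset.sum_filter]
  refine Finset.sum_bij' (fun a _ => Function.update a x (Function.update (a x) c j))
    (fun a _ => Function.update a x (Function.update (a x) c i))
    (fun a _ => ?_) (fun b _ => ?_) (fun a ha => ?_) (fun b hb' => ?_) (fun a ha => ?_)
  · rw [Finset.mem_filter, hb]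
    simp
  · simp
  · rw [Finset.mem_filter] at ha
    rw [Function.update_self, update_update_eq j ha.2, Function.update_idem,
      Function.update_eq_self]
  · rw [Finset.mem_filter, hb] at hb'
    rw [Function.update_self, update_update_eq i hb'.2, Function.update_idem,
      Function.update_eq_self]
  · rw [Finset.mem_filter] at ha
    congr 1
    funext w
    funext c'
    by_cases hw : w = σ c x
    · subst hw
      rw [Function.update_self]
      by_cases hc : c' = c
      · subst hc
        rw [Function.update_self, hb]
        exact ha.2
      · rw [Function.update_of_ne hc]
        unfold blackIndex
        by_cases hx : (σ c')⁻¹ (σ c x) = x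
        · rw [hx, Function.update_self, Function.update_of_ne hc]
        · rw [Function.update_of_ne hx]
    · rw [Function.update_of_ne hw]
      unfold blackIndex
      by_cases hx : (σ c')⁻¹ w = x
      · rw [hx, Function.update_self]
        by_cases hc : c' = c
        · subst hc
          refine absurd ?_ hw
          rw [← hx]
          simp
        · rw [Function.update_of_ne hc]
      · rw [Function.update_of_ne hx]

variable {I : Type*} [Fintype I] {B : I → ColoredGraph D} (t : I → ℂ)

/-- The Ward identity: both the Gaussian weight and the interaction are invariant under
rotations. -/
theorem expect_rotation (hB : ∀ i, 2 ≤ (B i).p) (hN : 1 ≤ N) (c : Fin D) (i j : Fin N)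
    (p : TensorPoly (Fin D → Fin N)) : expect B t hN (rotation c i j p) = 0 := by
  rw [expect_apply]
  have h : momentPoly B t hN (rotation c i j p) = 0 := by
    ext n
    rw [coeff_momentPoly]
    have h1 := gaussE_rotation (scale_pos (D := D) hN) c i j
      (p * expCoeff (interactionPoly B t N) n)
    rw [Derivation.leibniz, map_add, smul_eq_mul, gaussE_mul_derivation_expCoeff t hB hN] at h1
    simp only [rotation_tracePoly, mul_zero, map_zero, smul_zero, Finset.sum_const_zero,
      zero_add] at h1
    rw [smul_eq_mul, mul_comm] at h1
    rw [h1, map_zero]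
  rw [h, zero_mul]

end Ward

/-! ### Invariant tensors -/

section Invariant

variable {R : Type*} [AddCommGroup R] [Module ℂ R] {N : ℕ}

/-- An invariant tensor with one index and one conjugate index is a multiple of the identity. -/
theorem invariant_two (hN : 1 ≤ N) (h : Fin N → Fin N → R)
    (hh : ∀ x y i j, (if x = i then h j y else 0) = if y = j then h x i else 0) (x y : Fin N) :
    h x y = if x = y then h ⟨0, hN⟩ ⟨0, hN⟩ else 0 := by
  have h1 := hh x y x x
  have h2 := hh ⟨0, hN⟩ x ⟨0, hN⟩ x
  rw [if_pos rfl] at h1 h2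
  rw [if_pos rfl] at h2
  rw [h1]
  by_cases hxy : x = y
  · rw [if_pos hxy.symm, if_pos hxy, h2]
  · rw [if_neg (Ne.symm hxy), if_neg hxy]

/-- An invariant tensor with two indices and two conjugate indices is a combination of the two
contractions of the former with the latter. -/
theorem invariant_four (hN : 2 ≤ N) (g : Fin N → Fin N → Fin N → Fin N → R)
    (hg : ∀ x₁ x₂ y₁ y₂ i j, (if x₁ = i then g j x₂ y₁ y₂ else 0) +
      (if x₂ = i then g x₁ j y₁ y₂ else 0) = (if y₁ = j then g x₁ x₂ i y₂ else 0) +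
        if y₂ = j then g x₁ x₂ y₁ i else 0) (x₁ x₂ y₁ y₂ : Fin N) :
    g x₁ x₂ y₁ y₂ =
      (if x₁ = y₁ ∧ x₂ = y₂ then g ⟨0, by omega⟩ ⟨1, hN⟩ ⟨0, by omega⟩ ⟨1, hN⟩ else 0) +
      (if x₁ = y₂ ∧ x₂ = y₁ then g ⟨0, by omega⟩ ⟨1, hN⟩ ⟨1, hN⟩ ⟨0, by omega⟩ else 0) := by
  have sum_ite : ∀ (q : Prop) [Decidable q] (f : Fin N → R),
      (∑ k, if q then f k else 0) = if q then ∑ k, f k else 0 := by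
    intro q _ f
    split_ifs <;> simp
  set h₁ : Fin N → Fin N → R := fun x y => ∑ i, g i x i y with hh₁
  set h₂ : Fin N → Fin N → R := fun x y => ∑ i, g i x y i with hh₂
  have inv₁ := invariant_two (by omega : 1 ≤ N) h₁ (fun x y i j => by
    have := Finset.sum_congr (rfl : (Finset.univ : Finset (Fin N)) = Finset.univ)
      fun k _ => hg k x k y i j
    simp only [Finset.sum_add_distrib, Finset.sum_ite_eq', Finset.mem_univ, if_true] at this
    have h3 := add_left_cancel this
    rw [sum_ite, sum_ite] at h3
    exact h3)
  have inv₂ := invariant_two (by omega : 1 ≤ N) h₂ (fun x y i j => by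
    have := Finset.sum_congr (rfl : (Finset.univ : Finset (Fin N)) = Finset.univ)
      fun k _ => hg k x y k i j
    simp only [Finset.sum_add_distrib, Finset.sum_ite_eq', Finset.mem_univ, if_true] at this
    rw [add_comm] at this
    have h3 := add_right_cancel this
    rw [sum_ite, sum_ite] at h3
    exact h3)
  set κ₁ := h₁ ⟨0, by omega⟩ ⟨0, by omega⟩
  set κ₂ := h₂ ⟨0, by omega⟩ ⟨0, by omega⟩
  -- the sum of the invariance identities over the index rotated
  have key : ∀ j x₂ y₁ y₂, (N : ℂ) • g j x₂ y₁ y₂ + g x₂ j y₁ y₂ =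
      (if y₁ = j ∧ x₂ = y₂ then κ₁ else 0) + if y₂ = j ∧ x₂ = y₁ then κ₂ else 0 := by
    intro j x₂ y₁ y₂
    have := Finset.sum_congr (rfl : (Finset.univ : Finset (Fin N)) = Finset.univ)
      fun i _ => hg i x₂ y₁ y₂ i j
    simp only [Finset.sum_add_distrib, Finset.sum_ite_eq, Finset.mem_univ, if_true,
      Finset.sum_const, Finset.card_univ, Fintype.card_fin] at this
    rw [← Nat.cast_smul_eq_nsmul ℂ] at this
    rw [this]
    have e1 := inv₁ x₂ y₂
    have e2 := inv₂ x₂ y₁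
    congr 1
    · by_cases hy : y₁ = j
      · simp only [hy, if_true, true_and]
        exact e1
      · simp [hy]
    · by_cases hy : y₂ = j
      · simp only [hy, if_true, true_and]
        exact e2
      · simp [hy]
  have hNC : (N : ℂ) ^ 2 - 1 ≠ 0 := by
    have h3 : ((N : ℂ) - 1) * (N + 1) ≠ 0 := by
      refine mul_ne_zero (fun hc => ?_) (by exact_mod_cast Nat.succ_ne_zero N)
      have : (N : ℂ) = (1 : ℕ) := by
        rw [Nat.cast_one]
        exact sub_eq_zero.1 hc
      have := Nat.cast_injective this
      omega
    intro hc
    apply h3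
    rw [← hc]
    ring
  obtain ⟨α, β, hαβ⟩ : ∃ α β : R, ∀ x₁ x₂ y₁ y₂, g x₁ x₂ y₁ y₂ =
      (if x₁ = y₁ ∧ x₂ = y₂ then α else 0) + if x₁ = y₂ ∧ x₂ = y₁ then β else 0 := by
    refine ⟨((N : ℂ) ^ 2 - 1)⁻¹ • ((N : ℂ) • κ₁ - κ₂), ((N : ℂ) ^ 2 - 1)⁻¹ • ((N : ℂ) • κ₂ - κ₁),
      fun x₁ x₂ y₁ y₂ => ?_⟩
    have h3 := key x₁ x₂ y₁ y₂
    have h4 := key x₂ x₁ y₁ y₂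
    have h5 : ((N : ℂ) ^ 2 - 1) • g x₁ x₂ y₁ y₂ =
        (if x₁ = y₁ ∧ x₂ = y₂ then (N : ℂ) • κ₁ - κ₂ else 0) +
          if x₁ = y₂ ∧ x₂ = y₁ then (N : ℂ) • κ₂ - κ₁ else 0 := by
      have h6 : ((N : ℂ) ^ 2 - 1) • g x₁ x₂ y₁ y₂ =
          (N : ℂ) • ((N : ℂ) • g x₁ x₂ y₁ y₂ + g x₂ x₁ y₁ y₂) -
            ((N : ℂ) • g x₂ x₁ y₁ y₂ + g x₁ x₂ y₁ y₂) := by module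
      rw [h6, h3, h4]
      have c1 : (y₁ = x₁ ∧ x₂ = y₂) ↔ (x₁ = y₁ ∧ x₂ = y₂) := by rw [eq_comm (a := y₁)]
      have c2 : (y₂ = x₁ ∧ x₂ = y₁) ↔ (x₁ = y₂ ∧ x₂ = y₁) := by rw [eq_comm (a := y₂)]
      have c3 : (y₁ = x₂ ∧ x₁ = y₂) ↔ (x₁ = y₂ ∧ x₂ = y₁) := by rw [eq_comm (a := y₁), and_comm]
      have c4 : (y₂ = x₂ ∧ x₁ = y₁) ↔ (x₁ = y₁ ∧ x₂ = y₂) := by rw [eq_comm (a := y₂), and_comm]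
      simp only [c1, c2, c3, c4]
      split_ifs <;> module
    rw [← inv_smul_smul₀ hNC (g x₁ x₂ y₁ y₂), h5, smul_add]
    simp only [smul_ite, smul_zero]
  have h01 : (⟨0, by omega⟩ : Fin N) ≠ ⟨1, hN⟩ := by simp
  have e1 := hαβ ⟨0, by omega⟩ ⟨1, hN⟩ ⟨0, by omega⟩ ⟨1, hN⟩
  have e2 := hαβ ⟨0, by omega⟩ ⟨1, hN⟩ ⟨1, hN⟩ ⟨0, by omega⟩
  rw [if_pos ⟨rfl, rfl⟩, if_neg fun hc => h01 hc.1, add_zero] at e1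
  rw [if_neg fun hc => h01 hc.1, if_pos ⟨rfl, rfl⟩, zero_add] at e2
  rw [e1, e2]
  exact hαβ x₁ x₂ y₁ y₂

end Invariant

end TensorModel

namespace TensorModel

/-! ### The 4-point cumulant -/

section FourPoint

open MvPolynomial (X)

theorem sum_prod_ite_mem {ι R : Type*} [Fintype ι] [DecidableEq ι] [CommRing R] (f g : ι → R) :
    ∑ C : Finset ι, ∏ c, (if c ∈ C then f c else g c) = ∏ c, (f c + g c) := by
  rw [Finset.prod_add, Finset.powerset_univ]
  refine Finset.sum_congr rfl fun C _ => ?_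
  rw [Finset.prod_ite]
  congr 1
  · refine Finset.prod_congr ?_ fun _ _ => rfl
    ext c
    simp
  · refine Finset.prod_congr ?_ fun _ _ => rfl
    ext c
    simp

theorem sum_pairs_prod {ι A R : Type*} [Fintype ι] [DecidableEq ι] [Fintype A] [DecidableEq A]
    [CommRing R] (f : ι → A → A → R) :
    ∑ a : ι → A, ∑ b : ι → A, ∏ c, f c (a c) (b c) = ∏ c, ∑ x, ∑ y, f c x y := by
  have h : ∀ c, ∑ x, ∑ y, f c x y = ∑ z : A × A, f c z.1 z.2 := fun c =>
    (Fintype.sum_prod_type' (f c)).symm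
  simp only [h]
  rw [Finset.prod_univ_sum, Fintype.piFinset_univ,
    ← Fintype.sum_prod_type' fun a b : ι → A => ∏ c, f c (a c) (b c)]
  exact (Fintype.sum_equiv (Equiv.arrowProdEquivProdArrow ι (fun _ => A) (fun _ => A)) _ _
    fun z => rfl).symm

variable {D N : ℕ}

/-- Invariance of a tensor with two indices and two conjugate indices under the rotations of the
colour `c`. -/
def ColourInvariant (c : Fin D)
    (G : (Fin D → Fin N) → (Fin D → Fin N) → (Fin D → Fin N) → (Fin D → Fin N) →
      PowerSeries ℂ) : Prop :=
  ∀ a₁ a₂ b₁ b₂ i j,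
    (if a₁ c = i then G (Function.update a₁ c j) a₂ b₁ b₂ else 0) +
      (if a₂ c = i then G a₁ (Function.update a₂ c j) b₁ b₂ else 0) =
    (if b₁ c = j then G a₁ a₂ (Function.update b₁ c i) b₂ else 0) +
      if b₂ c = j then G a₁ a₂ b₁ (Function.update b₂ c i) else 0

/-- The index whose colours in `C` are equal to `1`, and the others to `0`. -/
def markIndex (hN : 2 ≤ N) (C : Finset (Fin D)) : Fin D → Fin N :=
  fun c => if c ∈ C then ⟨1, hN⟩ else ⟨0, by omega⟩

/-- The contraction of the colour `c` in the trace invariant of the bubble with four vertices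
associated with `C`. -/
def deltaFactor (C : Finset (Fin D)) (a₁ a₂ b₁ b₂ : Fin D → Fin N) (c : Fin D) : ℂ :=
  if c ∈ C then (if a₁ c = b₂ c ∧ a₂ c = b₁ c then 1 else 0)
    else (if a₁ c = b₁ c ∧ a₂ c = b₂ c then 1 else 0)

/-- The expansion of an invariant tensor on contractions of the indices of one colour. -/
theorem ColourInvariant.apply_eq (hN : 2 ≤ N) {c : Fin D}
    {G : (Fin D → Fin N) → (Fin D → Fin N) → (Fin D → Fin N) → (Fin D → Fin N) → PowerSeries ℂ}
    (hG : ColourInvariant c G) (a₁ a₂ b₁ b₂ : Fin D → Fin N) :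
    G a₁ a₂ b₁ b₂ =
      (if a₁ c = b₁ c ∧ a₂ c = b₂ c then G (Function.update a₁ c ⟨0, by omega⟩)
        (Function.update a₂ c ⟨1, hN⟩) (Function.update b₁ c ⟨0, by omega⟩)
        (Function.update b₂ c ⟨1, hN⟩) else 0) +
      if a₁ c = b₂ c ∧ a₂ c = b₁ c then G (Function.update a₁ c ⟨0, by omega⟩)
        (Function.update a₂ c ⟨1, hN⟩) (Function.update b₁ c ⟨1, hN⟩)
        (Function.update b₂ c ⟨0, by omega⟩) else 0 := by
  have h := invariant_four hN (fun x₁ x₂ y₁ y₂ => G (Function.update a₁ c x₁)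
    (Function.update a₂ c x₂) (Function.update b₁ c y₁) (Function.update b₂ c y₂))
    (fun x₁ x₂ y₁ y₂ i j => by
      have := hG (Function.update a₁ c x₁) (Function.update a₂ c x₂) (Function.update b₁ c y₁)
        (Function.update b₂ c y₂) i j
      simpa only [Function.update_self, Function.update_idem] using this)
    (a₁ c) (a₂ c) (b₁ c) (b₂ c)
  simpa only [Function.update_eq_self] using h

/-- A tensor invariant under the rotations of all colours is a combination of products of
contractions. -/
theorem ColourInvariant.expansion (hN : 2 ≤ N)
    {G : (Fin D → Fin N) → (Fin D → Fin N) → (Fin D → Fin N) → (Fin D → Fin N) → PowerSeries ℂ}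
    (hG : ∀ c, ColourInvariant c G) (a₁ a₂ b₁ b₂ : Fin D → Fin N) :
    G a₁ a₂ b₁ b₂ = ∑ C : Finset (Fin D), (∏ c, deltaFactor C a₁ a₂ b₁ b₂ c) •
      G (markIndex hN ∅) (markIndex hN Finset.univ) (markIndex hN C) (markIndex hN Cᶜ) := by
  have key : ∀ S : Finset (Fin D), G a₁ a₂ b₁ b₂ =
      ∑ C ∈ S.powerset, (∏ c ∈ S, deltaFactor C a₁ a₂ b₁ b₂ c) •
        G (S.piecewise (markIndex hN ∅) a₁) (S.piecewise (markIndex hN Finset.univ) a₂)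
          (S.piecewise (markIndex hN C) b₁) (S.piecewise (markIndex hN Cᶜ) b₂) := by
    intro S
    induction S using Finset.induction_on with
    | empty => simp
    | insert c S hc ih =>
      rw [ih, Finset.sum_powerset_insert hc, ← Finset.sum_add_distrib]
      refine Finset.sum_congr rfl fun C hC => ?_
      have hcC : c ∉ C := fun h => hc (Finset.mem_powerset.1 hC h)
      rw [(hG c).apply_eq hN, smul_add]
      have hval : ∀ f g : Fin D → Fin N, S.piecewise f g c = g c := fun f g =>
        Finset.piecewise_eq_of_notMem _ _ _ hc
      have hpw : ∀ (f f' g : Fin D → Fin N) (x : Fin N), f c = x → (∀ c' ∈ S, f c' = f' c') →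
          Function.update (S.piecewise f' g) c x = (insert c S).piecewise f g := by
        intro f f' g x hx hf
        rw [Finset.piecewise_insert, hx]
        congr 1
        funext c'
        by_cases h : c' ∈ S
        · rw [Finset.piecewise_eq_of_mem _ _ _ h, Finset.piecewise_eq_of_mem _ _ _ h, hf c' h]
        · rw [Finset.piecewise_eq_of_notMem _ _ _ h, Finset.piecewise_eq_of_notMem _ _ _ h]
      have hne : ∀ c' ∈ S, c' ≠ c := fun c' hc' h => hc (h ▸ hc')
      simp only [hval]
      rw [hpw (markIndex hN ∅) (markIndex hN ∅) a₁ _ (by simp [markIndex]) fun _ _ => rfl,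
        hpw (markIndex hN Finset.univ) (markIndex hN Finset.univ) a₂ _ (by simp [markIndex])
          fun _ _ => rfl,
        hpw (markIndex hN C) (markIndex hN C) b₁ _ (by simp [markIndex, hcC]) fun _ _ => rfl,
        hpw (markIndex hN Cᶜ) (markIndex hN Cᶜ) b₂ _ (by simp [markIndex, hcC]) fun _ _ => rfl,
        hpw (markIndex hN (insert c C)) (markIndex hN C) b₁ _ (by simp [markIndex])
          fun c' hc' => by simp [markIndex, hne c' hc'],
        hpw (markIndex hN (insert c C)ᶜ) (markIndex hN Cᶜ) b₂ _ (by simp [markIndex])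
          fun c' hc' => by simp [markIndex, hne c' hc']]
      rw [Finset.prod_insert hc, Finset.prod_insert hc]
      have h1 : ∏ c' ∈ S, deltaFactor (insert c C) a₁ a₂ b₁ b₂ c' =
          ∏ c' ∈ S, deltaFactor C a₁ a₂ b₁ b₂ c' := by
        refine Finset.prod_congr rfl fun c' hc' => ?_
        simp [deltaFactor, hne c' hc']
      rw [h1]
      have h2 : deltaFactor C a₁ a₂ b₁ b₂ c = if a₁ c = b₁ c ∧ a₂ c = b₂ c then 1 else 0 := by
        simp [deltaFactor, hcC]
      have h3 : deltaFactor (insert c C) a₁ a₂ b₁ b₂ c =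
          if a₁ c = b₂ c ∧ a₂ c = b₁ c then 1 else 0 := by
        simp [deltaFactor]
      rw [h2, h3]
      congr 1
      · split_ifs <;> simp
      · split_ifs <;> simp
  rw [key Finset.univ, Finset.powerset_univ]
  simp only [Finset.piecewise_univ]

/-- Evaluation of an expansion on contractions at the indices marking one of them. -/
theorem sum_deltaFactor_markIndex (hN : 2 ≤ N) (w : Finset (Fin D) → PowerSeries ℂ)
    (C : Finset (Fin D)) :
    ∑ C', (∏ c, deltaFactor C' (markIndex hN ∅) (markIndex hN Finset.univ) (markIndex hN C)
      (markIndex hN Cᶜ) c) • w C' = w C := by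
  have h01 : (⟨0, by omega⟩ : Fin N) ≠ ⟨1, hN⟩ := by simp
  have h : ∀ C' c, deltaFactor C' (markIndex hN ∅) (markIndex hN Finset.univ) (markIndex hN C)
      (markIndex hN Cᶜ) c = if (c ∈ C' ↔ c ∈ C) then 1 else 0 := by
    intro C' c
    by_cases h1 : c ∈ C' <;> by_cases h2 : c ∈ C <;>
      simp [deltaFactor, markIndex, h1, h2]
  rw [Finset.sum_eq_single C]
  · simp [h]
  · intro C' _ hC'
    obtain ⟨c, hc⟩ : ∃ c, ¬(c ∈ C' ↔ c ∈ C) := by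
      by_contra! hcon
      exact hC' (Finset.ext hcon)
    rw [Finset.prod_eq_zero (Finset.mem_univ c), zero_smul]
    rw [h, if_neg hc]
  · simp

variable {I : Type*} [Fintype I] (B : I → ColoredGraph D) (t : I → ℂ)

theorem cumulantTwo_eq (hN : 1 ≤ N) (a b : Fin D → Fin N) :
    cumulantTwo B t N a b = expect B t hN (X (Sum.inl a) * X (Sum.inr b)) := by
  rw [cumulantTwo, ← expectation_evalTensor]
  simp only [map_mul, evalTensor_inl, evalTensor_inr]

theorem cumulantFour_eq (hN : 1 ≤ N) (a₁ a₂ b₁ b₂ : Fin D → Fin N) :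
    cumulantFour B t N a₁ a₂ b₁ b₂ =
      expect B t hN (X (Sum.inl a₁) * X (Sum.inl a₂) * X (Sum.inr b₁) * X (Sum.inr b₂)) -
        cumulantTwo B t N a₁ b₁ * cumulantTwo B t N a₂ b₂ -
        cumulantTwo B t N a₁ b₂ * cumulantTwo B t N a₂ b₁ := by
  rw [cumulantFour, ← expectation_evalTensor]
  simp only [map_mul, evalTensor_inl, evalTensor_inr]

theorem cumulantFour_swap (hN : 1 ≤ N) (a₁ a₂ b₁ b₂ : Fin D → Fin N) :
    cumulantFour B t N a₁ a₂ b₂ b₁ = cumulantFour B t N a₁ a₂ b₁ b₂ := by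
  rw [cumulantFour_eq B t hN, cumulantFour_eq B t hN, mul_right_comm (_ * _)]
  ring

variable {B}

theorem cumulantTwo_rotation (hB : ∀ i, 2 ≤ (B i).p) (hN : 1 ≤ N) (c : Fin D) (i j : Fin N)
    (a b : Fin D → Fin N) :
    (if a c = i then cumulantTwo B t N (Function.update a c j) b else 0) =
      if b c = j then cumulantTwo B t N a (Function.update b c i) else 0 := by
  have h := expect_rotation t hB hN c i j (X (Sum.inl a) * X (Sum.inr b))
  rw [Derivation.leibniz, rotation_inl, rotation_inr, map_add, smul_eq_mul, smul_eq_mul] at h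
  simp only [cumulantTwo_eq B t hN]
  have h1 : ∀ (q : Prop) [Decidable q] (x y : TensorPoly (Fin D → Fin N)),
      expect B t hN (x * if q then y else 0) = if q then expect B t hN (y * x) else 0 := by
    intro q _ x y
    split_ifs
    · rw [mul_comm]
    · simp
  rw [mul_neg, map_neg, h1, h1, neg_add_eq_zero] at h
  rw [← h]
  split_ifs
  · rw [mul_comm]
  · rfl

theorem cumulantFour_colourInvariant (hB : ∀ i, 2 ≤ (B i).p) (hN : 1 ≤ N) (c : Fin D) :
    ColourInvariant c (cumulantFour B t N) := by
  intro a₁ a₂ b₁ b₂ i j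
  have h := expect_rotation t hB hN c i j
    (X (Sum.inl a₁) * X (Sum.inl a₂) * X (Sum.inr b₁) * X (Sum.inr b₂))
  simp only [Derivation.leibniz, rotation_inl, rotation_inr, smul_eq_mul] at h
  have h1 : (X (Sum.inl a₁) * X (Sum.inl a₂) * X (Sum.inr b₁)) *
        -(if b₂ c = j then X (Sum.inr (Function.update b₂ c i)) else 0) +
      X (Sum.inr b₂) * ((X (Sum.inl a₁) * X (Sum.inl a₂)) *
        -(if b₁ c = j then X (Sum.inr (Function.update b₁ c i)) else 0) +
      X (Sum.inr b₁) * (X (Sum.inl a₁) *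
        (if a₂ c = i then X (Sum.inl (Function.update a₂ c j)) else 0) +
      X (Sum.inl a₂) * (if a₁ c = i then X (Sum.inl (Function.update a₁ c j)) else 0))) =
      (if a₁ c = i then X (Sum.inl (Function.update a₁ c j)) * X (Sum.inl a₂) *
        X (Sum.inr b₁) * X (Sum.inr b₂) else 0) +
      (if a₂ c = i then X (Sum.inl a₁) * X (Sum.inl (Function.update a₂ c j)) *
        X (Sum.inr b₁) * X (Sum.inr b₂) else 0) -
      (if b₁ c = j then X (Sum.inl a₁) * X (Sum.inl a₂) *
        X (Sum.inr (Function.update b₁ c i)) * X (Sum.inr b₂) else 0) -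
      (if b₂ c = j then X (Sum.inl a₁) * X (Sum.inl a₂) *
        X (Sum.inr b₁) * X (Sum.inr (Function.update b₂ c i)) else (0 : TensorPoly _)) := by
    split_ifs <;> ring
  rw [h1] at h
  simp only [map_add, map_sub, apply_ite (expect B t hN), map_zero] at h
  simp only [cumulantFour_eq B t hN]
  have e := fun a b => cumulantTwo_rotation t hB hN c i j a b
  have h2 : ∀ (q : Prop) [Decidable q] (x y z : PowerSeries ℂ),
      (if q then x - y - z else 0) = (if q then x else 0) - (if q then y else 0) -
        if q then z else 0 := by
    intro q _ x y z
    split_ifs <;> simp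
  have e1 : ∀ a b y, (if a c = i then cumulantTwo B t N (Function.update a c j) b * y else 0) =
      if b c = j then cumulantTwo B t N a (Function.update b c i) * y else 0 := by
    intro a b y
    simpa only [ite_mul, zero_mul] using congrArg (· * y) (e a b)
  have e2 : ∀ a b y, (if a c = i then y * cumulantTwo B t N (Function.update a c j) b else 0) =
      if b c = j then y * cumulantTwo B t N a (Function.update b c i) else 0 := by
    intro a b y
    simpa only [mul_ite, mul_zero] using congrArg (y * ·) (e a b)
  simp only [h2]
  linear_combination h - e1 a₁ b₁ (cumulantTwo B t N a₂ b₂) -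
    e2 a₂ b₂ (cumulantTwo B t N a₁ b₁) - e1 a₁ b₂ (cumulantTwo B t N a₂ b₁) -
    e2 a₂ b₁ (cumulantTwo B t N a₁ b₂)

/-- By the diagonal rotations, the 2-point function is diagonal. -/
theorem cumulantTwo_of_ne (hB : ∀ i, 2 ≤ (B i).p) (hN : 1 ≤ N) {a b : Fin D → Fin N}
    (h : a ≠ b) : cumulantTwo B t N a b = 0 := by
  obtain ⟨c, hc⟩ := Function.ne_iff.1 h
  have h1 := cumulantTwo_rotation t hB hN c (a c) (a c) a b
  rwa [if_pos rfl, Function.update_eq_self, if_neg (Ne.symm hc)] at h1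

/-- By the rotations of one colour at a time, the diagonal entries of the 2-point function are
equal. -/
theorem cumulantTwo_self (hB : ∀ i, 2 ≤ (B i).p) (hN : 1 ≤ N) (a a' : Fin D → Fin N) :
    cumulantTwo B t N a a = cumulantTwo B t N a' a' := by
  have key : ∀ S : Finset (Fin D), cumulantTwo B t N a a =
      cumulantTwo B t N (S.piecewise a' a) (S.piecewise a' a) := by
    intro S
    induction S using Finset.induction_on with
    | empty => simp
    | insert c S hc ih =>
      have h1 := cumulantTwo_rotation t hB hN c (S.piecewise a' a c) (a' c) (S.piecewise a' a)
        (Function.update (S.piecewise a' a) c (a' c))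
      rw [if_pos rfl, Function.update_self, if_pos rfl, Function.update_idem,
        Function.update_eq_self] at h1
      rw [ih, Finset.piecewise_insert, h1]
  rw [key Finset.univ, Finset.piecewise_univ]

/-- The coefficients of the expansion on trace invariants are the values of the cumulant at marked
indices. Two distinct values of the indices are needed. -/
theorem isInvariantExpansion_iff (hB : ∀ i, 2 ≤ (B i).p) (hN : 2 ≤ N)
    (w : Finset (Fin D) → PowerSeries ℂ) : IsInvariantExpansion B t N w ↔
      w = fun C => cumulantFour B t N (markIndex hN ∅) (markIndex hN Finset.univ) (markIndex hN C)
        (markIndex hN Cᶜ) := by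
  constructor
  · rintro ⟨-, h⟩
    funext C
    rw [h]
    exact (sum_deltaFactor_markIndex hN w C).symm
  · rintro rfl
    refine ⟨fun C => ?_, fun a₁ a₂ b₁ b₂ => ?_⟩
    · simp only [compl_compl]
      exact cumulantFour_swap B t (by omega) _ _ _ _
    · exact ColourInvariant.expansion hN
        (fun c => cumulantFour_colourInvariant t hB (by omega) c) a₁ a₂ b₁ b₂

theorem existsUnique_isInvariantExpansion (hB : ∀ i, 2 ≤ (B i).p) (hN : 2 ≤ N) :
    ∃! w, IsInvariantExpansion B t N w :=
  ⟨_, (isInvariantExpansion_iff t hB hN _).2 rfl, fun w hw =>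
    (isInvariantExpansion_iff t hB hN w).1 hw⟩

/-- The graph of the bubble with four vertices associated with a set of colours. -/
def fourGraph (C : Finset (Fin D)) : Fin D → Equiv.Perm (Option Unit) :=
  fun c => if c ∈ C then Equiv.swap none (some ()) else 1

/-- The colours in `C` are taken from `b`, and the others from `a`. -/
def mixIndex (C : Finset (Fin D)) (a b : Fin D → Fin N) : Fin D → Fin N :=
  fun c => if c ∈ C then b c else a c

theorem tracePoly_fourGraph (C : Finset (Fin D)) : tracePoly N (fourGraph C) =
    ∑ a₁, ∑ a₂, X (Sum.inl a₁) * X (Sum.inl a₂) * X (Sum.inr (mixIndex C a₁ a₂)) *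
      X (Sum.inr (mixIndex C a₂ a₁)) := by
  set e : (Option Unit → Fin D → Fin N) ≃ (Fin D → Fin N) × (Fin D → Fin N) :=
    { toFun := fun a => (a none, a (some ()))
      invFun := fun p x => x.elim p.1 fun _ => p.2
      left_inv := fun a => by
        funext x
        rcases x with _ | x <;> rfl
      right_inv := fun p => rfl } with he
  rw [← Fintype.sum_prod_type' fun a₁ a₂ : Fin D → Fin N => X (Sum.inl a₁) * X (Sum.inl a₂) *
    X (Sum.inr (mixIndex C a₁ a₂)) * X (Sum.inr (mixIndex C a₂ a₁)), tracePoly]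
  refine Fintype.sum_equiv e _ _ fun a => ?_
  have h1 : blackIndex (fourGraph C) a none = mixIndex C (a none) (a (some ())) := by
    funext c
    simp only [blackIndex, fourGraph, mixIndex]
    split_ifs
    · rw [Equiv.swap_inv, Equiv.swap_apply_left]
    · rfl
  have h2 : blackIndex (fourGraph C) a (some ()) = mixIndex C (a (some ())) (a none) := by
    funext c
    simp only [blackIndex, fourGraph, mixIndex]
    split_ifs
    · rw [Equiv.swap_inv, Equiv.swap_apply_right]
    · rfl
  rw [Fintype.prod_option, Fintype.prod_option, h1]
  simp only [Finset.univ_unique, Finset.prod_singleton, PUnit.default_eq_unit, h2]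
  exact (mul_assoc _ _ _).symm

/-- The contraction of the 4-point cumulant along the bubble with four vertices associated with
`C`. -/
noncomputable def fourTrace (B : I → ColoredGraph D) (t : I → ℂ) (N : ℕ) (C : Finset (Fin D)) :
    PowerSeries ℂ :=
  ∑ a₁, ∑ a₂, cumulantFour B t N a₁ a₂ (mixIndex C a₁ a₂) (mixIndex C a₂ a₁)

theorem sum_sum_ite_eq (N : ℕ) : ∑ x : Fin N, ∑ y : Fin N, (if x = y then (1 : ℂ) else 0) = N := by
  simp

/-- Contraction of two trace invariants of bubbles with four vertices: two faces for each colour in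
which they agree, and one for each other colour. -/
theorem fourTrace_eq_sum {w : Finset (Fin D) → PowerSeries ℂ} (hw : IsInvariantExpansion B t N w)
    (C : Finset (Fin D)) : fourTrace B t N C =
      ∑ C', (∏ c, if (c ∈ C ↔ c ∈ C') then (N : ℂ) ^ 2 else N) • w C' := by
  unfold fourTrace
  rw [Finset.sum_congr rfl fun a₁ _ => Finset.sum_congr rfl fun a₂ _ => hw.2 a₁ a₂ _ _,
    Finset.sum_congr rfl fun a₁ _ => Finset.sum_comm, Finset.sum_comm]
  refine Finset.sum_congr rfl fun C' _ => ?_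
  simp only [← Finset.sum_smul]
  congr 1
  have h1 : ∀ a₁ a₂ : Fin D → Fin N,
      (∏ c, if c ∈ C' then
          (if a₁ c = mixIndex C a₂ a₁ c ∧ a₂ c = mixIndex C a₁ a₂ c then (1 : ℂ) else 0)
        else (if a₁ c = mixIndex C a₁ a₂ c ∧ a₂ c = mixIndex C a₂ a₁ c then 1 else 0)) =
      ∏ c, if (c ∈ C ↔ c ∈ C') then (1 : ℂ) else if a₁ c = a₂ c then 1 else 0 := by
    intro a₁ a₂
    refine Finset.prod_congr rfl fun c _ => ?_
    by_cases h1 : c ∈ C <;> by_cases h2 : c ∈ C' <;> simp [mixIndex, h1, h2, eq_comm]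
  simp only [h1]
  rw [sum_pairs_prod fun c (x y : Fin N) =>
    if (c ∈ C ↔ c ∈ C') then (1 : ℂ) else if x = y then 1 else 0]
  refine Finset.prod_congr rfl fun c _ => ?_
  split_ifs
  · simp [pow_two]
  · exact sum_sum_ite_eq N

/-- The disconnected part of a contraction of the 4-point function: two faces for each colour
outside `C`, and one for each colour in `C`. -/
theorem sum_cumulantTwo_mul (hB : ∀ i, 2 ≤ (B i).p) (hN : 1 ≤ N) (C : Finset (Fin D))
    (a₀ : Fin D → Fin N) :
    ∑ a₁, ∑ a₂, cumulantTwo B t N a₁ (mixIndex C a₁ a₂) * cumulantTwo B t N a₂ (mixIndex C a₂ a₁) =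
      ((N : ℂ) ^ C.card * (N ^ 2) ^ (D - C.card)) • cumulantTwo B t N a₀ a₀ ^ 2 := by
  have h1 : ∀ a₁ a₂ : Fin D → Fin N, cumulantTwo B t N a₁ (mixIndex C a₁ a₂) *
      cumulantTwo B t N a₂ (mixIndex C a₂ a₁) =
      (∏ c, (fun c (x y : Fin N) => if c ∈ C then (if x = y then (1 : ℂ) else 0) else 1) c (a₁ c)
        (a₂ c)) • cumulantTwo B t N a₀ a₀ ^ 2 := by
    intro a₁ a₂
    by_cases h : ∀ c ∈ C, a₁ c = a₂ c
    · have e1 : mixIndex C a₁ a₂ = a₁ := by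
        funext c
        unfold mixIndex
        split_ifs with hc
        · exact (h c hc).symm
        · rfl
      have e2 : mixIndex C a₂ a₁ = a₂ := by
        funext c
        unfold mixIndex
        split_ifs with hc
        · exact h c hc
        · rfl
      rw [e1, e2, cumulantTwo_self t hB hN a₁ a₀, cumulantTwo_self t hB hN a₂ a₀,
        Finset.prod_eq_one, one_smul, pow_two]
      intro c _
      by_cases hc : c ∈ C
      · simp [hc, h c hc]
      · simp [hc]
    · push Not at h
      obtain ⟨c, hc, hne⟩ := h
      rw [cumulantTwo_of_ne t hB hN (a := a₁) (b := mixIndex C a₁ a₂), zero_mul,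
        Finset.prod_eq_zero (Finset.mem_univ c), zero_smul]
      · simp [hc, hne]
      · intro heq
        have := congrFun heq c
        rw [mixIndex, if_pos hc] at this
        exact hne this
  rw [Finset.sum_congr rfl fun a₁ _ => Finset.sum_congr rfl fun a₂ _ => h1 a₁ a₂]
  simp only [← Finset.sum_smul]
  congr 1
  rw [sum_pairs_prod fun c (x y : Fin N) =>
    if c ∈ C then (if x = y then (1 : ℂ) else 0) else 1]
  have h2 : ∀ c, (∑ x : Fin N, ∑ y : Fin N,
      if c ∈ C then (if x = y then (1 : ℂ) else 0) else 1) = if c ∈ C then (N : ℂ) else N ^ 2 := by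
    intro c
    split_ifs
    · exact sum_sum_ite_eq N
    · simp [pow_two]
  rw [Finset.prod_congr rfl fun c _ => h2 c, Finset.prod_ite, Finset.prod_const, Finset.prod_const,
    Finset.filter_mem_eq_inter, Finset.univ_inter]
  congr 2
  rw [Finset.filter_not, Finset.filter_mem_eq_inter, Finset.univ_inter, Finset.card_sdiff_of_subset
    (Finset.subset_univ C), Finset.card_univ, Fintype.card_fin]

theorem expect_tracePoly_one (hB : ∀ i, 2 ≤ (B i).p) (hN : 1 ≤ N) (a₀ : Fin D → Fin N) :
    expect B t hN (tracePoly N fun _ : Fin D => (1 : Equiv.Perm Unit)) =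
      ((N : ℂ) ^ D) • cumulantTwo B t N a₀ a₀ := by
  rw [tracePoly, map_sum]
  have h1 : ∀ a : Unit → Fin D → Fin N, expect B t hN ((∏ v, X (Sum.inl (a v))) *
      ∏ w, X (Sum.inr (blackIndex (fun _ : Fin D => (1 : Equiv.Perm Unit)) a w))) =
      cumulantTwo B t N a₀ a₀ := by
    intro a
    simp only [Finset.univ_unique, Finset.prod_singleton]
    rw [cumulantTwo_self t hB hN a₀ (a ()), cumulantTwo_eq B t hN]
    rfl
  rw [Finset.sum_congr rfl fun a _ => h1 a, Finset.sum_const, Finset.card_univ,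
    ← Nat.cast_smul_eq_nsmul ℂ]
  congr 1
  simp

/-- The contraction of the cumulant is the expectation of the bubble with four vertices, minus the
two ways to close it by 2-point functions. -/
theorem fourTrace_eq (hB : ∀ i, 2 ≤ (B i).p) (hN : 1 ≤ N) (C : Finset (Fin D)) :
    fourTrace B t N C = expect B t hN (tracePoly N (fourGraph C)) -
      (((N : ℂ) ^ C.card)⁻¹ + ((N : ℂ) ^ (D - C.card))⁻¹) •
        expect B t hN (tracePoly N fun _ : Fin D => (1 : Equiv.Perm Unit)) ^ 2 := by
  have hN' : (N : ℂ) ≠ 0 := by exact_mod_cast (by omega : N ≠ 0)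
  set a₀ : Fin D → Fin N := fun _ => ⟨0, hN⟩ with ha₀
  have h1 : ∀ a₁ a₂ : Fin D → Fin N, mixIndex C a₂ a₁ = mixIndex Cᶜ a₁ a₂ := by
    intro a₁ a₂
    funext c
    by_cases h : c ∈ C <;> simp [mixIndex, h]
  -- exchanging the two conjugate indices replaces `C` by its complement
  have h2 := sum_cumulantTwo_mul t hB hN Cᶜ a₀
  have hcard := C.card_le_univ
  rw [Fintype.card_fin] at hcard
  rw [Finset.card_compl, Fintype.card_fin, Nat.sub_sub_self hcard] at h2
  simp only [← h1] at h2
  have h3 : fourTrace B t N C = expect B t hN (tracePoly N (fourGraph C)) -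
      ((N : ℂ) ^ C.card * (N ^ 2) ^ (D - C.card)) • cumulantTwo B t N a₀ a₀ ^ 2 -
      ((N : ℂ) ^ (D - C.card) * (N ^ 2) ^ C.card) • cumulantTwo B t N a₀ a₀ ^ 2 := by
    rw [← sum_cumulantTwo_mul t hB hN C a₀, ← h2, tracePoly_fourGraph, map_sum]
    simp only [map_sum]
    rw [← Finset.sum_sub_distrib, ← Finset.sum_sub_distrib]
    refine Finset.sum_congr rfl fun a₁ _ => ?_
    rw [← Finset.sum_sub_distrib, ← Finset.sum_sub_distrib]
    exact Finset.sum_congr rfl fun a₂ _ => cumulantFour_eq B t hN _ _ _ _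
  rw [h3, expect_tracePoly_one t hB hN a₀, smul_pow, smul_smul, sub_sub, ← add_smul]
  congr 2
  have e1 : (N : ℂ) ^ D = N ^ C.card * N ^ (D - C.card) := by
    rw [← pow_add, Nat.add_sub_cancel' hcard]
  rw [e1]
  field_simp
  ring

/-- The coefficients of the 4-point cumulant, in terms of its contractions. -/
theorem sum_fourTrace {w : Finset (Fin D) → PowerSeries ℂ} (hw : IsInvariantExpansion B t N w)
    (C : Finset (Fin D)) : ∑ C', (∏ c, if (c ∈ C' ↔ c ∈ C) then (N : ℂ) ^ 2 else -N) •
      fourTrace B t N C' = (((N : ℂ) ^ 4 - N ^ 2) ^ D) • w C := by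
  -- the matrices are tensor powers with the blocks `N ^ 2, ∓N`, whose product is `N ^ 4 - N ^ 2`
  have h1 : ∀ C'', ∑ C' : Finset (Fin D), (∏ c, if (c ∈ C' ↔ c ∈ C) then (N : ℂ) ^ 2 else -N) *
      (∏ c, if (c ∈ C' ↔ c ∈ C'') then (N : ℂ) ^ 2 else N) =
      if C'' = C then ((N : ℂ) ^ 4 - N ^ 2) ^ D else 0 := by
    intro C''
    have e1 : ∀ C' : Finset (Fin D), (∏ c, if (c ∈ C' ↔ c ∈ C) then (N : ℂ) ^ 2 else -N) *
        (∏ c, if (c ∈ C' ↔ c ∈ C'') then (N : ℂ) ^ 2 else N) =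
        ∏ c, if c ∈ C' then (if c ∈ C then (N : ℂ) ^ 2 else -N) *
          (if c ∈ C'' then (N : ℂ) ^ 2 else N) else
          (if c ∈ C then -(N : ℂ) else N ^ 2) * (if c ∈ C'' then (N : ℂ) else N ^ 2) := by
      intro C'
      rw [← Finset.prod_mul_distrib]
      refine Finset.prod_congr rfl fun c _ => ?_
      by_cases a : c ∈ C' <;> by_cases b : c ∈ C <;> by_cases d : c ∈ C'' <;> simp [a, b, d]
    rw [Finset.sum_congr rfl fun C' _ => e1 C', sum_prod_ite_mem]
    split_ifs with h
    · subst h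
      have e2 : ∀ c : Fin D, (if c ∈ C'' then (N : ℂ) ^ 2 else -N) *
          (if c ∈ C'' then (N : ℂ) ^ 2 else N) + (if c ∈ C'' then -(N : ℂ) else N ^ 2) *
          (if c ∈ C'' then (N : ℂ) else N ^ 2) = (N : ℂ) ^ 4 - N ^ 2 := by
        intro c
        split_ifs <;> ring
      rw [Finset.prod_congr rfl fun c _ => e2 c, Finset.prod_const, Finset.card_univ,
        Fintype.card_fin]
    · obtain ⟨c, hc⟩ : ∃ c, ¬(c ∈ C'' ↔ c ∈ C) := by
        by_contra! hcon
        exact h (Finset.ext hcon)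
      refine Finset.prod_eq_zero (Finset.mem_univ c) ?_
      by_cases b : c ∈ C <;> by_cases d : c ∈ C''
      · simp [b, d] at hc
      · simp [b, d]
        ring
      · simp [b, d]
        ring
      · simp [b, d] at hc
  simp only [fourTrace_eq_sum t hw, Finset.smul_sum, smul_smul]
  rw [Finset.sum_comm]
  simp only [← Finset.sum_smul, h1, ite_smul, zero_smul, Finset.sum_ite_eq', Finset.mem_univ,
    if_true]

end FourPoint

end TensorModel

namespace TensorModel

/-! ### Large `N` expansion of the 4-point cumulant -/

section FourPointExpansion

open PowerSeries Filter Asymptotics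

variable {D : ℕ}

theorem nloConst_one {V : Type*} [Fintype V] [DecidableEq V] :
    nloConst (fun _ : Fin D => (1 : Equiv.Perm V)) = 0 := by
  simp [nloConst, faceSq, cycleSq_one]

theorem isForest_one {V : Type*} [Fintype V] [DecidableEq V] (hD : 1 ≤ D) :
    IsForest fun _ : Fin D => (1 : Equiv.Perm V) := by
  unfold IsForest numFaces
  rw [numOrbits_one, Finset.sum_congr rfl fun _ _ => numCycles_one]
  simp only [Finset.sum_const, Finset.card_univ, Fintype.card_fin, smul_eq_mul]
  obtain ⟨d, rfl⟩ := Nat.exists_eq_add_of_le hD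
  rw [Nat.add_sub_cancel_left]
  ring

theorem fourGraph_empty : fourGraph (∅ : Finset (Fin D)) = fun _ => 1 := by
  funext c
  simp [fourGraph]

theorem fourGraph_singleton (c : Fin D) :
    fourGraph {c} = insDipole (fun _ => (1 : Equiv.Perm Unit)) c () := by
  funext c'
  ext1 x
  by_cases h : c' = c
  · subst h
    simp [fourGraph, insDipole, swapAt, addBubble, Equiv.swap_comm]
  · simp [fourGraph, insDipole, swapAt, addBubble, h]

theorem graphComps_fourGraph_le {C : Finset (Fin D)} (h1 : C ≠ ∅) (h2 : C ≠ Finset.univ) :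
    graphComps (fourGraph C) ≤ 1 := by
  obtain ⟨c₁, hc₁⟩ := Finset.nonempty_iff_ne_empty.2 h1
  obtain ⟨c₂, hc₂⟩ : ∃ c, c ∉ C := by
    by_contra! h
    exact h2 (Finset.eq_univ_of_forall h)
  refine finrank_le_one (⟨(fun _ => 1, fun _ => 1), fun _ _ => rfl⟩ : graphSpace (fourGraph C))
    fun f => ⟨f.1.1 none, ?_⟩
  have hf := f.2
  rw [mem_graphSpace] at hf
  have e1 := hf c₁ none
  have e2 := hf c₁ (some ())
  have e3 := hf c₂ none
  have e4 := hf c₂ (some ())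
  simp only [fourGraph, hc₁, hc₂, if_true, if_false, Equiv.swap_apply_left, Equiv.swap_apply_right,
    Equiv.Perm.one_apply] at e1 e2 e3 e4
  ext x
  · rcases x with _ | x
    · simp
    · simp only [Submodule.coe_smul, Prod.smul_fst, Pi.smul_apply, smul_eq_mul, mul_one]
      exact e3.symm.trans e2
  · rcases x with _ | x
    · simp [e3]
    · simp only [Submodule.coe_smul, Prod.smul_snd, Pi.smul_apply, smul_eq_mul, mul_one]
      exact e1.symm

variable {I : Type*} [Fintype I] {B : I → ColoredGraph D} (t : I → ℂ)

/-- The contractions of the 4-point cumulant, as sequences indexed by `N - 1`. -/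
noncomputable def fourSeq (B : I → ColoredGraph D) (t : I → ℂ) (C : Finset (Fin D)) :
    ℕ → PowerSeries ℂ := fun k => fourTrace B t (k + 1) C

/-- The expectation of the two-vertex bubble, as a sequence indexed by `N - 1`. -/
noncomputable def bareSeq (B : I → ColoredGraph D) (t : I → ℂ) : ℕ → PowerSeries ℂ :=
  graphExp B t fun _ : Fin D => (1 : Equiv.Perm Unit)

theorem fourSeq_eq (hB : ∀ i, 2 ≤ (B i).p) (C : Finset (Fin D)) : fourSeq B t C =
    graphExp B t (fourGraph C) - powN (-C.card) * bareSeq B t ^ 2 -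
      powN (C.card - D) * bareSeq B t ^ 2 := by
  funext k
  have hcard := C.card_le_univ
  rw [Fintype.card_fin] at hcard
  have h1 := zpow_natCast_sub (k := k) hcard
  have h2 : ((k : ℂ) + 1) ^ (-(C.card : ℤ)) = (((k + 1 : ℕ) : ℂ) ^ C.card)⁻¹ := by
    rw [zpow_neg, zpow_natCast]
    push_cast
    rfl
  rw [fourSeq, fourTrace_eq t hB (Nat.le_add_left 1 k) C]
  simp only [Pi.sub_apply, Pi.mul_apply, Pi.pow_apply, powN, ← smul_eq_C_mul]
  rw [h1, h2, add_smul, sub_sub]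
  rfl

variable {τ : ∀ i, Equiv.Perm (Fin (B i).p)} (S : MelonicSeries B t τ)

/-- The 2-point function at next-to-leading order. -/
theorem bareSeq_sub_mem (hD : 3 ≤ D) (hB : ∀ i, 2 ≤ (B i).p)
    (hτ : ∀ i, IsMelonicPairing (B i) (τ i)) (n : ℕ) :
    bareSeq B t - (S.T • powN 1 + S.K • powN (3 - D)) ∈ orderBound n (2 - D) := by
  have h := graphExp_sub_main_mem t S hD hB hτ n _ (fun _ : Fin D => (1 : Equiv.Perm Unit)) rfl
    (isForest_one (by omega))
  have h1 : S.main (fun _ : Fin D => (1 : Equiv.Perm Unit)) =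
      S.T • powN 1 + S.K • powN (3 - D) := by
    rw [MelonicSeries.main, numOrbits_one, nloConst_one, MelonicSeries.nlo]
    simp only [Fintype.card_unit, pow_one, Nat.cast_one, one_mul, zero_mul, add_zero]
    rw [S.mul_U, one_mul, show (1 : ℤ) + 2 - D = 3 - D by ring]
  rw [h1, numOrbits_one] at h
  exact orderBound_mono le_rfl (by simp) h

theorem bareSeq_sub_mem' (hD : 3 ≤ D) (hB : ∀ i, 2 ≤ (B i).p)
    (hτ : ∀ i, IsMelonicPairing (B i) (τ i)) (n : ℕ) :
    bareSeq B t - S.T • powN 1 ∈ orderBound n (3 - D) := by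
  have h := Submodule.add_mem _ (orderBound_mono le_rfl (by linarith)
    (bareSeq_sub_mem t S hD hB hτ n)) (Submodule.smul_mem _ S.K (powN_mem n (3 - D)))
  convert h using 1
  abel

theorem bareSeq_mem (S : MelonicSeries B t τ) (hD : 3 ≤ D) (hB : ∀ i, 2 ≤ (B i).p)
    (hτ : ∀ i, IsMelonicPairing (B i) (τ i)) (n : ℕ) : bareSeq B t ∈ orderBound n 1 := by
  have hD' : (3 : ℤ) ≤ D := by exact_mod_cast hD
  have h := Submodule.add_mem _ (orderBound_mono (e' := 1) le_rfl (by linarith)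
    (bareSeq_sub_mem' t S hD hB hτ n)) (Submodule.smul_mem _ S.T (powN_mem n 1))
  rwa [sub_add_cancel] at h

theorem smul_powN_mul (A A' : PowerSeries ℂ) (a b : ℤ) :
    (A • powN a) * (A' • powN b) = (A * A') • powN (a + b) := by
  rw [smul_mul_smul_comm, powN_add]

theorem bareSeq_sq_sub_mem (hD : 3 ≤ D) (hB : ∀ i, 2 ≤ (B i).p)
    (hτ : ∀ i, IsMelonicPairing (B i) (τ i)) (n : ℕ) :
    bareSeq B t ^ 2 - (S.T ^ 2 • powN 2 + (2 * S.T * S.K) • powN (4 - D)) ∈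
      orderBound n (3 - D) := by
  have hD' : (3 : ℤ) ≤ D := by exact_mod_cast hD
  have h1 := bareSeq_sub_mem t S hD hB hτ n
  have h2 : S.T • powN 1 + S.K • powN (3 - D) ∈ orderBound n 1 :=
    Submodule.add_mem _ (Submodule.smul_mem _ _ (powN_mem n 1))
      (orderBound_mono le_rfl (by linarith) (Submodule.smul_mem _ _ (powN_mem n (3 - D))))
  have h3 := orderBound_mono (e' := 3 - D) le_rfl (by linarith) (mul_mem_orderBound h1
    (Submodule.add_mem _ (bareSeq_mem t S hD hB hτ n) h2))
  have h4 : (S.K * S.K) • powN ((3 - D) + (3 - D)) ∈ orderBound n (3 - D) :=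
    orderBound_mono le_rfl (by linarith) (Submodule.smul_mem _ _ (powN_mem n _))
  have h5 := Submodule.add_mem _ h3 h4
  convert h5 using 1
  have e1 : S.T ^ 2 • powN 2 = (S.T • powN 1) * (S.T • powN 1) := by
    rw [smul_powN_mul, ← pow_two]
    rfl
  have e2 : (2 * S.T * S.K) • powN (4 - D) =
      2 * ((S.T • powN 1) * (S.K • powN (3 - D))) := by
    rw [smul_powN_mul, show (1 : ℤ) + (3 - D) = 4 - D by ring, mul_assoc, ← smul_smul]
    funext k
    simp only [Pi.smul_apply, Pi.mul_apply, smul_eq_mul]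
    rfl
  rw [e1, e2, ← smul_powN_mul]
  ring

theorem bareSeq_sq_sub_mem' (hD : 3 ≤ D) (hB : ∀ i, 2 ≤ (B i).p)
    (hτ : ∀ i, IsMelonicPairing (B i) (τ i)) (n : ℕ) :
    bareSeq B t ^ 2 - S.T ^ 2 • powN 2 ∈ orderBound n (4 - D) := by
  have h := Submodule.add_mem _ (orderBound_mono le_rfl (by linarith)
    (bareSeq_sq_sub_mem t S hD hB hτ n))
    (Submodule.smul_mem _ (2 * S.T * S.K) (powN_mem n (4 - D)))
  convert h using 1
  abel

/-- The contraction of the 4-point cumulant along a melonic quartic bubble, at leading order. -/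
theorem fourSeq_singleton_sub_mem (hD : 3 ≤ D) (hB : ∀ i, 2 ≤ (B i).p)
    (hτ : ∀ i, IsMelonicPairing (B i) (τ i)) (n : ℕ) (c : Fin D) :
    fourSeq B t {c} - (S.M - S.T ^ 2) • powN (3 - D) ∈ orderBound n (2 - D) := by
  have hD' : (3 : ℤ) ≤ D := by exact_mod_cast hD
  have h1 := graphExp_sub_main_mem t S hD hB hτ n _ (fourGraph {c}) rfl
    (by rw [fourGraph_singleton, isForest_insDipole (by omega)]; exact isForest_one (by omega))
  have h2 : numOrbits (fourGraph {c}) = 1 := by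
    rw [fourGraph_singleton, numOrbits_insDipole]
    exact numOrbits_one
  have h3 : nloConst (fourGraph {c}) = 1 := by
    rw [fourGraph_singleton, nloConst_insDipole, nloConst_one, cycleLen_one, zero_add, Nat.cast_one]
  have h4 : S.main (fourGraph {c}) = S.T ^ 2 • powN 1 + (2 * S.T * S.K + S.M) • powN (3 - D) := by
    rw [MelonicSeries.main, h2, h3, MelonicSeries.nlo]
    have : Fintype.card (Option Unit) = 2 := rfl
    rw [this]
    congr 2
    push_cast
    linear_combination (2 * S.T * S.K + S.M * (S.T * S.U + 1)) * S.mul_U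
  rw [h4, h2] at h1
  have h5 := powN_mul_mem (e' := 2 - D) (-1) (bareSeq_sq_sub_mem t S hD hB hτ n) (by linarith)
  have h6 := powN_mul_mem (e' := 2 - D) (1 - D) (bareSeq_sq_sub_mem' t S hD hB hτ n) (by linarith)
  have h7 := Submodule.sub_mem _ (Submodule.sub_mem _
    (orderBound_mono (e' := 2 - D) le_rfl (by simp) h1) h5) h6
  convert h7 using 1
  rw [fourSeq_eq t hB, Finset.card_singleton]
  simp only [mul_sub, mul_add, mul_smul_comm, ← powN_add, Nat.cast_one]
  rw [show (-1 : ℤ) + 2 = 1 by ring, show (-1 : ℤ) + (4 - D) = 3 - D by ring,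
    show (1 : ℤ) - D + 2 = 3 - D by ring]
  simp only [sub_smul, add_smul]
  abel

/-- The connected part of the product of two two-vertex bubbles: the next-to-leading orders of the
expectation and of the square cancel. -/
theorem fourSeq_empty_mem (S : MelonicSeries B t τ) (hD : 3 ≤ D) (hB : ∀ i, 2 ≤ (B i).p)
    (hτ : ∀ i, IsMelonicPairing (B i) (τ i)) (n : ℕ) :
    graphExp B t (fourGraph (∅ : Finset (Fin D))) - bareSeq B t ^ 2 - powN (-D) * bareSeq B t ^ 2 ∈
      orderBound n (3 - D) := by
  have hD' : (3 : ℤ) ≤ D := by exact_mod_cast hD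
  have h1 := graphExp_sub_main_mem t S hD hB hτ n _ (fourGraph (∅ : Finset (Fin D))) rfl
    (by rw [fourGraph_empty]; exact isForest_one (by omega))
  have hcard : Fintype.card (Option Unit) = 2 := rfl
  have h2 : numOrbits (fourGraph (∅ : Finset (Fin D))) = 2 := by
    rw [fourGraph_empty]
    exact numOrbits_one
  have h3 : nloConst (fourGraph (∅ : Finset (Fin D))) = 0 := by
    rw [fourGraph_empty, nloConst_one]
  have h4 : S.main (fourGraph (∅ : Finset (Fin D))) =
      S.T ^ 2 • powN 2 + (2 * S.T * S.K) • powN (4 - D) := by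
    rw [MelonicSeries.main, h2, h3, MelonicSeries.nlo, hcard]
    congr 2
    · push_cast
      linear_combination (2 * S.T * S.K) * S.mul_U
  rw [h4, h2] at h1
  have hE := bareSeq_mem t S hD hB hτ n
  have h5 := powN_mul_mem (e' := 3 - D) (-D) (mul_mem_orderBound hE hE) (by linarith)
  have h6 := Submodule.sub_mem _ (Submodule.sub_mem _
    (orderBound_mono (e' := 3 - D) le_rfl (by push_cast; linarith) h1)
    (bareSeq_sq_sub_mem t S hD hB hτ n)) h5
  convert h6 using 1
  rw [pow_two]
  abel

theorem graphExp_fourGraph_univ :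
    graphExp B t (fourGraph (Finset.univ : Finset (Fin D))) =
      graphExp B t (fourGraph (∅ : Finset (Fin D))) := by
  -- the two black vertices are exchanged
  refine graphExp_eq_of_equiv t (Equiv.refl _) (Equiv.swap none (some ())) fun c v => ?_
  simp [fourGraph]

theorem directEdges_fourGraph_none (C : Finset (Fin D)) :
    (directEdges (fourGraph C) none : ℤ) = D - C.card := by
  have h : (Finset.univ.filter fun c => fourGraph C c none = none) = Cᶜ := by
    ext c
    rw [Finset.mem_filter]
    by_cases h : c ∈ C <;> simp [fourGraph, h]
  have hcard := C.card_le_univ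
  rw [Fintype.card_fin] at hcard
  rw [directEdges, h, Finset.card_compl, Fintype.card_fin, Nat.cast_sub hcard]

theorem directEdges_fourGraph_some (C : Finset (Fin D)) :
    directEdges (fourGraph C) (some ()) = C.card := by
  have h : (Finset.univ.filter fun c => fourGraph C c (some ()) = none) = C := by
    ext c
    rw [Finset.mem_filter]
    by_cases h : c ∈ C <;> simp [fourGraph, h]
  rw [directEdges, h]

/-- The fixed point equation for `T`, divided by `T`. -/
theorem MelonicSeries.U_eq {t : I → ℂ} (S : MelonicSeries B t τ) (hB : ∀ i, 2 ≤ (B i).p) :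
    1 - ∑ i, (B i).p * vertexWeight B t i * S.T ^ ((B i).p - 1) = S.U := by
  have h1 : ∑ i, (B i).p * vertexWeight B t i * S.T ^ (B i).p =
      S.T * ∑ i, (B i).p * vertexWeight B t i * S.T ^ ((B i).p - 1) := by
    rw [Finset.mul_sum]
    refine Finset.sum_congr rfl fun i _ => ?_
    have := hB i
    obtain ⟨q, hq⟩ : ∃ q, (B i).p = q + 1 := ⟨(B i).p - 1, by omega⟩
    rw [hq, Nat.add_sub_cancel, pow_succ]
    ring
  have h2 := S.T_eq
  rw [h1] at h2
  linear_combination S.U * h2 + (-1 + ∑ i, (B i).p * vertexWeight B t i * S.T ^ ((B i).p - 1)) *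
    S.mul_U

/-- Connected quartic bubbles: the first step of the loop equation produces the two ways to join
the vertices by 2-point functions, and the rest is a factor `T`. -/
theorem graphExp_fourGraph_sub_mem (hD : 3 ≤ D) (hB : ∀ i, 2 ≤ (B i).p)
    (hτ : ∀ i, IsMelonicPairing (B i) (τ i)) (n : ℕ) {C : Finset (Fin D)} (hC₁ : C ≠ ∅)
    (hC₂ : C ≠ Finset.univ) :
    graphExp B t (fourGraph C) - S.T • ((powN (1 - C.card) + powN (1 - D + C.card)) *
      bareSeq B t) ∈ orderBound n (3 - D) := by
  have hcomp := graphComps_fourGraph_le hC₁ hC₂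
  have h1 := graphExp_loop t τ (by omega) hB (fourGraph C)
  have h2 : ∀ x, graphExp B t (contract (fourGraph C) x) = bareSeq B t := fun x => by
    rw [bareSeq]
    congr 1
  rw [Fintype.sum_option, Finset.univ_unique, Finset.sum_singleton, h2, h2,
    directEdges_fourGraph_none, PUnit.default_eq_unit, directEdges_fourGraph_some,
    show (1 : ℤ) - D + (D - C.card) = 1 - C.card by ring, ← add_mul] at h1
  -- gluing an interaction bubble multiplies by `T ^ (p - 1)` at this order, so that the loop
  -- equation becomes a linear equation for `E`, with the coefficient `U = 1 / T`
  have h3 : ∀ i, ∀ x : Fin (B i).p, graphExp B t (glue (fourGraph C) (rootAt (core τ i) x)) -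
      S.T ^ ((B i).p - 1) • graphExp B t (fourGraph C) ∈ orderBound n (3 - D) := by
    intro i x
    have h : IsTree (rootAt (core τ i) x) := isTree_rootAt (hτ i) x
    rw [← graft_glueForest]
    refine graphExp_graft_sub_mem t S hD hB hτ hcomp n _ _ ?_
      (isRootedForest_glueForest (by omega) _ h.isForest h.connected)
    rw [Fintype.card_subtype_compl, Fintype.card_subtype_eq, Fintype.card_fin]
  set E := graphExp B t (fourGraph C) with hE
  have h4 : S.U • E - (powN (1 - C.card) + powN (1 - D + C.card)) * bareSeq B t ∈
      orderBound n (3 - D) := by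
    have h5 : ∑ i, vertexWeight B t i • ∑ x : Fin (B i).p,
        (graphExp B t (glue (fourGraph C) (rootAt (core τ i) x)) - S.T ^ ((B i).p - 1) • E) ∈
        orderBound n (3 - D) :=
      Submodule.sum_mem _ fun i _ => Submodule.smul_mem _ _ (Submodule.sum_mem _ fun x _ => h3 i x)
    convert h5 using 1
    have h6 : ∀ i, vertexWeight B t i • ∑ x : Fin (B i).p,
        (graphExp B t (glue (fourGraph C) (rootAt (core τ i) x)) - S.T ^ ((B i).p - 1) • E) =
        vertexWeight B t i • ∑ x : Fin (B i).p,
          graphExp B t (glue (fourGraph C) (rootAt (core τ i) x)) -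
        ((B i).p * vertexWeight B t i * S.T ^ ((B i).p - 1)) • E := by
      intro i
      rw [Finset.sum_sub_distrib, smul_sub, Finset.sum_const, Finset.card_univ, Fintype.card_fin,
        ← Nat.cast_smul_eq_nsmul (PowerSeries ℂ), smul_smul, smul_smul]
      congr 2
      ring
    rw [Finset.sum_congr rfl fun i _ => h6 i, Finset.sum_sub_distrib, ← Finset.sum_smul,
      ← S.U_eq hB, sub_smul, one_smul]
    nth_rewrite 1 [h1]
    abel
  have h7 := Submodule.smul_mem _ S.T h4
  rwa [smul_sub, smul_smul, S.mul_U, one_smul] at h7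

/-- All contractions of the 4-point cumulant are `O(N^{3-D})`. -/
theorem fourSeq_mem (S : MelonicSeries B t τ) (hD : 3 ≤ D) (hB : ∀ i, 2 ≤ (B i).p)
    (hτ : ∀ i, IsMelonicPairing (B i) (τ i)) (n : ℕ) (C : Finset (Fin D)) :
    fourSeq B t C ∈ orderBound n (3 - D) := by
  have hD' : (3 : ℤ) ≤ D := by exact_mod_cast hD
  by_cases hC₁ : C = ∅
  · subst hC₁
    have h := fourSeq_empty_mem t S hD hB hτ n
    rw [fourSeq_eq t hB, Finset.card_empty]
    simpa [powN_zero] using h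
  by_cases hC₂ : C = Finset.univ
  · subst hC₂
    have h := fourSeq_empty_mem t S hD hB hτ n
    rw [fourSeq_eq t hB, Finset.card_univ, Fintype.card_fin, graphExp_fourGraph_univ, sub_self,
      powN_zero, one_mul, sub_right_comm]
    exact h
  have hpos : (1 : ℤ) ≤ C.card := by
    exact_mod_cast Finset.card_pos.2 (Finset.nonempty_iff_ne_empty.2 hC₁)
  have hlt : (C.card : ℤ) + 1 ≤ D := by
    have := Finset.card_lt_univ_of_notMem
      (not_forall.1 fun h => hC₂ (Finset.eq_univ_of_forall h)).choose_spec
    rw [Fintype.card_fin] at this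
    exact_mod_cast this
  have h1 := graphExp_fourGraph_sub_mem t S hD hB hτ n hC₁ hC₂
  have h2 := mul_mem_orderBound (bareSeq_sub_mem' t S hD hB hτ n) (bareSeq_mem t S hD hB hτ n)
  have h3 := powN_mul_mem (e' := 3 - D) (-C.card) h2 (by linarith)
  have h4 := powN_mul_mem (e' := 3 - D) (C.card - D) h2 (by linarith)
  have h5 := Submodule.sub_mem _ (Submodule.sub_mem _ h1 h3) h4
  convert h5 using 1
  rw [fourSeq_eq t hB]
  simp only [mul_sub, sub_mul, smul_mul_assoc, mul_smul_comm, ← mul_assoc, ← powN_add, add_mul,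
    smul_add]
  rw [show -(C.card : ℤ) + 1 = 1 - C.card by ring, show (C.card : ℤ) - D + 1 = 1 - D + C.card by ring]
  simp only [mul_assoc, ← pow_two]
  abel

theorem isBigO_coeff_pred {n : ℕ} {e : ℤ} {f : ℕ → PowerSeries ℂ} (hf : f ∈ orderBound (n + 1) e) :
    (fun N : ℕ => coeff n (f (N - 1))) =O[atTop] fun N : ℕ => (N : ℝ) ^ e := by
  refine ((hf n (Nat.lt_succ_self n)).comp_tendsto (tendsto_sub_atTop_nat 1)).congr'
    EventuallyEq.rfl ?_
  filter_upwards [eventually_ge_atTop 1] with N hN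
  have : ((N - 1 : ℕ) : ℝ) + 1 = N := by exact_mod_cast Nat.sub_add_cancel hN
  simp only [Function.comp_apply, this]

theorem inv_isBigO_sub (D : ℕ) : (fun N : ℕ => ((1 - ((N : ℂ)⁻¹) ^ 2) ^ D)⁻¹ - 1) =O[atTop]
    fun N : ℕ => (N : ℝ)⁻¹ := by
  -- differentiability in `1 / N` at `0`
  have h1 : DifferentiableAt ℂ (fun x : ℂ => ((1 - x ^ 2) ^ D)⁻¹) 0 := by
    refine DifferentiableAt.inv (by fun_prop) (by simp)
  have h2 : Tendsto (fun N : ℕ => ((N : ℂ))⁻¹) atTop (nhds 0) :=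
    tendsto_inv_atTop_nhds_zero_nat
  have h3 := h1.isBigO_sub.comp_tendsto h2
  refine (h3.congr_left fun N => ?_).trans (IsBigO.of_norm_right ?_)
  · simp
  · refine IsBigO.of_bound 1 (Eventually.of_forall fun N => ?_)
    simp

theorem inv_isBigO_one (D : ℕ) : (fun N : ℕ => ((1 - ((N : ℂ)⁻¹) ^ 2) ^ D)⁻¹) =O[atTop]
    fun _ : ℕ => (1 : ℝ) := by
  have h1 := (inv_isBigO_sub D).trans (g := fun N : ℕ => (N : ℝ)⁻¹) (k := fun _ : ℕ => (1 : ℝ))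
    ((tendsto_inv_atTop_nhds_zero_nat (𝕜 := ℝ)).isBigO_one ℝ)
  refine (h1.add (isBigO_const_const (1 : ℂ) (one_ne_zero (α := ℝ)) atTop)).congr_left fun N => ?_
  ring

/-- The weights of the off-diagonal terms lose a factor `N` for each colour in which the bubbles
differ, hence at least one. -/
theorem prod_ite_isBigO {D : ℕ} {C C' : Finset (Fin D)} (h : C' ≠ C) :
    (fun N : ℕ => ∏ c, if (c ∈ C' ↔ c ∈ C) then (N : ℂ) ^ 2 else -N) =O[atTop]
      fun N : ℕ => (N : ℝ) ^ (2 * D - 1 : ℤ) := by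
  obtain ⟨c, hc⟩ : ∃ c, ¬(c ∈ C' ↔ c ∈ C) := by
    by_contra! hcon
    exact h (Finset.ext hcon)
  refine IsBigO.of_bound 1 ?_
  filter_upwards [eventually_ge_atTop 1] with N hN
  have hN' : (1 : ℝ) ≤ N := by exact_mod_cast hN
  rw [one_mul, ← Finset.mul_prod_erase _ _ (Finset.mem_univ c), if_neg hc, norm_mul, norm_neg,
    Complex.norm_natCast, Real.norm_of_nonneg (by positivity), norm_prod]
  have h1 : ∏ c ∈ Finset.univ.erase c, ‖if (c ∈ C' ↔ c ∈ C) then (N : ℂ) ^ 2 else -N‖ ≤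
      ∏ c ∈ (Finset.univ : Finset (Fin D)).erase c, (N : ℝ) ^ 2 := by
    refine Finset.prod_le_prod (fun _ _ => norm_nonneg _) fun c' _ => ?_
    split_ifs
    · simp
    · rw [norm_neg, Complex.norm_natCast]
      nlinarith
  have hD : 1 ≤ D := c.pos
  rw [Finset.prod_const, Finset.card_erase_of_mem (Finset.mem_univ c), Finset.card_univ,
    Fintype.card_fin] at h1
  refine (mul_le_mul_of_nonneg_left h1 (by positivity)).trans_eq ?_
  rw [← pow_mul, ← pow_succ', ← zpow_natCast]
  congr 1
  push_cast [hD]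
  ring

/-- The leading order of the coefficients of the 4-point cumulant on the melonic quartic bubbles. -/
theorem hasLOExpansion_fourPoint (hD : 3 ≤ D) (hB : ∀ i, 2 ≤ (B i).p)
    (hτ : ∀ i, IsMelonicPairing (B i) (τ i)) {W : ℕ → Finset (Fin D) → PowerSeries ℂ}
    (hW : ∀ N, 2 ≤ N → IsInvariantExpansion B t N (W N)) (c : Fin D) :
    HasLOExpansion (fun N => ((N : ℂ) ^ (3 * (D - 1))) • W N {c}) (S.M - S.T ^ 2) := by
  intro n
  set v : ℕ → ℂ := fun N => ((1 - ((N : ℂ)⁻¹) ^ 2) ^ D)⁻¹ with hv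
  set s : Finset (Fin D) → ℕ → ℂ := fun C' N =>
    ∏ c', if (c' ∈ C' ↔ c' ∈ ({c} : Finset (Fin D))) then (N : ℂ) ^ 2 else -N with hs
  set Y : Finset (Fin D) → ℕ → ℂ := fun C' N => coeff n (fourSeq B t C' (N - 1)) with hY
  have hYO : ∀ C', Y C' =O[atTop] fun N : ℕ => (N : ℝ) ^ (3 - D : ℤ) := fun C' =>
    isBigO_coeff_pred (fourSeq_mem t S hD hB hτ (n + 1) C')
  have hYc : (fun N : ℕ => Y {c} N - coeff n (S.M - S.T ^ 2) * (N : ℂ) ^ (3 - D : ℤ)) =O[atTop]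
      fun N : ℕ => (N : ℝ) ^ (2 - D : ℤ) := by
    refine (isBigO_coeff_pred (fourSeq_singleton_sub_mem t S hD hB hτ (n + 1) c)).congr' ?_
      EventuallyEq.rfl
    filter_upwards [eventually_ge_atTop 1] with N hN
    have : ((N - 1 : ℕ) : ℂ) + 1 = N := by exact_mod_cast Nat.sub_add_cancel hN
    simp only [hY, Pi.sub_apply, Pi.smul_apply, powN, smul_eq_mul, map_sub, coeff_mul_C, this]
  -- the inversion formula, split into the dominant contraction along `{c}`, the deviation of the
  -- normalization from `1`, and the contractions along the other bubbles
  have hmain : (fun N : ℕ => coeff n (((N : ℂ) ^ (3 * (D - 1))) • W N {c}) -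
      coeff n (S.M - S.T ^ 2)) =ᶠ[atTop] fun N : ℕ =>
      v N * ((N : ℂ) ^ (D - 3 : ℤ) * (Y {c} N - coeff n (S.M - S.T ^ 2) * (N : ℂ) ^ (3 - D : ℤ))) +
      (v N - 1) * coeff n (S.M - S.T ^ 2) +
      ∑ C' ∈ Finset.univ.erase {c}, v N * ((N : ℂ) ^ (-D - 3 : ℤ) * (s C' N * Y C' N)) := by
    filter_upwards [eventually_ge_atTop 2] with N hN
    have hN0 : (N : ℂ) ≠ 0 := by exact_mod_cast (by omega : N ≠ 0)
    have h1 := congrArg (coeff n) (sum_fourTrace t (hW N hN) {c})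
    have h2 : ∀ C', fourTrace B t N C' = fourSeq B t C' (N - 1) := fun C' => by
      rw [fourSeq, Nat.sub_add_cancel (by omega)]
    simp only [h2, map_sum, map_smul, smul_eq_mul] at h1
    change ∑ C', s C' N * Y C' N = _ at h1
    have h3 : (1 - ((N : ℂ)⁻¹) ^ 2) ^ D ≠ 0 := by
      refine pow_ne_zero _ ?_
      have : (N : ℂ) ^ 2 ≠ 1 := by
        norm_cast
        nlinarith
      field_simp
      exact div_ne_zero (sub_ne_zero.2 this) (pow_ne_zero 2 hN0)
    have h4 : ((N : ℂ) ^ 4 - N ^ 2) ^ D = N ^ (4 * D) * (1 - ((N : ℂ)⁻¹) ^ 2) ^ D := by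
      rw [pow_mul, ← mul_pow]
      congr 1
      field_simp
    have h5 : v N * (1 - ((N : ℂ)⁻¹) ^ 2) ^ D = 1 := inv_mul_cancel₀ h3
    have h6 : (N : ℂ) ^ (-D - 3 : ℤ) * N ^ (4 * D) = N ^ (3 * (D - 1)) := by
      rw [← zpow_natCast, ← zpow_natCast, ← zpow_add₀ hN0]
      congr 1
      push_cast [show 1 ≤ D by omega]
      ring
    have h7 : s {c} N = (N : ℂ) ^ (2 * D) := by
      simp [hs, ← pow_mul]
    have h8 : (N : ℂ) ^ (-D - 3 : ℤ) * N ^ (2 * D) = N ^ (D - 3 : ℤ) := by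
      rw [← zpow_natCast, ← zpow_add₀ hN0]
      congr 1
      push_cast
      ring
    have h9 : (N : ℂ) ^ (D - 3 : ℤ) * N ^ (3 - D : ℤ) = 1 := by
      rw [← zpow_add₀ hN0]
      simp
    rw [h4, ← Finset.add_sum_erase _ _ (Finset.mem_univ {c}), h7] at h1
    rw [← Finset.mul_sum, ← Finset.mul_sum, map_smul, smul_eq_mul, ← h6]
    linear_combination (-(v N * (N : ℂ) ^ (-D - 3 : ℤ))) * h1 -
      (N : ℂ) ^ (-D - 3 : ℤ) * N ^ (4 * D) * coeff n (W N {c}) * h5 +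
      v N * Y {c} N * h8 + v N * coeff n (S.M - S.T ^ 2) * h9
  refine IsBigO.congr' ?_ hmain.symm EventuallyEq.rfl
  have hzpow : ∀ (e : ℤ), (fun N : ℕ => (N : ℂ) ^ e) =O[atTop] fun N : ℕ => (N : ℝ) ^ e :=
    fun e => IsBigO.of_bound 1 (Eventually.of_forall fun N => by simp)
  have hprod : ∀ {f g : ℕ → ℂ} {a b : ℤ}, f =O[atTop] (fun N : ℕ => (N : ℝ) ^ a) →
      g =O[atTop] (fun N : ℕ => (N : ℝ) ^ b) →
      (fun N => f N * g N) =O[atTop] fun N : ℕ => (N : ℝ) ^ (a + b) := by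
    intro f g a b hf hg
    refine (hf.mul hg).congr' EventuallyEq.rfl ?_
    filter_upwards [eventually_ge_atTop 1] with N hN
    rw [zpow_add₀ (by exact_mod_cast (by omega : N ≠ 0))]
  have hv0 : v =O[atTop] fun N : ℕ => (N : ℝ) ^ (0 : ℤ) :=
    (inv_isBigO_one D).congr_right fun N => by simp
  have hgoal : (fun N : ℕ => (N : ℝ)⁻¹) = fun N : ℕ => (N : ℝ) ^ (-1 : ℤ) := by
    funext N
    simp
  rw [hgoal]
  refine ((?_ : _ =O[atTop] _).add ?_).add ?_
  · have := hprod hv0 (hprod (hzpow (D - 3)) hYc)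
    rwa [show (0 : ℤ) + (D - 3 + (2 - D)) = -1 by ring] at this
  · rw [← hgoal]
    simpa only [mul_comm] using (inv_isBigO_sub D).const_mul_left (coeff n (S.M - S.T ^ 2))
  · refine (IsBigO.sum (s := Finset.univ.erase {c}) (A := fun C' N => v N *
      ((N : ℂ) ^ (-D - 3 : ℤ) * (s C' N * Y C' N))) fun C' hC' => ?_).congr_left fun N => ?_
    · have := hprod hv0 (hprod (hzpow (-D - 3))
        (hprod (prod_ite_isBigO (Finset.ne_of_mem_erase hC')) (hYO C')))
      rwa [show (0 : ℤ) + (-D - 3 + (2 * D - 1 + (3 - D))) = -1 by ring] at this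
    · rw [Finset.sum_apply]

end FourPointExpansion

end TensorModel

namespace TensorModel

/-! ### Schwinger–Dyson equations -/

section SchwingerDyson

open PowerSeries ColoredGraph

variable {D N : ℕ} {I : Type*} [Fintype I] {B : I → ColoredGraph D} (t : I → ℂ)

theorem tracePoly_twoVertex {V : Type*} [Fintype V] [DecidableEq V] [Unique V] :
    tracePoly N (fun _ : Fin D => (1 : Equiv.Perm V)) = tracePoly N (twoVertex D).adj :=
  tracePoly_relabel (W := Fin 1) (Equiv.ofUnique V (Fin 1)) (Equiv.ofUnique V (Fin 1))
    fun _ _ => rfl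

theorem tracePoly_insertDipole (G : ColoredGraph D) (c : Fin D) (v : Fin G.p) :
    tracePoly N (G.insertDipole c v).adj = tracePoly N (insDipole G.adj c v) :=
  (tracePoly_relabel (W := Fin (G.p + 1)) finSuccEquivLast.symm finSuccEquivLast.symm
    (insertDipole_adj_apply G c v)).symm

/-- The loop equation of an isolated bubble added to the empty graph. -/
theorem schwingerDyson_twoVertex (hB : ∀ i, 2 ≤ (B i).p) (hD : 1 ≤ D) (hN : 1 ≤ N) :
    (N : ℂ) • (1 : PowerSeries ℂ) - expectation B t N (traceInvariant (twoVertex D)) +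
      ∑ i, t i • (X ^ ((B i).p - 1) * expectation B t N (traceInvariant (B i))) = 0 := by
  have h := loop_equation_addBubble t hB hN hD (fun i => rfl) fun _ : Fin D =>
    (1 : Equiv.Perm Empty)
  have h1 : addBubble (fun _ : Fin D => (1 : Equiv.Perm Empty)) = fun _ => 1 := by
    funext c
    exact Equiv.optionCongr_refl
  have h2 : ∀ i, tracePoly N (graphSum (fun _ : Fin D => (1 : Equiv.Perm Empty)) (B i).adj) =
      tracePoly N (B i).adj := fun i => by
    rw [tracePoly_graphSum, tracePoly_of_isEmpty, one_mul]
  have : Unique (Option Empty) := ⟨⟨none⟩, fun x => by rcases x with _ | x; exacts [rfl, x.elim]⟩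
  rw [h1, tracePoly_twoVertex (V := Option Empty),
    tracePoly_of_isEmpty fun _ : Fin D => (1 : Equiv.Perm Empty), expect_one] at h
  simp only [h2, Fintype.card_empty, Nat.cast_zero, zero_mul, add_zero] at h
  simp only [expectation_traceInvariant B t hN]
  rw [h]
  abel

/-- The loop equation of a dipole inserted in the two-vertex bubble. -/
theorem schwingerDyson_quartic (hB : ∀ i, 2 ≤ (B i).p) (hD : 2 ≤ D) (hN : 1 ≤ N) (c : Fin D) :
    (1 + ((N : ℂ) ^ (D - 2))⁻¹) • expectation B t N (traceInvariant (twoVertex D)) -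
        expectation B t N (traceInvariant (quartic c)) +
      ∑ i, (t i / (B i).p) • (X ^ ((B i).p - 1) *
        ∑ v, expectation B t N (traceInvariant ((B i).insertDipole c v))) = 0 := by
  have h := loop_equation_insDipole t hB hN hD (fun i => rfl) (V := Fin 1) (twoVertex D).adj c 0
  have h1 : ∀ i (x : Fin (B i).p),
      tracePoly N (swapAt (graphSum (V := Fin 1) (twoVertex D).adj (B i).adj) c (Sum.inl 0)
        (Sum.inr x)) = tracePoly N (insDipole (B i).adj c x) := by
    intro i x
    set e : Fin 1 ⊕ Fin (B i).p ≃ Option (Fin (B i).p) :=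
      { toFun := Sum.elim (fun _ => none) some
        invFun := fun y => y.elim (Sum.inl 0) Sum.inr
        left_inv := by
          rintro (y | y)
          · rw [Subsingleton.elim y 0]
            rfl
          · rfl
        right_inv := by rintro (_ | y) <;> rfl } with he
    have h2 : ∀ c' y, addBubble (B i).adj c' (e y) =
        e (graphSum (V := Fin 1) (twoVertex D).adj (B i).adj c' y) := by
      rintro c' (y | y) <;> rfl
    refine tracePoly_relabel e e fun c' y => ?_
    by_cases hc : c' = c
    · subst hc
      simp only [insDipole, swapAt, if_true, Equiv.Perm.mul_apply]
      rw [← h2, Equiv.swap_comm (Sum.inl 0), ← e.injective.swap_apply]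
      rfl
    · simp only [insDipole, swapAt, if_neg hc]
      exact h2 c' y
  have h3 : tracePoly N (insDipole (V := Fin 1) (twoVertex D).adj c 0) =
      tracePoly N (quartic c).adj := (tracePoly_insertDipole (twoVertex D) c (0 : Fin 1)).symm
  have h4 : (Finset.univ : Finset (Fin 1)).erase 0 = ∅ := by decide
  rw [h3, h4, Finset.sum_empty, add_zero] at h
  simp only [h1, ← tracePoly_insertDipole] at h
  simp only [expectation_traceInvariant B t hN]
  have key : ∀ a b q : PowerSeries ℂ, q = a + b → a - q + b = 0 := by
    rintro a b q rfl
    ring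
  exact key _ _ _ h

end SchwingerDyson

/-! ### The next-to-leading order -/

section Solution

open PowerSeries ColoredGraph Filter Asymptotics

variable {D : ℕ} {I : Type*} [Fintype I] {B : I → ColoredGraph D} (t : I → ℂ)
  {τ : ∀ i, Equiv.Perm (Fin (B i).p)}

/-- By symmetry, the colours of the interaction have the same weight. -/
theorem sum_cycleSq_eq (hD : 3 ≤ D) (hτ : ∀ i, IsMelonicPairing (B i) (τ i))
    (hsym : IsColorSymmetric B t) (T : PowerSeries ℂ) (c c' : Fin D) :
    ∑ i, vertexWeight B t i * cycleSq (core τ i c) * T ^ (B i).p =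
      ∑ i, vertexWeight B t i * cycleSq (core τ i c') * T ^ (B i).p := by
  obtain ⟨ε, hε⟩ := hsym (Equiv.swap c c')
  rw [← Equiv.sum_comp ε]
  refine Finset.sum_congr rfl fun i _ => ?_
  obtain ⟨h1, h2⟩ := cycleSq_of_iso_relabel hD (hτ i) (hτ (ε i)) (hε i).2 c
  rw [Equiv.swap_apply_left] at h2
  have h3 : cycleSq (core τ (ε i) c) = cycleSq (core τ i c') := h2
  rw [h3, vertexWeight, vertexWeight, (hε i).1, h1]

/-- After division by `T`, the equations for `M` and `K` are linear with coefficients divisible by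
`z`, hence solvable; the equation for `M` does not depend on the colour by symmetry. -/
theorem exists_melonicSeries (hD : 3 ≤ D) (hB : ∀ i, 2 ≤ (B i).p)
    (hτ : ∀ i, IsMelonicPairing (B i) (τ i)) (hsym : IsColorSymmetric B t) :
    Nonempty (MelonicSeries B t τ) := by
  obtain ⟨T, hT, -⟩ := existsUnique_leadingOrder (fun i => (B i).p) t hB
  have hX : ∀ (i) (F : PowerSeries ℂ), constantCoeff (vertexWeight B t i * F) = 0 := fun i F => by
    rw [map_mul, X_dvd_iff.1 (X_dvd_vertexWeight t hB i), zero_mul]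
  have hT' : T = 1 + ∑ i, (B i).p * vertexWeight B t i * T ^ (B i).p := by
    nth_rewrite 1 [hT]
    simp only [natCast_mul_vertexWeight t hB, smul_mul_assoc]
  have hT0 : constantCoeff T = 1 := by
    rw [hT', map_add, map_sum, map_one, Finset.sum_eq_zero, add_zero]
    intro i _
    rw [mul_comm ((B i).p : PowerSeries ℂ), mul_assoc, hX]
  have hU : T * T⁻¹ = 1 := PowerSeries.mul_inv_cancel T (by rw [hT0]; exact one_ne_zero)
  set c₀ : Fin D := ⟨0, by omega⟩
  set Q : PowerSeries ℂ := ∑ i, vertexWeight B t i * cycleSq (core τ i c₀) * T ^ (B i).p with hQ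
  have hQ0 : constantCoeff (1 - T⁻¹ * Q) = 1 := by
    rw [map_sub, map_one, map_mul, hQ, map_sum, Finset.sum_eq_zero, mul_zero, sub_zero]
    intro i _
    rw [mul_assoc, hX]
  have hQ1 := PowerSeries.mul_inv_cancel (1 - T⁻¹ * Q) (by rw [hQ0]; exact one_ne_zero)
  set M : PowerSeries ℂ := T * (1 - T⁻¹ * Q)⁻¹ with hM
  set P : PowerSeries ℂ := ∑ i, (B i).p * vertexWeight B t i * ((B i).p * T ^ (B i).p) with hP
  set A : PowerSeries ℂ := ∑ i, (B i).p * vertexWeight B t i * ((B i).alpha * T ^ (B i).p) with hA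
  have hP0 : constantCoeff (1 - T⁻¹ * P) = 1 := by
    rw [map_sub, map_one, map_mul, hP, map_sum, Finset.sum_eq_zero, mul_zero, sub_zero]
    intro i _
    rw [mul_comm ((B i).p : PowerSeries ℂ), mul_assoc, hX]
  have hP1 := PowerSeries.mul_inv_cancel (1 - T⁻¹ * P) (by rw [hP0]; exact one_ne_zero)
  refine ⟨⟨T, T⁻¹, M, T⁻¹ ^ 2 * M * A * (1 - T⁻¹ * P)⁻¹, hU, hT', fun c => ?_, ?_⟩⟩
  · rw [sum_cycleSq_eq t hD hτ hsym T c c₀, ← hQ, hM]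
    linear_combination T * hQ1
  · have h1 : ∀ K : PowerSeries ℂ, ∑ i, (B i).p * vertexWeight B t i *
        ((B i).p * T ^ (B i).p * T⁻¹ * K + (B i).alpha * T ^ (B i).p * T⁻¹ ^ 2 * M) =
        P * T⁻¹ * K + A * T⁻¹ ^ 2 * M := by
      intro K
      simp only [hP, hA, Finset.sum_mul]
      rw [← Finset.sum_add_distrib]
      exact Finset.sum_congr rfl fun i _ => by ring
    rw [h1]
    linear_combination (T⁻¹ ^ 2 * M * A) * hP1

variable {t} (S : MelonicSeries B t τ)

theorem MelonicSeries.constantCoeff_T (hB : ∀ i, 2 ≤ (B i).p) : constantCoeff S.T = 1 := by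
  rw [S.T_eq, map_add, map_sum, map_one, Finset.sum_eq_zero, add_zero]
  intro i _
  rw [map_mul, map_mul, X_dvd_iff.1 (X_dvd_vertexWeight t hB i), mul_zero, zero_mul]

theorem MelonicSeries.inv_T (hB : ∀ i, 2 ≤ (B i).p) : S.T⁻¹ = S.U := by
  have h := PowerSeries.mul_inv_cancel S.T (by rw [S.constantCoeff_T hB]; exact one_ne_zero)
  linear_combination S.U * h - S.T⁻¹ * S.mul_U

theorem MelonicSeries.leadingOrder (hB : ∀ i, 2 ≤ (B i).p) :
    1 - S.T + ∑ i, t i • (X ^ ((B i).p - 1) * S.T ^ (B i).p) = 0 := by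
  have h := S.T_eq
  simp only [natCast_mul_vertexWeight t hB, smul_mul_assoc] at h
  linear_combination -h

/-- The linear system for the next-to-leading orders and its solution, written with the sums
`L`, `A` and `Q` of the monomials `z^{pᵢ-1} T^{pᵢ}` with the weights `tᵢ`, `tᵢ αᵢ` and
`tᵢ sᵢ / pᵢ`, where `βᵢ = pᵢ αᵢ + sᵢ`. -/
theorem MelonicSeries.solution (hD : 3 ≤ D) (hB : ∀ i, 2 ≤ (B i).p)
    (hτ : ∀ i, IsMelonicPairing (B i) (τ i)) (c : Fin D) :
    Matrix.mulVec
        !![-singularFactor B t S.T,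
            ∑ i, (t i * (B i).alphaPrime) • (X ^ ((B i).p - 1) * S.T ^ ((B i).p - 2));
           -singularFactor B t S.T,
            S.T⁻¹ * (-1 + ∑ i, (t i * ((B i).betaPrime c / (B i).p)) •
              (X * S.T) ^ ((B i).p - 1))]
        ![S.K, S.M - S.T ^ 2]
      = ![-∑ i, (t i * (B i).alpha) • (X ^ ((B i).p - 1) * S.T ^ (B i).p),
          ∑ i, (t i * (((B i).p - (B i).beta c) / (B i).p)) •
            (X ^ ((B i).p - 1) * S.T ^ (B i).p)] ∧
    S.K = S.T * (singularFactor B t S.T)⁻¹ *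
      (((1 - ∑ i, (t i * (B i).betaPrime c / (B i).p) • (X * S.T) ^ ((B i).p - 1))
            * (∑ i, (t i * (B i).alpha) • (X ^ ((B i).p - 1) * S.T ^ (B i).p))
          - ∑ i, ∑ j,
              (t i * t j * (B i).alphaPrime * ((B j).p - (B j).beta c) / (B j).p) •
              (X ^ ((B i).p + (B j).p - 2) * S.T ^ ((B i).p + (B j).p - 1)))
        * (denominator B t S.T c)⁻¹) ∧
    S.M - S.T ^ 2 = (∑ i, (t i * ((B i).beta c / (B i).p - ((B i).alpha + 1))) •
        (X ^ ((B i).p - 1) * S.T ^ ((B i).p + 2))) * (denominator B t S.T c)⁻¹ := by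
  have hp0 : ∀ i, ((B i).p : ℂ) ≠ 0 := fun i => by
    have := hB i
    exact_mod_cast (by omega : (B i).p ≠ 0)
  have hbeta : ∀ i, ((B i).beta c : ℂ) = (B i).p * (B i).alpha + cycleSq (core τ i c) := fun i => by
    exact_mod_cast beta_eq hD (hτ i) c
  have hT0 := S.constantCoeff_T hB
  have hU := S.mul_U
  -- all sums of the statement are combinations of these monomials, up to powers of `U = 1 / T`
  set m : I → PowerSeries ℂ := fun i => X ^ ((B i).p - 1) * S.T ^ (B i).p with hm
  have hm1 : ∀ i, (X * S.T) ^ ((B i).p - 1) = S.U * m i := fun i => by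
    obtain ⟨q, hq⟩ := Nat.exists_eq_add_of_le' (hB i)
    simp only [hm, hq]
    rw [mul_pow, show q + 2 - 1 = q + 1 by omega]
    linear_combination (-X ^ (q + 1) * S.T ^ (q + 1)) * hU
  have hm2 : ∀ i, X ^ ((B i).p - 1) * S.T ^ ((B i).p - 2) = S.U ^ 2 * m i := fun i => by
    obtain ⟨q, hq⟩ := Nat.exists_eq_add_of_le' (hB i)
    simp only [hm, hq]
    rw [show q + 2 - 1 = q + 1 by omega, show q + 2 - 2 = q by omega]
    linear_combination (-X ^ (q + 1) * S.T ^ q * (S.T * S.U + 1)) * hU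
  have hm3 : ∀ i, X ^ ((B i).p - 1) * S.T ^ ((B i).p + 2) = S.T ^ 2 * m i := fun i => by
    simp only [hm]
    ring
  have hm4 : ∀ i j, X ^ ((B i).p + (B j).p - 2) * S.T ^ ((B i).p + (B j).p - 1) =
      S.U * (m i * m j) := fun i j => by
    obtain ⟨q, hq⟩ := Nat.exists_eq_add_of_le' (hB i)
    obtain ⟨r, hr⟩ := Nat.exists_eq_add_of_le' (hB j)
    simp only [hm, hq, hr]
    rw [show q + 2 + (r + 2) - 2 = (q + 1) + (r + 1) by omega, show q + 2 - 1 = q + 1 by omega,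
      show r + 2 - 1 = r + 1 by omega, show q + 2 + (r + 2) - 1 = q + r + 3 by omega]
    linear_combination (-X ^ (q + 1 + (r + 1)) * S.T ^ (q + r + 3)) * hU
  set L : PowerSeries ℂ := ∑ i, t i • m i with hL
  set A : PowerSeries ℂ := ∑ i, (t i * (B i).alpha) • m i with hA
  set Q : PowerSeries ℂ := ∑ i, (t i * (cycleSq (core τ i c) / (B i).p)) • m i with hQ
  have hL1 : S.T = 1 + L := by
    have h := S.T_eq
    simp only [natCast_mul_vertexWeight t hB, smul_mul_assoc] at h
    exact h
  have hM : S.M = S.T + S.M * S.U * Q := by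
    have h := S.M_eq c
    have h1 : ∑ i, vertexWeight B t i * cycleSq (core τ i c) * S.T ^ (B i).p = Q := by
      refine Finset.sum_congr rfl fun i _ => ?_
      rw [vertexWeight, smul_eq_C_mul, smul_eq_C_mul, ← map_natCast (C (R := ℂ))]
      rw [show t i * ((cycleSq (core τ i c) : ℂ) / (B i).p) =
        t i / (B i).p * cycleSq (core τ i c) by ring, map_mul]
      simp only [hm]
      ring
    rwa [h1] at h
  have hC : singularFactor B t S.T = 1 - S.U * ∑ i, (t i * (B i).p) • m i := by
    rw [singularFactor, Finset.mul_sum]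
    simp only [hm1, mul_smul_comm]
  have hK : singularFactor B t S.T * S.K = S.U ^ 2 * S.M * A := by
    have h := S.K_eq
    have h1 : ∑ i, (B i).p * vertexWeight B t i * ((B i).p * S.T ^ (B i).p * S.U * S.K +
        (B i).alpha * S.T ^ (B i).p * S.U ^ 2 * S.M) =
        (∑ i, (t i * (B i).p) • m i) * S.U * S.K + A * S.U ^ 2 * S.M := by
      rw [hA]
      simp only [Finset.sum_mul]
      rw [← Finset.sum_add_distrib]
      refine Finset.sum_congr rfl fun i _ => ?_
      rw [natCast_mul_vertexWeight t hB, smul_eq_C_mul, smul_eq_C_mul, smul_eq_C_mul, map_mul,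
        map_mul, map_natCast, map_natCast]
      simp only [hm]
      ring
    rw [h1] at h
    rw [hC]
    linear_combination h
  have hs1 : ∑ i, (t i * (B i).alphaPrime) • (X ^ ((B i).p - 1) * S.T ^ ((B i).p - 2)) =
      S.U ^ 2 * A := by
    rw [hA, Finset.mul_sum]
    refine Finset.sum_congr rfl fun i _ => ?_
    rw [hm2, mul_smul_comm, alphaPrime_eq_alpha hD (hτ i)]
  have hs2 : ∑ i, (t i * ((B i).betaPrime c / (B i).p)) • (X * S.T) ^ ((B i).p - 1) =
      S.U * (A + Q) := by
    rw [hA, hQ, ← Finset.sum_add_distrib, Finset.mul_sum]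
    refine Finset.sum_congr rfl fun i _ => ?_
    rw [hm1, betaPrime_eq_beta hD (hτ i), hbeta, ← add_smul, mul_smul_comm, ← mul_add, add_div,
      mul_div_cancel_left₀ _ (hp0 i)]
  have hs2' : ∑ i, (t i * (B i).betaPrime c / (B i).p) • (X * S.T) ^ ((B i).p - 1) =
      S.U * (A + Q) := by
    rw [← hs2]
    exact Finset.sum_congr rfl fun i _ => by rw [mul_div_assoc]
  have hs3 : ∑ i, (t i * (((B i).p - (B i).beta c) / (B i).p)) • m i = L - A - Q := by
    rw [hL, hA, hQ, ← Finset.sum_sub_distrib, ← Finset.sum_sub_distrib]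
    refine Finset.sum_congr rfl fun i _ => ?_
    rw [← sub_smul, ← sub_smul, hbeta]
    congr 1
    have := hp0 i
    field_simp
    ring
  have hs4 : ∑ i, ∑ j, (t i * t j * (B i).alphaPrime * ((B j).p - (B j).beta c) / (B j).p) •
      (X ^ ((B i).p + (B j).p - 2) * S.T ^ ((B i).p + (B j).p - 1)) =
      S.U * (A * (L - A - Q)) := by
    rw [← hs3, hA, Finset.sum_mul_sum, Finset.mul_sum]
    refine Finset.sum_congr rfl fun i _ => ?_
    rw [Finset.mul_sum]
    refine Finset.sum_congr rfl fun j _ => ?_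
    rw [hm4, smul_mul_smul_comm, mul_smul_comm, alphaPrime_eq_alpha hD (hτ i)]
    congr 1
    ring
  have hs5 : ∑ i, (t i * ((B i).beta c / (B i).p - ((B i).alpha + 1))) •
      (X ^ ((B i).p - 1) * S.T ^ ((B i).p + 2)) = S.T ^ 2 * (Q - L) := by
    rw [hL, hQ, ← Finset.sum_sub_distrib, Finset.mul_sum]
    refine Finset.sum_congr rfl fun i _ => ?_
    rw [hm3, ← sub_smul, mul_smul_comm, hbeta]
    congr 1
    have := hp0 i
    field_simp
    ring
  have hden : denominator B t S.T c = S.T - Q := by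
    have h1 : ∑ i, (t i * ((B i).betaPrime c / (B i).p - ((B i).alphaPrime + 1))) • m i = Q - L := by
      rw [hL, hQ, ← Finset.sum_sub_distrib]
      refine Finset.sum_congr rfl fun i _ => ?_
      rw [← sub_smul, betaPrime_eq_beta hD (hτ i), alphaPrime_eq_alpha hD (hτ i), hbeta]
      congr 1
      have := hp0 i
      field_simp
      ring
    rw [denominator, h1, hL1]
    ring
  have hm0 : ∀ i, constantCoeff (m i) = 0 := fun i => by
    have h1 : (X : PowerSeries ℂ) ∣ m i :=
      Dvd.dvd.mul_right (dvd_pow_self X (by have := hB i; omega)) _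
    exact X_dvd_iff.1 h1
  have hsum0 : ∀ a : I → ℂ, constantCoeff (∑ i, a i • m i) = 0 := fun a => by
    rw [map_sum]
    refine Finset.sum_eq_zero fun i _ => ?_
    rw [smul_eq_C_mul, map_mul, hm0, mul_zero]
  have hC1 : singularFactor B t S.T * (singularFactor B t S.T)⁻¹ = 1 := by
    refine PowerSeries.mul_inv_cancel _ ?_
    rw [hC, map_sub, map_mul, hsum0, map_one, mul_zero, sub_zero]
    exact one_ne_zero
  have hden1 : (S.T - Q) * (S.T - Q)⁻¹ = 1 := by
    refine PowerSeries.mul_inv_cancel _ ?_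
    rw [map_sub, hT0, hQ, hsum0, sub_zero]
    exact one_ne_zero
  have hM1 : S.M = S.T ^ 2 * (S.T - Q)⁻¹ := by
    linear_combination (S.T * (S.T - Q)⁻¹) * hM + (S.M * (S.T - Q)⁻¹ * Q) * hU -
      S.M * hden1
  rw [hs1, hs2, hs2', hs3, hs4, hs5, hden, S.inv_T hB]
  refine ⟨?_, ?_, ?_⟩
  · ext1 i
    fin_cases i
    · simp only [Matrix.mulVec, dotProduct, Fin.sum_univ_two, Fin.zero_eta, Matrix.of_apply,
        Matrix.cons_val_zero, Matrix.cons_val_one]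
      linear_combination -hK - A * (S.T * S.U + 1) * hU
    · simp only [Matrix.mulVec, dotProduct, Fin.sum_univ_two, Fin.mk_one, Matrix.of_apply,
        Matrix.cons_val_zero, Matrix.cons_val_one]
      linear_combination -hK - S.U * hM + hL1 -
        (A * (S.T * S.U + 1) + 1 - S.T + Q * S.T * S.U + Q) * hU
  · linear_combination (-S.K) * hC1 + (singularFactor B t S.T)⁻¹ * hK +
      (singularFactor B t S.T)⁻¹ * S.U ^ 2 * A * hM1 +
      (singularFactor B t S.T)⁻¹ * A * (S.T - Q)⁻¹ * (S.T * S.U + 2 - S.T + 2 * L) * hU +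
      (singularFactor B t S.T)⁻¹ * A * (S.T - Q)⁻¹ * (S.T * S.U - 2) * hL1
  · linear_combination hM1 + S.T ^ 2 * hden1 - S.T ^ 2 * (S.T - Q)⁻¹ * hL1

theorem hasNLOExpansion_of_mem {f : ℕ → PowerSeries ℂ} {A A' : PowerSeries ℂ} (hD : 2 ≤ D)
    (h : ∀ n, (fun k => f (k + 1)) - (A • powN 0 + A' • powN (2 - D)) ∈ orderBound n (1 - D)) :
    HasNLOExpansion D f A A' := by
  intro n
  have h1 : (fun N : ℕ => (N : ℂ) ^ (D - 2)) =O[atTop] fun N : ℕ => (N : ℝ) ^ (D - 2) :=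
    IsBigO.of_bound 1 (Eventually.of_forall fun N => by simp)
  refine (h1.mul (isBigO_coeff_pred (h (n + 1)))).congr' ?_ ?_
  · filter_upwards [eventually_ge_atTop 1] with N hN
    have hN0 : (N : ℂ) ≠ 0 := by exact_mod_cast (by omega : N ≠ 0)
    have h2 : ((N - 1 : ℕ) : ℂ) + 1 = N := by exact_mod_cast Nat.sub_add_cancel hN
    simp only [Pi.sub_apply, Pi.add_apply, Pi.smul_apply, powN, smul_eq_mul, map_sub, map_add,
      coeff_mul_C, h2, Nat.sub_add_cancel hN, zpow_zero, mul_one]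
    have h3 : (N : ℂ) ^ (D - 2) * (N : ℂ) ^ (2 - D : ℤ) = 1 := by
      rw [← zpow_natCast, ← zpow_add₀ hN0, Nat.cast_sub hD]
      simp
    linear_combination (-(coeff n A')) * h3
  · filter_upwards [eventually_ge_atTop 1] with N hN
    have hN0 : (N : ℝ) ≠ 0 := by exact_mod_cast (by omega : N ≠ 0)
    rw [← zpow_natCast, ← zpow_add₀ hN0, Nat.cast_sub hD]
    rw [show ((D : ℤ) - (2 : ℕ) + (1 - D)) = -1 by push_cast; ring, zpow_neg_one]

/-- The expansion of a melonic bubble, in terms of `M`. -/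
theorem hasNLOExpansion_nlo (hD : 3 ≤ D) (hB : ∀ i, 2 ≤ (B i).p)
    (hτ : ∀ i, IsMelonicPairing (B i) (τ i)) {G : ColoredGraph D} {τ' : Equiv.Perm (Fin G.p)}
    (hG : IsMelonicPairing G τ') :
    HasNLOExpansion D (fun N => ((N : ℂ)⁻¹) • expectation B t N (traceInvariant G)) (S.T ^ G.p)
      (S.nlo G.p G.alpha) := by
  refine hasNLOExpansion_of_mem (by omega) fun n => ?_
  have h := powN_mul_mem (e' := 1 - D) (-1)
    (graphExp_sub_main_mem t S hD hB hτ n _ (repair τ' G.adj) rfl hG.isForest)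
    (by rw [hG.connected]; push_cast; linarith)
  convert h using 1
  have hnlo : nloConst (repair τ' G.adj) = (G.alpha : PowerSeries ℂ) := by
    rw [nloConst, ← two_mul_alpha_add hD hG, Fintype.card_fin]
    push_cast
    rw [add_sub_cancel_right, mul_div_cancel_left₀ _ (two_ne_zero' ℂ), map_natCast]
  have h1 : (fun k : ℕ => ((k + 1 : ℕ) : ℂ)⁻¹ • expectation B t (k + 1) (traceInvariant G)) =
      powN (-1) * graphExp B t (repair τ' G.adj) := by
    funext k
    rw [expectation_traceInvariant B t (Nat.le_add_left 1 k), tracePoly_repair (k + 1) τ']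
    simp only [Pi.mul_apply, powN, graphExp, zpow_neg_one, ← smul_eq_C_mul]
    push_cast
    rfl
  rw [h1, MelonicSeries.main, hG.connected, hnlo, Fintype.card_fin]
  simp only [mul_sub, mul_add, mul_smul_comm, ← powN_add, Nat.cast_one]
  rw [show (-1 : ℤ) + 1 = 0 by ring, show (-1 : ℤ) + (1 + 2 - D) = 2 - D by ring]

theorem alpha_eq_zero_of_p_eq_one (hD : 3 ≤ D) {G : ColoredGraph D} {τ' : Equiv.Perm (Fin G.p)}
    (hG : IsMelonicPairing G τ') (hp : G.p = 1) : G.alpha = 0 := by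
  have h := two_mul_alpha_add hD hG
  have : Subsingleton (Fin G.p) := by rw [hp]; infer_instance
  have h1 : repair τ' G.adj = fun _ => 1 := by
    funext c
    ext1 x
    exact Subsingleton.elim _ _
  rw [h1, faceSq, Finset.sum_congr rfl fun _ _ => cycleSq_one, Fintype.card_fin, hp] at h
  simp at h
  exact h

/-- The expansion of a melonic bubble: as `α' = α`, the terms in `T ^ 2` and in the 4-point function
add up to `M`. -/
theorem hasNLOExpansion_melonic (hD : 3 ≤ D) (hB : ∀ i, 2 ≤ (B i).p)
    (hτ : ∀ i, IsMelonicPairing (B i) (τ i)) {G : ColoredGraph D} (hG : G.IsMelonic) :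
    HasNLOExpansion D (fun N => ((N : ℂ)⁻¹) • expectation B t N (traceInvariant G)) (S.T ^ G.p)
      ((G.p : ℂ) • (S.T ^ (G.p - 1) * S.K) + (G.alpha : ℂ) • S.T ^ G.p +
        (G.alphaPrime : ℂ) • (S.T ^ (G.p - 2) * (S.M - S.T ^ 2))) := by
  obtain ⟨τ', hτ'⟩ := hG.exists_pairing (by omega)
  have h := hasNLOExpansion_nlo S hD hB hτ hτ'
  convert h using 1
  have hU := S.mul_U
  rw [alphaPrime_eq_alpha hD hτ', MelonicSeries.nlo]
  simp only [smul_eq_C_mul, map_natCast]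
  rcases Nat.lt_or_ge G.p 2 with hp | hp
  · have hp1 : G.p = 1 := by
      have := hG.p_pos
      omega
    rw [alpha_eq_zero_of_p_eq_one hD hτ' hp1, hp1]
    simp only [Nat.cast_one, Nat.cast_zero, Nat.sub_self, pow_zero, pow_one]
    linear_combination (-S.K) * hU
  · obtain ⟨q, hq⟩ := Nat.exists_eq_add_of_le' hp
    rw [hq, show q + 2 - 1 = q + 1 by omega, show q + 2 - 2 = q by omega]
    push_cast
    linear_combination (-(((q : PowerSeries ℂ) + 2) * S.T ^ (q + 1) * S.K) -
      G.alpha * S.T ^ q * S.M * (S.T * S.U + 1)) * hU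

theorem isLargeNSolution (hD : 3 ≤ D) (hB : ∀ i, 2 ≤ (B i).p)
    (hτ : ∀ i, IsMelonicPairing (B i) (τ i)) :
    IsLargeNSolution B t S.T S.K (S.M - S.T ^ 2) where
  two_point := by
    have h := hasNLOExpansion_nlo S hD hB hτ (isMelonicPairing_twoVertex (by omega))
    have h1 : (twoVertex D).alpha = 0 :=
      alpha_eq_zero_of_p_eq_one hD (isMelonicPairing_twoVertex (by omega)) rfl
    rw [h1, MelonicSeries.nlo, show (twoVertex D).p = 1 from rfl] at h
    simp only [Nat.cast_one, Nat.cast_zero, pow_one, one_mul, zero_mul, add_zero, S.mul_U] at h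
    exact h
  expansion N hN := existsUnique_isInvariantExpansion t hB hN
  four_point W hW c := hasLOExpansion_fourPoint t S hD hB hτ hW c

end Solution

end TensorModel

namespace TensorModel

/-! ### Convergent power series -/

section Convergence

open PowerSeries

/-- The power series `A` converges to `f` on the open disc of radius `R`. -/
def SumsTo (R : ℝ) (A : PowerSeries ℂ) (f : ℂ → ℂ) : Prop :=
  ∀ z : ℂ, ‖z‖ < R → HasSum (fun n => coeff n A * z ^ n) (f z)

variable {R : ℝ} {A B G : PowerSeries ℂ} {f g : ℂ → ℂ}

theorem SumsTo.add (hA : SumsTo R A f) (hB : SumsTo R B g) :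
    SumsTo R (A + B) fun z => f z + g z := fun z hz => by
  refine ((hA z hz).add (hB z hz)).congr_fun fun n => ?_
  rw [map_add, add_mul]

theorem SumsTo.sub (hA : SumsTo R A f) (hB : SumsTo R B g) :
    SumsTo R (A - B) fun z => f z - g z := fun z hz => by
  refine ((hA z hz).sub (hB z hz)).congr_fun fun n => ?_
  rw [map_sub, sub_mul]

theorem sumsTo_C (a : ℂ) : SumsTo R (C a) fun _ => a := fun z _ => by
  have h := hasSum_ite_eq 0 a
  refine h.congr_fun fun n => ?_
  rw [coeff_C]
  split_ifs with hn
  · simp [hn]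
  · simp

theorem sumsTo_X : SumsTo R X fun z => z := fun z _ => by
  have h := hasSum_ite_eq 1 z
  refine h.congr_fun fun n => ?_
  rw [coeff_X]
  split_ifs with hn
  · simp [hn]
  · simp

theorem SumsTo.mul (hA : SumsTo R A f) (hB : SumsTo R B g) :
    SumsTo R (A * B) fun z => f z * g z := fun z hz => by
  have h1 := (hA z hz).summable.norm
  have h2 := (hB z hz).summable.norm
  have h3 := tsum_mul_tsum_eq_tsum_sum_antidiagonal_of_summable_norm h1 h2
  have h4 := (summable_norm_sum_mul_antidiagonal_of_summable_norm h1 h2).of_norm.hasSum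
  rw [← h3, (hA z hz).tsum_eq, (hB z hz).tsum_eq] at h4
  refine h4.congr_fun fun n => ?_
  rw [coeff_mul, Finset.sum_mul]
  refine Finset.sum_congr rfl fun x hx => ?_
  rw [← Finset.HasAntidiagonal.mem_antidiagonal.1 hx, pow_add]
  ring

theorem SumsTo.congr (hA : SumsTo R A f) (h : ∀ z, ‖z‖ < R → f z = g z) : SumsTo R A g :=
  fun z hz => h z hz ▸ hA z hz

/-- A power series is determined by its sum. -/
theorem SumsTo.unique (hR : 0 < R) (hA : SumsTo R A f) (hB : SumsTo R B f) : A = B := by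
  have key : ∀ {A : PowerSeries ℂ}, SumsTo R A f →
      HasFPowerSeriesAt f (FormalMultilinearSeries.ofScalars ℂ fun n => coeff n A) 0 := by
    intro A hA
    rw [hasFPowerSeriesAt_iff]
    filter_upwards [Metric.ball_mem_nhds (0 : ℂ) hR] with z hz
    rw [zero_add]
    refine (hA z (by simpa using hz)).congr_fun fun n => ?_
    rw [FormalMultilinearSeries.coeff_ofScalars, smul_eq_mul, mul_comm]
  have h := (key hA).eq_formalMultilinearSeries (key hB)
  ext n
  have h1 := congrArg (fun p => FormalMultilinearSeries.coeff p n) h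
  simpa only [FormalMultilinearSeries.coeff_ofScalars] using h1

theorem exists_sumsTo (hf : DifferentiableOn ℂ f (Metric.ball 0 R)) : ∃ A, SumsTo R A f := by
  refine ⟨PowerSeries.mk fun n => (n.factorial : ℂ)⁻¹ * iteratedDeriv n f 0, fun z hz => ?_⟩
  refine (Complex.hasSum_taylorSeries_on_ball hf (by simpa using hz)).congr_fun fun n => ?_
  rw [coeff_mk, sub_zero, smul_eq_mul, smul_eq_mul]
  ring

/-- A power series solving a linear equation with convergent coefficients converges to the quotient,
if the latter is holomorphic. -/
theorem SumsTo.div (hR : 0 < R) (hf : DifferentiableOn ℂ f (Metric.ball 0 R))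
    (hg : DifferentiableOn ℂ g (Metric.ball 0 R)) (h0 : ∀ z, ‖z‖ < R → f z ≠ 0)
    (hA : SumsTo R A f) (hB : SumsTo R B g) (h : G * A = B) : SumsTo R G fun z => g z / f z := by
  -- the quotient has a Taylor series, which solves the same linear equation
  obtain ⟨G', hG'⟩ := exists_sumsTo (hg.div hf fun z hz => h0 z (by simpa using hz))
  have h1 : G' * A = B := SumsTo.unique hR (hG'.mul hA)
    (hB.congr fun z hz => (div_mul_cancel₀ _ (h0 z hz)).symm)
  have hA0 : A ≠ 0 := by
    rintro rfl
    have h2 := hA 0 (by simpa using hR)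
    simp only [map_zero, zero_mul] at h2
    exact h0 0 (by simpa using hR) (h2.unique hasSum_zero)
  rw [mul_right_cancel₀ hA0 (h.trans h1.symm)]
  exact hG'

end Convergence

/-! ### The quartic model -/

section Quartic

open PowerSeries ColoredGraph

variable {D : ℕ}

theorem isColorSymmetric_quartic :
    IsColorSymmetric (fun c : Fin D => quartic c) fun _ => 1 := by
  intro π
  refine ⟨π⁻¹, fun i => ⟨rfl, Equiv.refl _, Equiv.refl _, fun c v => ?_⟩⟩
  have h : c = π⁻¹ i ↔ π c = i := by rw [Equiv.Perm.eq_inv_iff_eq]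
  change (if c = π⁻¹ i then _ else _ : Equiv.Perm (Fin 2)) v =
    (if π c = i then _ else _ : Equiv.Perm (Fin 2)) v
  simp only [h]
  rfl

/-- The square root in the solution of the quartic model. -/
noncomputable def quarticRoot (D : ℕ) (z : ℂ) : ℂ := (1 - 4 * D * z) ^ (1 / 2 : ℂ)

theorem quarticRoot_sq (z : ℂ) : quarticRoot D z ^ 2 = 1 - 4 * D * z := by
  rw [quarticRoot, one_div]
  exact Complex.cpow_ofNat_inv_pow _ 2

theorem quarticRoot_re (z : ℂ) : 0 ≤ (quarticRoot D z).re := by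
  rw [quarticRoot, one_div, Complex.cpow_inv_two_re]
  exact Real.sqrt_nonneg _

theorem one_add_quarticRoot_ne_zero (z : ℂ) : 1 + quarticRoot D z ≠ 0 := by
  intro h
  have h1 := congrArg Complex.re h
  have h2 := quarticRoot_re (D := D) z
  simp at h1
  linarith

/-- A form of `T` without singularity at `0`. -/
theorem quarticT_eq (hD : D ≠ 0) (z : ℂ) : quarticT D z = 2 / (1 + quarticRoot D z) := by
  have hD' : (D : ℂ) ≠ 0 := by exact_mod_cast hD
  have h0 := one_add_quarticRoot_ne_zero (D := D) z
  rw [quarticT]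
  split_ifs with hz
  · subst hz
    simp only [quarticRoot, mul_zero, sub_zero, Complex.one_cpow]
    norm_num
  · change (1 - quarticRoot D z) / (2 * D * z) = _
    rw [div_eq_div_iff (mul_ne_zero (mul_ne_zero two_ne_zero hD') hz) h0]
    linear_combination -quarticRoot_sq (D := D) z

theorem quarticT_equation (hD : D ≠ 0) (z : ℂ) :
    quarticT D z = 1 + D * z * quarticT D z ^ 2 := by
  rw [quarticT_eq hD]
  have h0 := one_add_quarticRoot_ne_zero (D := D) z
  field_simp
  linear_combination -quarticRoot_sq (D := D) z

theorem quarticRoot_eq (hD : D ≠ 0) (z : ℂ) :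
    quarticRoot D z = 1 - 2 * D * z * quarticT D z := by
  rw [quarticT_eq hD]
  have h0 := one_add_quarticRoot_ne_zero (D := D) z
  field_simp
  linear_combination quarticRoot_sq (D := D) z

theorem one_sub_mem_slitPlane (hD : D ≠ 0) {z : ℂ} (hz : ‖z‖ < 1 / (4 * D)) :
    1 - 4 * D * z ∈ Complex.slitPlane := by
  have hD' : (0 : ℝ) < D := by exact_mod_cast Nat.pos_of_ne_zero hD
  rw [lt_div_iff₀ (by positivity)] at hz
  refine Or.inl ?_
  have h1 : (4 * D * z).re ≤ ‖4 * D * z‖ := Complex.re_le_norm _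
  have h2 : ‖4 * D * z‖ = 4 * D * ‖z‖ := by simp
  rw [Complex.sub_re, Complex.one_re]
  linarith

theorem quarticRoot_ne_zero (hD : D ≠ 0) {z : ℂ} (hz : ‖z‖ < 1 / (4 * D)) :
    quarticRoot D z ≠ 0 := by
  intro h
  have h1 := quarticRoot_sq (D := D) z
  rw [h] at h1
  exact Complex.slitPlane_ne_zero (one_sub_mem_slitPlane hD hz) (by rw [← h1]; ring)

theorem differentiableOn_quarticRoot (hD : D ≠ 0) :
    DifferentiableOn ℂ (quarticRoot D) (Metric.ball 0 (1 / (4 * D))) := by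
  intro z hz
  refine DifferentiableAt.differentiableWithinAt ?_
  unfold quarticRoot
  exact DifferentiableAt.cpow_const (by fun_prop)
    (one_sub_mem_slitPlane hD (by simpa using hz))

theorem differentiableOn_quarticT (hD : D ≠ 0) :
    DifferentiableOn ℂ (quarticT D) (Metric.ball 0 (1 / (4 * D))) := by
  have h : quarticT D = fun z => 2 / (1 + quarticRoot D z) := funext (quarticT_eq hD)
  rw [h]
  exact (differentiableOn_const _).div ((differentiableOn_const _).add
    (differentiableOn_quarticRoot hD)) fun z _ => one_add_quarticRoot_ne_zero z

/-- At a zero of `1 - z T²` one has `T = D + 1`, so that the square root would be negative. -/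
theorem one_sub_mul_quarticT_sq_ne_zero (hD : 2 ≤ D) (z : ℂ) : 1 - z * quarticT D z ^ 2 ≠ 0 := by
  intro h
  have hD' : (2 : ℝ) ≤ D := by exact_mod_cast hD
  have hD0 : D ≠ 0 := by omega
  have h0 := one_add_quarticRoot_ne_zero (D := D) z
  have h1 : quarticT D z = D + 1 := by
    linear_combination quarticT_equation hD0 z - D * h
  rw [quarticT_eq hD0, div_eq_iff h0] at h1
  have h2 := congrArg Complex.re h1
  have h3 : (((D : ℂ) + 1) * (1 + quarticRoot D z)).re = (D + 1) * (1 + (quarticRoot D z).re) := by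
    have : (D : ℂ) + 1 = ((D + 1 : ℝ) : ℂ) := by push_cast; rfl
    rw [this, Complex.re_ofReal_mul]
    simp
  rw [h3] at h2
  have h4 := quarticRoot_re (D := D) z
  simp at h2
  nlinarith

variable {τ : ∀ c : Fin D, Equiv.Perm (Fin (quartic c).p)}

theorem quartic_T_eq (S : MelonicSeries (fun c : Fin D => quartic c) (fun _ => 1) τ) :
    S.T = 1 + C (D : ℂ) * (X * S.T ^ 2) := by
  have h := S.leadingOrder fun _ => le_rfl
  have h1 : ∑ i : Fin D, (1 : ℂ) • (X ^ ((quartic i).p - 1) * S.T ^ (quartic i).p) =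
      C (D : ℂ) * (X * S.T ^ 2) := by
    have h2 : ∀ i : Fin D, (1 : ℂ) • (X ^ ((quartic i).p - 1) * S.T ^ (quartic i).p) =
        X * S.T ^ 2 := fun i => by
      rw [show (quartic i).p = 2 from rfl, one_smul, pow_one]
    rw [Finset.sum_congr rfl fun i _ => h2 i, Finset.sum_const, Finset.card_univ,
      Fintype.card_fin, nsmul_eq_mul, map_natCast]
  rw [h1] at h
  linear_combination -h

/-- The next-to-leading orders of the quartic model, without denominators. The factor `1 - 2 D z T`
will be the square root. -/
theorem quartic_solution (hD : 3 ≤ D) (hτ : ∀ c : Fin D, IsMelonicPairing (quartic c) (τ c))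
    (S : MelonicSeries (fun c : Fin D => quartic c) (fun _ => 1) τ) :
    S.K * ((1 - C (2 * D : ℂ) * (X * S.T)) * (1 - X * S.T ^ 2)) = C (D : ℂ) * (X * S.T ^ 2) ∧
      (S.M - S.T ^ 2) * (1 - X * S.T ^ 2) = X * S.T ^ 4 := by
  set c : Fin D := ⟨0, by omega⟩
  have hα : ∀ i : Fin D, (quartic i).alpha = 1 := fun i => (quartic_constants hD i i).1
  have hα' : ∀ i : Fin D, (quartic i).alphaPrime = 1 := fun i => (quartic_constants hD i i).2.1
  have hβ : ∀ i : Fin D, (quartic i).beta c = if i = c then 6 else 4 := fun i =>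
    (quartic_constants hD c i).2.2.1
  have hβ' : ∀ i : Fin D, (quartic i).betaPrime c = if i = c then 6 else 4 := fun i =>
    (quartic_constants hD c i).2.2.2
  have hp : ∀ i : Fin D, (quartic i).p = 2 := fun i => rfl
  have hT := quartic_T_eq S
  have hT0 := S.constantCoeff_T fun _ => le_rfl
  obtain ⟨-, h2, h3⟩ := S.solution hD (fun _ => le_rfl) hτ c
  have hsum : ∀ (a b : ℂ) (F : PowerSeries ℂ),
      ∑ i : Fin D, (a + if i = c then b else 0) • F = C (D * a + b) * F := by
    intro a b F
    rw [← Finset.sum_smul, Finset.sum_add_distrib, Finset.sum_ite_eq', if_pos (Finset.mem_univ c),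
      Finset.sum_const, Finset.card_univ, Fintype.card_fin, nsmul_eq_mul, smul_eq_C_mul]
  have hden : denominator (fun c : Fin D => quartic c) (fun _ => 1) S.T c = 1 - X * S.T ^ 2 := by
    have h4 : ∀ i : Fin D, ((1 : ℂ) * ((quartic i).betaPrime c / (quartic i).p -
        ((quartic i).alphaPrime + 1))) • (X ^ ((quartic i).p - 1) * S.T ^ (quartic i).p) =
        (0 + if i = c then (1 : ℂ) else 0) • (X * S.T ^ 2) := by
      intro i
      rw [hp, hα', hβ', pow_one]
      congr 1
      split_ifs <;> norm_num
    rw [denominator, Finset.sum_congr rfl fun i _ => h4 i, hsum]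
    simp
  have hsing : singularFactor (fun c : Fin D => quartic c) (fun _ => 1) S.T =
      1 - C (2 * D : ℂ) * (X * S.T) := by
    have h4 : ∀ i : Fin D, ((1 : ℂ) * (quartic i).p) • (X * S.T) ^ ((quartic i).p - 1) =
        (2 + if i = c then (0 : ℂ) else 0) • (X * S.T) := by
      intro i
      rw [hp, pow_one]
      congr 1
      simp
    rw [singularFactor, Finset.sum_congr rfl fun i _ => h4 i, hsum, add_zero, mul_comm (D : ℂ)]
  have hden1 : (1 - X * S.T ^ 2) * (1 - X * S.T ^ 2)⁻¹ = 1 :=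
    PowerSeries.mul_inv_cancel _ (by simp)
  have hsing1 : (1 - C (2 * D : ℂ) * (X * S.T)) * (1 - C (2 * D : ℂ) * (X * S.T))⁻¹ = 1 :=
    PowerSeries.mul_inv_cancel _ (by simp)
  rw [hden, hsing] at h2
  rw [hden] at h3
  have s1 : ∑ i : Fin D, ((1 : ℂ) * (quartic i).betaPrime c / (quartic i).p) •
      (X * S.T) ^ ((quartic i).p - 1) = C (D * 2 + 1 : ℂ) * (X * S.T) := by
    rw [← hsum]
    refine Finset.sum_congr rfl fun i _ => ?_
    rw [hp, hβ', pow_one]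
    congr 1
    split_ifs <;> norm_num
  have s2 : ∑ i : Fin D, ((1 : ℂ) * (quartic i).alpha) •
      (X ^ ((quartic i).p - 1) * S.T ^ (quartic i).p) = C (D : ℂ) * (X * S.T ^ 2) := by
    have := hsum 1 0 (X * S.T ^ 2)
    rw [mul_one, add_zero] at this
    rw [← this]
    refine Finset.sum_congr rfl fun i _ => ?_
    rw [hp, hα, pow_one]
    congr 1
    simp
  have s3 : ∑ i : Fin D, ∑ j : Fin D, ((1 : ℂ) * 1 * (quartic i).alphaPrime *
      ((quartic j).p - (quartic j).beta c) / (quartic j).p) •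
      (X ^ ((quartic i).p + (quartic j).p - 2) * S.T ^ ((quartic i).p + (quartic j).p - 1)) =
      C (D : ℂ) * (C (-D - 1 : ℂ) * (X ^ 2 * S.T ^ 3)) := by
    have h4 : ∀ i : Fin D, ∑ j : Fin D, ((1 : ℂ) * 1 * (quartic i).alphaPrime *
        ((quartic j).p - (quartic j).beta c) / (quartic j).p) •
        (X ^ ((quartic i).p + (quartic j).p - 2) * S.T ^ ((quartic i).p + (quartic j).p - 1)) =
        C (-D - 1 : ℂ) * (X ^ 2 * S.T ^ 3) := by
      intro i
      rw [show (-D - 1 : ℂ) = D * (-1) + (-1) by ring, ← hsum]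
      refine Finset.sum_congr rfl fun j _ => ?_
      rw [hp, hp, hα', hβ]
      congr 1
      split_ifs <;> norm_num
    rw [Finset.sum_congr rfl fun i _ => h4 i, Finset.sum_const, Finset.card_univ,
      Fintype.card_fin, nsmul_eq_mul, map_natCast]
  have s4 : ∑ i : Fin D, ((1 : ℂ) * ((quartic i).beta c / (quartic i).p -
      ((quartic i).alpha + 1))) • (X ^ ((quartic i).p - 1) * S.T ^ ((quartic i).p + 2)) =
      X * S.T ^ 4 := by
    have := hsum 0 1 (X * S.T ^ 4)
    rw [mul_zero, zero_add, map_one, one_mul] at this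
    rw [← this]
    refine Finset.sum_congr rfl fun i _ => ?_
    rw [hp, hα, hβ, pow_one]
    congr 1
    split_ifs <;> norm_num
  rw [s1, s2, s3] at h2
  rw [s4] at h3
  simp only [map_add, map_sub, map_neg, map_mul, map_one, map_natCast, map_ofNat] at h2 hT hsing1 ⊢
  constructor
  · rw [h2]
    generalize (1 - 2 * (D : PowerSeries ℂ) * (X * S.T))⁻¹ = g at hsing1 ⊢
    generalize (1 - X * S.T ^ 2)⁻¹ = e at hden1 ⊢
    linear_combination ((D : PowerSeries ℂ) * X * S.T ^ 3 * (1 - D * X * S.T)) *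
      ((1 - 2 * (D : PowerSeries ℂ) * (X * S.T)) * g) * hden1 +
      ((D : PowerSeries ℂ) * X * S.T ^ 3 * (1 - D * X * S.T)) * hsing1 +
      ((D : PowerSeries ℂ) * X * S.T ^ 2) * hT
  · linear_combination (1 - X * S.T ^ 2) * h3 + X * S.T ^ 4 * hden1

/-- The Taylor series of the explicit function satisfies the fixed point equation, whose solution is
unique. -/
theorem quartic_sumsTo_T (hD : D ≠ 0)
    (S : MelonicSeries (fun c : Fin D => quartic c) (fun _ => 1) τ) :
    SumsTo (1 / (4 * D)) S.T (quarticT D) := by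
  have hD' : (0 : ℝ) < D := by exact_mod_cast Nat.pos_of_ne_zero hD
  have hR : (0 : ℝ) < 1 / (4 * D) := by positivity
  obtain ⟨A, hA⟩ := exists_sumsTo (differentiableOn_quarticT hD)
  have h1 : SumsTo (1 / (4 * D)) (1 + C (D : ℂ) * (X * (A * A))) (quarticT D) := by
    refine ((sumsTo_C 1).add ((sumsTo_C (D : ℂ)).mul (sumsTo_X.mul (hA.mul hA)))).congr
      fun z _ => ?_
    rw [quarticT_equation hD z]
    linear_combination (-(D * z * (quarticT D z + 1 + D * z * quarticT D z ^ 2))) *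
      quarticT_equation hD z
  have h2 := SumsTo.unique hR hA h1
  have hT := quartic_T_eq S
  obtain ⟨T, -, huniq⟩ := existsUnique_leadingOrder (fun _ : Unit => 2) (fun _ => (D : ℂ))
    fun _ => le_rfl
  have key : ∀ F : PowerSeries ℂ, F = 1 + C (D : ℂ) * (X * F ^ 2) → F = T := by
    intro F hF
    refine huniq F ?_
    simpa [smul_eq_C_mul] using hF
  rw [key S.T hT, ← key A (by rw [pow_two]; exact h2)]
  exact hA

theorem quartic_hasSum (hD : 3 ≤ D) (hτ : ∀ c : Fin D, IsMelonicPairing (quartic c) (τ c))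
    (S : MelonicSeries (fun c : Fin D => quartic c) (fun _ => 1) τ) :
    SumsTo (1 / (4 * D)) S.T (quarticT D) ∧
    SumsTo (1 / (4 * D)) S.K (fun z => D * z * quarticT D z ^ 2 /
      ((1 - 4 * D * z) ^ (1 / 2 : ℂ) * (1 - z * quarticT D z ^ 2))) ∧
    SumsTo (1 / (4 * D)) (S.M - S.T ^ 2)
      (fun z => z * quarticT D z ^ 4 / (1 - z * quarticT D z ^ 2)) := by
  have hD0 : D ≠ 0 := by omega
  have hD' : (0 : ℝ) < D := by exact_mod_cast Nat.pos_of_ne_zero hD0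
  have hR : (0 : ℝ) < 1 / (4 * D) := by positivity
  have hT := quartic_sumsTo_T hD0 S
  obtain ⟨hK, hM⟩ := quartic_solution hD hτ S
  have dT := differentiableOn_quarticT hD0
  have ds := differentiableOn_quarticRoot hD0
  have hT2 : SumsTo (1 / (4 * D)) (S.T ^ 2) fun z => quarticT D z ^ 2 := by
    simp only [pow_two]
    exact hT.mul hT
  have hT4 : SumsTo (1 / (4 * D)) (S.T ^ 4) fun z => quarticT D z ^ 4 := by
    have h4 : S.T ^ 4 = S.T ^ 2 * S.T ^ 2 := by ring
    rw [h4]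
    exact (hT2.mul hT2).congr fun z _ => by ring
  have hden : SumsTo (1 / (4 * D)) (1 - X * S.T ^ 2) fun z => 1 - z * quarticT D z ^ 2 :=
    (sumsTo_C 1).sub (sumsTo_X.mul hT2)
  have hroot : SumsTo (1 / (4 * D)) (1 - C (2 * D : ℂ) * (X * S.T)) (quarticRoot D) :=
    ((sumsTo_C 1).sub ((sumsTo_C _).mul (sumsTo_X.mul hT))).congr fun z _ => by
      rw [quarticRoot_eq hD0]
      ring
  refine ⟨hT, ?_, ?_⟩
  · refine SumsTo.div hR (ds.mul (by fun_prop)) (by fun_prop) (fun z hz => mul_ne_zero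
      (quarticRoot_ne_zero hD0 hz) (one_sub_mul_quarticT_sq_ne_zero (by omega) z))
      (hroot.mul hden) ?_ hK
    exact ((sumsTo_C (D : ℂ)).mul (sumsTo_X.mul hT2)).congr fun z _ => by ring
  · exact SumsTo.div hR (by fun_prop) (by fun_prop)
      (fun z _ => one_sub_mul_quarticT_sq_ne_zero (by omega) z) hden (sumsTo_X.mul hT4) hM

end Quartic

end TensorModel

open TensorModel PowerSeries in
theorem mainTheorem4 (D : ℕ) (hD : 3 ≤ D) :
    -- melonic interactions, symmetric in the colours
    (∀ {I : Type*} [Fintype I] (B : I → ColoredGraph D) (t : I → ℂ),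
      (∀ i, 2 ≤ (B i).p) → (∀ i, (B i).IsMelonic) → IsColorSymmetric B t →
      -- the two Schwinger–Dyson equations
      (∀ N : ℕ, 1 ≤ N →
        ((N : ℂ) • (1 : PowerSeries ℂ)
          - expectation B t N (traceInvariant (ColoredGraph.twoVertex D))
          + ∑ i, t i • (X ^ ((B i).p - 1)
              * expectation B t N (traceInvariant (B i))) = 0) ∧
        ∀ c : Fin D,
          (1 + ((N : ℂ) ^ (D - 2))⁻¹) •
              expectation B t N (traceInvariant (ColoredGraph.twoVertex D))
            - expectation B t N (traceInvariant (ColoredGraph.quartic c))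
            + ∑ i, (t i / (B i).p) • (X ^ ((B i).p - 1)
                * ∑ v, expectation B t N (traceInvariant ((B i).insertDipole c v))) = 0) ∧
      ∃ T K₂ K₄ : PowerSeries ℂ,
        IsLargeNSolution B t T K₂ K₄ ∧
        -- leading order equation, with its initial condition
        PowerSeries.constantCoeff T = 1 ∧
        1 - T + ∑ i, t i • (X ^ ((B i).p - 1) * T ^ (B i).p) = 0 ∧
        -- expectations of melonic bubbles at next-to-leading order
        (∀ G : ColoredGraph D, G.IsMelonic →
          HasNLOExpansion D (fun N => ((N : ℂ)⁻¹) • expectation B t N (traceInvariant G))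
            (T ^ G.p)
            ((G.p : ℂ) • (T ^ (G.p - 1) * K₂) + (G.alpha : ℂ) • T ^ G.p
              + (G.alphaPrime : ℂ) • (T ^ (G.p - 2) * K₄))) ∧
        ∀ c : Fin D,
          -- the linear system
          Matrix.mulVec
              !![-singularFactor B t T,
                  ∑ i, (t i * (B i).alphaPrime) • (X ^ ((B i).p - 1) * T ^ ((B i).p - 2));
                 -singularFactor B t T,
                  T⁻¹ * (-1 + ∑ i, (t i * ((B i).betaPrime c / (B i).p)) •
                    (X * T) ^ ((B i).p - 1))]
              ![K₂, K₄]
            = ![-∑ i, (t i * (B i).alpha) • (X ^ ((B i).p - 1) * T ^ (B i).p),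
                ∑ i, (t i * (((B i).p - (B i).beta c) / (B i).p)) •
                  (X ^ ((B i).p - 1) * T ^ (B i).p)] ∧
          -- its solution
          K₂ = T * (singularFactor B t T)⁻¹ *
            (((1 - ∑ i, (t i * (B i).betaPrime c / (B i).p) • (X * T) ^ ((B i).p - 1))
                  * (∑ i, (t i * (B i).alpha) • (X ^ ((B i).p - 1) * T ^ (B i).p))
                - ∑ i, ∑ j,
                    (t i * t j * (B i).alphaPrime * ((B j).p - (B j).beta c) / (B j).p) •
                    (X ^ ((B i).p + (B j).p - 2) * T ^ ((B i).p + (B j).p - 1)))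
              * (denominator B t T c)⁻¹) ∧
          K₄ = (∑ i, (t i * ((B i).beta c / (B i).p - ((B i).alpha + 1))) •
              (X ^ ((B i).p - 1) * T ^ ((B i).p + 2))) * (denominator B t T c)⁻¹) ∧
    -- the quartic model
    ((∀ c c' : Fin D,
        (ColoredGraph.quartic c).alpha = 1 ∧ (ColoredGraph.quartic c).alphaPrime = 1 ∧
        (ColoredGraph.quartic c').beta c = (if c' = c then 6 else 4) ∧
        (ColoredGraph.quartic c').betaPrime c = (if c' = c then 6 else 4)) ∧
      ∃ T K₂ K₄ : PowerSeries ℂ,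
        IsLargeNSolution (fun c : Fin D => ColoredGraph.quartic c) (fun _ => 1) T K₂ K₄ ∧
        ∀ z : ℂ, ‖z‖ < 1 / (4 * D) →
          HasSum (fun n => PowerSeries.coeff n T * z ^ n) (quarticT D z) ∧
          HasSum (fun n => PowerSeries.coeff n K₂ * z ^ n)
            (D * z * quarticT D z ^ 2 /
              ((1 - 4 * D * z) ^ (1 / 2 : ℂ) * (1 - z * quarticT D z ^ 2))) ∧
          HasSum (fun n => PowerSeries.coeff n K₄ * z ^ n)
            (z * quarticT D z ^ 4 / (1 - z * quarticT D z ^ 2))) := by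
  refine ⟨fun {I} _ B t hB hmel hsym => ⟨fun N hN => ⟨?_, fun c => ?_⟩, ?_⟩,
    quartic_constants hD, ?_⟩
  · exact schwingerDyson_twoVertex t hB (by omega) hN
  · exact schwingerDyson_quartic t hB (by omega) hN c
  · choose τ hτ using fun i => (hmel i).exists_pairing (by omega)
    obtain ⟨S⟩ := exists_melonicSeries t hD hB hτ hsym
    exact ⟨S.T, S.K, S.M - S.T ^ 2, isLargeNSolution S hD hB hτ, S.constantCoeff_T hB,
      S.leadingOrder hB, fun G hG => hasNLOExpansion_melonic S hD hB hτ hG, S.solution hD hB hτ⟩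
  · choose τ hτ using fun c : Fin D =>
      (isMelonic_quartic c).exists_pairing (by omega)
    obtain ⟨S⟩ := exists_melonicSeries (fun _ => 1) hD (fun _ => le_rfl) hτ isColorSymmetric_quartic
    obtain ⟨hT, hK, hM⟩ := quartic_hasSum hD hτ S
    exact ⟨S.T, S.K, S.M - S.T ^ 2, isLargeNSolution S hD (fun _ => le_rfl) hτ,
      fun z hz => ⟨hT z hz, hK z hz, hM z hz⟩⟩
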